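/- Let $k$ be an algebraically closed field of characteristic $0$, let $V=k^s$ with $s\ge 1$, and let $G\subset GL(V)$ be a finite subgroup. For a finite subgroup $H\subset GL(W)$, where $W=k^n$, a \emph{bound McKay quiver} of $H$ is a pair $(Q,\rho)$ as follows. The quiver $Q$ is the McKay quiver of $H$: its vertices $i$ index the irreducible representations $S_i$ of $H$, and the number of arrows $i\to j$ is the multiplicity of $S_j$ in $W\otimes S_i$. The set $\rho\subset kQ_2$ consists of quadratic relations (linear combinations of parallel paths of length two), and $kQ/(\rho)$ is isomorphic to the basic algebra $e\,(k[W]*H)\,e$ of the skew group algebra of $H$ over the symmetric algebra $k[W]$ of $W$. Here $e=\sum_i e_i$ with orthogonal idempotents $e_i\in kH$ such that $kH e_i\cong S_i$; the isomorphism sends the trivial path at $i$ to $e_i$ and arrows to elements of degree $1$. Paths are written from right to left. Let $(Q_G,\rho_G)$ be a bound McKay quiver of $G$. Let $\theta_G\subset kQ_{G,2}$ be a set that spans the orthogonal complement of $\rho_G$ in $kQ_{G,2}$, for the bilinear form for which the paths of length two are orthonormal, so that $\Lambda(G)=kQ_G/(\theta_G)$ is the quadratic dual of $kQ_G/(\rho_G)$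 (with the same quiver). Let $\nu$ be a graded Nakayama automorphism of $\Lambda(G)$ that permutes the trivial paths: there is a nondegenerate linear form $f$ on $\Lambda(G)$ with $f(xy)=f(y\,\nu(x))$, and $\nu(e_i)=e_{\nu i}$. On the arrows of $kQ_G/(\rho_G)$, which are the basis dual to the arrows of $\Lambda(G)$, $\nu$ acts contragrediently; so there $\nu^{-1}\alpha=\sum_\gamma c_{\alpha\gamma}\gamma$, where $c_{\alpha\gamma}$ is the coefficient of $\alpha$ in $\nu(\gamma)\in\Lambda(G)_1$. Let $m\ge1$, let $\xi\in k$ be a primitive $m$-th root of unity, and let $\widetilde G=G'C_m\subset GL(s+1,k)$, where $G'=\{\mathrm{diag}(g,\det(g)^{-1}) : g\in G\}$ and $C_m$ is generated by $\mathrm{diag}(1,\dots,1,\xi)$. Let $Q_{\widetilde G}$ be the quiver with vertex set $Q_{G,0}\times\mathbb Z/m\mathbb Z$ and arrows $(\alpha,t):(i,t)\to(j,t)$ for each arrow $\alpha:i\to j$ of $Q_G$ and $(\beta_i,t):(i,t)\to(\nu i,t+1)$ for each vertex $i$ of $Q_G$, where $t\in\mathbb Z/m\mathbb Z$. For $\varrho\in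 kQ_G$ let $(\varrho,t)$ be its copy in the $t$-th copy of $Q_G$. Put $$\rho_{\widetilde G}=\bigcup_{t\in\mathbb Z/m\mathbb Z}\Bigl(\{(\varrho,t) : \varrho\in\rho_G\}\cup\{(\alpha,t)(\beta_{\nu^{-1}i},t-1)-(-1)^{s-1}(\beta_{\nu^{-1}j},t-1)(\nu^{-1}\alpha,t-1) : \alpha:i\to j\in Q_{G,1}\}\Bigr),$$ $$\theta_{\widetilde G}=\bigcup_{t\in\mathbb Z/m\mathbb Z}\Bigl(\{(\varrho,t) : \varrho\in\theta_G\}\cup\{(\beta_{\nu i},t+1)(\beta_i,t) : i\in Q_{G,0}\}\cup\{(\alpha,t)(\beta_{\nu^{-1}i},t-1)-(-1)^{s}(\beta_{\nu^{-1}j},t-1)(\nu^{-1}\alpha,t-1) : \alpha:i\to j\in Q_{G,1}\}\Bigr),$$ where in $\rho_{\widetilde G}$ the element $\nu^{-1}\alpha$ is formed with the contragredient action, and in $\theta_{\widetilde G}$ with the action of $\nu$ on $\Lambda(G)_1$. Then $(Q_{\widetilde G},\rho_{\widetilde G})$ is a bound McKay quiver of $\widetilde G$, and the span of $\rho_{\widetilde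 G}$ is the orthogonal complement of $\theta_{\widetilde G}$ in $kQ_{\widetilde G,2}$. -/

import Mathlib

open scoped MonoidAlgebra MatrixGroups
open Matrix

universe u v w

noncomputable section

/-! ### Quivers, paths and path algebras -/

/-- A quiver with vertex set `V` and arrow set `A`. -/
structure ArrowQuiver (V : Type v) (A : Type w) where
  /-- source of an arrow -/
  src : A → V
  /-- target of an arrow -/
  tgt : A → V

namespace ArrowQuiver

variable {V : Type v} {A : Type w} (Q : ArrowQuiver V A)

/-- `Q.IsWalk t [α_l, …, α_1] s`: the word `α_l ⋯ α_1` is a path from `s` to `t`, where `α_1` is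
the first arrow that is walked along. -/
def IsWalk : V → List A → V → Prop
  | t, [], s => t = s
  | t, a :: l, s => Q.tgt a = t ∧ IsWalk (Q.src a) l s

theorem IsWalk.append {Q : ArrowQuiver V A} {l₂ : List A} {y z : V} (h₂ : Q.IsWalk y l₂ z) :
    ∀ {l₁ : List A} {x : V}, Q.IsWalk x l₁ y → Q.IsWalk x (l₁ ++ l₂) z
  | [], _, h => by cases h; exact h₂
  | _ :: _, _, h => ⟨h.1, IsWalk.append h₂ h.2⟩

/-- Paths of a quiver, including the trivial path at each vertex. -/
@[ext]
structure QPath where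
  source : V
  target : V
  /-- the path `α_l ⋯ α_1` has the list `[α_l, …, α_1]` -/
  arrows : List A
  isWalk : Q.IsWalk target arrows source

namespace QPath

variable {Q}

/-- The trivial path at a vertex. -/
def nil (Q : ArrowQuiver V A) (i : V) : Q.QPath := ⟨i, i, [], rfl⟩

/-- An arrow as a path of length one. -/
def ofArrow (Q : ArrowQuiver V A) (a : A) : Q.QPath := ⟨Q.src a, Q.tgt a, [a], rfl, rfl⟩

/-- `p.comp q` is the path `p q`: first `q`, then `p`. -/
def comp (p q : Q.QPath) (h : p.source = q.target) : Q.QPath :=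
  ⟨q.source, p.target, p.arrows ++ q.arrows, IsWalk.append (h ▸ q.isWalk) p.isWalk⟩

/-- The number of arrows of a path. -/
def length (p : Q.QPath) : ℕ := p.arrows.length

end QPath

end ArrowQuiver

open ArrowQuiver

/-- The path algebra `kQ`: the vector space with the paths of `Q` as a basis. -/
def PathAlgebra (k : Type u) [CommRing k] {V : Type v} {A : Type w} (Q : ArrowQuiver V A) :
    Type (max u v w) :=
  Q.QPath →₀ k

namespace PathAlgebra

variable {k : Type u} [CommRing k] {V : Type v} {A : Type w} {Q : ArrowQuiver V A}

instance : AddCommGroup (PathAlgebra k Q) := inferInstanceAs (AddCommGroup (Q.QPath →₀ k))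

instance : Module k (PathAlgebra k Q) := inferInstanceAs (Module k (Q.QPath →₀ k))

/-- The coordinates of an element of `kQ` in the basis of paths. -/
def toFinsupp : PathAlgebra k Q ≃ₗ[k] (Q.QPath →₀ k) := LinearEquiv.refl k (Q.QPath →₀ k)

/-- The scalar multiple `c p` of a path `p`. -/
def single (p : Q.QPath) (c : k) : PathAlgebra k Q := toFinsupp.symm (Finsupp.single p c)

/-- The coefficient of a path in an element of the path algebra. -/
def coeff (x : PathAlgebra k Q) (p : Q.QPath) : k := toFinsupp x p

/-- Linear extension of a map that is given on paths. -/
def lift {M : Type*} [AddCommMonoid M] [Module k M] (f : Q.QPath → M) : PathAlgebra k Q →ₗ[k] M :=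
  Finsupp.lift M k Q.QPath f ∘ₗ toFinsupp.toLinearMap

theorem lift_single {M : Type*} [AddCommMonoid M] [Module k M] (f : Q.QPath → M) (p : Q.QPath)
    (c : k) : lift f (single p c) = c • f p := by
  simp [lift, single]

open Classical in
/-- The product of two paths in `kQ`: their composite, or `0` if they are not composable. -/
def pathMul (k : Type u) [CommRing k] (p q : Q.QPath) : PathAlgebra k Q :=
  if h : p.source = q.target then single (p.comp q h) 1 else 0

/-- Multiplication of `kQ`, as a bilinear map. -/
def mulHom (k : Type u) [CommRing k] (Q : ArrowQuiver V A) :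
    PathAlgebra k Q →ₗ[k] PathAlgebra k Q →ₗ[k] PathAlgebra k Q :=
  lift fun p => lift fun q => pathMul k p q

instance : Mul (PathAlgebra k Q) := ⟨fun x y => mulHom k Q x y⟩

theorem mul_def (x y : PathAlgebra k Q) : x * y = mulHom k Q x y := rfl

theorem single_mul_single (p q : Q.QPath) (c d : k) :
    (single p c * single q d : PathAlgebra k Q) = (c * d) • pathMul k p q := by
  rw [mul_def, mulHom, lift_single, LinearMap.smul_apply, lift_single, smul_smul]

@[elab_as_elim]
theorem induction_linear {P : PathAlgebra k Q → Prop} (x : PathAlgebra k Q) (zero : P 0)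
    (add : ∀ x y, P x → P y → P (x + y)) (single : ∀ p c, P (single p c)) : P x :=
  Finsupp.induction_linear x zero add single

theorem smul_single (c d : k) (p : Q.QPath) :
    (c • single p d : PathAlgebra k Q) = single p (c * d) :=
  Finsupp.smul_single c p d

theorem pathMul_mul (p q r : Q.QPath) :
    (pathMul k p q * single r 1 : PathAlgebra k Q) = single p 1 * pathMul k q r := by
  have z1 (x : PathAlgebra k Q) : 0 * x = 0 := by simp [mul_def]
  have z2 (x : PathAlgebra k Q) : x * 0 = 0 := by simp [mul_def]
  by_cases h : p.source = q.target <;> by_cases h' : q.source = r.target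
  · have h1 : (p.comp q h).source = r.target := h'
    have h2 : p.source = (q.comp r h').target := h
    have h3 : (p.comp q h).comp r h1 = p.comp (q.comp r h') h2 :=
      QPath.ext rfl rfl (List.append_assoc _ _ _)
    rw [pathMul, dif_pos h, single_mul_single, pathMul, dif_pos h1, pathMul, dif_pos h',
      single_mul_single, pathMul, dif_pos h2, h3]
  · have h1 : ¬ (p.comp q h).source = r.target := h'
    rw [pathMul, dif_pos h, single_mul_single, pathMul, dif_neg h1, pathMul, dif_neg h',
      smul_zero, z2]
  · have h2 : ¬ p.source = (q.comp r h').target := h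
    rw [pathMul, dif_neg h, z1, pathMul, dif_pos h', single_mul_single, pathMul, dif_neg h2,
      smul_zero]
  · rw [pathMul, dif_neg h, z1, pathMul, dif_neg h', z2]

/-- The trivial path `e_i` at the vertex `i`. -/
def vertex (k : Type u) [CommRing k] (Q : ArrowQuiver V A) (i : V) : PathAlgebra k Q :=
  single (QPath.nil Q i) 1

/-- An arrow as an element of `kQ`. -/
def arrow (k : Type u) [CommRing k] (Q : ArrowQuiver V A) (a : A) : PathAlgebra k Q :=
  single (QPath.ofArrow Q a) 1

theorem vertex_mul_single (i : V) (p : Q.QPath) (c : k) :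
    vertex k Q i * single p c = open Classical in if i = p.target then single p c else 0 := by
  rw [vertex, single_mul_single]
  by_cases h : i = p.target
  · have h1 : (QPath.nil Q i).source = p.target := h
    rw [if_pos h, pathMul, dif_pos h1, smul_single]
    congr 1
    · ext <;> simp [QPath.comp, QPath.nil, h]
    · ring
  · have h1 : ¬ (QPath.nil Q i).source = p.target := h
    rw [if_neg h, pathMul, dif_neg h1, smul_zero]

theorem single_mul_vertex (i : V) (p : Q.QPath) (c : k) :
    single p c * vertex k Q i = open Classical in if p.source = i then single p c else 0 := by
  rw [vertex, single_mul_single]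
  by_cases h : p.source = i
  · have h1 : p.source = (QPath.nil Q i).target := h
    rw [if_pos h, pathMul, dif_pos h1, smul_single]
    congr 1
    · ext <;> simp [QPath.comp, QPath.nil, h]
    · ring
  · have h1 : ¬ p.source = (QPath.nil Q i).target := h
    rw [if_neg h, pathMul, dif_neg h1, smul_zero]

variable [Fintype V]

/-- The unit of `kQ` is the sum of the trivial paths. -/
instance : One (PathAlgebra k Q) := ⟨∑ i, vertex k Q i⟩

theorem one_def : (1 : PathAlgebra k Q) = ∑ i, vertex k Q i := rfl

instance : Ring (PathAlgebra k Q) where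
  __ := (inferInstance : AddCommGroup (PathAlgebra k Q))
  left_distrib x y z := by simp [mul_def]
  right_distrib x y z := by simp [mul_def]
  zero_mul x := by simp [mul_def]
  mul_zero x := by simp [mul_def]
  mul_assoc x y z := by
    induction x using induction_linear with
    | zero => simp [mul_def]
    | add x x' hx hx' => simp only [mul_def, map_add, LinearMap.add_apply] at *; rw [hx, hx']
    | single p a =>
    induction y using induction_linear with
    | zero => simp [mul_def]
    | add x x' hx hx' => simp only [mul_def, map_add, LinearMap.add_apply] at *; rw [hx, hx']
    | single q b =>
    induction z using induction_linear with
    | zero => simp [mul_def]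
    | add x x' hx hx' => simp only [mul_def, map_add] at *; rw [hx, hx']
    | single r c =>
    have e := pathMul_mul (k := k) p q r
    have h1 : (single r c : PathAlgebra k Q) = c • single r 1 := by simp [smul_single]
    have h2 : (single p a : PathAlgebra k Q) = a • single p 1 := by simp [smul_single]
    rw [single_mul_single, single_mul_single, h1, h2]
    simp only [mul_def, map_smul, LinearMap.smul_apply] at *
    rw [e]
    simp only [smul_smul]
    congr 1
    ring
  one_mul x := by
    induction x using induction_linear with
    | zero => simp [mul_def]
    | add x y hx hy => simp only [mul_def, map_add] at *; rw [hx, hy]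
    | single p c =>
      have : (1 : PathAlgebra k Q) * single p c = ∑ i, vertex k Q i * single p c := by
        simp [one_def, mul_def]
      rw [this]
      classical
      simp [vertex_mul_single]
  mul_one x := by
    induction x using induction_linear with
    | zero => simp [mul_def]
    | add x y hx hy => simp only [mul_def, map_add, LinearMap.add_apply] at *; rw [hx, hy]
    | single p c =>
      have : single p c * (1 : PathAlgebra k Q) = ∑ i, single p c * vertex k Q i := by
        simp [one_def, mul_def]
      rw [this]
      classical
      simp [single_mul_vertex]

instance : Algebra k (PathAlgebra k Q) :=
  Algebra.ofModule (fun r x y => by simp [mul_def]) (fun r x y => by simp [mul_def])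


/-- `kQ_n`, the span of the paths of length `n`. -/
def degree (k : Type u) [CommRing k] {V : Type v} {A : Type w} (Q : ArrowQuiver V A) (n : ℕ) :
    Submodule k (PathAlgebra k Q) :=
  Submodule.span k {x | ∃ p : Q.QPath, p.length = n ∧ x = single p 1}

/-- Quadratic relations: linear combinations of parallel paths of length two. -/
def IsQuadraticRelation {V : Type v} {A : Type w} {Q : ArrowQuiver V A}
    (r : PathAlgebra k Q) : Prop :=
  ∃ i j : V, r ∈ Submodule.span k {x : PathAlgebra k Q |
    ∃ p : Q.QPath, p.length = 2 ∧ p.source = i ∧ p.target = j ∧ x = single p 1}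

/-- The bilinear form on `kQ` for which the paths are orthonormal; on `kQ_2` it is determined by
`αβ(α'β') = α(α') β(β')` for arrows. -/
def pairing {V : Type v} {A : Type w} {Q : ArrowQuiver V A} :
    PathAlgebra k Q →ₗ[k] PathAlgebra k Q →ₗ[k] k :=
  lift fun p => Finsupp.lapply p ∘ₗ toFinsupp.toLinearMap

/-- The orthogonal subspace in `kQ_2` of a set of elements. -/
def quadraticOrthogonal {V : Type v} {A : Type w} {Q : ArrowQuiver V A}
    (ρ : Set (PathAlgebra k Q)) : Submodule k (PathAlgebra k Q) where
  carrier := {x | x ∈ degree k Q 2 ∧ ∀ r ∈ ρ, pairing x r = 0}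
  add_mem' hx hy := ⟨add_mem hx.1 hy.1, fun r hr => by simp [hx.2 r hr, hy.2 r hr]⟩
  zero_mem' := ⟨zero_mem _, fun r _ => by simp⟩
  smul_mem' c x hx := ⟨Submodule.smul_mem _ c hx.1, fun r hr => by simp [hx.2 r hr]⟩

/-- The element of `kQ_1` with the given coefficients on the arrows. -/
def ofArrows (k : Type u) [CommRing k] {V : Type v} {A : Type w} (Q : ArrowQuiver V A) :
    (A →₀ k) →ₗ[k] PathAlgebra k Q :=
  Finsupp.lift (PathAlgebra k Q) k A fun a => arrow k Q a

end PathAlgebra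

open PathAlgebra

/-- The algebra `kQ/(ρ)` of a bound quiver `(Q, ρ)`: the quotient of the path algebra by the
two-sided ideal that is generated by `ρ`. -/
abbrev BoundQuiverAlgebra (k : Type u) [CommRing k] {V : Type v} {A : Type w} [Fintype V]
    (Q : ArrowQuiver V A) (ρ : Set (PathAlgebra k Q)) : Type (max u v w) :=
  RingQuot fun x y : PathAlgebra k Q => x ∈ ρ ∧ y = 0

/-- The projection `kQ → kQ/(ρ)`. -/
abbrev BoundQuiverAlgebra.mk {k : Type u} [CommRing k] {V : Type v} {A : Type w} [Fintype V]
    {Q : ArrowQuiver V A} (ρ : Set (PathAlgebra k Q)) :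
    PathAlgebra k Q →ₐ[k] BoundQuiverAlgebra k Q ρ :=
  RingQuot.mkAlgHom k _

/-! ### Skew group algebras and McKay quivers -/

section McKay

variable {k : Type u} [Field k] {ι : Type} [Fintype ι] [DecidableEq ι]

/-- The automorphism of `k[V]` that is induced by `g ∈ GL(V)`, where `V = k^ι` and `k[V]` is the
symmetric algebra of `V`: the variable `X i` is the `i`-th vector of the standard basis of `V`,
and `g` sends it to the `i`-th column of the matrix. -/
def polyAct (g : GL ι k) : MvPolynomial ι k →ₐ[k] MvPolynomial ι k :=
  MvPolynomial.aeval fun i => ∑ j, MvPolynomial.C (g.1 j i) * MvPolynomial.X j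

theorem polyAct_one : polyAct (1 : GL ι k) = AlgHom.id k _ := by
  ext i : 1
  simp [polyAct, Matrix.one_apply]

theorem polyAct_mul (g h : GL ι k) : polyAct (g * h) = (polyAct g).comp (polyAct h) := by
  ext i : 1
  simp only [polyAct, MvPolynomial.aeval_X, AlgHom.comp_apply, map_sum, map_mul,
    MvPolynomial.algHom_C, Units.val_mul, Matrix.mul_apply, Finset.sum_mul, Finset.mul_sum,
    MvPolynomial.algebraMap_eq]
  rw [Finset.sum_comm]
  refine Finset.sum_congr rfl fun x _ => Finset.sum_congr rfl fun y _ => ?_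
  ring

/-- The action of `GL(V)` on `k[V]` by algebra automorphisms. -/
instance : MulSemiringAction (GL ι k) (MvPolynomial ι k) where
  smul g f := polyAct g f
  one_smul f := congrArg (fun φ : MvPolynomial ι k →ₐ[k] MvPolynomial ι k => φ f) polyAct_one
  mul_smul g h f :=
    congrArg (fun φ : MvPolynomial ι k →ₐ[k] MvPolynomial ι k => φ f) (polyAct_mul g h)
  smul_zero g := map_zero (polyAct g)
  smul_add g := map_add (polyAct g)
  smul_one g := map_one (polyAct g)
  smul_mul g := map_mul (polyAct g)

instance : SMulCommClass (GL ι k) k (MvPolynomial ι k) where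
  smul_comm g c f := map_smul (polyAct g) c f

/-- The skew group algebra `k[V] * G`, in which `(f g)(f' g') = (f g(f')) (g g')`. -/
abbrev SkewGroupAlgebra (G : Subgroup (GL ι k)) : Type u :=
  SkewMonoidAlgebra (MvPolynomial ι k) G

/-- The inclusion of the group algebra `kG` in `k[V] * G`. -/
def groupAlgebraIncl (G : Subgroup (GL ι k)) : k[G] →ₐ[k] SkewGroupAlgebra G :=
  MonoidAlgebra.lift k (SkewGroupAlgebra G) G (SkewMonoidAlgebra.of (MvPolynomial ι k) G)

/-- The representation of `G ⊆ GL(V)` on `V = k^ι`. -/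
def naturalRep (G : Subgroup (GL ι k)) : Representation k G (ι → k) where
  toFun g := Matrix.toLin' g.1.1
  map_one' := by simp [Module.End.one_eq_id]
  map_mul' g h := by simp [Matrix.toLin'_mul, Module.End.mul_eq_comp]

/-- The representation that underlies an object of the category of finite-dimensional
representations. -/
abbrev FDRep.rep {G : Subgroup (GL ι k)} (X : FDRep k G) : Representation k G X := X.ρ

variable {V : Type v} {A : Type w}

/-- `Q` is the McKay quiver of `G ⊆ GL(V)`, where the vertex `i` stands for the irreducible
representation `S i`: the `S i` are a complete list of the irreducible representations up to
isomorphism, without repetitions, and `V ⊗ S i` is the direct sum of the `S (t(a))` over the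
arrows `a` with source `i`; thus the number of arrows from `i` to `j` is the multiplicity of
`S j` in `V ⊗ S i`. -/
structure IsMcKayQuiver (G : Subgroup (GL ι k)) (Q : ArrowQuiver V A)
    (S : V → FDRep k G) : Prop where
  irreducible : ∀ i, (S i).rep.IsIrreducible
  complete : ∀ X : FDRep k G, X.rep.IsIrreducible → ∃ i, Nonempty (X.rep.Equiv (S i).rep)
  distinct : ∀ i j, Nonempty ((S i).rep.Equiv (S j).rep) → i = j
  decomposition : ∀ i, Nonempty (((naturalRep G).tprod (S i).rep).Equiv
    (Representation.directSum fun a : {a : A // Q.src a = i} => (S (Q.tgt a)).rep))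

/-- `(Q, ρ)` is the bound McKay quiver of `G ⊆ GL(V)`: `Q` is the McKay quiver of `G`, `ρ` is a
set of quadratic relations, and `kQ/(ρ)` is isomorphic to the basic algebra `e (k[V] * G) e` of
`k[V] * G`. Here `e` is the sum of orthogonal idempotents `e i` of `kG`, one for each vertex, such
that `kG (e i)` is the irreducible representation at the vertex `i`; the isomorphism, which is
given by its composite with the inclusion of `e (k[V] * G) e` in `k[V] * G`, identifies the
trivial path at `i` with `e i`, and sends arrows to elements of degree one. -/
def IsBoundMcKayQuiver [Fintype V] (G : Subgroup (GL ι k)) (Q : ArrowQuiver V A)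
    (ρ : Set (PathAlgebra k Q)) : Prop :=
  (∀ r ∈ ρ, IsQuadraticRelation r) ∧
  ∃ (S : V → FDRep k G) (e : V → k[G])
    (φ : BoundQuiverAlgebra k Q ρ →ₙₐ[k] SkewGroupAlgebra G),
    IsMcKayQuiver G Q S ∧
    OrthogonalIdempotents e ∧
    (∀ i, Nonempty (Submodule.span k[G] {e i} ≃ₗ[k[G]] (S i).rep.asModule)) ∧
    (∀ i, φ (.mk ρ (vertex k Q i)) = groupAlgebraIncl G (e i)) ∧
    (∀ a g, (φ (.mk ρ (arrow k Q a))).coeff g ∈ MvPolynomial.homogeneousSubmodule ι k 1) ∧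
    Function.Injective φ ∧
    Set.range φ = {x | groupAlgebraIncl G (∑ i, e i) * x * groupAlgebraIncl G (∑ i, e i) = x}

/-! ### The group `G̃` -/

/-- The block diagonal matrix with blocks `M` and `c`, for `V' = V ⊕ k`. -/
def blockDiagMat : Matrix ι ι k × k →* Matrix (ι ⊕ Unit) (ι ⊕ Unit) k where
  toFun x := Matrix.fromBlocks x.1 0 0 (Matrix.diagonal fun _ => x.2)
  map_one' := by
    rw [← Matrix.fromBlocks_one]
    simp [← Matrix.diagonal_one]
  map_mul' x y := by simp [Matrix.fromBlocks_multiply]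

/-- The block diagonal embedding `GL(V) × kˣ → GL(V')`, where `V' = V ⊕ k`. -/
def blockDiagGL : GL ι k × kˣ →* GL (ι ⊕ Unit) k :=
  (Units.map blockDiagMat).comp (MulEquiv.prodUnits.symm : GL ι k × kˣ ≃* _).toMonoidHom

/-- The embedding `g ↦ diag(g, det(g)⁻¹)` of `GL(V)` in `SL(V') ⊆ GL(V')`. -/
def detEmbedding : GL ι k →* GL (ι ⊕ Unit) k :=
  blockDiagGL.comp ((MonoidHom.id _).prod (Matrix.GeneralLinearGroup.det)⁻¹)

/-- The group `G̃ = G' C_m`, where `G'` is the image of `G` in `SL(V')` and `C_m` is generated by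
`diag(1, …, 1, ξ)` for a primitive `m`-th root of unity `ξ`. -/
def cyclicExtension (G : Subgroup (GL ι k)) (ξ : kˣ) : Subgroup (GL (ι ⊕ Unit) k) :=
  G.map detEmbedding ⊔ Subgroup.zpowers (blockDiagGL (1, ξ))

end McKay

/-! ### Nakayama automorphisms -/

section Nakayama

variable {k : Type u} [Field k] {V : Type v} {A : Type w} [Fintype V]

/-- A Nakayama automorphism `ν` of the algebra `Λ = kQ/(θ)` which is graded and permutes the
trivial paths: there is a nondegenerate linear form `f` on `Λ` with `f (x y) = f (y ν(x))`. -/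
structure NakayamaAutomorphism (k : Type u) [Field k] (Q : ArrowQuiver V A)
    (θ : Set (PathAlgebra k Q)) where
  toAlgEquiv : BoundQuiverAlgebra k Q θ ≃ₐ[k] BoundQuiverAlgebra k Q θ
  /-- the Nakayama translation on the vertices -/
  onVertices : Equiv.Perm V
  /-- the action on `kQ_1` -/
  onArrows : (A →₀ k) ≃ₗ[k] (A →₀ k)
  map_vertex : ∀ i, toAlgEquiv (.mk θ (vertex k Q i)) = .mk θ (vertex k Q (onVertices i))
  map_arrow : ∀ a,
    toAlgEquiv (.mk θ (arrow k Q a)) = .mk θ (ofArrows k Q (onArrows (Finsupp.single a 1)))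
  exists_form : ∃ f : BoundQuiverAlgebra k Q θ →ₗ[k] k,
    (∀ x, (∀ y, f (x * y) = 0) → x = 0) ∧ ∀ x y, f (x * y) = f (y * toAlgEquiv x)

/-- `ν⁻¹ α` for an arrow `α` of the quadratic dual of `kQ/(θ)`. The arrows of the two algebras are
dual bases, and `ν` acts on the degree one part of the dual algebra contragrediently, that is by
the inverse of the transpose of the matrix of `ν`. Hence the coefficient of `γ` in `ν⁻¹ α` is the
coefficient of `α` in `ν γ`. -/
def NakayamaAutomorphism.dualInv [Fintype A] {Q : ArrowQuiver V A} {θ : Set (PathAlgebra k Q)}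
    (ν : NakayamaAutomorphism k Q θ) (α : A) : A →₀ k :=
  Finsupp.equivFunOnFinite.symm fun γ => ν.onArrows (Finsupp.single γ 1) α

end Nakayama

/-! ### The quiver of `G̃` and its relations -/

/-- The quiver with vertices `(i, t)`, arrows `(α, t) : (i, t) → (j, t)` for each arrow
`α : i → j` of `Q`, and arrows `(β_i, t) : (i, t) → (ν i, t + 1)` for each vertex `i` of `Q`,
where `t ∈ ℤ/m`. -/
def ArrowQuiver.tilde {V : Type v} {A : Type w} (Q : ArrowQuiver V A) (ν : Equiv.Perm V) (m : ℕ) :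
    ArrowQuiver (V × ZMod m) (A × ZMod m ⊕ V × ZMod m) where
  src
    | .inl (α, t) => (Q.src α, t)
    | .inr (i, t) => (i, t)
  tgt
    | .inl (α, t) => (Q.tgt α, t)
    | .inr (i, t) => (ν i, t + 1)

section Tilde

variable {V : Type v} {A : Type w} {Q : ArrowQuiver V A} (ν : Equiv.Perm V) (m : ℕ)

theorem ArrowQuiver.isWalk_tilde (t : ZMod m) : ∀ {l : List A} {x y : V}, Q.IsWalk x l y →
    (Q.tilde ν m).IsWalk (x, t) (l.map fun α => .inl (α, t)) (y, t)
  | [], _, _, h => congrArg (fun i => (i, t)) h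
  | _ :: _, _, _, h => ⟨congrArg (fun i => (i, t)) h.1, isWalk_tilde t h.2⟩

/-- The path `(p, t)` in the `t`-th copy of `Q`. -/
def ArrowQuiver.QPath.copy (t : ZMod m) (p : Q.QPath) : (Q.tilde ν m).QPath :=
  ⟨(p.source, t), (p.target, t), p.arrows.map fun α => .inl (α, t), isWalk_tilde ν m t p.isWalk⟩

variable {k : Type u} [Field k]

/-- The linear map `ϱ ↦ (ϱ, t)`. -/
def PathAlgebra.copy (t : ZMod m) : PathAlgebra k Q →ₗ[k] PathAlgebra k (Q.tilde ν m) :=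
  lift fun p => single (p.copy ν m t) 1

/-- The arrow `(α, t)`. -/
def alphaArrow (k : Type u) [Field k] (Q : ArrowQuiver V A) (α : A) (t : ZMod m) :
    PathAlgebra k (Q.tilde ν m) :=
  arrow k (Q.tilde ν m) (.inl (α, t))

/-- The arrow `(β_i, t)`. -/
def betaArrow (k : Type u) [Field k] (Q : ArrowQuiver V A) (i : V) (t : ZMod m) :
    PathAlgebra k (Q.tilde ν m) :=
  arrow k (Q.tilde ν m) (.inr (i, t))

end Tilde

section Relations

variable {k : Type u} [Field k] {V : Type v} {A : Type w} [Fintype V] [Fintype A]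
  {Q : ArrowQuiver V A} {θ : Set (PathAlgebra k Q)} (ν : NakayamaAutomorphism k Q θ) (m : ℕ)

/-- The relations `(ϱ, t)` for `ϱ ∈ ρ`, and
`(α, t) (β_{ν⁻¹ i}, t - 1) - c (β_{ν⁻¹ j}, t - 1) (x α, t - 1)` for the arrows `α : i → j` of `Q`,
where `x α` is an element of `kQ_1` and `c` is a scalar. -/
def commutationRelations (ρ : Set (PathAlgebra k Q)) (c : k) (x : A → A →₀ k) :
    Set (PathAlgebra k (Q.tilde ν.onVertices m)) :=
  ⋃ t : ZMod m,
    {r | ∃ ϱ ∈ ρ, r = copy ν.onVertices m t ϱ} ∪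
    {r | ∃ α : A, r =
      alphaArrow ν.onVertices m k Q α t *
          betaArrow ν.onVertices m k Q (ν.onVertices.symm (Q.src α)) (t - 1) -
        c • (betaArrow ν.onVertices m k Q (ν.onVertices.symm (Q.tgt α)) (t - 1) *
          copy ν.onVertices m (t - 1) (ofArrows k Q (x α)))}

/-- The relation set `ρ_{G̃}` for `G ⊆ GL(s, k)`:
the relations `(ϱ, t)` for `ϱ ∈ ρ_G`, and
`(α, t) (β_{ν⁻¹ i}, t - 1) - (-1)^(s-1) (β_{ν⁻¹ j}, t - 1) (ν⁻¹ α, t - 1)`. -/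
def rhoTilde (s : ℕ) (ρ : Set (PathAlgebra k Q)) :
    Set (PathAlgebra k (Q.tilde ν.onVertices m)) :=
  commutationRelations ν m ρ ((-1) ^ (s + 1)) ν.dualInv

/-- The relation set `θ_{G̃}` for `G ⊆ GL(s, k)`:
the relations `(ϱ, t)` for `ϱ ∈ θ_G`, the relations `(β_{ν i}, t + 1) (β_i, t)`, and
`(α, t) (β_{ν⁻¹ i}, t - 1) - (β_{ν⁻¹ j}, t - 1) (ν⁻¹ σ α, t - 1)`, where `σ α = (-1)^s α`. -/
def thetaTilde (s : ℕ) : Set (PathAlgebra k (Q.tilde ν.onVertices m)) :=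
  commutationRelations ν m θ ((-1) ^ s) (fun α => ν.onArrows.symm (Finsupp.single α 1)) ∪
    {r | ∃ (i : V) (t : ZMod m), r =
      betaArrow ν.onVertices m k Q (ν.onVertices i) (t + 1) * betaArrow ν.onVertices m k Q i t}

end Relations

end

/-! Write `τ` for the automorphism `g ↦ det(g) g` of `kG` and `e` for the sum of the `e i`. In `k[V
⊕ k] * G̃` the new variable `x` commutes with `k[V]`, and `z x = x τ⁻¹(z)` for `z` in `kG`, because
`G` acts on `x` by `det⁻¹`. The idempotents `ε_t` of the cyclic group commute with `k[V] * G` and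
satisfy `ε_{t+1} x = x ε_t`. So this algebra is a skew polynomial extension in `x` of `m` copies of
`k[V] * G`. Its corner at `e` becomes a skew polynomial extension of `m` copies of `kQ/(ρ)` in `b =
x v`, once there is an element `v` of `kG` which is invertible between `e` and `τ⁻¹(e)` and
intertwines `e i` with `τ⁻¹(e (ν i))`. Then `β_i` in level `t` is `b (e i) ε_t`, and moving arrows
past `b` must yield the action of `ν⁻¹` with the sign `(-1)^(s-1)`.

The heart of the proof is the construction of `v` from the Nakayama automorphism. The arrows are
elements of `V ⊗ kG`, and the span of `ρ` consists of the quadratic elements whose image in `V ⊗ V ⊗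
kG` is antisymmetric (`isArrowSystem_arrowCol`). A linear form `F` on `kQ` defines in each degree
the tensor `∑ F(p) p` (`tensorOf`), and a tensor gives back a form by contraction with dual rows
(`formOf`, `exists_dualRows`). Under this correspondence, forms that vanish on the ideal `(θ)`
belong to alternating tensors (`isAlternatingOn_tensorOf`, `formOf_ideal`). Hence a form on `Λ(G)`
vanishes above degree `s`, and in degree `s` its tensor is the volume form times some `u` in `kG`.

For the form of the Nakayama automorphism, the identity for trivial paths becomes `τ(e i) u = u e (ν
i)`, as `G` acts on the volume form by `det`. The identity for arrows compares the removal of the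
first letter with the removal of the last one; carrying a letter past the `s - 1` others is the
origin of the sign. Nondegeneracy gives `τ(e i) u ≠ 0`, and Schur's lemma makes these elements
invertible between corners (`exists_nakayamaElement`). The inverses, rescaled and twisted by `τ⁻¹`,
add up to `v` (`exists_twistElements`, `exists_isTwistElement`).

The isomorphism of algebras then follows from normal forms in powers of `b` (`exists_isNormal`,
`IsTwistedExtension.exists_iso`). On the side of representations, `G̃` is `G × ℤ/m`, its irreducible
representations are those of `G` with a character of `ℤ/m`, and `v` gives `S_{ν i} ≅ S_i ⊗ det⁻¹`,
which accounts for the arrows `β_i` (`IsMcKayQuiver.tilde`). The orthogonality statement is linear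
algebra: the mixed relations of the two families have opposite signs and mutually inverse transposed
matrices (`span_rhoTilde`). -/

set_option linter.unusedSectionVars false

noncomputable section

open ArrowQuiver PathAlgebra

/-! ### Paths, coefficients and length -/

namespace ArrowQuiver.QPath

variable {V : Type v} {A : Type w} {Q : ArrowQuiver V A}

@[elab_as_elim]
theorem induction_cons {P : Q.QPath → Prop} (nil : ∀ i, P (nil Q i))
    (cons : ∀ a p h, P p → P ((ofArrow Q a).comp p h)) (p : Q.QPath) : P p := by
  obtain ⟨s, t, l, h⟩ := p
  induction l generalizing t with
  | nil => obtain rfl : t = s := h; exact nil _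
  | cons a l ih =>
    obtain ⟨rfl, h2⟩ := h
    exact cons a ⟨s, Q.src a, l, h2⟩ rfl (ih _ h2)

@[simp] theorem length_nil (i : V) : (nil Q i).length = 0 := rfl
@[simp] theorem length_ofArrow (a : A) : (ofArrow Q a).length = 1 := rfl
@[simp] theorem length_comp (p q : Q.QPath) (h) : (p.comp q h).length = p.length + q.length :=
  List.length_append

end ArrowQuiver.QPath

namespace PathAlgebra

section Basic

variable {k : Type u} [CommRing k] {V : Type v} {A : Type w} {Q : ArrowQuiver V A}

theorem coeff_single [DecidableEq Q.QPath] (p q : Q.QPath) (c : k) :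
    coeff (single p c) q = if p = q then c else 0 :=
  Finsupp.single_apply

/-- The coefficient of a path, as a linear form. -/
def coeffHom (k : Type u) [CommRing k] (p : Q.QPath) : PathAlgebra k Q →ₗ[k] k :=
  Finsupp.lapply p ∘ₗ toFinsupp.toLinearMap

@[simp] theorem coeff_sub (x y : PathAlgebra k Q) (p) : coeff (x - y) p = coeff x p - coeff y p :=
  rfl
@[simp] theorem coeff_smul (c : k) (x : PathAlgebra k Q) (p) : coeff (c • x) p = c * coeff x p :=
  rfl

theorem coeff_sum {ι : Type*} (s : Finset ι) (f : ι → PathAlgebra k Q) (p) :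
    coeff (∑ i ∈ s, f i) p = ∑ i ∈ s, coeff (f i) p :=
  map_sum (coeffHom k p) f s

theorem ext_coeff {x y : PathAlgebra k Q} (h : ∀ p, coeff x p = coeff y p) : x = y :=
  Finsupp.ext h

theorem pairing_single_left (p : Q.QPath) (c : k) (x : PathAlgebra k Q) :
    pairing (single p c) x = c * coeff x p := by
  rw [pairing, lift_single]; rfl

theorem mem_span_single_iff (P : Q.QPath → Prop) (x : PathAlgebra k Q) :
    x ∈ Submodule.span k {x : PathAlgebra k Q | ∃ p, P p ∧ x = single p 1} ↔
      ∀ p, coeff x p ≠ 0 → P p := by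
  have h := Finsupp.supported_eq_span_single k {p : Q.QPath | P p}
  have h2 : {x : PathAlgebra k Q | ∃ p, P p ∧ x = single p 1} =
      (fun i => Finsupp.single i (1 : k)) '' {p : Q.QPath | P p} := by
    ext y
    constructor
    · rintro ⟨p, hp, rfl⟩; exact ⟨p, hp, rfl⟩
    · rintro ⟨p, hp, rfl⟩; exact ⟨p, hp, rfl⟩
  have h3 : x ∈ Submodule.span k {x : PathAlgebra k Q | ∃ p, P p ∧ x = single p 1} ↔
      (x : Q.QPath →₀ k) ∈ Finsupp.supported k k {p : Q.QPath | P p} := by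
    rw [h2, h]; rfl
  exact h3.trans ((Finsupp.mem_supported' _ _).trans (forall_congr' fun p => not_imp_comm))

theorem mem_degree_iff (n : ℕ) (x : PathAlgebra k Q) :
    x ∈ degree k Q n ↔ ∀ p, coeff x p ≠ 0 → p.length = n :=
  mem_span_single_iff (fun p : Q.QPath => p.length = n) x

theorem single_comp (a : A) (p : Q.QPath) (h : (QPath.ofArrow Q a).source = p.target) (c : k) :
    single ((QPath.ofArrow Q a).comp p h) c = arrow k Q a * single p c := by
  rw [arrow, single_mul_single, pathMul, dif_pos h, smul_single]; simp

theorem single_mul_single_of_eq (p q : Q.QPath) (h : p.source = q.target) (c d : k) :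
    single p c * single q d = single (p.comp q h) (c * d) := by
  rw [single_mul_single, pathMul, dif_pos h, smul_single, mul_one]

theorem single_mul_single_of_ne (p q : Q.QPath) (h : ¬ p.source = q.target) (c d : k) :
    single p c * single q d = 0 := by
  rw [single_mul_single, pathMul, dif_neg h, smul_zero]

/-- The span of the paths of length at least `n`. -/
def atLeast (k : Type u) [CommRing k] {V : Type v} {A : Type w} (Q : ArrowQuiver V A) (n : ℕ) :
    Submodule k (PathAlgebra k Q) :=
  Submodule.span k {x | ∃ p : Q.QPath, n ≤ p.length ∧ x = single p 1}

theorem mem_atLeast_iff (n : ℕ) (x : PathAlgebra k Q) :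
    x ∈ atLeast k Q n ↔ ∀ p, coeff x p ≠ 0 → n ≤ p.length :=
  mem_span_single_iff (fun p : Q.QPath => n ≤ p.length) x

theorem single_mem_atLeast {n : ℕ} (p : Q.QPath) (hp : n ≤ p.length) (c : k) :
    single p c ∈ atLeast k Q n := by
  classical
  rw [mem_atLeast_iff]
  intro q hq
  rw [coeff_single] at hq
  split_ifs at hq with h
  · rw [← h]; exact hp
  · exact absurd rfl hq

end Basic

/-! ### Products in the path algebra and ideals generated by relations -/

section Ring

variable {k : Type u} [CommRing k] {V : Type v} {A : Type w} [Fintype V] {Q : ArrowQuiver V A}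

theorem vertex_mul_vertex [DecidableEq V] (i j : V) :
    vertex k Q i * vertex k Q j = if i = j then vertex k Q i else 0 := by
  refine (vertex_mul_single i (QPath.nil Q j) 1).trans ?_
  by_cases h : i = j
  · subst h; simp [QPath.nil, vertex]
  · simp [QPath.nil, h]

theorem vertex_tgt_mul_arrow (a : A) : vertex k Q (Q.tgt a) * arrow k Q a = arrow k Q a := by
  rw [arrow, vertex_mul_single]; simp [QPath.ofArrow]

theorem arrow_mul_vertex_src (a : A) : arrow k Q a * vertex k Q (Q.src a) = arrow k Q a := by
  rw [arrow, single_mul_vertex]; simp [QPath.ofArrow]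

theorem vertex_mul_arrow [DecidableEq V] (i : V) (a : A) :
    vertex k Q i * arrow k Q a = if i = Q.tgt a then arrow k Q a else 0 := by
  rw [arrow, vertex_mul_single]; congr

theorem arrow_mul_vertex [DecidableEq V] (i : V) (a : A) :
    arrow k Q a * vertex k Q i = if Q.src a = i then arrow k Q a else 0 := by
  rw [arrow, single_mul_vertex]; congr

@[elab_as_elim]
theorem induction_arrow {P : PathAlgebra k Q → Prop} (x : PathAlgebra k Q) (zero : P 0)
    (add : ∀ x y, P x → P y → P (x + y)) (smul : ∀ (c : k) x, P x → P (c • x))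
    (vertex : ∀ i, P (vertex k Q i)) (arrow_mul : ∀ a x, P x → P (arrow k Q a * x)) : P x := by
  refine PathAlgebra.induction_linear x zero add fun p c => ?_
  have h : P (single p 1) := by
    induction p using QPath.induction_cons with
    | nil i => exact vertex i
    | cons a p h ih => rw [single_comp]; exact arrow_mul a _ ih
  have := smul c _ h
  rwa [smul_single, mul_one] at this

theorem mul_mem_of_single_mul {J : Submodule k (PathAlgebra k Q)} {s : Set (PathAlgebra k Q)}
    (h : ∀ p : Q.QPath, ∀ r ∈ s, single p 1 * r ∈ J) {x : PathAlgebra k Q}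
    (hx : x ∈ Submodule.span k s) (y : PathAlgebra k Q) : y * x ∈ J := by
  induction y using induction_linear with
  | zero => rw [zero_mul]; exact J.zero_mem
  | add y z hy hz => rw [add_mul]; exact J.add_mem hy hz
  | single p c =>
    have e : (single p c : PathAlgebra k Q) = c • single p 1 := by rw [smul_single, mul_one]
    rw [e, smul_mul_assoc]
    refine J.smul_mem c ?_
    induction hx using Submodule.span_induction with
    | mem r hr => exact h p r hr
    | zero => rw [mul_zero]; exact J.zero_mem
    | add y z _ _ hy hz => rw [mul_add]; exact J.add_mem hy hz
    | smul c y _ hy => rw [mul_smul_comm]; exact J.smul_mem c hy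

theorem mul_mem_of_mul_single {J : Submodule k (PathAlgebra k Q)} {s : Set (PathAlgebra k Q)}
    (h : ∀ p : Q.QPath, ∀ r ∈ s, r * single p 1 ∈ J) {x : PathAlgebra k Q}
    (hx : x ∈ Submodule.span k s) (y : PathAlgebra k Q) : x * y ∈ J := by
  induction y using induction_linear with
  | zero => rw [mul_zero]; exact J.zero_mem
  | add y z hy hz => rw [mul_add]; exact J.add_mem hy hz
  | single p c =>
    have e : (single p c : PathAlgebra k Q) = c • single p 1 := by rw [smul_single, mul_one]
    rw [e, mul_smul_comm]
    refine J.smul_mem c ?_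
    induction hx using Submodule.span_induction with
    | mem r hr => exact h p r hr
    | zero => rw [zero_mul]; exact J.zero_mem
    | add y z _ _ hy hz => rw [add_mul]; exact J.add_mem hy hz
    | smul c y _ hy => rw [smul_mul_assoc]; exact J.smul_mem c hy

theorem single_mul_mem_atLeast {n : ℕ} (p : Q.QPath) {x : PathAlgebra k Q}
    (hx : x ∈ atLeast k Q n) : single p 1 * x ∈ atLeast k Q (n + p.length) := by
  induction hx using Submodule.span_induction with
  | mem r hr =>
    obtain ⟨q, hq, rfl⟩ := hr
    by_cases h : p.source = q.target
    · rw [single_mul_single_of_eq p q h]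
      exact single_mem_atLeast _ (by simp; omega) _
    · rw [single_mul_single_of_ne p q h]; exact Submodule.zero_mem _
  | zero => rw [mul_zero]; exact Submodule.zero_mem _
  | add y z _ _ hy hz => rw [mul_add]; exact Submodule.add_mem _ hy hz
  | smul c y _ hy => rw [mul_smul_comm]; exact Submodule.smul_mem _ c hy

theorem mul_single_mem_atLeast {n : ℕ} (p : Q.QPath) {x : PathAlgebra k Q}
    (hx : x ∈ atLeast k Q n) : x * single p 1 ∈ atLeast k Q (n + p.length) := by
  induction hx using Submodule.span_induction with
  | mem r hr =>
    obtain ⟨q, hq, rfl⟩ := hr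
    by_cases h : q.source = p.target
    · rw [single_mul_single_of_eq q p h]
      exact single_mem_atLeast _ (by simp; omega) _
    · rw [single_mul_single_of_ne q p h]; exact Submodule.zero_mem _
  | zero => rw [zero_mul]; exact Submodule.zero_mem _
  | add y z _ _ hy hz => rw [add_mul]; exact Submodule.add_mem _ hy hz
  | smul c y _ hy => rw [smul_mul_assoc]; exact Submodule.smul_mem _ c hy

theorem atLeast_mono {n m : ℕ} (h : n ≤ m) : atLeast k Q m ≤ atLeast k Q n := fun x hx => by
  rw [mem_atLeast_iff] at *
  exact fun p hp => h.trans (hx p hp)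

theorem degree_le_atLeast (n : ℕ) : degree k Q n ≤ atLeast k Q n := fun x hx => by
  rw [mem_atLeast_iff]; rw [mem_degree_iff] at hx
  exact fun p hp => (hx p hp).ge

/-- An element of the ideal that is generated by `ρ` lies in each subspace which contains `ρ` and
is closed under multiplication with elements of `kQ` from both sides. -/
theorem mem_of_mk_eq_zero {ρ : Set (PathAlgebra k Q)} {x : PathAlgebra k Q}
    (hx : BoundQuiverAlgebra.mk ρ x = 0) (J : Submodule k (PathAlgebra k Q)) (hρ : ρ ⊆ J)
    (hl : ∀ y x, x ∈ J → y * x ∈ J) (hr : ∀ y x, x ∈ J → x * y ∈ J) : x ∈ J := by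
  -- The closure properties make `J` a two-sided ideal, and the projection to its quotient factors
  -- through `kQ/(ρ)`.
  let I : TwoSidedIdeal (PathAlgebra k Q) := TwoSidedIdeal.mk' (J : Set (PathAlgebra k Q))
    J.zero_mem J.add_mem J.neg_mem (hl _ _) (hr _ _)
  have hI : ∀ x, x ∈ I ↔ x ∈ J := fun x => TwoSidedIdeal.mem_mk' ..
  let f : RingQuot (fun x y : PathAlgebra k Q => x ∈ ρ ∧ y = 0) →+* I.ringCon.Quotient :=
    RingQuot.lift ⟨I.ringCon.mk', fun {a b} h => by
      obtain ⟨h1, rfl⟩ := h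
      exact (RingCon.eq _).2 ((TwoSidedIdeal.mem_iff _ _).1 ((hI _).2 (hρ h1)))⟩
  have h1 : f (RingQuot.mkRingHom _ x) = I.ringCon.mk' x :=
    RingQuot.lift_mkRingHom_apply _ _ _
  have h2 : RingQuot.mkRingHom (fun x y : PathAlgebra k Q => x ∈ ρ ∧ y = 0) x = 0 := by
    rw [← RingQuot.mkAlgHom_coe k]; exact hx
  rw [h2, map_zero] at h1
  rw [← hI, TwoSidedIdeal.mem_iff]
  exact (RingCon.eq _).1 h1.symm

theorem mk_eq_zero_of_mem {ρ : Set (PathAlgebra k Q)} {x : PathAlgebra k Q} (hx : x ∈ ρ) :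
    BoundQuiverAlgebra.mk ρ x = 0 := by
  have := RingQuot.mkAlgHom_rel k (s := fun x y : PathAlgebra k Q => x ∈ ρ ∧ y = 0)
    (show x ∈ ρ ∧ (0 : PathAlgebra k Q) = 0 from ⟨hx, rfl⟩)
  rw [map_zero] at this
  exact this

theorem mk_surjective (ρ : Set (PathAlgebra k Q)) :
    Function.Surjective (BoundQuiverAlgebra.mk ρ) :=
  RingQuot.mkAlgHom_surjective k _

/-- Multiplication never shortens paths, so the ideal stays where its generators are. For quadratic
relations this keeps the arrows linearly independent in the quotient. -/
theorem mem_atLeast_of_mk_eq_zero {ρ : Set (PathAlgebra k Q)} {n : ℕ}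
    (hρ : ∀ r ∈ ρ, r ∈ atLeast k Q n) {x : PathAlgebra k Q}
    (hx : BoundQuiverAlgebra.mk ρ x = 0) : x ∈ atLeast k Q n :=
  mem_of_mk_eq_zero hx _ hρ
    (fun y _ hx => mul_mem_of_single_mul (fun p _ hr => atLeast_mono (Nat.le_add_right _ p.length)
      (single_mul_mem_atLeast p (Submodule.subset_span hr))) hx y)
    (fun y _ hx => mul_mem_of_mul_single (fun p _ hr => atLeast_mono (Nat.le_add_right _ p.length)
      (mul_single_mem_atLeast p (Submodule.subset_span hr))) hx y)

theorem IsQuadraticRelation.mem_degree {r : PathAlgebra k Q} (hr : IsQuadraticRelation r) :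
    r ∈ degree k Q 2 := by
  obtain ⟨i, j, h⟩ := hr
  refine Submodule.span_mono ?_ h
  rintro _ ⟨p, h1, -, -, rfl⟩
  exact ⟨p, h1, rfl⟩

/-- All paths in `r` have the same target. This is what makes the span of quadratic relations stable
under trivial paths. -/
theorem IsQuadraticRelation.vertex_mul {r : PathAlgebra k Q} (hr : IsQuadraticRelation r) (l : V) :
    vertex k Q l * r = r ∨ vertex k Q l * r = 0 := by
  classical
  obtain ⟨i, j, h⟩ := hr
  have key : vertex k Q l * r = if l = j then r else 0 := by
    induction h using Submodule.span_induction with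
    | mem r hr =>
      obtain ⟨p, -, -, rfl, rfl⟩ := hr
      rw [vertex_mul_single]
    | zero => simp
    | add y z _ _ hy hz => rw [mul_add, hy, hz]; split_ifs <;> simp
    | smul c y _ hy => rw [mul_smul_comm, hy]; split_ifs <;> simp
  rw [key]; split_ifs <;> simp

theorem IsQuadraticRelation.mul_vertex {r : PathAlgebra k Q} (hr : IsQuadraticRelation r) (l : V) :
    r * vertex k Q l = r ∨ r * vertex k Q l = 0 := by
  classical
  obtain ⟨i, j, h⟩ := hr
  have key : r * vertex k Q l = if i = l then r else 0 := by
    induction h using Submodule.span_induction with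
    | mem r hr =>
      obtain ⟨p, -, rfl, -, rfl⟩ := hr
      rw [single_mul_vertex]
    | zero => simp
    | add y z _ _ hy hz => rw [add_mul, hy, hz]; split_ifs <;> simp
    | smul c y _ hy => rw [smul_mul_assoc, hy]; split_ifs <;> simp
  rw [key]; split_ifs <;> simp

/-- The quadratic part of the ideal generated by quadratic relations is their span. -/
theorem mem_span_of_mk_eq_zero {ρ : Set (PathAlgebra k Q)} (hρ : ∀ r ∈ ρ, IsQuadraticRelation r)
    {x : PathAlgebra k Q} (h2 : x ∈ degree k Q 2) (hx : BoundQuiverAlgebra.mk ρ x = 0) :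
    x ∈ Submodule.span k ρ := by
  -- This sum is an ideal: a trivial path fixes or kills a relation, and any longer path sends it to
  -- length at least three. A quadratic element of the ideal then has no component of length three
  -- or more.
  have key : x ∈ Submodule.span k ρ ⊔ atLeast k Q 3 := by
    have e : Submodule.span k ρ ⊔ atLeast k Q 3 = Submodule.span k (ρ ∪
        {x | ∃ p : Q.QPath, 3 ≤ p.length ∧ x = single p 1}) := by
      rw [Submodule.span_union]; rfl
    rw [e]
    refine mem_of_mk_eq_zero hx _ (fun r hr => Submodule.subset_span (Or.inl hr)) ?_ ?_
    · intro y x hx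
      refine mul_mem_of_single_mul (fun p r hr => ?_) hx y
      rw [← e]
      rcases hr with hr | hr
      · rcases Nat.eq_zero_or_pos p.length with h0 | h0
        · obtain ⟨s, t, l, hl⟩ := p
          obtain rfl : l = [] := List.eq_nil_of_length_eq_zero h0
          obtain rfl : t = s := hl
          refine Submodule.mem_sup_left ?_
          rcases (hρ r hr).vertex_mul t with h | h
          · change vertex k Q t * r ∈ _; rw [h]; exact Submodule.subset_span hr
          · change vertex k Q t * r ∈ _; rw [h]; exact Submodule.zero_mem _
        · exact Submodule.mem_sup_right (atLeast_mono (by omega)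
            (single_mul_mem_atLeast p (degree_le_atLeast 2 (hρ r hr).mem_degree)))
      · exact Submodule.mem_sup_right (atLeast_mono (Nat.le_add_right _ p.length)
          (single_mul_mem_atLeast p (Submodule.subset_span hr)))
    · intro y x hx
      refine mul_mem_of_mul_single (fun p r hr => ?_) hx y
      rw [← e]
      rcases hr with hr | hr
      · rcases Nat.eq_zero_or_pos p.length with h0 | h0
        · obtain ⟨s, t, l, hl⟩ := p
          obtain rfl : l = [] := List.eq_nil_of_length_eq_zero h0
          obtain rfl : t = s := hl
          refine Submodule.mem_sup_left ?_
          rcases (hρ r hr).mul_vertex t with h | h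
          · change r * vertex k Q t ∈ _; rw [h]; exact Submodule.subset_span hr
          · change r * vertex k Q t ∈ _; rw [h]; exact Submodule.zero_mem _
        · exact Submodule.mem_sup_right (atLeast_mono (by omega)
            (mul_single_mem_atLeast p (degree_le_atLeast 2 (hρ r hr).mem_degree)))
      · exact Submodule.mem_sup_right (atLeast_mono (Nat.le_add_right _ p.length)
          (mul_single_mem_atLeast p (Submodule.subset_span hr)))
  obtain ⟨r, hr, j, hj, rfl⟩ := Submodule.mem_sup.1 key
  have hr2 : r ∈ degree k Q 2 :=
    (Submodule.span_le.2 fun r hr => (hρ r hr).mem_degree : _ ≤ degree k Q 2) hr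
  have hj2 : j ∈ degree k Q 2 := by
    have := sub_mem h2 hr2
    rwa [add_sub_cancel_left] at this
  have : j = 0 := ext_coeff fun p => by
    by_contra hp
    have h1 := (mem_degree_iff 2 j).1 hj2 p hp
    have h3 := (mem_atLeast_iff 3 j).1 hj p hp
    omega
  rw [this, add_zero]
  exact hr

theorem ofArrows_apply [Fintype A] (x : A →₀ k) :
    ofArrows k Q x = ∑ a, x a • arrow k Q a := by
  rw [ofArrows, Finsupp.lift_apply, Finsupp.sum_fintype _ _ (fun a => by simp)]

theorem coeff_arrow [DecidableEq A] (a b : A) :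
    coeff (arrow k Q a) (QPath.ofArrow Q b) = if a = b then 1 else 0 := by
  classical
  rw [arrow, coeff_single]
  refine if_congr ⟨fun h => ?_, fun h => by rw [h]⟩ rfl rfl
  have := congrArg QPath.arrows h
  simpa [QPath.ofArrow] using this

theorem coeff_ofArrows [Fintype A] (x : A →₀ k) (a : A) :
    coeff (ofArrows k Q x) (QPath.ofArrow Q a) = x a := by
  classical
  rw [ofArrows_apply, coeff_sum]
  simp [coeff_arrow]

end Ring

/-! ### Homomorphisms from path algebras and their quotients -/

section Lift

variable {k : Type u} [CommRing k] {V : Type v} {A : Type w} [Fintype V] {Q : ArrowQuiver V A}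
  {S : Type*} [Ring S] [Algebra k S]

/-- The image of a path under the map that is given by orthogonal idempotents at the vertices and
by elements for the arrows. -/
def pathImage (E : V → S) (f : A → S) (p : Q.QPath) : S := (p.arrows.map f).prod * E p.source

theorem pathImage_comp_arrow (E : V → S) (f : A → S) (a : A) (p : Q.QPath) (h) :
    pathImage E f ((QPath.ofArrow Q a).comp p h) = f a * pathImage E f p := by
  simp [pathImage, QPath.comp, QPath.ofArrow, mul_assoc]

theorem idempotent_mul_pathImage [DecidableEq V] {E : V → S} (hE : OrthogonalIdempotents E)
    {f : A → S} (hf : ∀ a, E (Q.tgt a) * f a = f a) (i : V) (p : Q.QPath) :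
    E i * pathImage E f p = if i = p.target then pathImage E f p else 0 := by
  cases p using QPath.induction_cons with
  | nil j =>
    simp only [pathImage, QPath.nil, List.map_nil, List.prod_nil, one_mul]
    rw [hE.mul_eq]
    split_ifs with h
    · rw [h]
    · rfl
  | cons a p h =>
    rw [pathImage_comp_arrow, ← mul_assoc, ← hf a, ← mul_assoc, hE.mul_eq]
    change _ = if i = Q.tgt a then _ else _
    split_ifs with h
    · rw [h]
    · simp

/-- For composable paths the idempotent in the middle is absorbed by the target of the second path;
for the others it annihilates it. Induction on the first path reduces both cases to a trivial path.
-/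
theorem pathImage_mul [DecidableEq V] {E : V → S} (hE : OrthogonalIdempotents E)
    {f : A → S} (hf : ∀ a, E (Q.tgt a) * f a = f a) (p q : Q.QPath) :
    pathImage E f p * pathImage E f q = lift (k := k) (pathImage E f) (pathMul k p q) := by
  induction p using QPath.induction_cons with
  | nil i =>
    have h0 : pathImage E f (QPath.nil Q i) = E i := by simp [pathImage, QPath.nil]
    rw [h0, idempotent_mul_pathImage hE hf]
    by_cases h : i = q.target
    · have h1 : (QPath.nil Q i).source = q.target := h
      rw [if_pos h, pathMul, dif_pos h1, lift_single, one_smul]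
      congr 1
      ext <;> simp [QPath.comp, QPath.nil, h]
    · have h1 : ¬ (QPath.nil Q i).source = q.target := h
      rw [if_neg h, pathMul, dif_neg h1, map_zero]
  | cons a p h ih =>
    rw [pathImage_comp_arrow, mul_assoc, ih]
    by_cases h1 : p.source = q.target
    · have h2 : ((QPath.ofArrow Q a).comp p h).source = q.target := h1
      rw [pathMul, dif_pos h1, pathMul, dif_pos h2, lift_single, lift_single, one_smul, one_smul]
      have h3 : ((QPath.ofArrow Q a).comp p h).comp q h2 =
          (QPath.ofArrow Q a).comp (p.comp q h1) h :=
        QPath.ext rfl rfl (List.append_assoc _ _ _)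
      rw [h3]
      exact (pathImage_comp_arrow E f a (p.comp q h1) h).symm
    · have h2 : ¬ ((QPath.ofArrow Q a).comp p h).source = q.target := h1
      rw [pathMul, dif_neg h1, pathMul, dif_neg h2, map_zero, mul_zero]

/-- The algebra homomorphism from `kQ` that is given by orthogonal idempotents at the vertices and
by elements for the arrows. -/
def liftHom (k : Type u) [CommRing k] [Algebra k S] (E : V → S) (hE : OrthogonalIdempotents E)
    (f : A → S) (hf : ∀ a, E (Q.tgt a) * f a = f a) :
    PathAlgebra k Q →ₙₐ[k] S where
  __ := lift (k := k) (pathImage E f)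
  map_smul' c x := map_smul (lift (k := k) (pathImage E f)) c x
  map_zero' := map_zero (lift (k := k) (pathImage E f))
  map_mul' x y := by
    classical
    change lift (k := k) (pathImage E f) (x * y) = lift (k := k) (pathImage E f) x *
      lift (k := k) (pathImage E f) y
    induction x using induction_linear with
    | zero => simp
    | add x x' hx hx' => rw [add_mul, map_add, hx, hx', map_add, add_mul]
    | single p a =>
    induction y using induction_linear with
    | zero => simp
    | add x x' hx hx' => rw [mul_add, map_add, hx, hx', map_add, mul_add]
    | single q b =>
    rw [single_mul_single, map_smul, ← pathImage_mul hE hf, lift_single, lift_single,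
      smul_mul_smul_comm]

theorem liftHom_vertex (E : V → S) (hE : OrthogonalIdempotents E) (f : A → S) (hf) (i : V) :
    liftHom (Q := Q) k E hE f hf (vertex k Q i) = E i := by
  change lift (k := k) (pathImage E f) (single _ _) = _
  rw [lift_single]; simp [pathImage, QPath.nil]

theorem liftHom_arrow (E : V → S) (hE : OrthogonalIdempotents E) (f : A → S) (hf)
    (hf' : ∀ a, f a * E (Q.src a) = f a) (a : A) :
    liftHom (Q := Q) k E hE f hf (arrow k Q a) = f a := by
  change lift (k := k) (pathImage E f) (single _ _) = _
  rw [lift_single]; simpa [pathImage, QPath.ofArrow] using hf' a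

/-- A homomorphism from `kQ` that annihilates `ρ` factors through `kQ/(ρ)`. -/
theorem exists_lift_quot {ρ : Set (PathAlgebra k Q)} (f : PathAlgebra k Q →ₙₐ[k] S)
    (hf : ∀ r ∈ ρ, f r = 0) :
    ∃ φ : BoundQuiverAlgebra k Q ρ →ₙₐ[k] S, ∀ x, φ (.mk ρ x) = f x := by
  let f' : PathAlgebra k Q →ₗ[k] S := (f : PathAlgebra k Q →ₗ[k] S)
  have hker : ∀ x, BoundQuiverAlgebra.mk ρ x = 0 → f x = 0 := fun x hx => by
    have := mem_of_mk_eq_zero hx (LinearMap.ker f') (fun r hr => hf r hr)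
      (fun y x hx => by
        rw [LinearMap.mem_ker] at *
        change f _ = 0 at hx
        change f _ = 0
        rw [map_mul, hx, mul_zero])
      (fun y x hx => by
        rw [LinearMap.mem_ker] at *
        change f _ = 0 at hx
        change f _ = 0
        rw [map_mul, hx, zero_mul])
    exact this
  have hfac : ∀ x y, BoundQuiverAlgebra.mk ρ x = BoundQuiverAlgebra.mk ρ y → f x = f y :=
    fun x y h => by
      have := hker (x - y) (by rw [map_sub, h, sub_self])
      rwa [map_sub, sub_eq_zero] at this
  -- The factorization need not preserve units, so it is defined through chosen representatives;
  -- `hfac` says that the choice is irrelevant.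
  let g := Function.surjInv (mk_surjective ρ)
  have hg : ∀ x, BoundQuiverAlgebra.mk ρ (g x) = x := Function.surjInv_eq _
  refine ⟨⟨⟨⟨fun x => f (g x), fun c x => ?_⟩, ?_, fun x y => ?_⟩, fun x y => ?_⟩, fun x => ?_⟩
  · change f (g (c • x)) = c • f (g x)
    rw [← map_smul]
    exact hfac _ _ (by rw [hg, map_smul, hg])
  · change f (g 0) = 0
    rw [← map_zero f]
    exact hfac _ _ (by rw [hg, map_zero])
  · change f (g (x + y)) = f (g x) + f (g y)
    rw [← map_add]
    exact hfac _ _ (by rw [hg, map_add, hg, hg])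
  · change f (g (x * y)) = f (g x) * f (g y)
    rw [← map_mul]
    exact hfac _ _ (by rw [hg, map_mul, hg, hg])
  · exact hfac _ _ (hg _)

end Lift

end PathAlgebra

end

/-! ### Basic idempotents of a finite-dimensional algebra -/

noncomputable section

/-- Orthogonal idempotents `e i` of an algebra such that the left modules `𝔸 (e i)` are
representatives of the isomorphism classes of simple modules. -/
structure IsBasicSystem {𝔸 : Type*} [Ring 𝔸] {V : Type*} (e : V → 𝔸) : Prop where
  orthogonal : OrthogonalIdempotents e
  simple : ∀ i, IsSimpleModule 𝔸 (Submodule.span 𝔸 {e i})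
  distinct : ∀ i j, Nonempty (Submodule.span 𝔸 {e i} ≃ₗ[𝔸] Submodule.span 𝔸 {e j}) → i = j
  complete : ∀ M : Submodule 𝔸 𝔸, IsCoatom M →
    ∃ i, Nonempty ((𝔸 ⧸ M) ≃ₗ[𝔸] Submodule.span 𝔸 {e i})

namespace IsBasicSystem

variable {k : Type*} [Field k] [IsAlgClosed k] {𝔸 : Type*} [Ring 𝔸] [Algebra k 𝔸]
  [FiniteDimensional k 𝔸] {V : Type*} {e : V → 𝔸} (he : IsBasicSystem e)
include he

theorem mul_self (i : V) : e i * e i = e i := he.orthogonal.idem i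

theorem mul_ne {i j : V} (h : i ≠ j) : e i * e j = 0 := he.orthogonal.ortho h

theorem ne_zero (i : V) : e i ≠ 0 := fun h => by
  have := (he.simple i).nontrivial
  obtain ⟨⟨x, hx⟩, hx0⟩ := exists_ne (0 : Submodule.span 𝔸 {e i})
  rw [h, Submodule.span_zero_singleton, Submodule.mem_bot] at hx
  exact hx0 (Subtype.ext hx)

theorem mem_span_iff {i : V} {x : 𝔸} : x ∈ Submodule.span 𝔸 {e i} ↔ x * e i = x := by
  rw [Submodule.mem_span_singleton]
  constructor
  · rintro ⟨y, rfl⟩; rw [smul_eq_mul, mul_assoc, he.mul_self]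
  · intro h; exact ⟨x, h⟩

/-- Right multiplication by an element of `e i 𝔸 e j`. -/
theorem exists_mulRight {i j : V} {z : 𝔸} (hz : z * e j = z) :
    ∃ f : Submodule.span 𝔸 {e i} →ₗ[𝔸] Submodule.span 𝔸 {e j}, ∀ x, (f x : 𝔸) = x * z := by
  refine ⟨((LinearMap.toSpanSingleton 𝔸 𝔸 z).domRestrict _).codRestrict _ fun x => ?_, fun x => rfl⟩
  rw [he.mem_span_iff]
  change (x : 𝔸) * z * e j = (x : 𝔸) * z
  rw [mul_assoc, hz]

/-- Schur's lemma: right multiplication by an element of `e i 𝔸 e j` is a map between nonisomorphic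
simple modules. -/
theorem corner_ne {i j : V} (h : i ≠ j) (z : 𝔸) : e i * z * e j = 0 := by
  have := he.simple i
  have := he.simple j
  obtain ⟨f, hf⟩ := he.exists_mulRight (i := i) (j := j) (z := e i * z * e j)
    (by rw [mul_assoc, he.mul_self])
  rcases LinearMap.bijective_or_eq_zero f with hb | h0
  · exact absurd (he.distinct i j ⟨LinearEquiv.ofBijective f hb⟩) h
  · have := hf ⟨e i, Submodule.mem_span_singleton_self _⟩
    rw [h0] at this
    simpa [← mul_assoc, he.mul_self] using this.symm

-- Schur's lemma over an algebraically closed field: right multiplication by `e i z e i` is an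
-- endomorphism of a simple module, hence a scalar.
variable (k) in
theorem corner_self (i : V) (z : 𝔸) : ∃ c : k, e i * z * e i = c • e i := by
  have := he.simple i
  have : FiniteDimensional k (Submodule.span 𝔸 {e i}) :=
    FiniteDimensional.of_injective ((Submodule.span 𝔸 {e i}).subtype.restrictScalars k)
      Subtype.val_injective
  obtain ⟨f, hf⟩ := he.exists_mulRight (i := i) (j := i) (z := e i * z * e i)
    (by rw [mul_assoc, he.mul_self])
  obtain ⟨c, hc⟩ := (IsSimpleModule.algebraMap_end_bijective_of_isAlgClosed (A := 𝔸)
    (V := Submodule.span 𝔸 {e i}) k).2 f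
  refine ⟨c, ?_⟩
  have h1 := hf ⟨e i, Submodule.mem_span_singleton_self _⟩
  rw [← hc] at h1
  have h2 : ((algebraMap k (Module.End 𝔸 (Submodule.span 𝔸 {e i})) c)
    ⟨e i, Submodule.mem_span_singleton_self _⟩ : 𝔸) = c • e i := rfl
  rw [h2] at h1
  rw [h1, ← mul_assoc, ← mul_assoc, he.mul_self]

theorem exists_mul_eq {i : V} {x : 𝔸} (hx : x * e i = x) (h0 : x ≠ 0) : ∃ y, y * x = e i := by
  have := he.simple i
  have h := IsSimpleModule.span_singleton_eq_top 𝔸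
    (m := (⟨x, he.mem_span_iff.2 hx⟩ : Submodule.span 𝔸 {e i}))
    (fun h => h0 (congrArg Subtype.val h))
  have h2 : (⟨e i, Submodule.mem_span_singleton_self _⟩ : Submodule.span 𝔸 {e i}) ∈
    Submodule.span 𝔸 {(⟨x, he.mem_span_iff.2 hx⟩ : Submodule.span 𝔸 {e i})} := by
    rw [h]; exact Submodule.mem_top
  obtain ⟨y, hy⟩ := Submodule.mem_span_singleton.1 h2
  exact ⟨y, congrArg Subtype.val hy⟩

-- The algebra is Morita equivalent to its basic corner. If the ideal generated by the `e i` were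
-- proper, it would lie in a maximal left ideal `M`; but `𝔸 ⧸ M` is some `𝔸 (e i)`, and an element
-- which is annihilated by the ideal cannot correspond to `e i = e i * e i`.
variable (k) in
theorem one_mem_span :
    (1 : 𝔸) ∈ Submodule.span k {z : 𝔸 | ∃ p i q, z = p * e i * q} := by
  let I : Submodule 𝔸 𝔸 := Submodule.span 𝔸 {z | ∃ i q, z = e i * q}
  have hI : I = ⊤ := by
    by_contra hI
    obtain ⟨M, hM, hle⟩ := (eq_top_or_exists_le_coatom I).resolve_left hI
    obtain ⟨i, ⟨f⟩⟩ := he.complete M hM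
    obtain ⟨y, hy⟩ := Submodule.mkQ_surjective M
      (f.symm ⟨e i, Submodule.mem_span_singleton_self _⟩)
    have h1 : M.mkQ (e i • y) = 0 := by
      rw [Submodule.mkQ_apply, Submodule.Quotient.mk_eq_zero]
      exact hle (Submodule.subset_span ⟨i, y, rfl⟩)
    rw [map_smul, hy, ← map_smul, LinearEquiv.map_eq_zero_iff] at h1
    exact he.ne_zero i (by simpa [he.mul_self] using congrArg Subtype.val h1)
  have h1 : (1 : 𝔸) ∈ I := by rw [hI]; exact Submodule.mem_top
  generalize (1 : 𝔸) = y at h1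
  induction h1 using Submodule.span_induction with
  | mem x h => obtain ⟨i, q, rfl⟩ := h; exact Submodule.subset_span ⟨e i, i, q, by rw [he.mul_self]⟩
  | zero => exact Submodule.zero_mem _
  | add x y _ _ hx hy => exact Submodule.add_mem _ hx hy
  | smul a x hx0 hx =>
    clear hx0
    induction hx using Submodule.span_induction with
    | mem x h => obtain ⟨p, i, q, rfl⟩ := h
                 exact Submodule.subset_span ⟨a * p, i, q, by simp [mul_assoc]⟩
    | zero => simp
    | add x y _ _ hx hy => rw [smul_add]; exact Submodule.add_mem _ hx hy
    | smul c x _ hx => rw [smul_comm]; exact Submodule.smul_mem _ _ hx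

variable (k) in
/-- The linear form with `e i z e i = s_i(z) e i`. -/
def cornerScalar (i : V) (z : 𝔸) : k := (he.corner_self k i z).choose

theorem mul_mul_self (i : V) (z : 𝔸) : e i * z * e i = he.cornerScalar k i z • e i :=
  (he.corner_self k i z).choose_spec

theorem cornerScalar_unique {i : V} {z : 𝔸} {c : k} (h : e i * z * e i = c • e i) :
    he.cornerScalar k i z = c := by
  rw [he.mul_mul_self (k := k)] at h
  exact smul_left_injective k (he.ne_zero i) h

theorem cornerScalar_add (i : V) (y z : 𝔸) :
    he.cornerScalar k i (y + z) = he.cornerScalar k i y + he.cornerScalar k i z :=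
  he.cornerScalar_unique (by rw [mul_add, add_mul, he.mul_mul_self (k := k),
    he.mul_mul_self (k := k), add_smul])

theorem cornerScalar_smul (i : V) (c : k) (z : 𝔸) :
    he.cornerScalar k i (c • z) = c * he.cornerScalar k i z :=
  he.cornerScalar_unique (by rw [mul_smul_comm, smul_mul_assoc, he.mul_mul_self (k := k),
    mul_smul])

/-- A nonzero element of `a 𝔸 (e j)` is invertible, if `a 𝔸 a` is one-dimensional. -/
theorem exists_inverse {j : V} {a x : 𝔸} (ha : a * a = a)
    (ha' : ∀ z, ∃ c : k, a * z * a = c • a) (hl : a * x = x) (hr : x * e j = x) (h0 : x ≠ 0) :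
    ∃ y, y * x = e j ∧ x * y = a ∧ e j * y = y ∧ y * a = y := by
  obtain ⟨y, hy⟩ := he.exists_mul_eq hr h0
  have h1 : e j * y * a * x = e j := by rw [mul_assoc, hl, mul_assoc, hy, he.mul_self]
  refine ⟨e j * y * a, h1, ?_, ?_, ?_⟩
  -- A left inverse is also a right inverse: `x y` is a scalar multiple of `a`, and `x y x = x`
  -- forces the scalar to be `1`.
  · obtain ⟨c, hc⟩ := ha' (x * (e j * y))
    have h2 : x * (e j * y * a) = c • a := by
      rw [← hc, ← mul_assoc a x, hl]; simp only [mul_assoc]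
    have h3 : c • x = x := by
      have : x * (e j * y * a) * x = x := by rw [mul_assoc, h1, hr]
      rwa [h2, smul_mul_assoc, hl] at this
    have h4 : c = 1 := by
      by_contra hc
      have : (c - 1) • x = 0 := by rw [sub_smul, one_smul, h3, sub_self]
      rcases smul_eq_zero.1 this with h | h
      · exact hc (sub_eq_zero.1 h)
      · exact h0 h
    rw [h2, h4, one_smul]
  · rw [← mul_assoc, ← mul_assoc, he.mul_self]
  · rw [mul_assoc, ha]

end IsBasicSystem

instance MonoidAlgebra.finiteDimensional_of_finite {k : Type*} [Field k] {G : Type*} [Finite G] :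
    Module.Finite k k[G] :=
  Module.Finite.equiv (MonoidAlgebra.coeffLinearEquiv k).symm

namespace Representation

variable {k : Type*} [Field k] {G : Type*} [Group G]

/-- Isomorphic modules over the group algebra come from isomorphic representations. -/
def equivOfAsModule {X Y : Type*} [AddCommGroup X] [Module k X] [AddCommGroup Y] [Module k Y]
    {ρ : Representation k G X} {σ : Representation k G Y} (f : ρ.asModule ≃ₗ[k[G]] σ.asModule) :
    ρ.Equiv σ :=
  ((IntertwiningMap.equivLinearMapAsModule ρ σ).symm f.toLinearMap).ofBijective f.bijective

/-- Isomorphic representations define isomorphic modules over the group algebra. -/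
def Equiv.asModule {X Y : Type*} [AddCommGroup X] [Module k X] [AddCommGroup Y] [Module k Y]
    {ρ : Representation k G X} {σ : Representation k G Y} (f : ρ.Equiv σ) :
    ρ.asModule ≃ₗ[k[G]] σ.asModule :=
  LinearEquiv.ofBijective (IntertwiningMap.equivLinearMapAsModule ρ σ f.toIntertwiningMap)
    f.toLinearEquiv.bijective

end Representation

section McKay

variable {k : Type u} [Field k] {ι : Type} [Fintype ι] [DecidableEq ι]
  {V : Type v} {A : Type w}

/-- Translates the list of irreducible representations into module theory over `kG`; each simple
quotient of the regular module is made into a representation, to which completeness of the list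
applies. -/
theorem IsMcKayQuiver.isBasicSystem {G : Subgroup (GL ι k)} [Finite G] {Q : ArrowQuiver V A}
    {S : V → FDRep k G} (hS : IsMcKayQuiver G Q S) {e : V → k[G]} (he : OrthogonalIdempotents e)
    (h : ∀ i, Nonempty (Submodule.span k[G] {e i} ≃ₗ[k[G]] (S i).rep.asModule)) :
    IsBasicSystem e where
  orthogonal := he
  simple i := by
    have := (Representation.irreducible_iff_isSimpleModule_asModule _).1 (hS.irreducible i)
    exact IsSimpleModule.congr (h i).some
  distinct i j hij :=
    hS.distinct i j ⟨Representation.equivOfAsModule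
      ((h i).some.symm.trans (hij.some.trans (h j).some))⟩
  complete M hM := by
    have hs : IsSimpleModule k[G] (k[G] ⧸ M) := isSimpleModule_iff_isCoatom.2 hM
    let r : Representation k G (k[G] ⧸ M) := Representation.ofModule' (k[G] ⧸ M)
    let f : r.asModule ≃ₗ[k[G]] (k[G] ⧸ M) :=
      { (LinearEquiv.refl k (k[G] ⧸ M)).toAddEquiv with
        map_smul' := fun a x => by
          change r.asAlgebraHom a x = a • (show k[G] ⧸ M from x)
          have : r.asAlgebraHom = Algebra.lsmul k k (k[G] ⧸ M) :=
            (MonoidAlgebra.lift k _ G).apply_symm_apply _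
          rw [this]; rfl }
    have hr : r.IsIrreducible := (Representation.irreducible_iff_isSimpleModule_asModule _).2
      (IsSimpleModule.congr f)
    obtain ⟨i, ⟨g⟩⟩ := hS.complete (FDRep.of r) hr
    exact ⟨i, ⟨f.symm.trans ((Representation.Equiv.asModule g).trans (h i).some.symm)⟩⟩

end McKay

end

/-! ### The degree one part of the skew group algebra as `V ⊗ kG` -/

noncomputable section

open PathAlgebra

section Columns

variable {k : Type u} [Field k] {ι : Type} [Fintype ι] [DecidableEq ι]
  (G : Subgroup (GL ι k))

/-- The homomorphism `kG → Mat(kG)`, `g ↦ (g_{lk} g)`, which describes how elements of `kG` are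
moved past the variables of `k[V]`. -/
def colAct : k[G] →ₐ[k] Matrix ι ι k[G] :=
  MonoidAlgebra.lift k (Matrix ι ι k[G]) G
    { toFun := fun g => Matrix.of fun l m => MonoidAlgebra.single g (g.1.1 l m)
      map_one' := by
        ext1 l m
        simp only [Matrix.of_apply, OneMemClass.coe_one, Units.val_one, Matrix.one_apply]
        split_ifs with h
        · rfl
        · simp
      map_mul' := fun g h => by
        ext1 l m
        simp only [Matrix.of_apply, Matrix.mul_apply, MonoidAlgebra.single_mul_single,
          Subgroup.coe_mul, Units.val_mul]
        exact map_sum (MonoidAlgebra.singleAddHom (g * h)) _ _ }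

variable {G}

theorem colAct_single (g : G) (c : k) (l m : ι) :
    colAct G (MonoidAlgebra.single g c) l m = MonoidAlgebra.single g (c * g.1.1 l m) := by
  simp [colAct, MonoidAlgebra.lift_single]

/-- The element `∑ X_m x_m` of the skew group algebra. -/
def embCol : (ι → k[G]) →ₗ[k] SkewGroupAlgebra G where
  toFun x := ∑ m, SkewMonoidAlgebra.single 1 (MvPolynomial.X m) * groupAlgebraIncl G (x m)
  map_add' x y := by simp [mul_add, Finset.sum_add_distrib]
  map_smul' c x := by simp [Finset.smul_sum]

theorem embCol_apply (x : ι → k[G]) : embCol x =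
    ∑ m, SkewMonoidAlgebra.single 1 (MvPolynomial.X m) * groupAlgebraIncl G (x m) := rfl

theorem groupAlgebraIncl_single (g : G) (c : k) :
    groupAlgebraIncl G (MonoidAlgebra.single g c) =
      SkewMonoidAlgebra.single g (MvPolynomial.C c) := by
  rw [groupAlgebraIncl, MonoidAlgebra.lift_single, SkewMonoidAlgebra.of_apply,
    SkewMonoidAlgebra.smul_single, MvPolynomial.smul_eq_C_mul, mul_one]

theorem groupAlgebraIncl_coeff (z : k[G]) (g : G) :
    (groupAlgebraIncl G z).coeff g = MvPolynomial.C (z.coeff g) := by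
  classical
  induction z using MonoidAlgebra.induction_linear with
  | zero => simp
  | add x y hx hy => simp [hx, hy]
  | single h c =>
    rw [groupAlgebraIncl_single, SkewMonoidAlgebra.coeff_single_apply,
      MonoidAlgebra.coeff_single, Finsupp.single_apply]
    split_ifs <;> simp

theorem coeff_single_one_mul_groupAlgebraIncl (f : MvPolynomial ι k) (z : k[G]) (g : G) :
    (SkewMonoidAlgebra.single 1 f * groupAlgebraIncl G z).coeff g =
      f * MvPolynomial.C (z.coeff g) := by
  rw [SkewMonoidAlgebra.coeff_single_one_mul, groupAlgebraIncl_coeff]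

theorem coeffHom_sum (s : Finset ι) (f : ι → SkewGroupAlgebra G) (g : G) :
    (∑ i ∈ s, f i).coeff g = ∑ i ∈ s, (f i).coeff g :=
  map_sum ((Finsupp.applyAddHom g).comp
    (SkewMonoidAlgebra.coeffAddEquiv (k := MvPolynomial ι k) (G := G)).toAddMonoidHom) f s

theorem embCol_coeff (x : ι → k[G]) (g : G) :
    (embCol x).coeff g = ∑ m, MvPolynomial.C ((x m).coeff g) * MvPolynomial.X m := by
  rw [embCol_apply, coeffHom_sum]
  simp only [coeff_single_one_mul_groupAlgebraIncl, mul_comm]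

theorem smul_X (g : G) (m : ι) : g • (MvPolynomial.X m : MvPolynomial ι k) =
    ∑ l, MvPolynomial.C (g.1.1 l m) * MvPolynomial.X l :=
  MvPolynomial.aeval_X _ _

/-- The rule that governs all later computations: a group algebra element moved to the right past a
variable is replaced by a column of `colAct`. -/
theorem groupAlgebraIncl_mul_X (z : k[G]) (m : ι) :
    groupAlgebraIncl G z * SkewMonoidAlgebra.single 1 (MvPolynomial.X m) =
      ∑ l, SkewMonoidAlgebra.single 1 (MvPolynomial.X l) *
        groupAlgebraIncl G (colAct G z l m) := by
  induction z using MonoidAlgebra.induction_linear with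
  | zero => simp
  | add x y hx hy => simp [hx, hy, add_mul, mul_add, Finset.sum_add_distrib]
  | single h c =>
    simp only [groupAlgebraIncl_single, colAct_single, SkewMonoidAlgebra.single_mul_single,
      mul_one, one_mul, one_smul, smul_X]
    rw [Finset.mul_sum]
    refine (map_sum (SkewMonoidAlgebra.singleAddHom h) _ _).trans
      (Finset.sum_congr rfl fun l _ => ?_)
    change SkewMonoidAlgebra.single h _ = _
    congr 1
    rw [map_mul]; ring

theorem groupAlgebraIncl_mul_embCol (z : k[G]) (x : ι → k[G]) :
    groupAlgebraIncl G z * embCol x = embCol (colAct G z *ᵥ x) := by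
  simp only [embCol_apply, Finset.mul_sum, ← mul_assoc, groupAlgebraIncl_mul_X, Finset.sum_mul,
    Matrix.mulVec, dotProduct, map_sum, map_mul]
  rw [Finset.sum_comm]

theorem embCol_mul_groupAlgebraIncl (x : ι → k[G]) (z : k[G]) :
    embCol x * groupAlgebraIncl G z = embCol fun m => x m * z := by
  simp only [embCol_apply, Finset.sum_mul, mul_assoc, map_mul]

variable [Finite G]

/-- The linear part of an element of the skew group algebra. -/
def linearPart : SkewGroupAlgebra G →ₗ[k] (ι → k[G]) where
  toFun r m := MonoidAlgebra.ofCoeff (Finsupp.equivFunOnFinite.symm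
    fun g => (r.coeff g).coeff (Finsupp.single m 1))
  map_add' x y := by ext; simp
  map_smul' c x := by ext; simp

theorem linearPart_coeff (r : SkewGroupAlgebra G) (m : ι) (g : G) :
    (linearPart r m).coeff g = (r.coeff g).coeff (Finsupp.single m 1) := rfl

theorem linearPart_embCol (x : ι → k[G]) : linearPart (embCol x) = x := by
  ext m g
  rw [linearPart_coeff, embCol_coeff, MvPolynomial.coeff_sum]
  simp [MvPolynomial.coeff_C_mul, MvPolynomial.coeff_X, Finsupp.single_left_inj]

theorem embCol_injective : Function.Injective (embCol (G := G)) :=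
  Function.LeftInverse.injective linearPart_embCol

/-- A homogeneous polynomial of degree one is determined by its coefficients at the variables, so `V
⊗ kG` fills the whole degree one part. -/
theorem embCol_linearPart {r : SkewGroupAlgebra G}
    (hr : ∀ g, r.coeff g ∈ MvPolynomial.homogeneousSubmodule ι k 1) :
    embCol (linearPart r) = r := by
  refine SkewMonoidAlgebra.ext fun g => ?_
  rw [embCol_coeff]
  have h : (r.coeff g).IsHomogeneous 1 := hr g
  ext d
  rw [MvPolynomial.coeff_sum]
  simp only [MvPolynomial.coeff_C_mul, MvPolynomial.coeff_X, linearPart_coeff]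
  by_cases hd : d.degree = 1
  · obtain ⟨m, rfl⟩ := Finsupp.sum_eq_one_iff d |>.1 hd
    simp [Finsupp.single_left_inj]
  · rw [h.coeff_eq_zero hd]
    refine Finset.sum_eq_zero fun m _ => ?_
    rw [if_neg, mul_zero]
    rintro rfl
    simp at hd

end Columns

end

/-! ### The degree two part, and relations as antisymmetric tensors -/

noncomputable section

open PathAlgebra ArrowQuiver

section Quadratic

variable {k : Type u} [Field k] {ι : Type} [Fintype ι] [DecidableEq ι]
  {G : Subgroup (GL ι k)}

/-- The element `∑ X_l X_m z_{lm}` of the skew group algebra. -/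
def embTwo (Z : ι → ι → k[G]) : SkewGroupAlgebra G :=
  ∑ l, ∑ m, SkewMonoidAlgebra.single 1 (MvPolynomial.X l * MvPolynomial.X m) *
    groupAlgebraIncl G (Z l m)

theorem embCol_mul_embCol (x y : ι → k[G]) :
    embCol x * embCol y = embTwo fun l m => (colAct G (x l) *ᵥ y) m := by
  rw [embCol_apply x, Finset.sum_mul]
  refine Finset.sum_congr rfl fun l _ => ?_
  rw [mul_assoc, groupAlgebraIncl_mul_embCol, embCol_apply, Finset.mul_sum]
  refine Finset.sum_congr rfl fun m _ => ?_
  rw [← mul_assoc, SkewMonoidAlgebra.single_mul_single, one_smul, mul_one]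

theorem embTwo_coeff (Z : ι → ι → k[G]) (g : G) : (embTwo Z).coeff g =
    ∑ l, ∑ m, MvPolynomial.C ((Z l m).coeff g) * (MvPolynomial.X l * MvPolynomial.X m) := by
  simp only [embTwo, coeffHom_sum, coeff_single_one_mul_groupAlgebraIncl, mul_comm]

/-- The kernel of the multiplication `V ⊗ V → Sym² V` consists of the antisymmetric tensors; this is
the only place where the symmetric algebra enters the quadratic relations. -/
theorem embTwo_eq_zero_iff [CharZero k] (Z : ι → ι → k[G]) :
    embTwo Z = 0 ↔ ∀ l m, Z l m + Z m l = 0 := by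
  constructor
  · intro h l m
    ext g
    have h1 := congrArg (fun r : SkewGroupAlgebra G => r.coeff g) h
    simp only [embTwo_coeff, SkewMonoidAlgebra.coeff_zero, Finsupp.coe_zero, Pi.zero_apply] at h1
    -- Two partial derivatives isolate the symmetrized coefficient at `l`, `m`.
    have h2 := congrArg (fun p => MvPolynomial.pderiv l (MvPolynomial.pderiv m p)) h1
    simp only [map_sum, Derivation.leibniz, MvPolynomial.pderiv_X,
      smul_eq_mul, map_zero, Pi.single_apply, mul_ite, mul_one, mul_zero, map_add,
      mul_add, Finset.sum_add_distrib, Finset.sum_ite_eq', Finset.mem_univ, if_true,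
      Finset.sum_ite_irrel, Finset.sum_const_zero] at h2
    have h3 : MvPolynomial.C ((Z l m).coeff g) + MvPolynomial.C ((Z m l).coeff g) =
      (0 : MvPolynomial ι k) := by simpa [add_comm] using h2
    rw [← map_add, MvPolynomial.C_eq_zero] at h3
    exact h3
  · intro h
    refine SkewMonoidAlgebra.ext fun g => ?_
    rw [embTwo_coeff]
    have h0 : ∀ l m, (Z l m).coeff g + (Z m l).coeff g = 0 := fun l m => by
      rw [← Finsupp.add_apply, ← MonoidAlgebra.coeff_add, h]; rfl
    set P := ∑ l, ∑ m, MvPolynomial.C ((Z l m).coeff g) *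
      (MvPolynomial.X l * MvPolynomial.X m : MvPolynomial ι k) with hP
    -- Interchanging the summation indices in one copy of `P` makes the coefficients cancel;
    -- division by two is allowed in characteristic zero.
    have h1 : P + P = 0 := by
      nth_rewrite 2 [hP]
      rw [Finset.sum_comm, hP, ← Finset.sum_add_distrib]
      refine Finset.sum_eq_zero fun l _ => ?_
      rw [← Finset.sum_add_distrib]
      refine Finset.sum_eq_zero fun m _ => ?_
      rw [mul_comm (MvPolynomial.X m), ← add_mul, ← map_add, h0, map_zero, zero_mul]
    exact self_eq_neg.1 (eq_neg_of_add_eq_zero_left h1)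

end Quadratic

namespace PathAlgebra

variable {k : Type u} [Field k] {V : Type v} {A : Type w} [Fintype V] [Fintype A]
  {Q : ArrowQuiver V A}

theorem mk_eq_zero_of_mem_span {ρ : Set (PathAlgebra k Q)} {x : PathAlgebra k Q}
    (hx : x ∈ Submodule.span k ρ) : BoundQuiverAlgebra.mk ρ x = 0 :=
  (Submodule.span_le.2 fun _ hr => mk_eq_zero_of_mem hr :
    _ ≤ LinearMap.ker (BoundQuiverAlgebra.mk ρ).toLinearMap) hx

theorem pairing_comm (x y : PathAlgebra k Q) : pairing x y = pairing y x := by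
  classical
  induction x using induction_linear with
  | zero => simp
  | add x x' hx hx' => simp [hx, hx']
  | single p a =>
  induction y using induction_linear with
  | zero => simp
  | add x x' hx hx' => simp [hx, hx']
  | single q b =>
  rw [pairing_single_left, pairing_single_left, coeff_single, coeff_single]
  by_cases h : p = q
  · subst h; simp [mul_comm]
  · rw [if_neg h, if_neg (Ne.symm h)]; simp

theorem exists_arrows_of_length_two {p : Q.QPath} (hp : p.length = 2) :
    ∃ a b, Q.src a = Q.tgt b ∧ (single p 1 : PathAlgebra k Q) = arrow k Q a * arrow k Q b := by
  cases p using QPath.induction_cons with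
  | nil i => simp at hp
  | cons a p h =>
    cases p using QPath.induction_cons with
    | nil i => simp at hp
    | cons b p h' =>
      cases p using QPath.induction_cons with
      | nil i =>
        refine ⟨a, b, h, ?_⟩
        obtain rfl : Q.src b = i := h'
        rw [single_comp]
        exact congrArg _ ((single_comp b (QPath.nil Q (Q.src b)) rfl 1).trans
          (arrow_mul_vertex_src b))
      | cons c p h'' => simp at hp; omega

theorem arrow_mul_arrow_of_eq {a b : A} (h : Q.src a = Q.tgt b) :
    arrow k Q a * arrow k Q b = single ((QPath.ofArrow Q a).comp (QPath.ofArrow Q b) h) 1 :=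
  (single_comp a (QPath.ofArrow Q b) h 1).symm

theorem arrow_mul_arrow_of_ne {a b : A} (h : Q.src a ≠ Q.tgt b) :
    arrow k Q a * arrow k Q b = 0 :=
  single_mul_single_of_ne _ _ h _ _

theorem pairing_arrow_mul_arrow [DecidableEq A] {a b : A} (h : Q.src a = Q.tgt b) (a' b' : A) :
    pairing (arrow k Q a' * arrow k Q b') (arrow k Q a * arrow k Q b) =
      if a' = a ∧ b' = b then 1 else 0 := by
  classical
  by_cases h' : Q.src a' = Q.tgt b'
  · rw [arrow_mul_arrow_of_eq h, arrow_mul_arrow_of_eq h', pairing_single_left, coeff_single,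
      one_mul]
    refine if_congr ⟨fun e => ?_, ?_⟩ rfl rfl
    · have := congrArg QPath.arrows e
      simp only [QPath.comp, QPath.ofArrow, List.cons_append, List.nil_append, List.cons.injEq,
        and_true] at this
      exact ⟨this.1.symm, this.2.symm⟩
    · rintro ⟨rfl, rfl⟩; rfl
  · rw [arrow_mul_arrow_of_ne h', map_zero, LinearMap.zero_apply, if_neg]
    rintro ⟨rfl, rfl⟩; exact h' h

theorem eq_sum_of_mem_degree_two {d : PathAlgebra k Q} (hd : d ∈ degree k Q 2) :
    d = ∑ a, ∑ b, pairing (arrow k Q a * arrow k Q b) d • (arrow k Q a * arrow k Q b) := by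
  classical
  induction hd using Submodule.span_induction with
  | mem x hx =>
    obtain ⟨p, hp, rfl⟩ := hx
    obtain ⟨a, b, hab, h⟩ := exists_arrows_of_length_two (k := k) hp
    rw [h]
    simp only [pairing_arrow_mul_arrow hab, ite_and, ite_smul, one_smul, zero_smul]
    simp
  | zero => simp
  | add x y _ _ hx hy =>
    simp only [map_add, add_smul, Finset.sum_add_distrib]
    rw [← hx, ← hy]
  | smul c x _ hx =>
    simp only [map_smul, smul_assoc, ← Finset.smul_sum]
    rw [← hx]

theorem arrow_mul_arrow_mem_degree (a b : A) : arrow k Q a * arrow k Q b ∈ degree k Q 2 := by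
  by_cases h : Q.src a = Q.tgt b
  · rw [arrow_mul_arrow_of_eq h]
    exact Submodule.subset_span ⟨_, rfl, rfl⟩
  · rw [arrow_mul_arrow_of_ne h]; exact Submodule.zero_mem _

theorem sum_mem_degree_two (c : A → A → k) :
    ∑ a, ∑ b, c a b • (arrow k Q a * arrow k Q b) ∈ degree k Q 2 :=
  Submodule.sum_mem _ fun a _ => Submodule.sum_mem _ fun b _ =>
    Submodule.smul_mem _ _ (arrow_mul_arrow_mem_degree a b)

/-- The pairing on `kQ_2` in terms of coefficients. -/
theorem pairing_eq_sum {d d' : PathAlgebra k Q} (hd : d ∈ degree k Q 2) :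
    pairing d d' = ∑ a, ∑ b, pairing (arrow k Q a * arrow k Q b) d *
      pairing (arrow k Q a * arrow k Q b) d' := by
  conv_lhs => rw [eq_sum_of_mem_degree_two hd]
  simp

end PathAlgebra

section Data

variable {k : Type u} [Field k] {ι : Type} [Fintype ι] [DecidableEq ι]
  {G : Subgroup (GL ι k)} {V : Type v} {A : Type w} [Fintype V] [Fintype A]

/-- The element of `V ⊗ V ⊗ kG` that belongs to the quadratic part of an element of `kQ`, where
the arrows are elements of `V ⊗ kG`. -/
def twoTensor {Q : ArrowQuiver V A} (col : A → ι → k[G]) (d : PathAlgebra k Q) (l m : ι) : k[G] :=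
  ∑ a, ∑ b, pairing (arrow k Q a * arrow k Q b) d • (colAct G (col a l) *ᵥ col b) m

/-- The elements of `V ⊗ kG` that represent the arrows of the bound McKay quiver `(Q, ρ)`. -/
structure IsArrowSystem (Q : ArrowQuiver V A) (ρ : Set (PathAlgebra k Q)) (e : V → k[G])
    (col : A → ι → k[G]) : Prop where
  basic : IsBasicSystem e
  tgt_mul : ∀ a, colAct G (e (Q.tgt a)) *ᵥ col a = col a
  mul_src : ∀ a m, col a m * e (Q.src a) = col a m
  indep : LinearIndependent k col
  span : ∀ x : ι → k[G], colAct G (∑ i, e i) *ᵥ x = x → (∀ m, x m * ∑ i, e i = x m) →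
    x ∈ Submodule.span k (Set.range col)
  mem_span_iff : ∀ d ∈ degree k Q 2,
    d ∈ Submodule.span k ρ ↔ ∀ l m, twoTensor col d l m + twoTensor col d m l = 0

theorem groupAlgebraIncl_injective : Function.Injective (groupAlgebraIncl G) := fun x y h => by
  ext g
  have := congrArg (fun r : SkewGroupAlgebra G => r.coeff g) h
  simpa [groupAlgebraIncl_coeff] using this

theorem embTwo_sum {α : Type*} (s : Finset α) (c : α → k) (Z : α → ι → ι → k[G]) :
    embTwo (fun l m => ∑ i ∈ s, c i • Z i l m) = ∑ i ∈ s, c i • embTwo (Z i) := by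
  simp only [embTwo, map_sum, map_smul, Finset.mul_sum, Finset.smul_sum, mul_smul_comm]
  rw [Finset.sum_comm]
  conv_lhs => enter [2, x]; rw [Finset.sum_comm]
  rw [Finset.sum_comm]
  conv_lhs => enter [2, x]; rw [Finset.sum_comm]

theorem homogeneous_mul {r r' : SkewGroupAlgebra G} {m n : ℕ}
    (hr : ∀ g, (r.coeff g).IsHomogeneous m) (hr' : ∀ g, (r'.coeff g).IsHomogeneous n) (g : G) :
    ((r * r').coeff g).IsHomogeneous (m + n) := by
  have hpoly : ∀ (h : G) (p : MvPolynomial ι k), p.IsHomogeneous n → (h • p).IsHomogeneous n := by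
    intro h p hp
    have := hp.aeval (fun i => ∑ j, MvPolynomial.C (h.1.1 j i) * MvPolynomial.X j) (n := 1)
      (fun i => MvPolynomial.IsHomogeneous.sum _ _ _ fun j _ => by
        simpa using (MvPolynomial.isHomogeneous_C ι (h.1.1 j i)).mul (MvPolynomial.isHomogeneous_X k j))
    rwa [one_mul] at this
  rw [SkewMonoidAlgebra.coeff_mul_left]
  exact MvPolynomial.IsHomogeneous.sum _ _ _ fun h _ => (hr h).mul (hpoly h _ (hr' _))

variable [Finite G] {Q : ArrowQuiver V A} {ρ : Set (PathAlgebra k Q)} {e : V → k[G]}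
  {φ : BoundQuiverAlgebra k Q ρ →ₙₐ[k] SkewGroupAlgebra G}

theorem homogeneous_path (hv : ∀ i, φ (.mk ρ (vertex k Q i)) = groupAlgebraIncl G (e i))
    (ha : ∀ a g, (φ (.mk ρ (arrow k Q a))).coeff g ∈ MvPolynomial.homogeneousSubmodule ι k 1)
    (p : Q.QPath) (g : G) : ((φ (.mk ρ (single p 1))).coeff g).IsHomogeneous p.length := by
  induction p using QPath.induction_cons generalizing g with
  | nil i =>
    change ((φ (.mk ρ (vertex k Q i))).coeff g).IsHomogeneous 0
    rw [hv, groupAlgebraIncl_coeff]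
    exact MvPolynomial.isHomogeneous_C _ _
  | cons a p h ih =>
    rw [single_comp, map_mul, map_mul, QPath.length_comp]
    exact homogeneous_mul (ha a) ih g

/-- The arrows of a bound McKay quiver, as elements of `V ⊗ kG`. -/
def arrowCol (φ : BoundQuiverAlgebra k Q ρ →ₙₐ[k] SkewGroupAlgebra G) (a : A) : ι → k[G] :=
  linearPart (φ (.mk ρ (arrow k Q a)))

theorem embCol_arrowCol
    (ha : ∀ a g, (φ (.mk ρ (arrow k Q a))).coeff g ∈ MvPolynomial.homogeneousSubmodule ι k 1)
    (a : A) : embCol (arrowCol φ a) = φ (.mk ρ (arrow k Q a)) :=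
  embCol_linearPart (ha a)

/-- Everything about the isomorphism with the basic algebra that is needed in degrees one and two.
Independence holds since the ideal of quadratic relations starts in length two. Columns span since a
degree one element of the corner has a preimage of which only the paths of length one contribute.
The criterion for relations combines injectivity of `φ` with `embTwo_eq_zero_iff`. -/
theorem isArrowSystem_arrowCol [CharZero k] (hρ : ∀ r ∈ ρ, IsQuadraticRelation r)
    (he : IsBasicSystem e) (hv : ∀ i, φ (.mk ρ (vertex k Q i)) = groupAlgebraIncl G (e i))
    (ha : ∀ a g, (φ (.mk ρ (arrow k Q a))).coeff g ∈ MvPolynomial.homogeneousSubmodule ι k 1)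
    (hinj : Function.Injective φ)
    (hrange : Set.range φ =
      {x | groupAlgebraIncl G (∑ i, e i) * x * groupAlgebraIncl G (∑ i, e i) = x}) :
    IsArrowSystem Q ρ e (arrowCol φ) where
  basic := he
  tgt_mul a := embCol_injective (by
    rw [← groupAlgebraIncl_mul_embCol, embCol_arrowCol ha, ← hv, ← map_mul, ← map_mul,
      vertex_tgt_mul_arrow])
  mul_src a m := by
    have : (fun m => arrowCol φ a m * e (Q.src a)) = arrowCol φ a := embCol_injective (by
      rw [← embCol_mul_groupAlgebraIncl, embCol_arrowCol ha, ← hv, ← map_mul, ← map_mul,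
        arrow_mul_vertex_src])
    exact congrFun this m
  indep := by
    rw [Fintype.linearIndependent_iff]
    intro c hc
    have h1 : φ (.mk ρ (∑ a, c a • arrow k Q a)) = 0 := by
      rw [← map_zero embCol, ← hc]
      simp only [map_sum, map_smul, embCol_arrowCol ha]
    have h2 := hinj (h1.trans (map_zero φ).symm)
    have h3 := mem_atLeast_of_mk_eq_zero (n := 2)
      (fun r hr => degree_le_atLeast 2 (hρ r hr).mem_degree) h2
    intro a
    classical
    by_contra h0
    have := (mem_atLeast_iff 2 _).1 h3 (QPath.ofArrow Q a) (by
      rw [coeff_sum]; simpa [coeff_arrow] using h0)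
    simp at this
  span x hx hx' := by
    have h1 : embCol x ∈ Set.range φ := by
      rw [hrange, Set.mem_ofPred_eq, groupAlgebraIncl_mul_embCol, hx, embCol_mul_groupAlgebraIncl]
      exact congrArg embCol (funext hx')
    obtain ⟨b, hb⟩ := h1
    obtain ⟨y, rfl⟩ := mk_surjective ρ b
    rw [← linearPart_embCol x, ← hb]
    clear hb hx hx'
    induction y using induction_linear with
    | zero => simp
    | add y z hy hz => simp only [map_add]; exact Submodule.add_mem _ hy hz
    | single p c =>
      have e : (single p c : PathAlgebra k Q) = c • single p 1 := by
        rw [PathAlgebra.smul_single, mul_one]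
      rw [e, map_smul, map_smul, map_smul]
      refine Submodule.smul_mem _ _ ?_
      by_cases hp : p.length = 1
      · cases p using QPath.induction_cons with
        | nil i => simp at hp
        | cons a p h =>
          cases p using QPath.induction_cons with
          | nil i =>
            obtain rfl : Q.src a = i := h
            rw [(single_comp a (QPath.nil Q (Q.src a)) rfl 1).trans (arrow_mul_vertex_src a)]
            exact Submodule.subset_span ⟨a, rfl⟩
          | cons b p h' => simp at hp
      · have : linearPart (φ (.mk ρ (single p 1))) = 0 := by
          ext m g
          rw [linearPart_coeff, (homogeneous_path hv ha p g).coeff_eq_zero]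
          · rfl
          · simpa using Ne.symm hp
        rw [this]; exact Submodule.zero_mem _
  mem_span_iff d hd := by
    rw [← embTwo_eq_zero_iff]
    -- A quadratic element is the sum of its products of arrows, and a product of two columns is the
    -- embedding of their twisted tensor product.
    have h1 : embTwo (twoTensor (arrowCol φ) d) = φ (.mk ρ d) := by
      conv_rhs => rw [eq_sum_of_mem_degree_two hd]
      simp only [map_sum, map_smul, map_mul, ← embCol_arrowCol ha, embCol_mul_embCol, ← embTwo_sum]
      have h3 : twoTensor (arrowCol φ) d = fun l m => ∑ a, (1 : k) • ∑ b,
          pairing (arrow k Q a * arrow k Q b) d •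
            (colAct G (arrowCol φ a l) *ᵥ arrowCol φ b) m := by
        funext l m; simp [twoTensor]
      rw [h3, embTwo_sum]
      simp only [one_smul]
    rw [h1]
    constructor
    · intro h
      rw [mk_eq_zero_of_mem_span h, map_zero]
    · intro h
      exact mem_span_of_mk_eq_zero hρ hd (hinj (h.trans (map_zero φ).symm))

end Data

end

/-! ### The symmetric algebra structure of `kG` and dual bases for the arrows -/

noncomputable section

open PathAlgebra ArrowQuiver

section Frobenius

variable {k : Type*} [Field k] {Γ : Type*} [Group Γ] [Fintype Γ]

/-- The element of the group algebra that represents a linear form `f`: the coefficient of `g` is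
`f g⁻¹`. -/
def frobElement (f : k[Γ] →ₗ[k] k) : k[Γ] :=
  MonoidAlgebra.ofCoeff (Finsupp.equivFunOnFinite.symm fun g => f (MonoidAlgebra.single g⁻¹ 1))

theorem frobElement_coeff (f : k[Γ] →ₗ[k] k) (g : Γ) :
    (frobElement f).coeff g = f (MonoidAlgebra.single g⁻¹ 1) := rfl

theorem frobElement_add (f f' : k[Γ] →ₗ[k] k) :
    frobElement (f + f') = frobElement f + frobElement f' := by
  ext g; rfl

theorem frobElement_sum {α : Type*} (s : Finset α) (f : α → k[Γ] →ₗ[k] k) :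
    frobElement (∑ i ∈ s, f i) = ∑ i ∈ s, frobElement (f i) :=
  map_sum (AddMonoidHom.mk' frobElement frobElement_add) f s

/-- Together with `frobElement_mul`: the identification of linear forms with elements through the
coefficient at `1` is a bimodule map. -/
theorem mul_frobElement (z : k[Γ]) (f : k[Γ] →ₗ[k] k) :
    z * frobElement f = frobElement (f ∘ₗ LinearMap.mulRight k z) := by
  induction z using MonoidAlgebra.induction_linear with
  | zero => ext g; simp [frobElement_coeff]
  | add x y hx hy => rw [add_mul, hx, hy, ← frobElement_add]; congr 1; ext; simp [mul_add]
  | single h c =>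
    ext g
    rw [MonoidAlgebra.coeff_single_mul_apply, frobElement_coeff, frobElement_coeff,
      LinearMap.comp_apply, LinearMap.mulRight_apply, MonoidAlgebra.single_mul_single, one_mul,
      ← mul_one c, ← smul_eq_mul c 1, ← MonoidAlgebra.smul_single, map_smul, smul_eq_mul,
      smul_eq_mul, mul_one, _root_.mul_inv_rev, inv_inv]

theorem frobElement_mul (f : k[Γ] →ₗ[k] k) (z : k[Γ]) :
    frobElement f * z = frobElement (f ∘ₗ LinearMap.mulLeft k z) := by
  induction z using MonoidAlgebra.induction_linear with
  | zero => ext g; simp [frobElement_coeff]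
  | add x y hx hy => rw [mul_add, hx, hy, ← frobElement_add]; congr 1; ext; simp [add_mul]
  | single h c =>
    ext g
    rw [MonoidAlgebra.coeff_mul_single_apply, frobElement_coeff, frobElement_coeff,
      LinearMap.comp_apply, LinearMap.mulLeft_apply, MonoidAlgebra.single_mul_single, mul_one,
      ← mul_one c, ← smul_eq_mul c 1, ← MonoidAlgebra.smul_single, map_smul, smul_eq_mul,
      smul_eq_mul, mul_one, _root_.mul_inv_rev, inv_inv, mul_comm]

variable [IsAlgClosed k] {V : Type*} {e : V → k[Γ]} (he : IsBasicSystem e)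
include he

/-- The linear form with `e i z e i = s_i(z) e i`. -/
def IsBasicSystem.cornerForm (i : V) : k[Γ] →ₗ[k] k where
  toFun := he.cornerScalar k i
  map_add' := he.cornerScalar_add i
  map_smul' := he.cornerScalar_smul i

theorem IsBasicSystem.mul_mul_eq_cornerForm (i : V) (z : k[Γ]) :
    e i * z * e i = he.cornerForm i z • e i := he.mul_mul_self i z

/-- The element of `cornerForm i` is fixed by `e i` on both sides, hence is a multiple `c` of `e i`.
Its coefficient at `1` is the value of the form at `1`, which is `1`, so `c` is inverse to the
coefficient of `e i` at `1`. These coefficients are the scalars that reappear with the Nakayama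
automorphism. -/
theorem IsBasicSystem.coeff_one_smul_frobElement (i : V) :
    (e i).coeff 1 • frobElement (he.cornerForm i) = e i ∧ (e i).coeff 1 ≠ 0 := by
  have h1 : he.cornerForm i 1 = 1 := he.cornerScalar_unique (by
    rw [mul_one, he.mul_self, one_smul])
  have h2 : e i * frobElement (he.cornerForm i) * e i = frobElement (he.cornerForm i) := by
    rw [mul_frobElement, frobElement_mul]
    congr 1
    ext z
    simp only [LinearMap.comp_apply, LinearMap.mulRight_apply, LinearMap.mulLeft_apply]
    refine he.cornerScalar_unique ?_
    rw [← mul_assoc, ← mul_assoc, he.mul_self, mul_assoc _ (e i), he.mul_self]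
    exact he.mul_mul_eq_cornerForm i _
  obtain ⟨c, hc⟩ := he.corner_self k i (frobElement (he.cornerForm i))
  rw [h2] at hc
  have h3 : c * (e i).coeff 1 = 1 := by
    have := congrArg (fun z : k[Γ] => z.coeff 1) hc
    simp only [frobElement_coeff, inv_one, MonoidAlgebra.coeff_smul, Finsupp.smul_apply,
      smul_eq_mul] at this
    rw [← this]; exact h1
  refine ⟨?_, fun h0 => ?_⟩
  · rw [hc, smul_smul, mul_comm, h3, one_smul]
  · rw [h0, mul_zero] at h3; exact zero_ne_one h3

end Frobenius

section Rows

variable {k : Type u} [Field k] {ι : Type} [Fintype ι] [DecidableEq ι]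
  {G : Subgroup (GL ι k)} {V : Type v} {A : Type w} [Fintype V] [Fintype A]

/-- Elements of `kG ⊗ V*` that are dual to the elements of `V ⊗ kG` which represent the arrows. -/
structure IsDualRows [DecidableEq A] (Q : ArrowQuiver V A) (e : V → k[G])
    (col row : A → ι → k[G]) : Prop where
  row_col : ∀ a b, ∑ m, row a m * col b m = if a = b then e (Q.src a) else 0
  col_row : ∀ l m, ∑ a, col a l * row a m = colAct G (∑ i, e i) l m
  src_mul : ∀ a m, e (Q.src a) * row a m = row a m
  mul_tgt : ∀ a, row a ᵥ* colAct G (e (Q.tgt a)) = row a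

/-- Right multiplication by `z` on `V ⊗ kG`. -/
def colMul (z : k[G]) : (ι → k[G]) →ₗ[k] (ι → k[G]) where
  toFun x m := x m * z
  map_add' x y := by ext1; simp [add_mul]
  map_smul' c x := by ext1; simp

/-- Left multiplication by `z` on `V ⊗ kG`. -/
def mulCol (z : k[G]) : (ι → k[G]) →ₗ[k] (ι → k[G]) where
  toFun x := colAct G z *ᵥ x
  map_add' _ _ := Matrix.mulVec_add _ _ _
  map_smul' _ _ := Matrix.mulVec_smul _ _ _

theorem colMul_apply (z : k[G]) (x : ι → k[G]) : colMul z x = fun m => x m * z := rfl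

theorem mulCol_apply (z : k[G]) (x : ι → k[G]) : mulCol z x = colAct G z *ᵥ x := rfl

theorem mulCol_mulCol (y z : k[G]) (x : ι → k[G]) : mulCol y (mulCol z x) = mulCol (y * z) x := by
  simp only [mulCol_apply, map_mul, Matrix.mulVec_mulVec]

theorem colMul_colMul (y z : k[G]) (x : ι → k[G]) : colMul y (colMul z x) = colMul (z * y) x := by
  ext1; simp only [colMul_apply, mul_assoc]

theorem mulCol_colMul (y z : k[G]) (x : ι → k[G]) :
    mulCol y (colMul z x) = colMul z (mulCol y x) := by
  ext1
  simp only [mulCol_apply, colMul_apply, Matrix.mulVec, dotProduct, Finset.sum_mul, mul_assoc]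

theorem colMul_smul (c : k) (z : k[G]) (x : ι → k[G]) : colMul (c • z) x = c • colMul z x := by
  ext1; simp [colMul_apply]

theorem colMul_zero (x : ι → k[G]) : colMul (0 : k[G]) x = 0 := by
  ext1; simp [colMul_apply]

theorem mulCol_zero (x : ι → k[G]) : mulCol (0 : k[G]) x = 0 := by
  simp only [mulCol_apply, map_zero, Matrix.zero_mulVec]

theorem IsBasicSystem.mul_sum {e : V → k[G]} (he : IsBasicSystem e) (i : V) : e i * ∑ j, e j = e i := by
  classical
  rw [Finset.mul_sum, Finset.sum_eq_single i]
  · exact he.mul_self i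
  · intro j _ hj; exact he.mul_ne (Ne.symm hj)
  · simp

theorem IsBasicSystem.sum_mul {e : V → k[G]} (he : IsBasicSystem e) (i : V) : (∑ j, e j) * e i = e i := by
  classical
  rw [Finset.sum_mul, Finset.sum_eq_single i]
  · exact he.mul_self i
  · intro j _ hj; exact he.mul_ne hj
  · simp

variable [Fintype G] [IsAlgClosed k] [DecidableEq A] {Q : ArrowQuiver V A}
  {ρ : Set (PathAlgebra k Q)} {e : V → k[G]} {col : A → ι → k[G]}

/-- Linear forms dual to the columns exist by linear independence; the symmetric form of `kG` turns
them into rows with entries in `kG`. The completeness relation `col_row` needs that the idempotents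
generate `kG` as an ideal. -/
theorem IsArrowSystem.exists_dualRows (hs : IsArrowSystem Q ρ e col) :
    ∃ row : A → ι → k[G], IsDualRows Q e col row := by
  classical
  have he := hs.basic
  -- linear forms that are dual to the columns
  have hχ : ∃ χ : A → (ι → k[G]) →ₗ[k] k, ∀ a b, χ a (col b) = if a = b then 1 else 0 := by
    let B := Module.Basis.span hs.indep
    choose χ hχ using fun a => LinearMap.exists_extend (B.coord a)
    refine ⟨χ, fun a b => ?_⟩
    have h1 : χ a (col b) = (χ a ∘ₗ (Submodule.span k (Set.range col)).subtype) (B b) := by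
      rw [LinearMap.comp_apply, Submodule.subtype_apply, Module.Basis.span_apply]
    rw [h1, hχ, Module.Basis.coord_apply, Module.Basis.repr_self, Finsupp.single_apply]
    simp [eq_comm]
  obtain ⟨χ, hχ⟩ := hχ
  -- Cutting with the idempotents at both ends makes `χ' a` vanish on all `col b * z` with `b ≠ a`,
  -- and not only on `col b`.
  let χ' : A → (ι → k[G]) →ₗ[k] k := fun a => χ a ∘ₗ mulCol (e (Q.tgt a)) ∘ₗ colMul (e (Q.src a))
  have hχ' : ∀ a x, χ' a x = χ a (mulCol (e (Q.tgt a)) (colMul (e (Q.src a)) x)) := fun _ _ => rfl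
  have hsrc : ∀ a, colMul (e (Q.src a)) (col a) = col a := fun a => funext (hs.mul_src a)
  have htgt : ∀ a, mulCol (e (Q.tgt a)) (col a) = col a := hs.tgt_mul
  have hχcol : ∀ a b (z : k[G]), χ' a (colMul z (col b)) =
      if a = b then he.cornerForm (Q.src a) z else 0 := by
    intro a b z
    rw [hχ', colMul_colMul, ← hsrc b, colMul_colMul, ← mul_assoc]
    by_cases h : Q.src a = Q.src b
    · rw [h, he.mul_mul_eq_cornerForm, colMul_smul, hsrc, map_smul, ← htgt b, mulCol_mulCol]
      by_cases h' : Q.tgt a = Q.tgt b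
      · rw [h', he.mul_self, htgt, map_smul, hχ]; split_ifs <;> simp
      · rw [he.mul_ne h', mulCol_zero, smul_zero, map_zero, if_neg]
        rintro rfl; exact h' rfl
    · rw [he.corner_ne (Ne.symm h), colMul_zero, map_zero, map_zero, if_neg]
      rintro rfl; exact h rfl
  -- The scalar normalizes the product of a row with its own column to `e (Q.src a)`, by
  -- `coeff_one_smul_frobElement`.
  let row : A → ι → k[G] := fun a m => (e (Q.src a)).coeff 1 •
    frobElement (χ' a ∘ₗ LinearMap.single k (fun _ => k[G]) m)
  have hrow : ∀ a x, ∑ m, row a m * x m = (e (Q.src a)).coeff 1 •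
      frobElement (χ' a ∘ₗ { toFun := fun z => colMul z x
                             map_add' := fun y z => by ext1; simp [colMul_apply, mul_add]
                             map_smul' := fun c z => colMul_smul c z x }) := by
    intro a x
    simp only [row, smul_mul_assoc, frobElement_mul, ← Finset.smul_sum, ← frobElement_sum]
    congr 2
    refine LinearMap.ext fun z => ?_
    simp only [LinearMap.sum_apply, LinearMap.comp_apply, LinearMap.mulLeft_apply, ← map_sum]
    congr 1
    ext1 m
    simp [colMul_apply, Finset.sum_apply, Pi.single_apply]
  have hrc : ∀ a b, ∑ m, row a m * col b m = if a = b then e (Q.src a) else 0 := by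
    intro a b
    rw [hrow]
    split_ifs with h
    · refine Eq.trans ?_ (he.coeff_one_smul_frobElement (Q.src a)).1
      congr 2
      refine LinearMap.ext fun z => ?_
      simpa [h] using hχcol a b z
    · refine (smul_eq_zero_of_right _ ?_)
      ext g
      rw [frobElement_coeff]
      simpa [h] using hχcol a b (MonoidAlgebra.single g⁻¹ 1)
  have hmt : ∀ a, row a ᵥ* colAct G (e (Q.tgt a)) = row a := by
    intro a
    ext1 m
    have h1 : (row a ᵥ* colAct G (e (Q.tgt a))) m =
      ∑ l, row a l * (mulCol (e (Q.tgt a)) (Pi.single m 1)) l := by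
      simp [Matrix.vecMul, dotProduct, mulCol_apply]
    have h2 : row a m = ∑ l, row a l * (Pi.single m 1 : ι → k[G]) l := by
      simp [Pi.single_apply]
    rw [h1, h2, hrow, hrow]
    congr 2
    refine LinearMap.ext fun z => ?_
    simp only [LinearMap.comp_apply, LinearMap.coe_mk, AddHom.coe_mk]
    rw [hχ', hχ', ← mulCol_colMul, ← mulCol_colMul, mulCol_mulCol, he.mul_self]
  refine ⟨row, hrc, ?_, ?_, hmt⟩
  -- The expansion in the dual bases is clear for combinations of columns. For such an `x`, each `x
  -- p (e i)` is one of them, hence the expansion holds for `x p (e i) q`, and `1` is a sum of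
  -- elements `p (e i) q`.
  · have key : ∀ x : ι → k[G], mulCol (∑ i, e i) x = x →
        ∑ a, colMul (∑ m, row a m * x m) (col a) = x := by
      intro x hx
      have hz : ∀ z ∈ Submodule.span k {z : k[G] | ∃ p i q, z = p * e i * q},
          ∑ a, colMul (∑ m, row a m * (x m * z)) (col a) = colMul z x := by
        intro z hz
        induction hz using Submodule.span_induction with
        | zero => simp [colMul_zero]
        | add y z _ _ hy hz =>
          have hadd : ∀ (y z : k[G]) (x : ι → k[G]), colMul (y + z) x = colMul y x + colMul z x :=
            fun y z x => by ext1; simp [colMul_apply, mul_add]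
          simp only [mul_add, Finset.sum_add_distrib, hadd, hy, hz]
        | smul c z _ hz =>
          simp only [mul_smul_comm, ← Finset.smul_sum, colMul_smul, hz]
        | mem z hz =>
          obtain ⟨p, i, q, rfl⟩ := hz
          have h1 : colMul (p * e i) x ∈ Submodule.span k (Set.range col) := by
            refine hs.span _ ?_ fun m => ?_
            · change mulCol _ (colMul _ x) = _
              rw [mulCol_colMul, hx]
            · simp only [colMul_apply]
              rw [mul_assoc (x m), mul_assoc p, he.mul_sum]
          have h2 : ∀ y ∈ Submodule.span k (Set.range col),
              ∑ a, colMul (∑ m, row a m * y m) (col a) = y := by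
            intro y hy
            induction hy using Submodule.span_induction with
            | zero => simp [colMul_zero]
            | add y z _ _ hy hz =>
              have hadd : ∀ (y z : k[G]) (x : ι → k[G]),
                  colMul (y + z) x = colMul y x + colMul z x :=
                fun y z x => by ext1; simp [colMul_apply, mul_add]
              simp only [Pi.add_apply, mul_add, Finset.sum_add_distrib, hadd, hy, hz]
            | smul c z _ hz =>
              simp only [Pi.smul_apply, mul_smul_comm, ← Finset.smul_sum, colMul_smul, hz]
            | mem y hy =>
              obtain ⟨b, rfl⟩ := hy
              simp only [hrc]
              rw [Finset.sum_eq_single b]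
              · rw [if_pos rfl, hsrc]
              · intro a _ hab; rw [if_neg hab, colMul_zero]
              · simp
          have h3 := congrArg (colMul q) (h2 _ h1)
          rw [colMul_colMul] at h3
          rw [← h3, map_sum]
          refine Finset.sum_congr rfl fun a _ => ?_
          rw [colMul_colMul, Finset.sum_mul]
          simp only [colMul_apply, mul_assoc]
      have := hz 1 (he.one_mem_span k)
      simpa [colMul_apply] using this
    intro l m
    have he2 : (∑ i, e i) * ∑ i, e i = ∑ i, e i := by
      rw [Finset.sum_mul]; exact Finset.sum_congr rfl fun i _ => he.mul_sum i
    have h1 := congrFun (key (mulCol (∑ i, e i) (Pi.single m 1)) (by rw [mulCol_mulCol, he2])) l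
    have h2 : ∀ a, ∑ l, row a l * (mulCol (∑ i, e i) (Pi.single m 1)) l = row a m := by
      intro a
      have h3 : ∑ l, row a l * (mulCol (∑ i, e i) (Pi.single m 1)) l =
        (row a ᵥ* colAct G (∑ i, e i)) m := by
        simp [Matrix.vecMul, dotProduct, mulCol_apply]
      rw [h3]
      conv_lhs => rw [← hmt a]
      rw [Matrix.vecMul_vecMul, ← map_mul, he.mul_sum, hmt]
    simp only [h2] at h1
    rw [Finset.sum_apply] at h1
    simpa [colMul_apply, mulCol_apply] using h1
  · intro a m
    simp only [row, mul_smul_comm, mul_frobElement]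
    congr 2
    refine LinearMap.ext fun z => ?_
    simp only [LinearMap.comp_apply, LinearMap.mulRight_apply]
    rw [hχ', hχ']
    congr 2
    ext1 l
    simp only [colMul_apply, LinearMap.single_apply, Pi.single_apply]
    split_ifs
    · rw [mul_assoc, he.mul_self]
    · simp

end Rows

end

/-! ### Alternating functions on words and the volume form -/

noncomputable section

open PathAlgebra ArrowQuiver

section Antisymmetric

variable {ι M : Type*} [AddCommGroup M]

/-- A function on words that changes its sign if two adjacent letters are interchanged. -/
def IsAlternatingOn (Y : List ι → M) : Prop :=
  ∀ p a b q, Y (p ++ a :: b :: q) = - Y (p ++ b :: a :: q)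

theorem IsAlternatingOn.cons {Y : List ι → M} (hY : IsAlternatingOn Y) (c : ι) :
    IsAlternatingOn fun w => Y (c :: w) :=
  fun p a b q => hY (c :: p) a b q

/-- Carrying the first letter to the end takes one interchange per remaining letter. This is the
source of the sign in the commutation relations. -/
theorem IsAlternatingOn.append_cons {Y : List ι → M} (hY : IsAlternatingOn Y) (a : ι) (w : List ι) :
    Y (a :: w) = (-1 : ℤ) ^ w.length • Y (w ++ [a]) := by
  induction w generalizing Y with
  | nil => simp
  | cons b w ih =>
    have h1 := hY [] a b w
    have h2 := ih (hY.cons b)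
    simp only [List.nil_append] at h1
    rw [h1, h2, List.length_cons, pow_succ, List.cons_append, mul_neg, mul_one, neg_smul]

theorem IsAlternatingOn.eq_zero_of_duplicate [IsAddTorsionFree M] {Y : List ι → M} (hY : IsAlternatingOn Y)
    (p : List ι) (a : ι) (q r : List ι) : Y (p ++ a :: (q ++ a :: r)) = 0 := by
  induction q generalizing p with
  | nil => exact self_eq_neg.1 (hY p a a r)
  | cons b q ih =>
    have h := ih (p ++ [b])
    rw [List.append_assoc, List.singleton_append] at h
    rw [List.cons_append, hY, h, neg_zero]

theorem IsAlternatingOn.eq_zero_of_not_nodup [IsAddTorsionFree M] {Y : List ι → M} (hY : IsAlternatingOn Y)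
    {w : List ι} (hw : ¬ w.Nodup) : Y w = 0 := by
  have : ∃ p a q r, w = p ++ a :: (q ++ a :: r) := by
    induction w with
    | nil => exact absurd List.nodup_nil hw
    | cons c w ih =>
      by_cases hc : c ∈ w
      · obtain ⟨q, r, rfl⟩ := List.append_of_mem hc
        exact ⟨[], c, q, r, rfl⟩
      · obtain ⟨p, a, q, r, rfl⟩ := ih fun h => hw (List.nodup_cons.2 ⟨hc, h⟩)
        exact ⟨c :: p, a, q, r, rfl⟩
  obtain ⟨p, a, q, r, rfl⟩ := this
  exact hY.eq_zero_of_duplicate p a q r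

theorem IsAlternatingOn.eq_zero_of_card_lt [Fintype ι] [IsAddTorsionFree M] {Y : List ι → M}
    (hY : IsAlternatingOn Y) {w : List ι} (hw : Fintype.card ι < w.length) : Y w = 0 :=
  hY.eq_zero_of_not_nodup fun h => (not_le.2 hw) h.length_le_card

/-- The sign depends on the words only, not on `Y` or its values, so that two alternating functions
can be compared. -/
theorem exists_sign_of_perm {w w' : List ι} (h : w.Perm w') :
    ∃ ε : ℤˣ, ∀ (M : Type u) [AddCommGroup M] (Y : List ι → M), IsAlternatingOn Y →
      Y w = ε • Y w' := by
  induction h with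
  | nil => exact ⟨1, fun M _ Y _ => by simp⟩
  | cons x _ ih =>
    obtain ⟨ε, hε⟩ := ih
    exact ⟨ε, fun M _ Y hY => hε M _ (hY.cons x)⟩
  | swap x y l =>
    exact ⟨-1, fun M _ Y hY => by simpa [Units.smul_def] using hY [] y x l⟩
  | trans _ _ ih ih' =>
    obtain ⟨ε, hε⟩ := ih
    obtain ⟨ε', hε'⟩ := ih'
    exact ⟨ε * ε', fun M _ Y hY => by rw [hε M Y hY, hε' M Y hY, mul_smul]⟩

theorem perm_finRange {s : ℕ} {w : List (Fin s)} (hw : w.Nodup) (h : w.length = s) :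
    w.Perm (List.finRange s) := by
  refine (List.perm_ext_iff_of_nodup hw (List.nodup_finRange s)).2 fun i => ?_
  have h1 : w.toFinset = Finset.univ := Finset.eq_univ_of_card _ (by
    rw [List.toFinset_card_of_nodup hw, h, Fintype.card_fin])
  have h2 := Finset.mem_univ i
  rw [← h1, List.mem_toFinset] at h2
  simp [h2]

/-- The top exterior power is one-dimensional: a word of length `s` either repeats a letter or is a
permutation of the standard word. -/
theorem IsAlternatingOn.eq_of_finRange {s : ℕ} {M : Type u} [AddCommGroup M] [IsAddTorsionFree M]
    {Y Y' : List (Fin s) → M} (hY : IsAlternatingOn Y) (hY' : IsAlternatingOn Y')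
    (h : Y (List.finRange s) = Y' (List.finRange s)) {w : List (Fin s)} (hw : w.length = s) :
    Y w = Y' w := by
  by_cases hn : w.Nodup
  · obtain ⟨ε, hε⟩ := exists_sign_of_perm.{u} (perm_finRange hn hw)
    rw [hε M Y hY, hε M Y' hY', h]
  · rw [hY.eq_zero_of_not_nodup hn, hY'.eq_zero_of_not_nodup hn]

end Antisymmetric

section VolumeForm

variable (k : Type u) [Field k] (s : ℕ)

/-- The determinant of the matrix whose rows are the standard basis vectors that belong to the
letters of a word of length `s`; words of other lengths are sent to zero. -/
def volumeForm (w : List (Fin s)) : k :=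
  if w.length = s then (Matrix.of fun i j : Fin s => if w[(i : ℕ)]? = some j then (1 : k) else 0).det
  else 0

theorem volumeForm_finRange : volumeForm k s (List.finRange s) = 1 := by
  rw [volumeForm, if_pos (by simp), ← Matrix.det_one (n := Fin s)]
  congr 1
  ext i j
  simp [Matrix.one_apply]

theorem volumeForm_of_length_ne {w : List (Fin s)} (h : w.length ≠ s) : volumeForm k s w = 0 :=
  if_neg h

theorem isAlternatingOn_volumeForm : IsAlternatingOn (volumeForm k s) := by
  intro p a b q
  by_cases hs : (p ++ a :: b :: q).length = s
  · have hs' : (p ++ b :: a :: q).length = s := by simpa using hs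
    rw [volumeForm, volumeForm, if_pos hs, if_pos hs']
    have h1 : p.length < s := by simp at hs; omega
    have h2 : p.length + 1 < s := by simp at hs; omega
    set σ : Equiv.Perm (Fin s) := Equiv.swap ⟨p.length, h1⟩ ⟨p.length + 1, h2⟩ with hσ
    -- Interchanging two adjacent letters interchanges two rows of the matrix.
    have hd := Matrix.det_permute σ
      (Matrix.of fun i j : Fin s => if (p ++ b :: a :: q)[(i : ℕ)]? = some j then (1 : k) else 0)
    have hsg : Equiv.Perm.sign σ = -1 := Equiv.Perm.sign_swap (by simp)
    rw [hsg] at hd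
    have : (Matrix.of fun i j : Fin s => if (p ++ a :: b :: q)[(i : ℕ)]? = some j then (1 : k)
        else 0) = (Matrix.of fun i j : Fin s =>
          if (p ++ b :: a :: q)[(i : ℕ)]? = some j then (1 : k) else 0).submatrix σ id := by
      ext i j
      simp only [Matrix.of_apply, Matrix.submatrix_apply, id]
      congr 2
      by_cases hi : (i : ℕ) = p.length
      · have : i = ⟨p.length, h1⟩ := Fin.ext hi
        rw [this, hσ, Equiv.swap_apply_left]
        simp
      · by_cases hi' : (i : ℕ) = p.length + 1
        · have : i = ⟨p.length + 1, h2⟩ := Fin.ext hi'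
          rw [this, hσ, Equiv.swap_apply_right]
          simp
        · rw [hσ, Equiv.swap_apply_of_ne_of_ne (fun h => hi (by rw [h]))
            (fun h => hi' (by rw [h]))]
          rcases lt_or_gt_of_ne hi with h | h
          · rw [List.getElem?_append_left h, List.getElem?_append_left h]
          · rw [List.getElem?_append_right h.le, List.getElem?_append_right h.le]
            obtain ⟨n, hn⟩ : ∃ n, (i : ℕ) - p.length = n + 2 := ⟨i - p.length - 2, by omega⟩
            rw [hn]; simp
    rw [this, hd]
    simp
  · have hs' : (p ++ b :: a :: q).length ≠ s := by simpa using hs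
    rw [volumeForm, volumeForm, if_neg hs, if_neg hs', neg_zero]

end VolumeForm

section WordAction

variable {k : Type u} [Field k]

/-- The action of a matrix on functions on words. -/
def wordAct {ι : Type*} [Fintype ι] (g : Matrix ι ι k) : List ι → (List ι → k) → k
  | [], y => y []
  | l :: w, y => ∑ m, g l m * wordAct g w fun v => y (m :: v)

theorem wordAct_ofFn {ι : Type*} [Fintype ι] (g : Matrix ι ι k) {n : ℕ} (w : Fin n → ι)
    (y : List ι → k) :
    wordAct g (List.ofFn w) y =
      ∑ w' : Fin n → ι, (∏ i, g (w i) (w' i)) * y (List.ofFn w') := by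
  induction n generalizing y with
  | zero => simp [wordAct]
  | succ n ih =>
    rw [List.ofFn_succ, wordAct, ← (Fin.consEquiv fun _ => ι).sum_comp, Fintype.sum_prod_type]
    refine Finset.sum_congr rfl fun m _ => ?_
    rw [ih, Finset.mul_sum]
    refine Finset.sum_congr rfl fun w' _ => ?_
    simp [Fin.consEquiv, Fin.prod_univ_succ, List.ofFn_succ, mul_assoc]

/-- Multilinearity turns the sum over words into the determinant of a product of two matrices: the
one with the basis vectors of the word as rows, and `g`. -/
theorem wordAct_volumeForm {s : ℕ} (g : Matrix (Fin s) (Fin s) k) {w : List (Fin s)}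
    (hw : w.length = s) : wordAct g w (volumeForm k s) = g.det * volumeForm k s w := by
  obtain ⟨v, rfl⟩ : ∃ v : Fin s → Fin s, w = List.ofFn v := by
    exact ⟨fun i => w.get (i.cast hw.symm), List.ext_getElem (by simp [hw]) (by simp)⟩
  have hv : ∀ v : Fin s → Fin s, volumeForm k s (List.ofFn v) =
      Matrix.detRowAlternating fun i => Pi.single (v i) (1 : k) := by
    intro v
    rw [volumeForm, if_pos (by simp)]
    change _ = Matrix.det (fun i => Pi.single (v i) (1 : k))
    congr 1
    ext i j
    simp [Pi.single_apply, eq_comm]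
  rw [wordAct_ofFn]
  have h1 : ∀ v' : Fin s → Fin s, (∏ i, g (v i) (v' i)) * volumeForm k s (List.ofFn v') =
      (Matrix.detRowAlternating (n := Fin s) (R := k)).toMultilinearMap
        fun i => g (v i) (v' i) • Pi.single (v' i) (1 : k) := by
    intro v'
    rw [MultilinearMap.map_smul_univ, hv, smul_eq_mul]; rfl
  simp only [h1]
  refine ((MultilinearMap.map_sum (Matrix.detRowAlternating (n := Fin s) (R := k)).toMultilinearMap
    (fun i j => g (v i) j • (Pi.single j (1 : k) : Fin s → k))).symm).trans ?_
  rw [hv]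
  change Matrix.det _ = g.det * Matrix.det _
  rw [mul_comm]
  refine Eq.trans ?_ (Matrix.det_mul (Matrix.of fun i => Pi.single (v i) (1 : k)) g)
  congr 1
  ext i j
  simp [Matrix.mul_apply, Finset.sum_apply, Pi.single_apply]

end WordAction

/-! ### Left multiplication by `kG` on tensors -/

section LeftAction

variable {k : Type u} [Field k] {ι : Type} [Fintype ι] [DecidableEq ι]
  {G : Subgroup (GL ι k)}

/-- An entry of the matrix `colAct G z`, as a linear map. -/
def colActEntry (G : Subgroup (GL ι k)) (l m : ι) : k[G] →ₗ[k] k[G] where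
  toFun z := colAct G z l m
  map_add' _ _ := by simp
  map_smul' _ _ := by simp

/-- Left multiplication by the group algebra on `kG`-valued functions on words, evaluated at a
word. A function `Y` stands for the formal sum of the `X_w Y(w)`. -/
def leftAct : List ι → (k[G] →ₗ[k] (List ι → k[G]) →ₗ[k] k[G])
  | [] => (LinearMap.mul k k[G]).compl₂ (LinearMap.proj [])
  | l :: w => ∑ m, (leftAct w).compl₁₂ (colActEntry G l m)
      (LinearMap.funLeft k k[G] (List.cons m))

theorem leftAct_nil (z : k[G]) (Y : List ι → k[G]) : leftAct [] z Y = z * Y [] := rfl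

theorem leftAct_cons (l : ι) (w : List ι) (z : k[G]) (Y : List ι → k[G]) :
    leftAct (l :: w) z Y = ∑ m, leftAct w (colAct G z l m) fun v => Y (m :: v) := by
  simp only [leftAct, LinearMap.sum_apply, LinearMap.compl₁₂_apply]
  rfl

theorem leftAct_congr {w : List ι} (z : k[G]) {Y Y' : List ι → k[G]}
    (h : ∀ v, v.length = w.length → Y v = Y' v) : leftAct w z Y = leftAct w z Y' := by
  induction w generalizing z Y Y' with
  | nil => rw [leftAct_nil, leftAct_nil, h [] rfl]
  | cons l w ih =>
    rw [leftAct_cons, leftAct_cons]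
    exact Finset.sum_congr rfl fun m _ => ih _ fun v hv => h _ (by simp [hv])

theorem leftAct_mul (w : List ι) (y z : k[G]) (Y : List ι → k[G]) :
    leftAct w (y * z) Y = leftAct w y fun v => leftAct v z Y := by
  induction w generalizing y z Y with
  | nil => simp only [leftAct_nil, mul_assoc]
  | cons l w ih =>
    simp only [leftAct_cons, map_mul, Matrix.mul_apply, map_sum, LinearMap.sum_apply, ih]
    rw [Finset.sum_comm]
    refine Finset.sum_congr rfl fun m _ => ?_
    rw [← map_sum]
    congr 1
    ext1 v
    simp

theorem leftAct_mul_right (w : List ι) (z : k[G]) (Y : List ι → k[G]) (x : k[G]) :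
    leftAct w z (fun v => Y v * x) = leftAct w z Y * x := by
  induction w generalizing z Y with
  | nil => simp only [leftAct_nil, mul_assoc]
  | cons l w ih => simp only [leftAct_cons, Finset.sum_mul, ← ih]

theorem colAct_colAct_comm (z : k[G]) (a b c d : ι) :
    colAct G (colAct G z a c) b d = colAct G (colAct G z b d) a c := by
  induction z using MonoidAlgebra.induction_linear with
  | zero => simp
  | add x y hx hy => simp [hx, hy]
  | single g r => simp only [colAct_single]; congr 1; ring

/-- A group element acts by the same matrix on every letter, so its action commutes with
permutations of the letters (`colAct_colAct_comm`). -/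
theorem isAlternatingOn_leftAct (z : k[G]) {Y : List ι → k[G]} (hY : IsAlternatingOn Y) :
    IsAlternatingOn fun w => leftAct w z Y := by
  intro p a b q
  induction p generalizing z Y with
  | nil =>
    simp only [List.nil_append, leftAct_cons]
    rw [Finset.sum_comm, ← Finset.sum_neg_distrib]
    refine Finset.sum_congr rfl fun m _ => ?_
    rw [← Finset.sum_neg_distrib]
    refine Finset.sum_congr rfl fun n _ => ?_
    rw [colAct_colAct_comm, ← map_neg]
    congr 1
    ext1 v
    exact hY [] n m v
  | cons c p ih =>
    simp only [List.cons_append, leftAct_cons, ← Finset.sum_neg_distrib]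
    exact Finset.sum_congr rfl fun m _ => ih _ (hY.cons m)

/-- If `Y` is the product of a tensor `y` with an element `x` of `V ⊗ kG` on its right, then left
multiplication acts on `y` alone. This is associativity, and it permits letters to be peeled off at
the end. -/
theorem leftAct_append_singleton (w : List ι) (l : ι) (z : k[G]) {Y y : List ι → k[G]}
    {x : ι → k[G]}
    (h : ∀ v, v.length = w.length → ∀ m, Y (v ++ [m]) = (colAct G (y v) *ᵥ x) m) :
    leftAct (w ++ [l]) z Y = (colAct G (leftAct w z y) *ᵥ x) l := by
  induction w generalizing z Y y with
  | nil =>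
    have h0 : ∀ m, Y [m] = (colAct G (y []) *ᵥ x) m := h [] rfl
    simp only [List.nil_append, leftAct_cons, leftAct_nil, h0]
    rw [map_mul, ← Matrix.mulVec_mulVec]
    rfl
  | cons c w ih =>
    simp only [List.cons_append, leftAct_cons]
    rw [map_sum, Matrix.sum_mulVec, Finset.sum_apply]
    exact Finset.sum_congr rfl fun m _ => ih _ fun v hv n => h (m :: v) (by simp [hv]) n

theorem leftAct_single (w : List ι) (g : G) (c : k) (y : List ι → k) (x : k[G]) :
    leftAct w (MonoidAlgebra.single g c) (fun v => y v • x) =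
      wordAct g.1.1 w y • (MonoidAlgebra.single g c * x) := by
  induction w generalizing c y with
  | nil => simp [leftAct_nil, wordAct]
  | cons l w ih =>
    rw [leftAct_cons, wordAct, Finset.sum_smul]
    refine Finset.sum_congr rfl fun m _ => ?_
    have h : MonoidAlgebra.single g (c * g.1.1 l m) = g.1.1 l m • MonoidAlgebra.single g c := by
      rw [MonoidAlgebra.smul_single, smul_eq_mul, mul_comm]
    rw [colAct_single, ih, h, smul_mul_assoc, smul_smul, mul_comm]

end LeftAction

end

/-! ### The tensor of a linear form on `kQ` -/

noncomputable section

open PathAlgebra ArrowQuiver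

section TensorOf

variable {k : Type u} [Field k] {ι : Type} [Fintype ι] [DecidableEq ι]
  {G : Subgroup (GL ι k)} {V : Type v} {A : Type w} [Fintype V] [Fintype A]

/-- The linear form `y ↦ F (x y)`. -/
def formMulLeft {Q : ArrowQuiver V A} (x : PathAlgebra k Q) :
    Module.Dual k (PathAlgebra k Q) →ₗ[k] Module.Dual k (PathAlgebra k Q) :=
  (LinearMap.mulLeft k x).dualMap

/-- The linear form `y ↦ F (y x)`. -/
def formMulRight {Q : ArrowQuiver V A} (x : PathAlgebra k Q) :
    Module.Dual k (PathAlgebra k Q) →ₗ[k] Module.Dual k (PathAlgebra k Q) :=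
  (LinearMap.mulRight k x).dualMap

theorem formMulLeft_apply {Q : ArrowQuiver V A} (x y : PathAlgebra k Q)
    (F : Module.Dual k (PathAlgebra k Q)) : formMulLeft x F y = F (x * y) := rfl

theorem formMulRight_apply {Q : ArrowQuiver V A} (x y : PathAlgebra k Q)
    (F : Module.Dual k (PathAlgebra k Q)) : formMulRight x F y = F (y * x) := rfl

theorem formMulLeft_formMulLeft {Q : ArrowQuiver V A} (x y : PathAlgebra k Q)
    (F : Module.Dual k (PathAlgebra k Q)) :
    formMulLeft x (formMulLeft y F) = formMulLeft (y * x) F := by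
  ext z; simp only [formMulLeft_apply, mul_assoc]

theorem formMulLeft_formMulRight {Q : ArrowQuiver V A} (x y : PathAlgebra k Q)
    (F : Module.Dual k (PathAlgebra k Q)) :
    formMulLeft x (formMulRight y F) = formMulRight y (formMulLeft x F) := by
  ext z; simp only [formMulLeft_apply, formMulRight_apply, mul_assoc]

theorem formMulLeft_sum_smul {Q : ArrowQuiver V A} {α : Type*} (s : Finset α) (c : α → k)
    (x : α → PathAlgebra k Q) (F : Module.Dual k (PathAlgebra k Q)) :
    formMulLeft (∑ i ∈ s, c i • x i) F = ∑ i ∈ s, c i • formMulLeft (x i) F := by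
  ext z
  simp only [formMulLeft_apply, Finset.sum_mul, smul_mul_assoc, map_sum, map_smul,
    LinearMap.sum_apply, LinearMap.smul_apply]

/-- The element `∑ F(p) p` of `V^{⊗n} ⊗ kG`, where the sum is over the paths of length `n` and the
arrows are considered as elements of `V ⊗ kG`. -/
def tensorOf {Q : ArrowQuiver V A} (e : V → k[G]) (col : A → ι → k[G]) :
    ℕ → (Module.Dual k (PathAlgebra k Q) →ₗ[k] (List ι → k[G]))
  | 0 => LinearMap.pi fun w => match w with
    | [] => ∑ i, LinearMap.toSpanSingleton k k[G] (e i) ∘ₗ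
        LinearMap.applyₗ (R := k) (vertex k Q i)
    | _ :: _ => 0
  | n + 1 => LinearMap.pi fun w => match w with
    | [] => 0
    | l :: w => ∑ a, leftAct w (col a l) ∘ₗ tensorOf e col n ∘ₗ formMulLeft (arrow k Q a)

variable {Q : ArrowQuiver V A} {ρ θ : Set (PathAlgebra k Q)} {e : V → k[G]} {col : A → ι → k[G]}

theorem tensorOf_zero_nil (F : Module.Dual k (PathAlgebra k Q)) :
    tensorOf e col 0 F [] = ∑ i, F (vertex k Q i) • e i := by
  simp [tensorOf]

theorem tensorOf_zero_cons (F : Module.Dual k (PathAlgebra k Q)) (l : ι) (w : List ι) :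
    tensorOf e col 0 F (l :: w) = 0 := rfl

theorem tensorOf_succ_nil (n : ℕ) (F : Module.Dual k (PathAlgebra k Q)) :
    tensorOf e col (n + 1) F [] = 0 := rfl

theorem tensorOf_succ_cons (n : ℕ) (F : Module.Dual k (PathAlgebra k Q)) (l : ι) (w : List ι) :
    tensorOf e col (n + 1) F (l :: w) =
      ∑ a, leftAct w (col a l) (tensorOf e col n (formMulLeft (arrow k Q a) F)) := by
  simp [tensorOf]

theorem tensorOf_of_length_ne {n : ℕ} (F : Module.Dual k (PathAlgebra k Q)) {w : List ι}
    (hw : w.length ≠ n) : tensorOf e col n F w = 0 := by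
  induction n generalizing F w with
  | zero =>
    cases w with
    | nil => simp at hw
    | cons l w => rfl
  | succ n ih =>
    cases w with
    | nil => rfl
    | cons l w =>
      rw [tensorOf_succ_cons]
      refine Finset.sum_eq_zero fun a _ => ?_
      rw [leftAct_congr (Y' := 0), map_zero]
      intro v hv
      exact ih _ (by rw [hv]; simpa using hw)

/-- The symmetric part of the element of `V ⊗ V ⊗ kG` that belongs to a path of length two. -/
def symTwo (col : A → ι → k[G]) (a b : A) (l m : ι) : k[G] :=
  (colAct G (col a l) *ᵥ col b) m + (colAct G (col a m) *ᵥ col b) l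

variable (hs : IsArrowSystem Q ρ e col)
include hs

theorem IsArrowSystem.colAct_mulVec [DecidableEq V] (i : V) (a : A) :
    colAct G (e i) *ᵥ col a = if i = Q.tgt a then col a else 0 := by
  rw [← hs.tgt_mul a, Matrix.mulVec_mulVec, ← map_mul]
  split_ifs with h
  · rw [h, hs.basic.mul_self]
  · rw [hs.basic.mul_ne h, map_zero, Matrix.zero_mulVec]

theorem IsArrowSystem.leftAct_tensorOf [DecidableEq V] (n : ℕ)
    (F : Module.Dual k (PathAlgebra k Q)) (i : V) (w : List ι) :
    leftAct w (e i) (tensorOf e col n F) =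
      tensorOf e col n (formMulLeft (vertex k Q i) F) w := by
  cases n with
  | zero =>
    cases w with
    | nil =>
      rw [leftAct_nil, tensorOf_zero_nil, tensorOf_zero_nil, Finset.mul_sum]
      refine Finset.sum_congr rfl fun j _ => ?_
      rw [formMulLeft_apply, vertex_mul_vertex, mul_smul_comm]
      split_ifs with h
      · rw [h, hs.basic.mul_self]
      · rw [hs.basic.mul_ne h, map_zero, zero_smul, smul_zero]
    | cons l w =>
      rw [leftAct_congr (Y' := 0), map_zero, tensorOf_zero_cons]
      intro v hv
      exact tensorOf_of_length_ne _ (by rw [hv]; simp)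
  | succ n =>
    cases w with
    | nil => rw [leftAct_nil, tensorOf_succ_nil, tensorOf_succ_nil, mul_zero]
    | cons l w =>
      rw [leftAct_cons, tensorOf_succ_cons]
      have h1 : ∀ m, (fun v => tensorOf e col (n + 1) F (m :: v)) =
          ∑ a, fun v => leftAct v (col a m) (tensorOf e col n (formMulLeft (arrow k Q a) F)) := by
        intro m; ext1 v; rw [tensorOf_succ_cons, Finset.sum_apply]
      simp only [h1, map_sum, ← leftAct_mul]
      rw [Finset.sum_comm]
      refine Finset.sum_congr rfl fun a _ => ?_
      rw [← LinearMap.sum_apply, ← map_sum]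
      have h2 : ∑ m, colAct G (e i) l m * col a m = (colAct G (e i) *ᵥ col a) l := rfl
      rw [h2, hs.colAct_mulVec, formMulLeft_formMulLeft, vertex_mul_arrow]
      split_ifs with h
      · rfl
      · have : formMulLeft (0 : PathAlgebra k Q) F = 0 := by
          ext z; simp [formMulLeft_apply]
        rw [this]; simp

theorem IsArrowSystem.tensorOf_mul [DecidableEq V] (n : ℕ)
    (F : Module.Dual k (PathAlgebra k Q)) (i : V) (w : List ι) :
    tensorOf e col n (formMulRight (vertex k Q i) F) w = tensorOf e col n F w * e i := by
  induction n generalizing F w with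
  | zero =>
    cases w with
    | nil =>
      rw [tensorOf_zero_nil, tensorOf_zero_nil, Finset.sum_mul]
      refine Finset.sum_congr rfl fun j _ => ?_
      rw [formMulRight_apply, vertex_mul_vertex, smul_mul_assoc]
      split_ifs with h
      · rw [h, hs.basic.mul_self]
      · rw [hs.basic.mul_ne h, map_zero, zero_smul, smul_zero]
    | cons l w => rw [tensorOf_zero_cons, tensorOf_zero_cons, zero_mul]
  | succ n ih =>
    cases w with
    | nil => rw [tensorOf_succ_nil, tensorOf_succ_nil, zero_mul]
    | cons l w =>
      rw [tensorOf_succ_cons, tensorOf_succ_cons, Finset.sum_mul]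
      refine Finset.sum_congr rfl fun a _ => ?_
      rw [formMulLeft_formMulRight, ← leftAct_mul_right]
      congr 1
      ext1 v
      exact ih _ _

/-- The tensor is defined by peeling off first arrows; here the last arrow is peeled off. Comparison
of the two descriptions brings in the Nakayama automorphism. -/
theorem IsArrowSystem.tensorOf_append (n : ℕ) (F : Module.Dual k (PathAlgebra k Q))
    {w : List ι} (hw : w.length = n) (l : ι) :
    tensorOf e col (n + 1) F (w ++ [l]) =
      ∑ a, (colAct G (tensorOf e col n (formMulRight (arrow k Q a) F) w) *ᵥ col a) l := by
  classical
  induction n generalizing F w l with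
  | zero =>
    obtain rfl := List.length_eq_zero_iff.1 hw
    rw [List.nil_append, tensorOf_succ_cons]
    refine Finset.sum_congr rfl fun a _ => ?_
    rw [leftAct_nil, tensorOf_zero_nil, tensorOf_zero_nil, map_sum, Matrix.sum_mulVec,
      Finset.sum_apply, Finset.mul_sum]
    have h1 : ∀ i, col a l * formMulLeft (arrow k Q a) F (vertex k Q i) • e i =
        if Q.src a = i then F (arrow k Q a) • col a l else 0 := by
      intro i
      rw [formMulLeft_apply, arrow_mul_vertex, mul_smul_comm]
      split_ifs with h
      · rw [← h, hs.mul_src]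
      · rw [map_zero, zero_smul]
    have h2 : ∀ i, (colAct G (formMulRight (arrow k Q a) F (vertex k Q i) • e i) *ᵥ col a) l =
        if i = Q.tgt a then F (arrow k Q a) • col a l else 0 := by
      intro i
      rw [formMulRight_apply, vertex_mul_arrow, map_smul, Matrix.smul_mulVec, hs.colAct_mulVec]
      split_ifs with h
      · rfl
      · rw [smul_zero]; rfl
    simp only [h1, h2]
    simp
  | succ n ih =>
    cases w with
    | nil => simp at hw
    | cons c w =>
      have hw' : w.length = n := by simpa using hw
      simp only [List.cons_append, tensorOf_succ_cons, map_sum, Matrix.sum_mulVec,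
        Finset.sum_apply]
      rw [Finset.sum_comm]
      refine Finset.sum_congr rfl fun a _ => ?_
      -- The function splits a word into its initial part and its last letter; its value at the
      -- empty word plays no role, since only words of the length of `w ++ [l]` matter.
      have h1 : ∀ b, leftAct (w ++ [l]) (col a c) (fun v => if h : v = [] then 0 else
          (colAct G (tensorOf e col n (formMulRight (arrow k Q b)
            (formMulLeft (arrow k Q a) F)) v.dropLast) *ᵥ col b) (v.getLast h)) =
          (colAct G (leftAct w (col a c) (tensorOf e col n (formMulLeft (arrow k Q a)
            (formMulRight (arrow k Q b) F)))) *ᵥ col b) l := by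
        intro b
        refine leftAct_append_singleton w l (col a c) fun v _ m => ?_
        rw [formMulLeft_formMulRight]
        simp
      rw [← Finset.sum_congr rfl fun b _ => h1 b, ← map_sum]
      refine leftAct_congr _ fun v hv => ?_
      obtain ⟨v', m, rfl⟩ : ∃ v' m, v = v' ++ [m] := by
        have : v ≠ [] := by rintro rfl; simp at hv
        exact ⟨v.dropLast, v.getLast this, (List.dropLast_append_getLast this).symm⟩
      have hv' : v'.length = n := by simpa [hw'] using hv
      rw [ih _ hv']
      simp

theorem IsArrowSystem.twoTensor_arrow_mul_arrow (a b : A) (l m : ι) :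
    twoTensor (Q := Q) col (arrow k Q a * arrow k Q b) l m = (colAct G (col a l) *ᵥ col b) m := by
  classical
  by_cases h : Q.src a = Q.tgt b
  · simp only [twoTensor, pairing_arrow_mul_arrow h, ite_and, ite_smul, one_smul, zero_smul]
    simp
  · rw [arrow_mul_arrow_of_ne h, ← hs.mul_src a l, ← hs.tgt_mul b, Matrix.mulVec_mulVec,
      ← map_mul, mul_assoc, hs.basic.mul_ne h]
    simp [twoTensor]

/-- The antisymmetry criterion for `ρ` is a system of linear equations on `kQ_2`, indexed by two
letters and a group element. Read as vectors, their coefficients are orthogonal to `ρ`, hence are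
relations of the quadratic dual. -/
theorem IsArrowSystem.sum_symTwo_mem (hθ : Submodule.span k θ = quadraticOrthogonal ρ)
    (hρ : ∀ r ∈ ρ, IsQuadraticRelation r) (l m : ι) (g : G) :
    ∑ a, ∑ b, (symTwo col a b l m).coeff g • (arrow k Q a * arrow k Q b) ∈
      Submodule.span k θ := by
  classical
  rw [hθ]
  refine ⟨sum_mem_degree_two _, fun r hr => ?_⟩
  have h1 := (hs.mem_span_iff r (hρ r hr).mem_degree).1 (Submodule.subset_span hr) l m
  have h2 := congrArg (fun z : k[G] => z.coeff g) h1
  simp only [map_sum, map_smul, LinearMap.sum_apply, LinearMap.smul_apply]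
  refine Eq.trans ?_ h2
  simp only [twoTensor, ← Finset.sum_add_distrib, ← smul_add]
  simp only [symTwo, MonoidAlgebra.coeff_sum, MonoidAlgebra.coeff_smul, Finsupp.coe_finsetSum,
    Finset.sum_apply, Finsupp.smul_apply, smul_eq_mul]
  refine Finset.sum_congr rfl fun a _ => Finset.sum_congr rfl fun b _ => mul_comm _ _

/-- An interchange of later letters is covered by induction after removal of the first arrow. For
the first two letters, the symmetrized tensor evaluates `F` on products that begin with the elements
of `sum_symTwo_mem`, where `F` vanishes. -/
theorem IsArrowSystem.isAlternatingOn_tensorOf [Fintype G]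
    (hθ : Submodule.span k θ = quadraticOrthogonal ρ)
    (hρ : ∀ r ∈ ρ, IsQuadraticRelation r) (n : ℕ) {F : Module.Dual k (PathAlgebra k Q)}
    (hF : ∀ x, ∀ r ∈ θ, ∀ y, F (x * r * y) = 0) :
    IsAlternatingOn (tensorOf e col n F) := by
  induction n generalizing F with
  | zero =>
    intro p a b q
    rw [tensorOf_of_length_ne, tensorOf_of_length_ne, neg_zero] <;> simp
  | succ n ih =>
    have hFa : ∀ a x, ∀ r ∈ θ, ∀ y, formMulLeft (arrow k Q a) F (x * r * y) = 0 := by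
      intro a x r hr y
      rw [formMulLeft_apply, ← mul_assoc, ← mul_assoc]
      exact hF _ r hr y
    intro p a b q
    cases p with
    | cons c p =>
      simp only [List.cons_append, tensorOf_succ_cons, ← Finset.sum_neg_distrib]
      exact Finset.sum_congr rfl fun a _ => isAlternatingOn_leftAct _ (ih (hFa a)) _ _ _ _
    | nil =>
      cases n with
      | zero => rw [tensorOf_of_length_ne, tensorOf_of_length_ne, neg_zero] <;> simp
      | succ n =>
        rw [eq_neg_iff_add_eq_zero]
        have h1 : ∀ l m, tensorOf e col (n + 2) F ([] ++ l :: m :: q) =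
            ∑ a, ∑ b, leftAct q ((colAct G (col a l) *ᵥ col b) m)
              (tensorOf e col n (formMulLeft (arrow k Q a * arrow k Q b) F)) := by
          intro l m
          rw [List.nil_append, tensorOf_succ_cons]
          refine Finset.sum_congr rfl fun a _ => ?_
          rw [leftAct_cons]
          have h1 : ∀ m, (fun v => tensorOf e col (n + 1) (formMulLeft (arrow k Q a) F) (m :: v)) =
              ∑ b, fun v => leftAct v (col b m) (tensorOf e col n
                (formMulLeft (arrow k Q a * arrow k Q b) F)) := by
            intro m; ext1 v
            simp only [tensorOf_succ_cons, Finset.sum_apply, formMulLeft_formMulLeft]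
          simp only [h1, map_sum, ← leftAct_mul]
          rw [Finset.sum_comm]
          refine Finset.sum_congr rfl fun b _ => ?_
          rw [← LinearMap.sum_apply, ← map_sum]
          rfl
        rw [h1, h1]
        simp only [← Finset.sum_add_distrib, ← LinearMap.add_apply, ← map_add]
        have h2 : ∀ z : k[G], z = ∑ g, z.coeff g • MonoidAlgebra.single g (1 : k) := by
          classical
          intro z
          ext g
          simp
        have h3 : ∀ (z : k[G]) (Y : List ι → k[G]), leftAct q z Y = ∑ g, leftAct q (MonoidAlgebra.single g (1 : k))
            (z.coeff g • Y) := by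
          intro z Y
          conv_lhs => rw [h2 z]
          simp only [map_sum, map_smul, LinearMap.sum_apply, LinearMap.smul_apply]
        change ∑ c, ∑ d, leftAct q (symTwo col c d a b) _ = 0
        have h4 : ∀ c d, leftAct q (symTwo col c d a b)
            (tensorOf e col n (formMulLeft (arrow k Q c * arrow k Q d) F)) =
            ∑ g, leftAct q (MonoidAlgebra.single g (1 : k)) (tensorOf e col n
              ((symTwo col c d a b).coeff g • formMulLeft (arrow k Q c * arrow k Q d) F)) := by
          intro c d; rw [h3]; simp only [map_smul]
        simp only [h4]
        have h5 : ∀ f : A → A → G → k[G], ∑ c, ∑ d, ∑ g, f c d g = ∑ g, ∑ c, ∑ d, f c d g := by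
          intro f
          simp only [Finset.sum_comm (s := (Finset.univ : Finset A)) (t := (Finset.univ : Finset G))]
        rw [h5]
        refine Finset.sum_eq_zero fun g _ => ?_
        simp only [← map_sum]
        -- The coefficient at each group element `g` is treated separately, because `F` is only
        -- linear over `k`.
        have h6 : ∑ c, ∑ d, (symTwo col c d a b).coeff g •
            formMulLeft (arrow k Q c * arrow k Q d) F = 0 := by
          have h7 := hs.sum_symTwo_mem hθ hρ a b g
          ext y
          have h8 : ∀ x ∈ Submodule.span k θ, F (x * y) = 0 := by
            intro x hx
            induction hx using Submodule.span_induction with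
            | mem x hx => simpa using hF 1 x hx y
            | zero => simp
            | add x x' _ _ hx hx' => rw [add_mul, map_add, hx, hx', add_zero]
            | smul c x _ hx => rw [smul_mul_assoc, map_smul, hx, smul_zero]
          have h9 := h8 _ h7
          simpa only [Finset.sum_mul, smul_mul_assoc, map_sum, map_smul, LinearMap.sum_apply,
            LinearMap.smul_apply, formMulLeft_apply, LinearMap.zero_apply] using h9
        rw [h6, map_zero, map_zero]

end TensorOf

end

/-! ### Contraction of tensors along arrows -/

noncomputable section

open PathAlgebra ArrowQuiver

section Contraction

variable {k : Type u} [Field k] {ι : Type} [Fintype ι] [DecidableEq ι]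
  {G : Subgroup (GL ι k)} {V : Type v} {A : Type w} [Fintype V] [Fintype A] [DecidableEq A]

/-- Contraction with the linear form on `V ⊗ kG` that is given by a row. -/
def contract (row : A → ι → k[G]) (a : A) : (List ι → k[G]) →ₗ[k] (List ι → k[G]) :=
  LinearMap.pi fun w => ∑ m, leftAct w (row a m) ∘ₗ LinearMap.funLeft k k[G] (List.cons m)

theorem contract_apply (row : A → ι → k[G]) (a : A) (Y : List ι → k[G]) (w : List ι) :
    contract row a Y w = ∑ m, leftAct w (row a m) fun v => Y (m :: v) := by
  simp only [contract, LinearMap.pi_apply, LinearMap.sum_apply, LinearMap.comp_apply]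
  rfl

theorem contract_mul_right (row : A → ι → k[G]) (a : A) (Y : List ι → k[G]) (x : k[G])
    (w : List ι) : contract row a (fun v => Y v * x) w = contract row a Y w * x := by
  simp only [contract_apply, Finset.sum_mul, ← leftAct_mul_right]

theorem isAlternatingOn_contract (row : A → ι → k[G]) (a : A) {Y : List ι → k[G]}
    (hY : IsAlternatingOn Y) : IsAlternatingOn (contract row a Y) := by
  intro p c d q
  simp only [contract_apply, ← Finset.sum_neg_distrib]
  exact Finset.sum_congr rfl fun m _ => isAlternatingOn_leftAct _ (hY.cons m) _ _ _ _

theorem leftAct_contract (row : A → ι → k[G]) (a : A) (z : k[G]) (Y : List ι → k[G])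
    (w : List ι) : leftAct w z (contract row a Y) =
      ∑ m, leftAct w (z * row a m) fun v => Y (m :: v) := by
  have h : contract row a Y = ∑ m, fun w => leftAct w (row a m) fun v => Y (m :: v) := by
    ext1 w; rw [contract_apply, Finset.sum_apply]
  rw [h, map_sum]
  simp only [leftAct_mul]

theorem contract_leftAct (row : A → ι → k[G]) (a : A) (z : k[G]) (Y : List ι → k[G])
    (w : List ι) : contract row a (fun v => leftAct v z Y) w =
      ∑ m, leftAct w ((row a ᵥ* colAct G z) m) fun v => Y (m :: v) := by
  have h : ∀ m, (fun v => leftAct (m :: v) z Y) =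
      ∑ n, fun v => leftAct v (colAct G z m n) fun v => Y (n :: v) := by
    intro m; ext1 v; rw [leftAct_cons, Finset.sum_apply]
  simp only [contract_apply, h, map_sum, ← leftAct_mul]
  rw [Finset.sum_comm]
  refine Finset.sum_congr rfl fun n _ => ?_
  rw [← LinearMap.sum_apply, ← map_sum]
  rfl

variable {Q : ArrowQuiver V A} {ρ θ : Set (PathAlgebra k Q)} {e : V → k[G]}
  {col row : A → ι → k[G]} (hs : IsArrowSystem Q ρ e col) (hr : IsDualRows Q e col row)

include hr in
theorem IsDualRows.leftAct_src_contract (a : A) (Y : List ι → k[G]) (w : List ι) :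
    leftAct w (e (Q.src a)) (contract row a Y) = contract row a Y w := by
  rw [leftAct_contract, contract_apply]
  simp only [hr.src_mul]

include hs hr in
theorem IsDualRows.contract_leftAct_idempotent [DecidableEq V] (a : A) (i : V)
    (Y : List ι → k[G]) :
    contract row a (fun v => leftAct v (e i) Y) = if i = Q.tgt a then contract row a Y else 0 := by
  ext1 w
  rw [contract_leftAct]
  have h : row a ᵥ* colAct G (e i) = if i = Q.tgt a then row a else 0 := by
    rw [← hr.mul_tgt a, Matrix.vecMul_vecMul, ← map_mul]
    split_ifs with h
    · rw [h, hs.basic.mul_self]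
    · rw [hs.basic.mul_ne (Ne.symm h), map_zero, Matrix.vecMul_zero]
  rw [h]
  split_ifs
  · rw [contract_apply]
  · simp

-- Contraction with the row of `a` undoes the multiplication with the column of `a` on the left, by
-- `row_col`.
include hs hr in
theorem IsDualRows.contract_tensorOf (n : ℕ) (F : Module.Dual k (PathAlgebra k Q)) (a : A) :
    contract row a (tensorOf e col (n + 1) F) =
      tensorOf e col n (formMulLeft (arrow k Q a) F) := by
  classical
  ext1 w
  rw [contract_apply]
  have h1 : ∀ m, (fun v => tensorOf e col (n + 1) F (m :: v)) =
      ∑ b, fun v => leftAct v (col b m) (tensorOf e col n (formMulLeft (arrow k Q b) F)) := by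
    intro m; ext1 v; rw [tensorOf_succ_cons, Finset.sum_apply]
  simp only [h1, map_sum, ← leftAct_mul]
  rw [Finset.sum_comm]
  simp only [← LinearMap.sum_apply, ← map_sum, hr.row_col]
  rw [Finset.sum_eq_single a]
  · rw [if_pos rfl, hs.leftAct_tensorOf, formMulLeft_formMulLeft, arrow_mul_vertex_src]
  · intro b _ hb; rw [if_neg (Ne.symm hb)]; simp
  · simp

include hr in
/-- A tensor is recovered from its contractions. -/
theorem IsDualRows.leftAct_sum_cons (Y : List ι → k[G]) (l : ι) (w : List ι) :
    leftAct (l :: w) (∑ i, e i) Y = ∑ a, leftAct w (col a l) (contract row a Y) := by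
  simp only [leftAct_contract]
  rw [leftAct_cons, Finset.sum_comm]
  refine Finset.sum_congr rfl fun m _ => ?_
  rw [← hr.col_row, map_sum, LinearMap.sum_apply]

include hs hr in
theorem IsDualRows.leftAct_sum_contract (a : A) (Y : List ι → k[G]) (w : List ι) :
    leftAct w (∑ i, e i) (contract row a Y) = contract row a Y w := by
  conv_lhs => rw [← funext (hr.leftAct_src_contract a Y)]
  rw [← leftAct_mul, hs.basic.sum_mul, hr.leftAct_src_contract]

include hs hr in
theorem IsDualRows.leftAct_sum_cons_cons (Y : List ι → k[G]) (l m : ι) (w : List ι) :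
    leftAct (l :: m :: w) (∑ i, e i) Y = ∑ a, ∑ b, leftAct w ((colAct G (col a l) *ᵥ col b) m)
      (contract row b (contract row a Y)) := by
  rw [hr.leftAct_sum_cons]
  refine Finset.sum_congr rfl fun a _ => ?_
  rw [leftAct_cons]
  have h : ∀ n, (fun v => contract row a Y (n :: v)) =
      ∑ b, fun v => leftAct v (col b n) (contract row b (contract row a Y)) := by
    intro n; ext1 v
    rw [← hr.leftAct_sum_contract hs, hr.leftAct_sum_cons, Finset.sum_apply]
  simp only [h, map_sum, ← leftAct_mul]
  rw [Finset.sum_comm]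
  refine Finset.sum_congr rfl fun b _ => ?_
  rw [← LinearMap.sum_apply, ← map_sum]
  rfl

include hs in
theorem IsArrowSystem.symTwo_mul (a b : A) (l m : ι) :
    symTwo col a b l m * e (Q.src b) = symTwo col a b l m := by
  simp only [symTwo, Matrix.mulVec, dotProduct, add_mul, Finset.sum_mul, mul_assoc, hs.mul_src]

variable [Fintype G] [IsAlgClosed k]

-- The alternation of `Y` in its first two letters gives one equation with coefficients in `kG`. The
-- lemma extracts from it an equation with scalar coefficients for each group element, using that
-- corners of `kG` are one-dimensional.
include hs hr in
theorem IsDualRows.sum_symTwo_smul_contract {Y : List ι → k[G]} (hY : IsAlternatingOn Y)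
    (l m : ι) (g : G) (w : List ι) :
    ∑ a, ∑ b, (symTwo col a b l m).coeff g • contract row b (contract row a Y) w = 0 := by
  classical
  have he := hs.basic
  have h1 : ∀ w, ∑ a, ∑ b, leftAct w (symTwo col a b l m) (contract row b (contract row a Y)) = 0 := by
    intro w
    have h := isAlternatingOn_leftAct (∑ i, e i) hY [] l m w
    rw [eq_neg_iff_add_eq_zero] at h
    simp only [List.nil_append, hr.leftAct_sum_cons_cons hs, ← Finset.sum_add_distrib,
      ← LinearMap.add_apply, ← map_add] at h
    exact h
  -- After multiplication by `e i g⁻¹` the coefficient lies in `e i kG e (Q.src b)`, since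
  -- contracted tensors are fixed by `e (Q.src b)`. It is thus zero or a scalar multiple of `e i`.
  have h2 : ∀ i, ∑ a, ∑ b, (if Q.src b = i then
      he.cornerForm i (MonoidAlgebra.single g⁻¹ 1 * symTwo col a b l m) •
        contract row b (contract row a Y) w else 0) = 0 := by
    intro i
    have h3 : ∑ a, ∑ b, leftAct w (e i * MonoidAlgebra.single g⁻¹ 1 * symTwo col a b l m)
        (contract row b (contract row a Y)) = 0 := by
      simp only [leftAct_mul w _ (symTwo col _ _ l m), ← map_sum]
      have : (∑ a, ∑ b, fun v => leftAct v (symTwo col a b l m)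
          (contract row b (contract row a Y))) = 0 := by
        ext1 v
        simpa only [Finset.sum_apply, Pi.zero_apply] using h1 v
      rw [this, map_zero]
    refine Eq.trans ?_ h3
    refine Finset.sum_congr rfl fun a _ => Finset.sum_congr rfl fun b _ => ?_
    have h5 : e i * MonoidAlgebra.single g⁻¹ 1 * symTwo col a b l m =
        e i * (MonoidAlgebra.single g⁻¹ 1 * symTwo col a b l m) * e (Q.src b) := by
      rw [mul_assoc (e i), mul_assoc (e i), mul_assoc (MonoidAlgebra.single g⁻¹ 1), hs.symTwo_mul]
    rw [h5]
    split_ifs with h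
    · subst h
      rw [he.mul_mul_eq_cornerForm, map_smul, LinearMap.smul_apply, hr.leftAct_src_contract]
    · rw [he.corner_ne (Ne.symm h), map_zero, LinearMap.zero_apply]
  -- The coefficient at `g` is the coefficient at `1` after multiplication by `g⁻¹`, and on `kG e
  -- (Q.src b)` the latter is a multiple of `cornerForm`.
  have h4 : ∀ a b, (symTwo col a b l m).coeff g = (e (Q.src b)).coeff 1 *
      he.cornerForm (Q.src b) (MonoidAlgebra.single g⁻¹ 1 * symTwo col a b l m) := by
    intro a b
    have h5 : (symTwo col a b l m).coeff g =
        (MonoidAlgebra.single g⁻¹ (1 : k) * symTwo col a b l m).coeff 1 := by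
      rw [MonoidAlgebra.coeff_single_mul_apply]; simp
    rw [h5]
    conv_lhs => rw [← hs.symTwo_mul a b l m, ← mul_assoc,
      ← (he.coeff_one_smul_frobElement (Q.src b)).1, mul_smul_comm, mul_frobElement,
      MonoidAlgebra.coeff_smul, Finsupp.smul_apply, frobElement_coeff]
    simp [MonoidAlgebra.one_def.symm]
  have h6 : ∑ i, (e i).coeff 1 • (∑ a, ∑ b, (if Q.src b = i then
      he.cornerForm i (MonoidAlgebra.single g⁻¹ 1 * symTwo col a b l m) •
        contract row b (contract row a Y) w else 0)) = 0 := by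
    simp only [h2, smul_zero, Finset.sum_const_zero]
  refine Eq.trans ?_ h6
  simp only [Finset.smul_sum]
  rw [Finset.sum_comm (s := (Finset.univ : Finset V))]
  refine Finset.sum_congr rfl fun a _ => ?_
  rw [Finset.sum_comm (s := (Finset.univ : Finset V))]
  refine Finset.sum_congr rfl fun b _ => ?_
  rw [Finset.sum_eq_single (Q.src b), if_pos rfl, h4, mul_smul]
  · intro i _ hi; rw [if_neg (Ne.symm hi), smul_zero]
  · simp

-- The linear forms `L` cut out the span of `ρ` in `kQ_2`. The form `pairing r` vanishes on their
-- common kernel, and so is a linear combination of them; for each `L` the claim is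
-- `sum_symTwo_smul_contract`.
include hs hr in
theorem IsDualRows.sum_smul_contract_eq_zero {Y : List ι → k[G]} (hY : IsAlternatingOn Y)
    {r : PathAlgebra k Q} (hrel : r ∈ quadraticOrthogonal ρ) (w : List ι) :
    ∑ a, ∑ b, pairing (arrow k Q a * arrow k Q b) r • contract row b (contract row a Y) w = 0 := by
  classical
  let L : (ι × ι) × G → PathAlgebra k Q →ₗ[k] k := fun x =>
    ∑ a, ∑ b, (symTwo col a b x.1.1 x.1.2).coeff x.2 • pairing (arrow k Q a * arrow k Q b)
  have hL : ∀ x d, L x d = (twoTensor col d x.1.1 x.1.2 + twoTensor col d x.1.2 x.1.1).coeff x.2 := by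
    intro x d
    simp only [L, twoTensor, ← Finset.sum_add_distrib, ← smul_add, LinearMap.sum_apply,
      LinearMap.smul_apply]
    simp only [symTwo, MonoidAlgebra.coeff_sum, MonoidAlgebra.coeff_smul, Finsupp.coe_finsetSum,
      Finset.sum_apply, Finsupp.smul_apply, smul_eq_mul]
    exact Finset.sum_congr rfl fun a _ => Finset.sum_congr rfl fun b _ => mul_comm _ _
  have hker : ⨅ x, LinearMap.ker (L x) ≤ LinearMap.ker (pairing r) := by
    intro d hd
    rw [Submodule.mem_iInf] at hd
    -- The quadratic part of `d`: all the forms see only this part, and the criterion for membership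
    -- in the span of `ρ` applies to it.
    set d₂ := ∑ a, ∑ b, pairing (arrow k Q a * arrow k Q b) d • (arrow k Q a * arrow k Q b) with hd₂
    have hmem : d₂ ∈ degree k Q 2 := sum_mem_degree_two _
    have hp : ∀ a b, pairing (arrow k Q a * arrow k Q b) d₂ =
        pairing (arrow k Q a * arrow k Q b) d := by
      intro a b
      by_cases h : Q.src a = Q.tgt b
      · rw [pairing_comm, hd₂]
        simp only [map_sum, map_smul, LinearMap.sum_apply, LinearMap.smul_apply,
          pairing_arrow_mul_arrow h, ite_and]
        simp
      · rw [arrow_mul_arrow_of_ne h]; simp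
    have ht : twoTensor col d₂ = twoTensor (Q := Q) col d := by
      ext1 l; ext1 m; simp only [twoTensor, hp]
    have hspan : d₂ ∈ Submodule.span k ρ := by
      rw [hs.mem_span_iff _ hmem, ht]
      intro l m
      ext g
      rw [← hL ((l, m), g)]
      exact hd ((l, m), g)
    have h0 : ∀ x ∈ Submodule.span k ρ, pairing r x = 0 := by
      intro x hx
      induction hx using Submodule.span_induction with
      | mem x hx => exact hrel.2 x hx
      | zero => simp
      | add x y _ _ hx hy => rw [map_add, hx, hy, add_zero]
      | smul c x _ hx => rw [map_smul, hx, smul_zero]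
    have h1 := h0 _ hspan
    rw [pairing_eq_sum hrel.1] at h1
    rw [LinearMap.mem_ker, pairing_eq_sum hrel.1]
    simpa only [hp] using h1
  obtain ⟨c, hc⟩ := (Submodule.mem_span_range_iff_exists_fun k).1
    (mem_span_of_iInf_ker_le_ker hker)
  have hS : ∀ a b, Q.src a ≠ Q.tgt b → ∀ l m, symTwo col a b l m = 0 := by
    intro a b h l m
    rw [symTwo, ← hs.twoTensor_arrow_mul_arrow, ← hs.twoTensor_arrow_mul_arrow,
      arrow_mul_arrow_of_ne h]
    simp [twoTensor]
  have hp : ∀ a b, pairing (arrow k Q a * arrow k Q b) r =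
      ∑ x, c x * (symTwo col a b x.1.1 x.1.2).coeff x.2 := by
    intro a b
    by_cases h : Q.src a = Q.tgt b
    · rw [pairing_comm, ← hc, LinearMap.sum_apply]
      refine Finset.sum_congr rfl fun x _ => ?_
      rw [LinearMap.smul_apply, hL, smul_eq_mul, hs.twoTensor_arrow_mul_arrow,
        hs.twoTensor_arrow_mul_arrow, symTwo]
    · rw [arrow_mul_arrow_of_ne h]
      simp [hS a b h]
  simp only [hp, Finset.sum_smul, mul_smul]
  have h5 : ∀ f : A → A → (ι × ι) × G → k[G],
      ∑ a, ∑ b, ∑ x, f a b x = ∑ x, ∑ a, ∑ b, f a b x := by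
    intro f
    simp only [Finset.sum_comm (s := (Finset.univ : Finset A))
      (t := (Finset.univ : Finset ((ι × ι) × G)))]
  rw [h5]
  refine Finset.sum_eq_zero fun x _ => ?_
  simp only [← Finset.smul_sum]
  rw [hr.sum_symTwo_smul_contract hs hY, smul_zero]

end Contraction

end

/-! ### From tensors back to linear forms on `kQ` -/

noncomputable section

open PathAlgebra ArrowQuiver

section FormOf

variable {k : Type u} [Field k] {ι : Type} [Fintype ι] [DecidableEq ι]
  {G : Subgroup (GL ι k)} {V : Type v} {A : Type w} [Fintype V] [Fintype A] [DecidableEq A]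

/-- Successive contraction along the arrows of a path. -/
def contractList (row : A → ι → k[G]) : List A → ((List ι → k[G]) →ₗ[k] (List ι → k[G]))
  | [] => LinearMap.id
  | a :: l => contractList row l ∘ₗ contract row a

variable [Fintype G] [IsAlgClosed k] {Q : ArrowQuiver V A} {ρ θ : Set (PathAlgebra k Q)}
  {e : V → k[G]} {col row : A → ι → k[G]}

/-- The linear form on `kQ` that sends a path to the corner component of the contraction of a
tensor along this path. -/
def IsBasicSystem.formOf (he : IsBasicSystem e) (row : A → ι → k[G]) (Y : List ι → k[G]) :
    Module.Dual k (PathAlgebra k Q) :=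
  PathAlgebra.lift fun p => he.cornerForm p.source (contractList row p.arrows Y [])

variable (he : IsBasicSystem e)

theorem IsBasicSystem.formOf_single (Y : List ι → k[G]) (p : Q.QPath) :
    he.formOf row Y (single p 1) = he.cornerForm p.source (contractList row p.arrows Y []) := by
  rw [IsBasicSystem.formOf, PathAlgebra.lift_single, one_smul]

theorem IsBasicSystem.cornerForm_mul [DecidableEq V] (i j : V) (z : k[G]) :
    he.cornerForm j (e i * z) = if i = j then he.cornerForm j z else 0 := by
  refine he.cornerScalar_unique ?_
  rw [← mul_assoc]
  split_ifs with h
  · rw [h, he.mul_self, he.mul_mul_eq_cornerForm]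
  · rw [he.mul_ne (Ne.symm h), zero_mul, zero_mul, zero_smul]

variable (hs : IsArrowSystem Q ρ e col) (hr : IsDualRows Q e col row)
include hs hr

theorem IsDualRows.formOf_leftAct (Y : List ι → k[G]) (i : V) (x : PathAlgebra k Q) :
    he.formOf row (fun w => leftAct w (e i) Y) x = he.formOf row Y (vertex k Q i * x) := by
  classical
  induction x using induction_linear with
  | zero => simp
  | add x y hx hy => rw [map_add, mul_add, map_add, hx, hy]
  | single p c =>
    have e1 : (single p c : PathAlgebra k Q) = c • single p 1 := by
      rw [PathAlgebra.smul_single, mul_one]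
    rw [e1, mul_smul_comm, map_smul, map_smul, vertex_mul_single]
    congr 1
    rw [apply_ite (he.formOf row Y), map_zero, he.formOf_single, he.formOf_single]
    cases p using QPath.induction_cons with
    | nil j =>
      change he.cornerForm j (leftAct [] (e i) Y) = if i = j then he.cornerForm j (Y []) else 0
      rw [leftAct_nil, he.cornerForm_mul]
    | cons a p h =>
      change he.cornerForm p.source (contractList row p.arrows
        (contract row a fun w => leftAct w (e i) Y) []) = if i = Q.tgt a then
          he.cornerForm p.source (contractList row p.arrows (contract row a Y) []) else 0
      rw [hr.contract_leftAct_idempotent hs]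
      split_ifs
      · rfl
      · rw [map_zero, Pi.zero_apply, map_zero]

/-- By construction for paths that compose with `a`; for all others both sides vanish, as the
contracted tensor is fixed by `e (Q.src a)`. -/
theorem IsDualRows.formOf_arrow_mul (Y : List ι → k[G]) (a : A) (x : PathAlgebra k Q) :
    he.formOf row Y (arrow k Q a * x) = he.formOf row (contract row a Y) x := by
  classical
  induction x using induction_linear with
  | zero => simp
  | add x y hx hy => rw [map_add, mul_add, map_add, hx, hy]
  | single p c =>
    have e1 : (single p c : PathAlgebra k Q) = c • single p 1 := by
      rw [PathAlgebra.smul_single, mul_one]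
    rw [e1, mul_smul_comm, map_smul, map_smul]
    congr 1
    by_cases h : Q.src a = p.target
    · rw [← single_comp a p h, he.formOf_single, he.formOf_single]
      rfl
    · rw [← funext (hr.leftAct_src_contract a Y), hr.formOf_leftAct he hs, vertex_mul_single,
        if_neg h, map_zero]
      have : arrow k Q a * single p 1 = 0 := single_mul_single_of_ne _ _ h _ _
      rw [this, map_zero]

/-- Contraction preserves alternation, so the left factor can be stripped off arrow by arrow until
the relation comes first. There `sum_smul_contract_eq_zero` applies before the remaining path is
contracted. -/
theorem IsDualRows.formOf_ideal (hθ : Submodule.span k θ = quadraticOrthogonal ρ)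
    {Y : List ι → k[G]} (hY : IsAlternatingOn Y) (x : PathAlgebra k Q) {r : PathAlgebra k Q}
    (hrel : r ∈ θ) (y : PathAlgebra k Q) : he.formOf row Y (x * r * y) = 0 := by
  rw [mul_assoc]
  induction x using induction_arrow generalizing Y with
  | zero => simp
  | add x x' hx hx' => rw [add_mul, map_add, hx hY, hx' hY, add_zero]
  | smul c x hx => rw [smul_mul_assoc, map_smul, hx hY, smul_zero]
  | arrow_mul a x hx =>
    rw [mul_assoc, hr.formOf_arrow_mul he hs]
    exact hx (isAlternatingOn_contract row a hY)
  | vertex i =>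
    rw [← hr.formOf_leftAct he hs]
    replace hY := isAlternatingOn_leftAct (e i) hY
    generalize (fun w => leftAct w (e i) Y) = Y at *
    have hmem : r ∈ quadraticOrthogonal ρ := hθ ▸ Submodule.subset_span hrel
    have h0 := hr.sum_smul_contract_eq_zero hs hY hmem
    rw [eq_sum_of_mem_degree_two hmem.1]
    simp only [Finset.sum_mul, smul_mul_assoc, map_sum, map_smul, mul_assoc,
      hr.formOf_arrow_mul he hs]
    induction y using induction_linear with
    | zero => simp
    | add y z hy hz => simp only [map_add, smul_add, Finset.sum_add_distrib, hy, hz, add_zero]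
    | single p c =>
      have e1 : (single p c : PathAlgebra k Q) = c • single p 1 := by
        rw [PathAlgebra.smul_single, mul_one]
      simp only [e1, map_smul, he.formOf_single]
      simp only [smul_comm _ c, ← Finset.smul_sum]
      have h1 : ∑ a, ∑ b, pairing (arrow k Q a * arrow k Q b) r •
          contract row b (contract row a Y) = 0 := by
        ext1 w
        simpa only [Finset.sum_apply, Pi.smul_apply, Pi.zero_apply] using h0 w
      have h2 := congrArg (fun Z => he.cornerForm p.source (contractList row p.arrows Z [])) h1
      simp only [map_sum, map_smul, Finset.sum_apply, Pi.smul_apply, map_zero,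
        Pi.zero_apply] at h2
      rw [h2, smul_zero]

/-- No information is lost in passing to the form: a tensor is recovered from its contractions, and
an element of `e kG e` from its diagonal corners. -/
theorem IsDualRows.eq_zero_of_formOf {n : ℕ} {Y : List ι → k[G]}
    (hl : ∀ w, leftAct w (∑ i, e i) Y = Y w) (hm : ∀ w, Y w * ∑ i, e i = Y w)
    (h0 : ∀ p : Q.QPath, p.length = n → he.formOf row Y (single p 1) = 0) {w : List ι}
    (hw : w.length = n) : Y w = 0 := by
  classical
  induction n generalizing Y w with
  | zero =>
    obtain rfl := List.length_eq_zero_iff.1 hw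
    have h1 : ∀ i, e i * Y [] * e i = 0 := by
      intro i
      have h2 := h0 (QPath.nil Q i) rfl
      rw [he.formOf_single] at h2
      change he.cornerForm i (Y []) = 0 at h2
      rw [he.mul_mul_eq_cornerForm, h2, zero_smul]
    rw [← hm, ← hl, leftAct_nil, Finset.sum_mul, Finset.sum_mul]
    refine Finset.sum_eq_zero fun i _ => ?_
    rw [Finset.mul_sum]
    refine Finset.sum_eq_zero fun j _ => ?_
    by_cases h : i = j
    · rw [h, h1]
    · exact he.corner_ne h _
  | succ n ih =>
    cases w with
    | nil => simp at hw
    | cons l w =>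
      rw [← hl, hr.leftAct_sum_cons]
      refine Finset.sum_eq_zero fun a _ => ?_
      rw [leftAct_congr (Y' := 0), map_zero]
      intro v hv
      refine ih (hr.leftAct_sum_contract hs a Y) (fun w => ?_) (fun p hp => ?_)
        (hv.trans (by simpa using hw))
      · rw [← contract_mul_right, funext hm]
      · by_cases h : Q.src a = p.target
        · rw [← hr.formOf_arrow_mul he hs, ← single_comp a p h]
          refine h0 _ ?_
          exact (QPath.length_comp _ _ _).trans (by rw [hp, QPath.length_ofArrow, add_comm])
        · rw [← hr.formOf_arrow_mul he hs]
          have : arrow k Q a * PathAlgebra.single p 1 = 0 := single_mul_single_of_ne _ _ h _ _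
          rw [this, map_zero]

/-- The linear form is recovered from its tensor. -/
theorem IsDualRows.formOf_tensorOf (F : Module.Dual k (PathAlgebra k Q)) (p : Q.QPath) :
    he.formOf row (tensorOf e col p.length F) (single p 1) = F (single p 1) := by
  classical
  induction p using QPath.induction_cons generalizing F with
  | nil i =>
    rw [he.formOf_single]
    change he.cornerForm i (tensorOf e col 0 F []) = F (vertex k Q i)
    refine he.cornerScalar_unique ?_
    rw [tensorOf_zero_nil, Finset.mul_sum, Finset.sum_mul, Finset.sum_eq_single i]
    · rw [mul_smul_comm, he.mul_self, smul_mul_assoc, he.mul_self]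
    · intro j _ hj
      rw [mul_smul_comm, he.mul_ne (Ne.symm hj), smul_zero, zero_mul]
    · simp
  | cons a p h ih =>
    have hl : ((QPath.ofArrow Q a).comp p h).length = p.length + 1 :=
      (QPath.length_comp _ _ _).trans (by rw [QPath.length_ofArrow, add_comm])
    rw [single_comp, hr.formOf_arrow_mul he hs, hl, hr.contract_tensorOf hs, ih,
      formMulLeft_apply]

end FormOf

/-! ### Twisting the group algebra by a character -/

section Twist

variable {k : Type*} [Field k] {Γ : Type*} [Group Γ]

/-- The automorphism `g ↦ χ(g) g` of the group algebra. -/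
def charTwist (χ : Γ →* kˣ) : k[Γ] →ₐ[k] k[Γ] :=
  MonoidAlgebra.lift k k[Γ] Γ
    { toFun := fun g => MonoidAlgebra.single g (χ g : k)
      map_one' := by simp [MonoidAlgebra.one_def]
      map_mul' := fun g h => by simp [MonoidAlgebra.single_mul_single] }

theorem charTwist_single (χ : Γ →* kˣ) (g : Γ) (c : k) :
    charTwist χ (MonoidAlgebra.single g c) = MonoidAlgebra.single g (c * χ g) := by
  simp [charTwist, MonoidAlgebra.lift_single]

theorem charTwist_charTwist (χ ψ : Γ →* kˣ) (z : k[Γ]) :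
    charTwist χ (charTwist ψ z) = charTwist (ψ * χ) z := by
  induction z using MonoidAlgebra.induction_linear with
  | zero => simp
  | add x y hx hy => simp [hx, hy]
  | single g c => simp [charTwist_single, mul_assoc]

theorem charTwist_one (z : k[Γ]) : charTwist 1 z = z := by
  induction z using MonoidAlgebra.induction_linear with
  | zero => simp
  | add x y hx hy => simp [hx, hy]
  | single g c => simp [charTwist_single]

theorem charTwist_inv_charTwist (χ : Γ →* kˣ) (z : k[Γ]) :
    charTwist χ⁻¹ (charTwist χ z) = z := by
  rw [charTwist_charTwist, show χ * χ⁻¹ = 1 from mul_inv_cancel χ, charTwist_one]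

theorem charTwist_charTwist_inv (χ : Γ →* kˣ) (z : k[Γ]) :
    charTwist χ (charTwist χ⁻¹ z) = z := by
  rw [charTwist_charTwist, show χ⁻¹ * χ = 1 from inv_mul_cancel χ, charTwist_one]

end Twist

/-! ### The volume form under the group algebra -/

section Volume

variable {k : Type u} [Field k]

/-- The character `det` of a group of matrices. -/
def detChar {ι : Type} [Fintype ι] [DecidableEq ι] (G : Subgroup (GL ι k)) : G →* kˣ :=
  Matrix.GeneralLinearGroup.det.comp G.subtype

/-- As `G` acts on the volume form by the determinant, moving `z` past it twists `z` by `det`. -/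
theorem leftAct_volumeForm {s : ℕ} {G : Subgroup (GL (Fin s) k)} (w : List (Fin s)) (z x : k[G]) :
    leftAct w z (fun v => volumeForm k s v • x) =
      volumeForm k s w • (charTwist (detChar G) z * x) := by
  by_cases hw : w.length = s
  · induction z using MonoidAlgebra.induction_linear with
    | zero => simp
    | add y z hy hz => rw [map_add, LinearMap.add_apply, hy, hz, map_add, add_mul, smul_add]
    | single g c =>
      rw [leftAct_single, wordAct_volumeForm _ hw, charTwist_single]
      have : MonoidAlgebra.single g (c * (detChar G g : k)) =
          (g.1.1).det • MonoidAlgebra.single g c := by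
        rw [MonoidAlgebra.smul_single, smul_eq_mul, mul_comm]; rfl
      rw [this, smul_mul_assoc, smul_smul, mul_comm]
  · rw [volumeForm_of_length_ne k s hw, zero_smul, leftAct_congr (Y' := 0), map_zero]
    intro v hv
    rw [volumeForm_of_length_ne k s (hv ▸ hw), zero_smul]; rfl

/-- The linear map `g ↦ (g⁻¹)_{lm} g` on the group algebra. -/
def dualAct {ι : Type} [Fintype ι] [DecidableEq ι] (G : Subgroup (GL ι k)) [Fintype G] (l m : ι) :
    k[G] →ₗ[k] k[G] where
  toFun z := MonoidAlgebra.ofCoeff (Finsupp.equivFunOnFinite.symm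
    fun g => z.coeff g * (g⁻¹).1.1 l m)
  map_add' x y := by ext; simp [add_mul]
  map_smul' c x := by ext; simp [mul_assoc]

section DualAct

variable {ι : Type} [Fintype ι] [DecidableEq ι] {G : Subgroup (GL ι k)} [Fintype G]

theorem dualAct_coeff (l m : ι) (z : k[G]) (g : G) :
    (dualAct G l m z).coeff g = z.coeff g * (g⁻¹).1.1 l m := rfl

theorem dualAct_single (l m : ι) (g : G) (c : k) :
    dualAct G l m (MonoidAlgebra.single g c) = MonoidAlgebra.single g (c * (g⁻¹).1.1 l m) := by
  classical
  ext h
  rw [dualAct_coeff, MonoidAlgebra.coeff_single, MonoidAlgebra.coeff_single,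
    Finsupp.single_apply, Finsupp.single_apply]
  split_ifs with hg
  · rw [hg]
  · rw [zero_mul]

theorem single_finsetSum {α : Type*} (s : Finset α) (g : G) (f : α → k) :
    MonoidAlgebra.single g (∑ i ∈ s, f i) = ∑ i ∈ s, MonoidAlgebra.single g (f i) :=
  map_sum (MonoidAlgebra.lsingle (R := k) (S := k) g) f s

theorem inv_mul_apply_sum (g : G) (l m : ι) :
    ∑ j, (g⁻¹).1.1 l j * g.1.1 j m = if l = m then 1 else 0 := by
  rw [← Matrix.mul_apply, ← Matrix.one_apply]
  have h : ((g⁻¹ : G) : GL ι k).1 * (g : GL ι k).1 = 1 := by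
    rw [← Units.val_mul, ← Subgroup.coe_mul, inv_mul_cancel]; rfl
  exact congrFun (congrFun h l) m

theorem inv_mul_apply (g h : G) (l m : ι) :
    ((g * h)⁻¹).1.1 l m = ∑ j, (h⁻¹).1.1 l j * (g⁻¹).1.1 j m := by
  rw [_root_.mul_inv_rev, ← Matrix.mul_apply]; rfl

/-- `dualAct` contains the inverse matrix, which cancels the matrix from `colAct`. With
`sum_dualAct_mul_colAct` this shows that the contraction in `sum_dualAct_col_row` respects
multiplication from both sides. -/
theorem sum_dualAct_colAct_mul (z x : k[G]) (m j : ι) :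
    ∑ l, dualAct G m l (colAct G z l j * x) = z * dualAct G m j x := by
  induction z using MonoidAlgebra.induction_linear with
  | zero => simp
  | add y z hy hz => simp only [map_add, Matrix.add_apply, add_mul, Finset.sum_add_distrib, hy, hz]
  | single g c =>
  induction x using MonoidAlgebra.induction_linear with
  | zero => simp
  | add y z hy hz => simp only [map_add, mul_add, Finset.sum_add_distrib, hy, hz]
  | single h d =>
    simp only [colAct_single, MonoidAlgebra.single_mul_single, dualAct_single, inv_mul_apply]
    rw [← single_finsetSum]
    congr 1
    have h1 : ∀ l, c * g.1.1 l j * d * ∑ n, (h⁻¹).1.1 m n * (g⁻¹).1.1 n l =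
        ∑ n, c * d * ((h⁻¹).1.1 m n * ((g⁻¹).1.1 n l * g.1.1 l j)) := by
      intro l; rw [Finset.mul_sum]; exact Finset.sum_congr rfl fun n _ => by ring
    simp only [h1]
    rw [Finset.sum_comm]
    simp only [← Finset.mul_sum, inv_mul_apply_sum]
    simp [mul_assoc]

theorem sum_dualAct_mul_colAct (x z : k[G]) (l j : ι) :
    ∑ m, dualAct G m l (x * colAct G z j m) = dualAct G j l x * z := by
  induction z using MonoidAlgebra.induction_linear with
  | zero => simp
  | add y z hy hz => simp only [map_add, Matrix.add_apply, mul_add, Finset.sum_add_distrib, hy, hz]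
  | single g c =>
  induction x using MonoidAlgebra.induction_linear with
  | zero => simp
  | add y z hy hz => simp only [map_add, add_mul, Finset.sum_add_distrib, hy, hz]
  | single h d =>
    simp only [colAct_single, MonoidAlgebra.single_mul_single, dualAct_single, inv_mul_apply]
    rw [← single_finsetSum]
    congr 1
    have h0 : ∀ n, ∑ m, g.1.1 j m * (g⁻¹).1.1 m n = if j = n then 1 else 0 := by
      intro n
      have := inv_mul_apply_sum g⁻¹ j n
      rwa [inv_inv] at this
    have h1 : ∀ m, d * (c * g.1.1 j m) * ∑ n, (g⁻¹).1.1 m n * (h⁻¹).1.1 n l =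
        ∑ n, d * c * ((h⁻¹).1.1 n l * (g.1.1 j m * (g⁻¹).1.1 m n)) := by
      intro m; rw [Finset.mul_sum]; exact Finset.sum_congr rfl fun n _ => by ring
    simp only [h1]
    rw [Finset.sum_comm]
    simp only [← Finset.mul_sum, h0]
    simp; ring

theorem dualAct_coeff_one (l m : ι) (z : k[G]) :
    (dualAct G l m z).coeff 1 = if l = m then z.coeff 1 else 0 := by
  rw [dualAct_coeff, inv_one, OneMemClass.coe_one, Units.val_one, Matrix.one_apply]
  simp

end DualAct

/-- A form of Cramer's rule: acting by `g` on all letters but the first one is acting on all of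
them, which gives `det g`, followed by `g⁻¹` on the first. -/
theorem leftAct_volumeForm_cons {n : ℕ} {G : Subgroup (GL (Fin (n + 1)) k)} [Fintype G]
    {w : List (Fin (n + 1))} (hw : w.length = n) (m : Fin (n + 1)) (z x : k[G]) :
    leftAct w z (fun v => volumeForm k (n + 1) (m :: v) • x) =
      ∑ l, volumeForm k (n + 1) (l :: w) • (charTwist (detChar G) (dualAct G m l z) * x) := by
  induction z using MonoidAlgebra.induction_linear with
  | zero => simp
  | add y z hy hz =>
    simp only [map_add, LinearMap.add_apply, hy, hz, add_mul, smul_add, Finset.sum_add_distrib]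
  | single g c =>
    rw [leftAct_single]
    have h1 : ∀ j, ∑ l, g.1.1 j l * wordAct g.1.1 w (fun v => volumeForm k (n + 1) (l :: v)) =
        g.1.1.det * volumeForm k (n + 1) (j :: w) := fun j =>
      wordAct_volumeForm g.1.1 (w := j :: w) (by simp [hw])
    have h2 : wordAct g.1.1 w (fun v => volumeForm k (n + 1) (m :: v)) =
        ∑ j, (g⁻¹).1.1 m j * (g.1.1.det * volumeForm k (n + 1) (j :: w)) := by
      simp only [← h1, Finset.mul_sum, ← mul_assoc]
      rw [Finset.sum_comm]
      simp only [← Finset.sum_mul, inv_mul_apply_sum]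
      simp
    rw [h2, Finset.sum_smul]
    refine Finset.sum_congr rfl fun l _ => ?_
    rw [dualAct_single, charTwist_single]
    have : MonoidAlgebra.single g (c * (g⁻¹).1.1 m l * (detChar G g : k)) =
        ((g⁻¹).1.1 m l * (g.1.1).det) • MonoidAlgebra.single g c := by
      rw [MonoidAlgebra.smul_single, smul_eq_mul]
      congr 1
      change c * _ * (g.1.1).det = _
      ring
    rw [this, smul_mul_assoc, smul_smul]
    congr 1
    ring

theorem volumeForm_ne_zero {s : ℕ} {w : List (Fin s)} (hw : w.Nodup) (h : w.length = s) :
    volumeForm k s w ≠ 0 := by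
  obtain ⟨ε, hε⟩ := exists_sign_of_perm.{u} (perm_finRange hw h)
  rw [hε k _ (isAlternatingOn_volumeForm k s), volumeForm_finRange]
  rcases Int.units_eq_one_or ε with rfl | rfl <;> simp [Units.smul_def]

/-- The word consists of all letters except `l`; it serves to isolate one summand in sums over the
missing letter. -/
theorem exists_word_volumeForm [CharZero k] {n : ℕ} (l : Fin (n + 1)) :
    ∃ w : List (Fin (n + 1)), w.length = n ∧ volumeForm k (n + 1) (w ++ [l]) ≠ 0 ∧
      ∀ m, m ≠ l → volumeForm k (n + 1) (w ++ [m]) = 0 := by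
  have hl : ((List.finRange (n + 1)).erase l).length = n := by
    rw [List.length_erase_of_mem (by simp)]; simp
  refine ⟨(List.finRange (n + 1)).erase l, hl, volumeForm_ne_zero ?_ (by simp [hl]),
    fun m hm => (isAlternatingOn_volumeForm k (n + 1)).eq_zero_of_not_nodup ?_⟩
  · rw [List.nodup_append_comm, List.singleton_append, List.nodup_cons]
    exact ⟨fun h => (List.nodup_finRange _).not_mem_erase h, (List.nodup_finRange _).erase l⟩
  · rw [List.nodup_append_comm, List.singleton_append, List.nodup_cons]
    exact fun h => h.1 ((List.mem_erase_of_ne hm).2 (by simp))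

end Volume

end

/-! ### The Nakayama automorphism and the element that implements it -/

noncomputable section

open PathAlgebra ArrowQuiver

namespace NakayamaAutomorphism

variable {k : Type u} [Field k] {V : Type v} {A : Type w} [Fintype V] [Fintype A]
  {Q : ArrowQuiver V A} {θ : Set (PathAlgebra k Q)} (ν : NakayamaAutomorphism k Q θ)

theorem map_ofArrows (c : A →₀ k) :
    ν.toAlgEquiv (.mk θ (ofArrows k Q c)) = .mk θ (ofArrows k Q (ν.onArrows c)) := by
  induction c using Finsupp.induction_linear with
  | zero => simp
  | add x y hx hy => simp only [map_add, hx, hy]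
  | single a c =>
    have h1 : Finsupp.single a c = c • Finsupp.single a (1 : k) := by simp
    have h2 : ofArrows k Q (Finsupp.single a (1 : k)) = arrow k Q a := by simp [ofArrows]
    rw [h1, map_smul, map_smul, map_smul, map_smul, map_smul, map_smul, h2, ν.map_arrow]

theorem vertex_mul_ofArrows_mul_vertex [DecidableEq V] (i j : V) (c : A →₀ k) :
    vertex k Q i * ofArrows k Q c * vertex k Q j =
      ofArrows k Q (c.filter fun a => Q.tgt a = i ∧ Q.src a = j) := by
  rw [ofArrows_apply, ofArrows_apply, Finset.mul_sum, Finset.sum_mul]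
  refine Finset.sum_congr rfl fun a _ => ?_
  rw [mul_smul_comm, smul_mul_assoc, vertex_mul_arrow, Finsupp.filter_apply]
  by_cases h1 : i = Q.tgt a
  · rw [if_pos h1, arrow_mul_vertex]
    by_cases h2 : Q.src a = j
    · rw [if_pos h2, if_pos ⟨h1.symm, h2⟩]
    · rw [if_neg h2, if_neg fun h => h2 h.2, smul_zero, zero_smul]
  · rw [if_neg h1, if_neg fun h => h1 h.1.symm, zero_mul, smul_zero, zero_smul]

variable (hθ : θ ⊆ degree k Q 2)
include hθ

theorem mk_ofArrows_injective {c d : A →₀ k}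
    (h : BoundQuiverAlgebra.mk θ (ofArrows k Q c) = .mk θ (ofArrows k Q d)) : c = d := by
  have h1 : BoundQuiverAlgebra.mk θ (ofArrows k Q (c - d)) = 0 := by
    rw [map_sub, map_sub, h, sub_self]
  have h2 := mem_atLeast_of_mk_eq_zero (n := 2) (fun r hr => degree_le_atLeast 2 (hθ hr)) h1
  rw [← sub_eq_zero]
  ext a
  by_contra h0
  have h3 := (mem_atLeast_iff 2 _).1 h2 (QPath.ofArrow Q a) (by
    rw [coeff_ofArrows]; exact h0)
  simp at h3

theorem onArrows_filter [DecidableEq V] (i j : V) (c : A →₀ k) :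
    ν.onArrows (c.filter fun a => Q.tgt a = i ∧ Q.src a = j) =
      (ν.onArrows c).filter fun a => Q.tgt a = ν.onVertices i ∧ Q.src a = ν.onVertices j := by
  refine mk_ofArrows_injective hθ ?_
  rw [← ν.map_ofArrows, ← vertex_mul_ofArrows_mul_vertex, ← vertex_mul_ofArrows_mul_vertex]
  simp only [map_mul, ν.map_vertex, ν.map_ofArrows]

/-- The automorphism permutes the trivial paths, and `kQ_1` embeds in `kQ/(θ)`, so the corner of
`kQ_1` that contains `β` is mapped to the corner at the translated vertices. -/
theorem onArrows_endpoints {β γ : A} (h : ν.onArrows (Finsupp.single β 1) γ ≠ 0) :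
    Q.tgt γ = ν.onVertices (Q.tgt β) ∧ Q.src γ = ν.onVertices (Q.src β) := by
  classical
  have h1 := ν.onArrows_filter hθ (Q.tgt β) (Q.src β) (Finsupp.single β 1)
  rw [Finsupp.filter_single_of_pos _ ⟨rfl, rfl⟩] at h1
  rw [h1, Finsupp.filter_apply] at h
  by_contra h2
  exact h (if_neg h2)

theorem onArrows_symm_endpoints {β γ : A} (h : ν.onArrows.symm (Finsupp.single γ 1) β ≠ 0) :
    Q.tgt γ = ν.onVertices (Q.tgt β) ∧ Q.src γ = ν.onVertices (Q.src β) := by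
  classical
  have h1 := ν.onArrows_filter hθ (ν.onVertices.symm (Q.tgt γ)) (ν.onVertices.symm (Q.src γ))
    (ν.onArrows.symm (Finsupp.single γ 1))
  rw [LinearEquiv.apply_symm_apply, Equiv.apply_symm_apply, Equiv.apply_symm_apply,
    Finsupp.filter_single_of_pos _ ⟨rfl, rfl⟩] at h1
  have h2 := congrArg ν.onArrows.symm h1
  rw [LinearEquiv.symm_apply_apply] at h2
  rw [← h2, Finsupp.filter_apply] at h
  by_contra h3
  refine h (if_neg fun h4 => h3 ?_)
  rw [h4.1, h4.2]
  simp

end NakayamaAutomorphism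

section NakayamaElement

variable {k : Type u} [Field k] [IsAlgClosed k] [CharZero k] {n : ℕ}
  {G : Subgroup (GL (Fin (n + 1)) k)} [Fintype G] {V : Type v} {A : Type w} [Fintype V] [Fintype A]
  {Q : ArrowQuiver V A} {ρ θ : Set (PathAlgebra k Q)} {e : V → k[G]}
  {col : A → Fin (n + 1) → k[G]}

/-- Alternation is defined by a change of sign, so vanishing at words with a repeated letter needs
division by two. -/
instance isAddTorsionFree_groupAlgebra {Γ : Type*} : IsAddTorsionFree k[Γ] where
  nsmul_right_injective m hm x y h := by
    have h' : (m : k) • x = (m : k) • y := by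
      simpa only [Nat.cast_smul_eq_nsmul] using h
    exact smul_right_injective _ (Nat.cast_ne_zero.2 hm) h'

/-- Columns and rows are paired here in the opposite order to `row_col`. The result lies in `e
(Q.tgt β) kG e (Q.tgt α)`, so it is zero or a multiple of an idempotent. The multiple is read off
from the coefficient at `1`, which does not depend on the order of factors; this yields the quotient
of the coefficients at source and target. -/
theorem sum_dualAct_col_row [DecidableEq A] {row : A → Fin (n + 1) → k[G]}
    (hs : IsArrowSystem Q ρ e col) (hr : IsDualRows Q e col row) (β α : A) :
    ∑ l, ∑ m, dualAct G m l (col β l * row α m) = if β = α then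
      ((e (Q.src β)).coeff 1 / (e (Q.tgt β)).coeff 1) • e (Q.tgt β) else 0 := by
  classical
  have he := hs.basic
  set c := ∑ l, ∑ m, dualAct G m l (col β l * row α m) with hc
  have h1 : e (Q.tgt β) * c = c := by
    rw [hc, Finset.mul_sum]
    conv_rhs => rw [← hs.tgt_mul β]
    simp only [Matrix.mulVec, dotProduct, Finset.sum_mul, map_sum]
    have h2 : ∀ j m, ∑ l, dualAct G m l (colAct G (e (Q.tgt β)) l j * col β j * row α m) =
        e (Q.tgt β) * dualAct G m j (col β j * row α m) := by
      intro j m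
      rw [← sum_dualAct_colAct_mul]
      simp only [mul_assoc]
    conv_rhs => rw [Finset.sum_comm]; enter [2, m]; rw [Finset.sum_comm]
    simp only [h2]
    rw [Finset.sum_comm]
    exact Finset.sum_congr rfl fun l _ => by rw [Finset.mul_sum]
  have h2 : c * e (Q.tgt α) = c := by
    rw [hc, Finset.sum_mul]
    refine Finset.sum_congr rfl fun l _ => ?_
    conv_rhs => rw [← hr.mul_tgt α]
    simp only [Matrix.vecMul, dotProduct, Finset.mul_sum, map_sum, ← mul_assoc]
    rw [Finset.sum_comm, Finset.sum_mul]
    exact Finset.sum_congr rfl fun j _ => (sum_dualAct_mul_colAct _ _ _ _).symm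
  have hcoeff : c.coeff 1 = if β = α then (e (Q.src β)).coeff 1 else 0 := by
    have h3 := congrArg (fun z : k[G] => z.coeff 1) (hr.row_col α β)
    have hcomm : ∀ x y : k[G], (x * y).coeff 1 = (y * x).coeff 1 := by
      intro x y
      induction x using MonoidAlgebra.induction_linear with
      | zero => simp
      | add x x' hx hx' => simp [add_mul, mul_add, hx, hx']
      | single g a =>
        rw [MonoidAlgebra.coeff_single_mul_apply, MonoidAlgebra.coeff_mul_single_apply, mul_one,
          one_mul, mul_comm]
    have hsum : ∀ f : Fin (n + 1) → k[G], (∑ l, f l).coeff 1 = ∑ l, (f l).coeff 1 := by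
      intro f; simp [MonoidAlgebra.coeff_sum]
    rw [hc]
    simp only [hsum, dualAct_coeff_one] at h3 ⊢
    simp only [Finset.sum_ite_eq', Finset.mem_univ, if_true]
    simp only [hcomm (col β _), h3]
    by_cases h : α = β
    · rw [if_pos h, if_pos h.symm, h]
    · rw [if_neg h, if_neg (Ne.symm h)]; rfl
  by_cases ht : Q.tgt β = Q.tgt α
  · obtain ⟨r, hr'⟩ := he.corner_self k (Q.tgt β) c
    rw [h1, ht, h2, ← ht] at hr'
    have h0 := (he.coeff_one_smul_frobElement (Q.tgt β)).2
    rw [hr', MonoidAlgebra.coeff_smul, Finsupp.smul_apply, smul_eq_mul] at hcoeff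
    rw [hr', eq_div_of_mul_eq h0 hcoeff]
    split_ifs
    · rfl
    · rw [zero_div, zero_smul]
  · have : c = 0 := by
      rw [← h2, ← h1]; exact he.corner_ne ht c
    rw [this, if_neg]
    rintro rfl; exact ht rfl

/-- A linear form that vanishes on the ideal `(θ)` vanishes on the kernel of `kQ → kQ/(θ)`. -/
theorem PathAlgebra.form_eq_zero_of_mk_eq_zero {F : Module.Dual k (PathAlgebra k Q)}
    (hF : ∀ x, ∀ r ∈ θ, ∀ y, F (x * r * y) = 0) {x : PathAlgebra k Q}
    (hx : BoundQuiverAlgebra.mk θ x = 0) : F x = 0 := by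
  have h := mem_of_mk_eq_zero hx
    (⨅ x, ⨅ y, LinearMap.ker (F ∘ₗ LinearMap.mulLeft k x ∘ₗ LinearMap.mulRight k y))
  simp only [Set.subset_def, SetLike.mem_coe, Submodule.mem_iInf, LinearMap.mem_ker,
    LinearMap.comp_apply, LinearMap.mulLeft_apply, LinearMap.mulRight_apply] at h
  have h1 := h (fun r hr x y => by rw [← mul_assoc]; exact hF x r hr y)
    (fun y x hx x' y' => by rw [mul_assoc, ← mul_assoc x']; exact hx _ _)
    (fun y x hx x' y' => by rw [mul_assoc]; exact hx _ _) 1 1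
  simpa using h1

theorem isAlternatingOn_volumeForm_smul (s : ℕ) (x : k[G]) :
    IsAlternatingOn fun w => volumeForm k s w • x := by
  intro p a b q
  simp only [isAlternatingOn_volumeForm k s p a b q, neg_smul]

section Form

variable (hs : IsArrowSystem Q ρ e col) (hρ : ∀ r ∈ ρ, IsQuadraticRelation r)
  (hθ : Submodule.span k θ = quadraticOrthogonal ρ) {F : Module.Dual k (PathAlgebra k Q)}
  (hF : ∀ x, ∀ r ∈ θ, ∀ y, F (x * r * y) = 0)
include hs hρ hθ hF

/-- In degree `n + 1`, the dimension of `V`, an alternating tensor is the volume form times its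
value at the standard word. -/
theorem IsArrowSystem.tensorOf_eq_volumeForm :
    tensorOf e col (n + 1) F = fun w => volumeForm k (n + 1) w •
      tensorOf e col (n + 1) F (List.finRange (n + 1)) := by
  ext1 w
  by_cases hw : w.length = n + 1
  · refine (hs.isAlternatingOn_tensorOf hθ hρ (n + 1) hF).eq_of_finRange
      (isAlternatingOn_volumeForm_smul _ _) ?_ hw
    rw [volumeForm_finRange, one_smul]
  · rw [volumeForm_of_length_ne k _ hw, zero_smul]
    exact tensorOf_of_length_ne _ hw

/-- The tensor of `F` is alternating in more letters than there are basis vectors, hence is zero,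
and `F` is recovered from it. -/
theorem IsArrowSystem.form_eq_zero_of_length (p : Q.QPath) (hp : n + 1 < p.length) :
    F (single p 1) = 0 := by
  classical
  obtain ⟨row, hr⟩ := hs.exists_dualRows
  rw [← hr.formOf_tensorOf hs.basic hs]
  have h0 : tensorOf e col p.length F = 0 := by
    ext1 w
    by_cases hw : w.length = p.length
    · exact (hs.isAlternatingOn_tensorOf hθ hρ p.length hF).eq_zero_of_card_lt
        (by rw [hw, Fintype.card_fin]; exact hp)
    · exact tensorOf_of_length_ne _ hw
  rw [h0, hs.basic.formOf_single, map_zero, Pi.zero_apply, map_zero]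

end Form

/-- The volume form times a nonzero element of `τ(e i) kG e j` is an alternating tensor that is
fixed by `e i`. Its form kills the ideal `(θ)` and is nonzero on some path of length `n + 1`, which
must end at `i`. -/
theorem IsArrowSystem.exists_path_ne_zero (hs : IsArrowSystem Q ρ e col)
    (hθ : Submodule.span k θ = quadraticOrthogonal ρ) (i : V) :
    ∃ p : Q.QPath, p.length = n + 1 ∧ p.target = i ∧
      BoundQuiverAlgebra.mk θ (single p 1) ≠ 0 := by
  classical
  have he := hs.basic
  obtain ⟨row, hr⟩ := hs.exists_dualRows
  set τ := charTwist (detChar G) with hτ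
  have hτi : τ (e i) ≠ 0 := fun h => he.ne_zero i (by
    rw [← charTwist_inv_charTwist (detChar G) (e i), ← hτ, h, map_zero])
  -- Otherwise `τ (e i)` would annihilate the ideal generated by the idempotents, which contains
  -- `1`.
  obtain ⟨j, q, hz⟩ : ∃ j q, τ (e i) * q * e j ≠ 0 := by
    by_contra! h
    refine hτi ?_
    have h2 : ∀ z ∈ Submodule.span k {z : k[G] | ∃ p i q, z = p * e i * q},
        τ (e i) * z = 0 := by
      intro z hz
      induction hz using Submodule.span_induction with
      | mem z hz =>
        obtain ⟨p, j, q, rfl⟩ := hz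
        rw [← mul_assoc, ← mul_assoc, h j p, zero_mul]
      | zero => simp
      | add x y _ _ hx hy => rw [mul_add, hx, hy, add_zero]
      | smul c x _ hx => rw [mul_smul_comm, hx, smul_zero]
    simpa using h2 1 (he.one_mem_span k)
  set z := τ (e i) * q * e j with hzdef
  let Z : List (Fin (n + 1)) → k[G] := fun w => volumeForm k (n + 1) w • z
  have hZi : ∀ w, leftAct w (e i) Z = Z w := by
    intro w
    rw [leftAct_volumeForm, ← hτ, hzdef, ← mul_assoc, ← mul_assoc, ← map_mul, he.mul_self]
  have hZl : ∀ w, leftAct w (∑ i, e i) Z = Z w := by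
    intro w
    conv_lhs => rw [← funext hZi]
    rw [← leftAct_mul, he.sum_mul, hZi]
  have hZr : ∀ w, Z w * ∑ i, e i = Z w := by
    intro w
    simp only [Z, hzdef]
    rw [smul_mul_assoc, mul_assoc _ (e j), he.mul_sum]
  obtain ⟨p, hp, hp0⟩ : ∃ p : Q.QPath, p.length = n + 1 ∧ he.formOf row Z (single p 1) ≠ 0 := by
    by_contra! h
    have h1 := hr.eq_zero_of_formOf he hs hZl hZr h (w := List.finRange (n + 1)) (by simp)
    simp only [Z, volumeForm_finRange, one_smul] at h1
    exact hz h1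
  have hpt : i = p.target := by
    by_contra hne
    refine hp0 ?_
    rw [← funext hZi, hr.formOf_leftAct he hs, vertex_mul_single, if_neg hne, map_zero]
  refine ⟨p, hp, hpt.symm, fun h => hp0 ?_⟩
  exact form_eq_zero_of_mk_eq_zero (fun x r hrel y => hr.formOf_ideal he hs hθ
    (isAlternatingOn_volumeForm_smul _ z) x hrel y) h

/-- The element of the group algebra that implements the Nakayama automorphism. -/
theorem exists_nakayamaElement (hs : IsArrowSystem Q ρ e col) (hρ : ∀ r ∈ ρ, IsQuadraticRelation r)
    (hθ : Submodule.span k θ = quadraticOrthogonal ρ) (ν : NakayamaAutomorphism k Q θ) :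
    ∃ u : k[G],
      (∀ i, charTwist (detChar G) (e i) * u = u * e (ν.onVertices i)) ∧
      (∀ i, charTwist (detChar G) (e i) * u ≠ 0) ∧
      ∀ β l, charTwist (detChar G) (col β l) * u =
        ((-1) ^ n * ((e (Q.src β)).coeff 1 / (e (Q.tgt β)).coeff 1)) •
          (colAct G (charTwist (detChar G) (e (Q.tgt β)) * u) *ᵥ
            ∑ γ, ν.onArrows.symm (Finsupp.single γ 1) β • col γ) l := by
  classical
  have he := hs.basic
  obtain ⟨row, hr⟩ := hs.exists_dualRows
  obtain ⟨f, hf, hfν⟩ := ν.exists_form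
  set τ := charTwist (detChar G) with hτ
  obtain ⟨F, hFdef⟩ : ∃ F : Module.Dual k (PathAlgebra k Q), ∀ x, F x = f (.mk θ x) :=
    ⟨f ∘ₗ (BoundQuiverAlgebra.mk θ).toLinearMap, fun _ => rfl⟩
  have hmul := map_mul (BoundQuiverAlgebra.mk θ)
  have hFθ : ∀ x, ∀ r ∈ θ, ∀ y, F (x * r * y) = 0 := by
    intro x r hr y
    rw [hFdef, hmul, hmul, mk_eq_zero_of_mem hr, mul_zero, zero_mul, map_zero]
  have hY := hs.tensorOf_eq_volumeForm hρ hθ hFθ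
  set Y := tensorOf e col (n + 1) F with hYdef
  set u := Y (List.finRange (n + 1)) with hu
  refine ⟨u, fun i => ?_, fun i h0 => ?_, fun β l => ?_⟩
  -- The Nakayama identity for a trivial path, rewritten as an identity of tensors and evaluated at
  -- the standard word.
  · have h1 : formMulLeft (vertex k Q i) F = formMulRight (vertex k Q (ν.onVertices i)) F := by
      ext1 y
      rw [formMulLeft_apply, formMulRight_apply, hFdef, hFdef, hmul, hmul, hfν,
        ν.map_vertex]
    have h2 := hs.leftAct_tensorOf (n + 1) F i (List.finRange (n + 1))
    rw [h1, hs.tensorOf_mul, ← hYdef, ← hu, hY, leftAct_volumeForm, volumeForm_finRange,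
      one_smul] at h2
    exact h2
  · obtain ⟨p, hp, hpt, hmk⟩ := hs.exists_path_ne_zero hθ i
    -- The path `p` has the top degree, so a product `p y` can only be nonzero under `F` through the
    -- trivial path in `y`. If `F` vanished at `p`, nondegeneracy would give `p = 0` in the
    -- quotient.
    have hFp : F (single p 1) ≠ 0 := by
      intro hF0
      refine hmk (hf _ fun y => ?_)
      obtain ⟨y, rfl⟩ := mk_surjective θ y
      rw [← hmul, ← hFdef]
      induction y using induction_linear with
      | zero => simp
      | add x y hx hy => rw [mul_add, map_add, hx, hy, add_zero]
      | single q c =>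
        have e1 : (single q c : PathAlgebra k Q) = c • single q 1 := by
          rw [PathAlgebra.smul_single, mul_one]
        rw [e1, mul_smul_comm, map_smul]
        by_cases hpq : p.source = q.target
        · by_cases hq : q.length = 0
          · cases q using QPath.induction_cons with
            | nil j =>
              change c • F (single p 1 * vertex k Q j) = 0
              rw [single_mul_vertex, if_pos (show p.source = j from hpq), hF0, smul_zero]
            | cons a q h => simp at hq
          · rw [single_mul_single_of_eq p q hpq, one_mul,
              hs.form_eq_zero_of_length hρ hθ hFθ, smul_zero]
            rw [QPath.length_comp]; omega
        · rw [single_mul_single_of_ne p q hpq, map_zero, smul_zero]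
    refine hFp ?_
    have h3 : (single p 1 : PathAlgebra k Q) = vertex k Q i * single p 1 := by
      rw [vertex_mul_single, if_pos hpt.symm]
    rw [← hr.formOf_tensorOf he hs, hp, h3, ← hr.formOf_leftAct he hs, ← hYdef, hY]
    simp only [leftAct_volumeForm, ← hτ, h0, smul_zero]
    have : (fun _ : List (Fin (n + 1)) => (0 : k[G])) = 0 := rfl
    rw [this, he.formOf_single, map_zero, Pi.zero_apply, map_zero]
  -- The Nakayama identity for arrows, with `ν⁻¹ γ` in front instead of `γ` at the end.
  · have hright : ∀ γ, formMulRight (arrow k Q γ) F =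
        ∑ α, ν.onArrows.symm (Finsupp.single γ 1) α • formMulLeft (arrow k Q α) F := by
      intro γ
      rw [← formMulLeft_sum_smul, ← ofArrows_apply]
      ext1 y
      rw [formMulLeft_apply, formMulRight_apply, hFdef, hFdef, hmul, hmul,
        hfν (.mk θ (ofArrows k Q _)), ν.map_ofArrows, LinearEquiv.apply_symm_apply]
      simp [ofArrows]
    have hT : ∀ γ, tensorOf e col n (formMulRight (arrow k Q γ) F) =
        ∑ α, ν.onArrows.symm (Finsupp.single γ 1) α • contract row α Y := by
      intro γ
      rw [hright, map_sum]
      refine Finset.sum_congr rfl fun α _ => ?_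
      rw [map_smul, ← hr.contract_tensorOf hs]
    -- The top tensor is computed twice: as the volume form times `u`, and by removing the last
    -- arrow, which `hT` converts into contractions at the front.
    have hmain : ∀ (h : k[G]) (w : List (Fin (n + 1))), w.length = n → ∀ l,
        volumeForm k (n + 1) (w ++ [l]) • (τ h * u) =
          ∑ γ, ∑ α, ν.onArrows.symm (Finsupp.single γ 1) α •
            (colAct G (leftAct w h (contract row α Y)) *ᵥ col γ) l := by
      intro h w hw l
      rw [← leftAct_volumeForm, ← hY]
      have h1 : ∀ γ, leftAct (w ++ [l]) h (fun v => if h : v = [] then 0 else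
          (colAct G (tensorOf e col n (formMulRight (arrow k Q γ) F) v.dropLast) *ᵥ col γ)
            (v.getLast h)) =
          (colAct G (leftAct w h (tensorOf e col n (formMulRight (arrow k Q γ) F))) *ᵥ col γ) l := by
        intro γ
        refine leftAct_append_singleton w l h fun v _ m => ?_
        simp
      have h2 : leftAct (w ++ [l]) h Y = ∑ γ, leftAct (w ++ [l]) h
          (fun v => if h : v = [] then 0 else
          (colAct G (tensorOf e col n (formMulRight (arrow k Q γ) F) v.dropLast) *ᵥ col γ)
            (v.getLast h)) := by
        rw [← map_sum]
        refine leftAct_congr _ fun v hv => ?_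
        obtain ⟨v', m, rfl⟩ : ∃ v' m, v = v' ++ [m] := by
          have : v ≠ [] := by rintro rfl; simp at hv
          exact ⟨v.dropLast, v.getLast this, (List.dropLast_append_getLast this).symm⟩
        have hv' : v'.length = n := by simpa [hw] using hv
        rw [hYdef, hs.tensorOf_append _ _ hv']
        simp
      rw [h2]
      refine Finset.sum_congr rfl fun γ _ => ?_
      rw [h1, hT]
      simp only [map_sum, map_smul, Matrix.sum_mulVec, Finset.sum_apply, Matrix.smul_mulVec,
        Pi.smul_apply]
    -- The missing letter, which is in front after contraction, is carried past the `n` letters of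
    -- `w`; this costs `(-1) ^ n`.
    have hcon : ∀ (h : k[G]) (w : List (Fin (n + 1))), w.length = n → ∀ α,
        leftAct w h (contract row α Y) = ∑ l, ((-1) ^ n * volumeForm k (n + 1) (w ++ [l])) •
          (τ (∑ m, dualAct G m l (h * row α m)) * u) := by
      intro h w hw α
      rw [leftAct_contract, hY]
      simp only [leftAct_volumeForm_cons hw]
      rw [Finset.sum_comm]
      refine Finset.sum_congr rfl fun l _ => ?_
      rw [map_sum, Finset.sum_mul, Finset.smul_sum]
      refine Finset.sum_congr rfl fun m _ => ?_
      rw [(isAlternatingOn_volumeForm k (n + 1)).append_cons l w, hw, hτ]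
      simp
    -- The volume form is divided out with a word to which only `l₀` can be added.
    have hstar : ∀ (h : k[G]) (l₀ l : Fin (n + 1)), (if l = l₀ then τ h * u else 0) =
        (-1 : k) ^ n • ∑ γ, ∑ α, ν.onArrows.symm (Finsupp.single γ 1) α •
          (colAct G (τ (∑ m, dualAct G m l₀ (h * row α m)) * u) *ᵥ col γ) l := by
      intro h l₀ l
      obtain ⟨w, hw, h0, h1⟩ := exists_word_volumeForm (k := k) l₀
      refine smul_right_injective _ h0 ?_
      have h2 := hmain h w hw l
      have h3 : ∀ α, leftAct w h (contract row α Y) =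
          ((-1) ^ n * volumeForm k (n + 1) (w ++ [l₀])) •
            (τ (∑ m, dualAct G m l₀ (h * row α m)) * u) := by
        intro α
        rw [hcon h w hw, Finset.sum_eq_single l₀]
        · intro m _ hm; rw [h1 m hm, mul_zero, zero_smul]
        · simp
      simp only [h3, map_smul, Matrix.smul_mulVec, Pi.smul_apply] at h2
      simp only [smul_comm _ ((-1) ^ n * volumeForm k (n + 1) (w ++ [l₀])), ← Finset.smul_sum] at h2
      change _ • (if l = l₀ then τ h * u else 0) = _ • (-1 : k) ^ n • _
      rw [smul_smul, mul_comm, ← h2]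
      split_ifs with hl
      · rw [hl]
      · rw [h1 l hl, zero_smul, smul_zero]
    -- With `h = col β l₀`, the sum of `hstar` over `l₀` produces the contraction of
    -- `sum_dualAct_col_row`, and only the term `α = β` survives.
    have hsum : ∑ l₀, (if l = l₀ then τ (col β l₀) * u else 0) = τ (col β l) * u := by simp
    rw [← hsum]
    simp only [hstar]
    rw [← Finset.smul_sum, mul_smul]
    congr 1
    rw [Finset.sum_comm, Matrix.mulVec_sum, Finset.sum_apply, Finset.smul_sum]
    refine Finset.sum_congr rfl fun γ _ => ?_
    rw [Finset.sum_comm]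
    have hα : ∀ α, ∑ l₀, ν.onArrows.symm (Finsupp.single γ 1) α •
          (colAct G (τ (∑ m, dualAct G m l₀ (col β l₀ * row α m)) * u) *ᵥ col γ) l =
        ν.onArrows.symm (Finsupp.single γ 1) α • (colAct G (τ (if β = α then
      ((e (Q.src β)).coeff 1 / (e (Q.tgt β)).coeff 1) • e (Q.tgt β) else 0) * u) *ᵥ col γ) l := by
      intro α
      rw [← sum_dualAct_col_row hs hr, ← Finset.smul_sum]
      simp only [map_sum, Finset.sum_mul, Matrix.sum_mulVec, Finset.sum_apply]
    simp only [hα]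
    rw [Finset.sum_eq_single β]
    · rw [if_pos rfl, map_smul, smul_mul_assoc, map_smul, Matrix.smul_mulVec, Pi.smul_apply,
        Matrix.mulVec_smul, Pi.smul_apply, smul_comm]
    · intro α _ hα; rw [if_neg (Ne.symm hα)]; simp
    · simp

end NakayamaElement

end

/-! ### The group algebra elements behind the arrows `β_i` -/

noncomputable section

open PathAlgebra ArrowQuiver

section TwistElements

variable {k : Type u} [Field k]

theorem charTwist_colAct {ι : Type} [Fintype ι] [DecidableEq ι] {G : Subgroup (GL ι k)}
    (χ : G →* kˣ) (z : k[G]) (l m : ι) :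
    charTwist χ (colAct G z l m) = colAct G (charTwist χ z) l m := by
  induction z using MonoidAlgebra.induction_linear with
  | zero => simp
  | add x y hx hy => simp [hx, hy]
  | single g c => simp only [charTwist_single, colAct_single]; congr 1; ring

variable [IsAlgClosed k] [CharZero k] {n : ℕ}
  {G : Subgroup (GL (Fin (n + 1)) k)} [Fintype G] {V : Type v} {A : Type w} [Fintype V] [Fintype A]
  {Q : ArrowQuiver V A} {ρ θ : Set (PathAlgebra k Q)} {e : V → k[G]}
  {col : A → Fin (n + 1) → k[G]}

/-- The elements `v i` of the group algebra for which `x v i`, where `x` is the additional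
variable, represents the arrow `β_i`. -/
theorem exists_twistElements (hs : IsArrowSystem Q ρ e col) (hρ : ∀ r ∈ ρ, IsQuadraticRelation r)
    (hθ : Submodule.span k θ = quadraticOrthogonal ρ) (ν : NakayamaAutomorphism k Q θ) :
    ∃ v v' : V → k[G],
      (∀ i, charTwist (detChar G)⁻¹ (e (ν.onVertices i)) * v i = v i) ∧
      (∀ i, v i * e i = v i) ∧ (∀ i, v' i * v i = e i) ∧
      (∀ i, v i * v' i = charTwist (detChar G)⁻¹ (e (ν.onVertices i))) ∧
      ∀ α l, charTwist (detChar G)⁻¹ (col α l) * v (ν.onVertices.symm (Q.src α)) =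
        (-1 : k) ^ n • (colAct G (v (ν.onVertices.symm (Q.tgt α))) *ᵥ
          ∑ γ, ν.onArrows (Finsupp.single γ 1) α • col γ) l := by
  classical
  have he := hs.basic
  have hθ2 : θ ⊆ degree k Q 2 := fun r hr =>
    (hθ ▸ Submodule.subset_span hr : r ∈ quadraticOrthogonal ρ).1
  obtain ⟨u, hu, hu0, hcol⟩ := exists_nakayamaElement hs hρ hθ ν
  have hστ := charTwist_inv_charTwist (k := k) (detChar G)
  set τ := charTwist (detChar G) with hτ
  set σ := charTwist (detChar G)⁻¹ with hσ
  -- `τ (e i)` inherits one-dimensional corners from `e i`, so the nonzero element `τ (e i) * u`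
  -- between the two corners is invertible.
  have hinv : ∀ i, ∃ y, y * (τ (e i) * u) = e (ν.onVertices i) ∧ (τ (e i) * u) * y = τ (e i) ∧
      e (ν.onVertices i) * y = y ∧ y * τ (e i) = y := by
    intro i
    refine he.exists_inverse (k := k) ?_ (fun z => ?_) ?_ ?_ (hu0 i)
    · rw [← map_mul, he.mul_self]
    · obtain ⟨c, hc⟩ := he.corner_self k i (σ z)
      refine ⟨c, ?_⟩
      have h := congrArg τ hc
      rw [map_mul, map_mul, hτ, hσ, charTwist_charTwist_inv, map_smul] at h
      exact h
    · rw [← mul_assoc, ← map_mul, he.mul_self]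
    · rw [hu, mul_assoc, he.mul_self]
  choose w hwu huw hew hwe using hinv
  have ht : ∀ i, (e i).coeff 1 ≠ 0 := fun i => (he.coeff_one_smul_frobElement i).2
  -- The factor `(e i).coeff 1` absorbs the quotient of coefficients in the relation for the arrows,
  -- so that a mere sign remains.
  refine ⟨fun i => σ ((e i).coeff 1 • w i), fun i => σ (((e i).coeff 1)⁻¹ • (τ (e i) * u)),
    fun i => ?_, fun i => ?_, fun i => ?_, fun i => ?_, fun α l => ?_⟩
  · rw [← map_mul, mul_smul_comm, hew]
  · have : σ ((e i).coeff 1 • w i) * e i = σ ((e i).coeff 1 • w i * τ (e i)) := by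
      rw [map_mul, hστ]
    rw [this, smul_mul_assoc, hwe]
  · rw [← map_mul, smul_mul_assoc, mul_smul_comm, smul_smul, huw, inv_mul_cancel₀ (ht i), one_smul,
      hστ]
  · rw [← map_mul, smul_mul_assoc, mul_smul_comm, smul_smul, hwu, mul_inv_cancel₀ (ht i), one_smul]
  · set i := ν.onVertices.symm (Q.src α) with hi
    set j := ν.onVertices.symm (Q.tgt α) with hj
    -- The matrix of `ν` times its inverse. Solving for the columns replaces the inverse matrix by
    -- the transposed matrix of `ν`, that is, by the contragredient action.
    have hsum : ∀ δ, ∑ γ, ν.onArrows (Finsupp.single γ 1) α *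
        ν.onArrows.symm (Finsupp.single δ 1) γ = if δ = α then 1 else 0 := by
      intro δ
      have h1 : ν.onArrows (ν.onArrows.symm (Finsupp.single δ 1)) α = if δ = α then 1 else 0 := by
        rw [LinearEquiv.apply_symm_apply, Finsupp.single_apply]
      rw [← h1]
      conv_rhs => rw [← Finsupp.univ_sum_single (ν.onArrows.symm (Finsupp.single δ 1))]
      rw [map_sum, Finsupp.finsetSum_apply]
      refine Finset.sum_congr rfl fun γ _ => ?_
      have h2 : Finsupp.single γ (ν.onArrows.symm (Finsupp.single δ 1) γ) =
        (ν.onArrows.symm (Finsupp.single δ 1) γ) • Finsupp.single γ (1 : k) := by simp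
      rw [h2, map_smul, Finsupp.smul_apply, smul_eq_mul, mul_comm]
    -- the relation for a single arrow, solved for the twisted column
    have hγ : ∀ γ, Q.src γ = i → Q.tgt γ = j → ∀ l,
        (colAct G (w j) *ᵥ fun m => τ (col γ m)) l =
        ((-1) ^ n * ((e i).coeff 1 / (e j).coeff 1)) •
          ∑ δ, ν.onArrows.symm (Finsupp.single δ 1) γ • (col δ l * w i) := by
      intro γ hsrc htgt l
      have h1 : (fun m => τ (col γ m)) = ((-1) ^ n * ((e i).coeff 1 / (e j).coeff 1)) •
          colMul (w i) (colAct G (τ (e j) * u) *ᵥ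
            ∑ δ, ν.onArrows.symm (Finsupp.single δ 1) γ • col δ) := by
        ext1 m
        have h2 : τ (col γ m) = τ (col γ m) * u * w i := by
          rw [← hs.mul_src γ m, map_mul, hsrc, mul_assoc (τ (col γ m)), mul_assoc (τ (col γ m)),
            huw]
        rw [h2, hcol, hsrc, htgt, Pi.smul_apply, colMul_apply, smul_mul_assoc]
      rw [h1, Matrix.mulVec_smul, Pi.smul_apply]
      congr 1
      change (mulCol (w j) (colMul (w i) (mulCol (τ (e j) * u) _))) l = _
      rw [mulCol_colMul, mulCol_mulCol, hwu, map_sum, map_sum, Finset.sum_apply]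
      refine Finset.sum_congr rfl fun δ _ => ?_
      by_cases h0 : ν.onArrows.symm (Finsupp.single δ 1) γ = 0
      · rw [h0]; simp
      · have h3 := (ν.onArrows_symm_endpoints hθ2 h0).1
        rw [htgt] at h3
        rw [map_smul, map_smul, ← h3, mulCol_apply, hs.tgt_mul, Pi.smul_apply, colMul_apply]
    have key : (e i).coeff 1 • (col α l * w i) = (-1 : k) ^ n • (e j).coeff 1 •
        ∑ γ, ν.onArrows (Finsupp.single γ 1) α • (colAct G (w j) *ᵥ fun m => τ (col γ m)) l := by
      have h1 : ∀ γ, ν.onArrows (Finsupp.single γ 1) α •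
          (colAct G (w j) *ᵥ fun m => τ (col γ m)) l =
          ((-1) ^ n * ((e i).coeff 1 / (e j).coeff 1)) • ∑ δ, (ν.onArrows (Finsupp.single γ 1) α *
            ν.onArrows.symm (Finsupp.single δ 1) γ) • (col δ l * w i) := by
        intro γ
        by_cases h0 : ν.onArrows (Finsupp.single γ 1) α = 0
        · rw [h0]; simp
        · obtain ⟨h2, h3⟩ := ν.onArrows_endpoints hθ2 h0
          rw [hγ γ (by rw [hi, h3]; simp) (by rw [hj, h2]; simp), smul_comm]
          simp only [Finset.smul_sum, mul_smul]
      simp only [h1, ← Finset.smul_sum]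
      rw [Finset.sum_comm]
      simp only [← Finset.sum_smul, hsum, ite_smul, one_smul, zero_smul]
      simp only [Finset.sum_ite_eq', Finset.mem_univ, if_true, smul_smul]
      congr 1
      have h4 : ((-1 : k) ^ n) * (-1) ^ n = 1 := by rw [← mul_pow]; simp
      have := ht j
      field_simp
      linear_combination (-(e i).coeff 1) * h4
    have h5 := congrArg σ key
    simp only [map_smul, map_sum, map_mul] at h5 ⊢
    rw [mul_smul_comm, h5, Matrix.mulVec_sum, Finset.sum_apply]
    congr 1
    rw [Finset.smul_sum]
    refine Finset.sum_congr rfl fun γ _ => ?_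
    rw [Matrix.mulVec_smul, Pi.smul_apply, smul_comm, Matrix.smul_mulVec, Pi.smul_apply]
    congr 2
    simp only [Matrix.mulVec, dotProduct, map_sum, map_mul, hστ]
    exact Finset.sum_congr rfl fun m _ => by rw [hσ, charTwist_colAct]

end TwistElements

end

/-! ### The group `G̃` as `G × ℤ/m`, and the idempotents of the cyclic group -/

noncomputable section

open PathAlgebra ArrowQuiver

section RootPower

variable {k : Type u} [Field k] {m : ℕ} {ξ : kˣ}

/-- The power `ξ ^ t` of a primitive `m`-th root of unity for `t ∈ ℤ/m`. -/
def IsPrimitiveRoot.zpw (_hξ : IsPrimitiveRoot ξ m) (t : ZMod m) : kˣ := ξ ^ t.val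

variable [NeZero m] (hξ : IsPrimitiveRoot ξ m)
include hξ

theorem IsPrimitiveRoot.zpw_natCast (n : ℕ) : hξ.zpw (n : ZMod m) = ξ ^ n := by
  rw [IsPrimitiveRoot.zpw, ZMod.val_natCast]
  conv_rhs => rw [← Nat.mod_add_div n m, pow_add, pow_mul, hξ.pow_eq_one, one_pow, mul_one]

theorem IsPrimitiveRoot.zpw_add (s t : ZMod m) : hξ.zpw (s + t) = hξ.zpw s * hξ.zpw t := by
  have h := hξ.zpw_natCast (s.val + t.val)
  rw [Nat.cast_add, ZMod.natCast_zmod_val, ZMod.natCast_zmod_val, pow_add] at h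
  exact h

theorem IsPrimitiveRoot.zpw_zero : hξ.zpw 0 = 1 := by simp [IsPrimitiveRoot.zpw]

theorem IsPrimitiveRoot.zpw_one : hξ.zpw 1 = ξ := by simpa using hξ.zpw_natCast 1

theorem IsPrimitiveRoot.zpw_neg (t : ZMod m) : hξ.zpw (-t) = (hξ.zpw t)⁻¹ := by
  rw [eq_inv_iff_mul_eq_one, ← hξ.zpw_add, neg_add_cancel, hξ.zpw_zero]

theorem IsPrimitiveRoot.zpw_eq_one {t : ZMod m} (h : hξ.zpw t = 1) : t = 0 := by
  rw [IsPrimitiveRoot.zpw, hξ.pow_eq_one_iff_dvd] at h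
  exact (ZMod.val_eq_zero t).1 (Nat.eq_zero_of_dvd_of_lt h t.val_lt)

theorem IsPrimitiveRoot.zpw_injective : Function.Injective hξ.zpw := fun s t h => by
  rw [← sub_eq_zero]
  refine hξ.zpw_eq_one ?_
  rw [sub_eq_add_neg, hξ.zpw_add, hξ.zpw_neg, h, mul_inv_cancel]

theorem IsPrimitiveRoot.sum_zpw (t : ZMod m) :
    ∑ j, (hξ.zpw (t * j) : k) = if t = 0 then (m : k) else 0 := by
  split_ifs with h
  · simp [h, hξ.zpw_zero, ZMod.card]
  · have h1 : (hξ.zpw t : k) * ∑ j, (hξ.zpw (t * j) : k) = ∑ j, (hξ.zpw (t * j) : k) := by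
      rw [Finset.mul_sum, ← Equiv.sum_comp (Equiv.addRight (1 : ZMod m)) fun j =>
        (hξ.zpw (t * j) : k)]
      refine Finset.sum_congr rfl fun j _ => ?_
      rw [Equiv.coe_addRight, mul_add, mul_one, add_comm, hξ.zpw_add, Units.val_mul]
    by_contra h0
    refine h (hξ.zpw_eq_one (Units.ext ?_))
    exact mul_right_cancel₀ h0 (h1.trans (one_mul _).symm)

end RootPower

section ExtensionGroup

variable {k : Type u} [Field k] {ι : Type} [Fintype ι] [DecidableEq ι]

theorem blockDiagGL_val (x : GL ι k × kˣ) : (blockDiagGL x).1 =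
    Matrix.fromBlocks x.1.1 0 0 (Matrix.diagonal fun _ => (x.2 : k)) := rfl

theorem blockDiagGL_injective : Function.Injective (blockDiagGL (k := k) (ι := ι)) := by
  rintro ⟨g, c⟩ ⟨h, d⟩ hgh
  have h1 := congrArg Units.val hgh
  rw [blockDiagGL_val, blockDiagGL_val, Matrix.fromBlocks_inj] at h1
  have h2 := congrFun (congrFun h1.2.2.2 ()) ()
  rw [Matrix.diagonal_apply_eq, Matrix.diagonal_apply_eq] at h2
  exact Prod.ext (Units.ext h1.1) (Units.ext h2)

variable (G : Subgroup (GL ι k)) {m : ℕ} [NeZero m] {ξ : kˣ} (hξ : IsPrimitiveRoot ξ m)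

/-- The homomorphism `(g, j) ↦ diag(g, det(g)⁻¹ ξ^j)`. -/
def extHom : G × Multiplicative (ZMod m) →* GL (ι ⊕ Unit) k where
  toFun x := blockDiagGL (x.1.1, (Matrix.GeneralLinearGroup.det x.1.1)⁻¹ *
    hξ.zpw (Multiplicative.toAdd x.2))
  map_one' := by
    rw [← map_one blockDiagGL]
    congr 1
    simp [hξ.zpw_zero]
  map_mul' x y := by
    rw [← map_mul]
    congr 1
    refine Prod.ext (by simp) ?_
    simp only [Prod.fst_mul, Prod.snd_mul, Subgroup.coe_mul, map_mul, toAdd_mul, hξ.zpw_add,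
      Prod.mk_mul_mk, _root_.mul_inv]
    exact mul_mul_mul_comm _ _ _ _

theorem extHom_apply (g : G) (j : ZMod m) : extHom G hξ (g, Multiplicative.ofAdd j) =
    blockDiagGL (g.1, (Matrix.GeneralLinearGroup.det g.1)⁻¹ * hξ.zpw j) := rfl

theorem extHom_injective : Function.Injective (extHom G hξ) := by
  rintro ⟨g, i⟩ ⟨h, j⟩ hgh
  have h1 := blockDiagGL_injective hgh
  simp only [Prod.mk.injEq] at h1
  obtain ⟨h2, h3⟩ := h1
  obtain rfl : g = h := Subtype.ext h2
  have h4 := hξ.zpw_injective (mul_left_cancel h3)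
  exact Prod.ext rfl h4

theorem range_extHom : (extHom G hξ).range = cyclicExtension G ξ := by
  apply le_antisymm
  · rintro _ ⟨⟨g, j⟩, rfl⟩
    have h1 : extHom G hξ (g, j) = detEmbedding g.1 *
        blockDiagGL (1, ξ) ^ (Multiplicative.toAdd j).val := by
      rw [← map_pow, detEmbedding, MonoidHom.comp_apply, ← map_mul]
      exact congrArg blockDiagGL (Prod.ext (by simp) rfl)
    rw [h1, cyclicExtension]
    exact mul_mem (Subgroup.mem_sup_left ⟨g.1, g.2, rfl⟩)
      (Subgroup.mem_sup_right (pow_mem (Subgroup.mem_zpowers _) _))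
  · refine sup_le ?_ (by
      rw [Subgroup.zpowers_le]
      refine ⟨(1, Multiplicative.ofAdd 1), ?_⟩
      rw [extHom_apply, hξ.zpw_one]
      simp)
    rintro _ ⟨g, hg, rfl⟩
    refine ⟨(⟨g, hg⟩, 1), ?_⟩
    refine congrArg blockDiagGL (Prod.ext rfl ?_)
    simp [hξ.zpw_zero]

/-- The group `G̃` is the product of `G` and a cyclic group of order `m`. -/
def extEquiv : G × Multiplicative (ZMod m) ≃* cyclicExtension G ξ :=
  (MonoidHom.ofInjective (extHom_injective G hξ)).trans
    (MulEquiv.subgroupCongr (range_extHom G hξ))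

/-- The element of `G̃` that belongs to `g ∈ G` and `j ∈ ℤ/m`. -/
def extElem (g : G) (j : ZMod m) : cyclicExtension G ξ := extEquiv G hξ (g, Multiplicative.ofAdd j)

variable {G}

theorem extElem_val (g : G) (j : ZMod m) : (extElem G hξ g j).1.1 =
    Matrix.fromBlocks g.1.1 0 0 (Matrix.diagonal fun _ =>
      (((Matrix.GeneralLinearGroup.det g.1)⁻¹ * hξ.zpw j : kˣ) : k)) := rfl

theorem extElem_mul (g h : G) (i j : ZMod m) :
    extElem G hξ g i * extElem G hξ h j = extElem G hξ (g * h) (i + j) := by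
  rw [extElem, extElem, ← map_mul]; rfl

theorem extElem_one : extElem G hξ 1 0 = 1 := map_one (extEquiv G hξ)

theorem exists_extElem (x : cyclicExtension G ξ) : ∃ g j, x = extElem G hξ g j := by
  obtain ⟨⟨g, j⟩, rfl⟩ := (extEquiv G hξ).surjective x
  exact ⟨g, Multiplicative.toAdd j, rfl⟩

theorem extElem_inj {g h : G} {i j : ZMod m} (hh : extElem G hξ g i = extElem G hξ h j) :
    g = h ∧ i = j := by
  have := (extEquiv G hξ).injective hh
  simpa using this

theorem extElem_smul_X_inl (g : G) (j : ZMod m) (l : ι) :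
    extElem G hξ g j • (MvPolynomial.X (Sum.inl l) : MvPolynomial (ι ⊕ Unit) k) =
      MvPolynomial.rename Sum.inl (g • (MvPolynomial.X l : MvPolynomial ι k)) := by
  rw [smul_X, smul_X, Fintype.sum_sum_type, map_sum]
  simp [extElem_val]

theorem extElem_smul_X_inr (g : G) (j : ZMod m) :
    extElem G hξ g j • (MvPolynomial.X (Sum.inr ()) : MvPolynomial (ι ⊕ Unit) k) =
      MvPolynomial.C (((detChar G g)⁻¹ * hξ.zpw j : kˣ) : k) * MvPolynomial.X (Sum.inr ()) := by
  rw [smul_X, Fintype.sum_sum_type]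
  simp [extElem_val]
  rfl

theorem extElem_smul_rename (g : G) (j : ZMod m) (f : MvPolynomial ι k) :
    extElem G hξ g j • (MvPolynomial.rename Sum.inl f : MvPolynomial (ι ⊕ Unit) k) =
      MvPolynomial.rename Sum.inl (g • f) := by
  induction f using MvPolynomial.induction_on with
  | C a =>
    have h1 : g • (MvPolynomial.C a : MvPolynomial ι k) = MvPolynomial.C a :=
      (polyAct g.1).commutes a
    have h2 : extElem G hξ g j • (MvPolynomial.C a : MvPolynomial (ι ⊕ Unit) k) =
      MvPolynomial.C a := (polyAct (extElem G hξ g j).1).commutes a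
    rw [h1, MvPolynomial.rename_C, h2]
  | add p q hp hq => rw [map_add, smul_add, smul_add, hp, hq, map_add]
  | mul_X p l hp =>
    rw [map_mul, smul_mul', smul_mul', hp, map_mul, MvPolynomial.rename_X, extElem_smul_X_inl]

variable (G) in
/-- The inclusion of `k[V] * G` in `k[V ⊕ k] * G̃`. -/
def skewIncl : SkewGroupAlgebra G →ₐ[k] SkewGroupAlgebra (cyclicExtension G ξ) :=
  SkewMonoidAlgebra.liftNCAlgHom
    ({ toFun := fun f => SkewMonoidAlgebra.single 1 (MvPolynomial.rename Sum.inl f)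
       map_one' := by rw [map_one, SkewMonoidAlgebra.one_def]
       map_mul' := fun f g => by simp [SkewMonoidAlgebra.single_mul_single]
       map_zero' := by simp
       map_add' := fun f g => by rw [map_add, SkewMonoidAlgebra.single_add]
       commutes' := fun c => by simp [SkewMonoidAlgebra.coe_algebraMap, MvPolynomial.algebraMap_eq] } :
      MvPolynomial ι k →ₐ[k] SkewGroupAlgebra (cyclicExtension G ξ))
    ((SkewMonoidAlgebra.of (MvPolynomial (ι ⊕ Unit) k) (cyclicExtension G ξ)).comp
      { toFun := fun g => extElem G hξ g 0
        map_one' := extElem_one hξ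
        map_mul' := fun g h => by rw [extElem_mul, add_zero] })
    (fun {f g} => by
      change SkewMonoidAlgebra.single 1 _ * SkewMonoidAlgebra.of _ _ (extElem G hξ g 0) =
        SkewMonoidAlgebra.of _ _ (extElem G hξ g 0) * SkewMonoidAlgebra.single 1 _
      simp only [SkewMonoidAlgebra.of_apply, SkewMonoidAlgebra.single_mul_single, one_mul, mul_one,
        one_smul]
      exact congrArg _ (extElem_smul_rename hξ g 0 f).symm)

theorem skewIncl_single (g : G) (f : MvPolynomial ι k) :
    skewIncl G hξ (SkewMonoidAlgebra.single g f) =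
      SkewMonoidAlgebra.single (extElem G hξ g 0) (MvPolynomial.rename Sum.inl f) := by
  refine (SkewMonoidAlgebra.liftNC_single _ _ _ _).trans ?_
  change SkewMonoidAlgebra.single 1 _ * SkewMonoidAlgebra.of _ _ (extElem G hξ g 0) = _
  rw [SkewMonoidAlgebra.of_apply, SkewMonoidAlgebra.single_mul_single, one_mul]
  simp

variable (G) in
/-- The inclusion of `kG` in `kG̃`. -/
def groupIncl : k[G] →ₐ[k] k[cyclicExtension G ξ] :=
  MonoidAlgebra.lift k _ G ((MonoidAlgebra.of k (cyclicExtension G ξ)).comp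
      { toFun := fun g => extElem G hξ g 0
        map_one' := extElem_one hξ
        map_mul' := fun g h => by rw [extElem_mul, add_zero] })

theorem groupIncl_single (g : G) (c : k) :
    groupIncl G hξ (MonoidAlgebra.single g c) = MonoidAlgebra.single (extElem G hξ g 0) c := by
  rw [groupIncl, MonoidAlgebra.lift_single]
  change c • MonoidAlgebra.single (extElem G hξ g 0) 1 = _
  rw [MonoidAlgebra.smul_single, smul_eq_mul, mul_one]

theorem skewIncl_groupAlgebraIncl (z : k[G]) : skewIncl G hξ (groupAlgebraIncl G z) =
    groupAlgebraIncl (cyclicExtension G ξ) (groupIncl G hξ z) := by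
  induction z using MonoidAlgebra.induction_linear with
  | zero => simp
  | add x y hx hy => simp only [map_add, hx, hy]
  | single g c =>
    rw [groupAlgebraIncl_single, skewIncl_single, groupIncl_single, groupAlgebraIncl_single,
      MvPolynomial.rename_C]

variable (G ξ) in
/-- The additional variable of `k[V ⊕ k]`. -/
def extraVar : SkewGroupAlgebra (cyclicExtension G ξ) :=
  SkewMonoidAlgebra.single 1 (MvPolynomial.X (Sum.inr ()))

variable (G) in
/-- The idempotent of `kG̃` that belongs to a character of the cyclic group. -/
def charIdem (t : ZMod m) : k[cyclicExtension G ξ] :=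
  (m : k)⁻¹ • ∑ j : ZMod m, MonoidAlgebra.single (extElem G hξ 1 j) ((hξ.zpw (-(t * j)) : kˣ) : k)

theorem extElem_mul_charIdem (j t : ZMod m) :
    MonoidAlgebra.single (extElem G hξ 1 j) (1 : k) * charIdem G hξ t =
      (hξ.zpw (t * j) : k) • charIdem G hξ t := by
  have h : MonoidAlgebra.single (extElem G hξ 1 j) (1 : k) * ∑ i : ZMod m,
      MonoidAlgebra.single (extElem G hξ 1 i) ((hξ.zpw (-(t * i)) : kˣ) : k) =
      (hξ.zpw (t * j) : k) • ∑ i : ZMod m,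
        MonoidAlgebra.single (extElem G hξ 1 i) ((hξ.zpw (-(t * i)) : kˣ) : k) := by
    rw [Finset.mul_sum, Finset.smul_sum, ← Equiv.sum_comp (Equiv.addLeft j) fun i =>
      (hξ.zpw (t * j) : k) • MonoidAlgebra.single (extElem G hξ 1 i) ((hξ.zpw (-(t * i)) : kˣ) : k)]
    refine Finset.sum_congr rfl fun i _ => ?_
    rw [MonoidAlgebra.single_mul_single, extElem_mul, one_mul, one_mul, MonoidAlgebra.smul_single,
      Equiv.coe_addLeft, smul_eq_mul, ← Units.val_mul, ← hξ.zpw_add]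
    congr 3
    ring
  rw [charIdem, mul_smul_comm, h, smul_comm]

variable [CharZero k]

theorem charIdem_mul_charIdem (s t : ZMod m) :
    charIdem G hξ s * charIdem G hξ t = if s = t then charIdem G hξ t else 0 := by
  have hm : (m : k) ≠ 0 := Nat.cast_ne_zero.2 (NeZero.ne m)
  have h1 : ∀ (j : ZMod m) (c : k), MonoidAlgebra.single (extElem G hξ 1 j) c * charIdem G hξ t =
      (c * hξ.zpw (t * j)) • charIdem G hξ t := by
    intro j c
    have : MonoidAlgebra.single (extElem G hξ 1 j) c =
        c • MonoidAlgebra.single (extElem G hξ 1 j) (1 : k) := by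
      rw [MonoidAlgebra.smul_single, smul_eq_mul, mul_one]
    rw [this, smul_mul_assoc, extElem_mul_charIdem, smul_smul]
  rw [charIdem, smul_mul_assoc, Finset.sum_mul]
  simp only [h1]
  have h2 : ∀ j, (hξ.zpw (-(s * j)) : k) * hξ.zpw (t * j) = hξ.zpw ((t - s) * j) := by
    intro j
    rw [← Units.val_mul, ← hξ.zpw_add]
    congr 2; ring
  simp only [h2]
  rw [← Finset.sum_smul, hξ.sum_zpw, smul_smul]
  by_cases h : s = t
  · rw [if_pos h, if_pos (by rw [h, sub_self]), inv_mul_cancel₀ hm, one_smul]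
  · rw [if_neg h, if_neg fun h' => h (sub_eq_zero.1 h').symm, mul_zero, zero_smul]

theorem sum_charIdem : ∑ t, charIdem G hξ t = 1 := by
  have hm : (m : k) ≠ 0 := Nat.cast_ne_zero.2 (NeZero.ne m)
  simp only [charIdem]
  rw [← Finset.smul_sum, Finset.sum_comm]
  have h1 : ∀ j : ZMod m, ∑ t : ZMod m, MonoidAlgebra.single (extElem G hξ 1 j)
      ((hξ.zpw (-(t * j)) : kˣ) : k) =
      MonoidAlgebra.single (extElem G hξ 1 j) (if j = 0 then (m : k) else 0) := by
    intro j
    have h2 : ∑ t : ZMod m, ((hξ.zpw (-(t * j)) : kˣ) : k) = if j = 0 then (m : k) else 0 := by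
      have h3 := hξ.sum_zpw (-j)
      simp only [neg_eq_zero] at h3
      rw [← h3]
      exact Finset.sum_congr rfl fun t _ => by congr 2; ring
    rw [← h2]
    exact (map_sum (MonoidAlgebra.lsingle (R := k) (S := k) (extElem G hξ 1 j)) _ _).symm
  simp only [h1]
  rw [Finset.sum_eq_single 0]
  · rw [if_pos rfl, MonoidAlgebra.smul_single, smul_eq_mul, inv_mul_cancel₀ hm, extElem_one]; rfl
  · intro j _ hj; rw [if_neg hj, MonoidAlgebra.single_zero]
  · simp

theorem charIdem_coeff (t : ZMod m) (g : G) (j : ZMod m) : (charIdem G hξ t).coeff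
    (extElem G hξ g j) = open Classical in if g = 1 then (m : k)⁻¹ * hξ.zpw (-(t * j)) else 0 := by
  classical
  rw [charIdem, MonoidAlgebra.coeff_smul, Finsupp.smul_apply, MonoidAlgebra.coeff_sum,
    Finsupp.finsetSum_apply]
  simp only [MonoidAlgebra.coeff_single, Finsupp.single_apply]
  rw [Finset.sum_eq_single j]
  · by_cases h : g = 1
    · rw [if_pos h, if_pos (by rw [h]), smul_eq_mul]
    · rw [if_neg h, if_neg fun h' => h (extElem_inj hξ h').1.symm, smul_zero]
  · intro i _ hi; rw [if_neg fun h' => hi (extElem_inj hξ h').2]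
  · simp

end ExtensionGroup

end

/-! ### The skew group algebra of `G̃` as an extension by one variable -/

noncomputable section

open PathAlgebra ArrowQuiver

section SkewExtension

variable {k : Type u} [Field k] {ι : Type} [Fintype ι] [DecidableEq ι]
  {G : Subgroup (GL ι k)} {m : ℕ} [NeZero m] {ξ : kˣ} (hξ : IsPrimitiveRoot ξ m)

theorem extElem_mul_extraVar (g : G) (j : ZMod m) :
    SkewMonoidAlgebra.single (extElem G hξ g j) 1 * extraVar G ξ =
      (((detChar G g)⁻¹ * hξ.zpw j : kˣ) : k) •
        (extraVar G ξ * SkewMonoidAlgebra.single (extElem G hξ g j) 1) := by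
  rw [extraVar, SkewMonoidAlgebra.single_mul_single, SkewMonoidAlgebra.single_mul_single,
    extElem_smul_X_inr, SkewMonoidAlgebra.smul_single, MvPolynomial.smul_eq_C_mul, one_smul]
  simp

theorem X_mul_extraVar (l : ι) :
    skewIncl G hξ (SkewMonoidAlgebra.single 1 (MvPolynomial.X l)) * extraVar G ξ =
      extraVar G ξ * skewIncl G hξ (SkewMonoidAlgebra.single 1 (MvPolynomial.X l)) := by
  rw [skewIncl_single, extElem_one, extraVar, SkewMonoidAlgebra.single_mul_single,
    SkewMonoidAlgebra.single_mul_single, one_smul, one_smul, mul_comm]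

theorem skewIncl_groupAlgebraIncl_single (g : G) (c : k) :
    skewIncl G hξ (groupAlgebraIncl G (MonoidAlgebra.single g c)) =
      c • SkewMonoidAlgebra.single (extElem G hξ g 0) 1 := by
  rw [groupAlgebraIncl_single, skewIncl_single, SkewMonoidAlgebra.smul_single,
    MvPolynomial.rename_C, MvPolynomial.smul_eq_C_mul, mul_one]

/-- The last diagonal entry of the copy of `g` in `G̃` is `det(g)⁻¹`. -/
theorem skewIncl_mul_extraVar (z : k[G]) :
    skewIncl G hξ (groupAlgebraIncl G z) * extraVar G ξ =
      extraVar G ξ * skewIncl G hξ (groupAlgebraIncl G (charTwist (detChar G)⁻¹ z)) := by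
  induction z using MonoidAlgebra.induction_linear with
  | zero => simp
  | add x y hx hy => simp only [map_add, add_mul, mul_add, hx, hy]
  | single g c =>
    rw [charTwist_single, skewIncl_groupAlgebraIncl_single, skewIncl_groupAlgebraIncl_single,
      smul_mul_assoc, extElem_mul_extraVar, mul_smul_comm, smul_smul, hξ.zpw_zero, mul_one,
      MonoidHom.inv_apply]

theorem skewIncl_embCol_mul_extraVar (x : ι → k[G]) :
    skewIncl G hξ (embCol x) * extraVar G ξ =
      extraVar G ξ * skewIncl G hξ (embCol fun l => charTwist (detChar G)⁻¹ (x l)) := by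
  simp only [embCol_apply, map_sum, Finset.sum_mul, Finset.mul_sum, map_mul, mul_assoc,
    skewIncl_mul_extraVar]
  simp only [← mul_assoc, X_mul_extraVar]

theorem extElem_mul_skewIncl (j : ZMod m) (r : SkewGroupAlgebra G) :
    SkewMonoidAlgebra.single (extElem G hξ 1 j) 1 * skewIncl G hξ r =
      skewIncl G hξ r * SkewMonoidAlgebra.single (extElem G hξ 1 j) 1 := by
  induction r using SkewMonoidAlgebra.induction_on with
  | zero => simp
  | add x y hx hy => simp only [map_add, add_mul, mul_add, hx, hy]
  | single g f =>
    rw [skewIncl_single, SkewMonoidAlgebra.single_mul_single, SkewMonoidAlgebra.single_mul_single,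
      extElem_mul, extElem_mul, extElem_smul_rename]
    simp

theorem groupAlgebraIncl_charIdem (t : ZMod m) :
    groupAlgebraIncl (cyclicExtension G ξ) (charIdem G hξ t) = (m : k)⁻¹ • ∑ j : ZMod m,
      ((hξ.zpw (-(t * j)) : kˣ) : k) • SkewMonoidAlgebra.single (extElem G hξ 1 j) 1 := by
  simp only [charIdem, map_smul, map_sum, groupAlgebraIncl_single, SkewMonoidAlgebra.smul_single,
    MvPolynomial.smul_eq_C_mul, mul_one]

theorem charIdem_mul_skewIncl (t : ZMod m) (r : SkewGroupAlgebra G) :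
    groupAlgebraIncl (cyclicExtension G ξ) (charIdem G hξ t) * skewIncl G hξ r =
      skewIncl G hξ r * groupAlgebraIncl (cyclicExtension G ξ) (charIdem G hξ t) := by
  simp only [groupAlgebraIncl_charIdem, smul_mul_assoc, mul_smul_comm, Finset.sum_mul,
    Finset.mul_sum, extElem_mul_skewIncl]

/-- The generator of the cyclic group multiplies the variable by `ξ`, so the variable raises the
character by one; for this reason the arrows `β_i` lead from level `t` to level `t + 1`. -/
theorem charIdem_mul_extraVar (t : ZMod m) :
    groupAlgebraIncl (cyclicExtension G ξ) (charIdem G hξ (t + 1)) * extraVar G ξ =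
      extraVar G ξ * groupAlgebraIncl (cyclicExtension G ξ) (charIdem G hξ t) := by
  simp only [groupAlgebraIncl_charIdem, smul_mul_assoc, mul_smul_comm, Finset.sum_mul,
    Finset.mul_sum, extElem_mul_extraVar, smul_smul, map_one, inv_one, one_mul]
  congr 1
  refine Finset.sum_congr rfl fun j _ => ?_
  rw [← Units.val_mul, ← hξ.zpw_add]
  congr 3; ring

theorem extraVar_mul_coeff (w : SkewGroupAlgebra (cyclicExtension G ξ)) (g) :
    (extraVar G ξ * w).coeff g = MvPolynomial.X (Sum.inr ()) * w.coeff g :=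
  SkewMonoidAlgebra.coeff_single_one_mul _ _ _

theorem eq_zero_of_extraVar_mul {w : SkewGroupAlgebra (cyclicExtension G ξ)}
    (h : extraVar G ξ * w = 0) : w = 0 := by
  refine SkewMonoidAlgebra.ext fun g => ?_
  have h1 := congrArg (fun r => r.coeff g) h
  rw [extraVar_mul_coeff] at h1
  exact (mul_eq_zero.1 h1).resolve_left (MvPolynomial.X_ne_zero _)

variable [CharZero k]

theorem skewIncl_mul_charIdem_coeff (r : SkewGroupAlgebra G) (t : ZMod m) (h : G) :
    (skewIncl G hξ r * groupAlgebraIncl (cyclicExtension G ξ) (charIdem G hξ t)).coeff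
      (extElem G hξ h 0) = MvPolynomial.C (m : k)⁻¹ * MvPolynomial.rename Sum.inl (r.coeff h) := by
  classical
  induction r using SkewMonoidAlgebra.induction_on with
  | zero => simp
  | add x y hx hy =>
    simp only [map_add, add_mul, SkewMonoidAlgebra.coeff_add, Finsupp.add_apply, hx, hy, mul_add]
  | single g f =>
    have h1 : (extElem G hξ g 0)⁻¹ * extElem G hξ h 0 = extElem G hξ (g⁻¹ * h) 0 := by
      rw [inv_mul_eq_iff_eq_mul, extElem_mul, add_zero, mul_inv_cancel_left]
    rw [skewIncl_single, SkewMonoidAlgebra.coeff_single_mul, groupAlgebraIncl_coeff, h1,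
      charIdem_coeff, SkewMonoidAlgebra.coeff_single_apply]
    by_cases hg : g = h
    · subst hg
      have h2 : extElem G hξ g 0 • (MvPolynomial.C (m : k)⁻¹ : MvPolynomial (ι ⊕ Unit) k) =
        MvPolynomial.C (m : k)⁻¹ := (polyAct (extElem G hξ g 0).1).commutes _
      rw [if_pos (inv_mul_cancel g), mul_zero, neg_zero, hξ.zpw_zero, Units.val_one, mul_one, h2,
        if_pos rfl, mul_comm]
    · rw [if_neg fun h' => hg (inv_mul_eq_one.1 h'), if_neg hg, map_zero, smul_zero, mul_zero,
        map_zero, mul_zero]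

/-- The constant term with respect to the additional variable is well defined: setting that variable
to zero in the coefficient of `extElem G hξ g 0` leaves `m⁻¹` times the coefficient of `r` at `g`.
-/
theorem eq_zero_of_skewIncl_add {r : SkewGroupAlgebra G} {t : ZMod m}
    {w : SkewGroupAlgebra (cyclicExtension G ξ)}
    (h : skewIncl G hξ r * groupAlgebraIncl (cyclicExtension G ξ) (charIdem G hξ t) +
      extraVar G ξ * w = 0) : r = 0 := by
  have hm : (m : k) ≠ 0 := Nat.cast_ne_zero.2 (NeZero.ne m)
  refine SkewMonoidAlgebra.ext fun g => ?_
  have h1 := congrArg (fun r => MvPolynomial.aeval (Sum.elim (MvPolynomial.X) 0 :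
    ι ⊕ Unit → MvPolynomial ι k) (r.coeff (extElem G hξ g 0))) h
  simp only [SkewMonoidAlgebra.coeff_add, Finsupp.add_apply, skewIncl_mul_charIdem_coeff,
    extraVar_mul_coeff, map_add, map_mul, MvPolynomial.aeval_X, Sum.elim_inr, Pi.zero_apply,
    zero_mul, add_zero, MvPolynomial.aeval_rename, Sum.elim_comp_inl, MvPolynomial.algHom_C,
    MvPolynomial.aeval_X_left_apply, SkewMonoidAlgebra.coeff_zero, Finsupp.zero_apply,
    map_zero] at h1
  refine (mul_eq_zero.1 h1).resolve_left ?_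
  simpa [MvPolynomial.algebraMap_eq] using hm

theorem extElem_eq_sum (j : ZMod m) : (SkewMonoidAlgebra.single (extElem G hξ 1 j) 1 :
    SkewGroupAlgebra (cyclicExtension G ξ)) = ∑ t, ((hξ.zpw (t * j) : kˣ) : k) •
      groupAlgebraIncl (cyclicExtension G ξ) (charIdem G hξ t) := by
  have h : (MonoidAlgebra.single (extElem G hξ 1 j) 1 : k[cyclicExtension G ξ]) =
      ∑ t, (hξ.zpw (t * j) : k) • charIdem G hξ t := by
    simp only [← extElem_mul_charIdem]
    rw [← Finset.mul_sum, sum_charIdem, mul_one]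
  have h1 := congrArg (groupAlgebraIncl (cyclicExtension G ξ)) h
  rw [groupAlgebraIncl_single, map_one] at h1
  simpa only [map_sum, map_smul] using h1

/-- Induction for elements of `k[V ⊕ k] * G̃`, which are sums of elements `x ^ n r ε_t` with
`r ∈ k[V] * G`. -/
theorem skewExtension_induction {P : SkewGroupAlgebra (cyclicExtension G ξ) → Prop}
    (z : SkewGroupAlgebra (cyclicExtension G ξ)) (zero : P 0)
    (add : ∀ x y, P x → P y → P (x + y)) (smul : ∀ (c : k) x, P x → P (c • x))
    (mem : ∀ n r t, P (extraVar G ξ ^ n * skewIncl G hξ r *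
      groupAlgebraIncl (cyclicExtension G ξ) (charIdem G hξ t))) : P z := by
  let M : Submodule k (SkewGroupAlgebra (cyclicExtension G ξ)) :=
    { carrier := {x | P x}
      zero_mem' := zero
      add_mem' := fun {x y} hx hy => add x y hx hy
      smul_mem' := fun c x hx => smul c x hx }
  have hmem : ∀ n r t, extraVar G ξ ^ n * skewIncl G hξ r *
      groupAlgebraIncl (cyclicExtension G ξ) (charIdem G hξ t) ∈ M := mem
  have hX : ∀ (l : ι) (n : ℕ), skewIncl G hξ (SkewMonoidAlgebra.single 1 (MvPolynomial.X l)) *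
      extraVar G ξ ^ n = extraVar G ξ ^ n *
        skewIncl G hξ (SkewMonoidAlgebra.single 1 (MvPolynomial.X l)) := fun l n =>
    (show Commute _ _ from X_mul_extraVar hξ l).pow_right n
  have hmul : ∀ (p : MvPolynomial (ι ⊕ Unit) k) n r t, SkewMonoidAlgebra.single 1 p *
      (extraVar G ξ ^ n * skewIncl G hξ r *
        groupAlgebraIncl (cyclicExtension G ξ) (charIdem G hξ t)) ∈ M := by
    intro p
    induction p using MvPolynomial.induction_on with
    | C c =>
      intro n r t
      have h : (SkewMonoidAlgebra.single 1 (MvPolynomial.C c) :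
          SkewGroupAlgebra (cyclicExtension G ξ)) = c • 1 := by
        rw [SkewMonoidAlgebra.one_def, SkewMonoidAlgebra.smul_single, MvPolynomial.smul_eq_C_mul,
          mul_one]
      rw [h, smul_mul_assoc, one_mul]
      exact M.smul_mem c (hmem n r t)
    | add p q hp hq =>
      intro n r t
      rw [SkewMonoidAlgebra.single_add, add_mul]
      exact M.add_mem (hp n r t) (hq n r t)
    | mul_X p i hp =>
      intro n r t
      have h : (SkewMonoidAlgebra.single 1 (p * MvPolynomial.X i) :
          SkewGroupAlgebra (cyclicExtension G ξ)) = SkewMonoidAlgebra.single 1 p *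
            SkewMonoidAlgebra.single 1 (MvPolynomial.X i) := by
        rw [SkewMonoidAlgebra.single_mul_single, one_smul, one_mul]
      rw [h, mul_assoc]
      rcases i with l | ⟨⟩
      · have h1 : (SkewMonoidAlgebra.single 1 (MvPolynomial.X (Sum.inl l)) :
            SkewGroupAlgebra (cyclicExtension G ξ)) =
            skewIncl G hξ (SkewMonoidAlgebra.single 1 (MvPolynomial.X l)) := by
          rw [skewIncl_single, extElem_one, MvPolynomial.rename_X]
        have h2 := hp n (SkewMonoidAlgebra.single 1 (MvPolynomial.X l) * r) t
        rw [map_mul, ← mul_assoc (extraVar G ξ ^ n), ← hX, mul_assoc (skewIncl G hξ _),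
          mul_assoc (skewIncl G hξ _)] at h2
        rw [h1]
        exact h2
      · have h1 := hp (n + 1) r t
        rw [pow_succ', mul_assoc (extraVar G ξ), mul_assoc (extraVar G ξ)] at h1
        exact h1
  change z ∈ M
  induction z using SkewMonoidAlgebra.induction_on with
  | zero => exact M.zero_mem
  | add x y hx hy => exact M.add_mem hx hy
  | single g p =>
    obtain ⟨g, j, rfl⟩ := exists_extElem hξ g
    have h : (SkewMonoidAlgebra.single (extElem G hξ g j) p :
        SkewGroupAlgebra (cyclicExtension G ξ)) = SkewMonoidAlgebra.single 1 p *
          (skewIncl G hξ (SkewMonoidAlgebra.single g 1) *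
            SkewMonoidAlgebra.single (extElem G hξ 1 j) 1) := by
      rw [skewIncl_single, SkewMonoidAlgebra.single_mul_single,
        SkewMonoidAlgebra.single_mul_single, extElem_mul]
      simp
    rw [h, extElem_eq_sum, Finset.mul_sum, Finset.mul_sum]
    refine M.sum_mem fun t _ => ?_
    rw [mul_smul_comm, mul_smul_comm]
    refine M.smul_mem _ ?_
    have h1 := hmul p 0 (SkewMonoidAlgebra.single g 1) t
    rwa [pow_zero, one_mul] at h1

end SkewExtension

end

/-! ### Copies of `Q` and normal forms in the quiver algebra of `G̃` -/

noncomputable section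

open PathAlgebra ArrowQuiver

section Copies

variable {k : Type u} [Field k] {V : Type v} {A : Type w} {Q : ArrowQuiver V A}
  (ν : Equiv.Perm V) (m : ℕ)

theorem copy_single (t : ZMod m) (p : Q.QPath) (c : k) :
    copy ν m t (PathAlgebra.single p c) = PathAlgebra.single (p.copy ν m t) c := by
  rw [copy, lift_single, PathAlgebra.smul_single, mul_one]

theorem copy_vertex (t : ZMod m) (i : V) :
    copy ν m t (vertex k Q i) = vertex k (Q.tilde ν m) (i, t) :=
  copy_single ν m t _ 1

theorem copy_arrow (t : ZMod m) (a : A) :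
    copy ν m t (arrow k Q a) = alphaArrow ν m k Q a t :=
  copy_single ν m t _ 1

variable [Fintype V] [NeZero m]

theorem copy_mul (t : ZMod m) (x y : PathAlgebra k Q) :
    copy ν m t (x * y) = copy ν m t x * copy ν m t y := by
  induction x using PathAlgebra.induction_linear with
  | zero => simp
  | add x x' hx hx' => simp only [add_mul, map_add, hx, hx']
  | single p c =>
    induction y using PathAlgebra.induction_linear with
    | zero => simp
    | add y y' hy hy' => simp only [mul_add, map_add, hy, hy']
    | single q d =>
      rw [copy_single, copy_single]
      by_cases h : p.source = q.target
      · have h' : (p.copy ν m t).source = (q.copy ν m t).target := congrArg (fun i => (i, t)) h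
        rw [single_mul_single_of_eq p q h, single_mul_single_of_eq _ _ h', copy_single]
        congr 1
        exact QPath.ext rfl rfl (List.map_append ..)
      · have h' : ¬ (p.copy ν m t).source = (q.copy ν m t).target :=
          fun h' => h (congrArg Prod.fst h')
        rw [PathAlgebra.single_mul_single_of_ne p q h,
          PathAlgebra.single_mul_single_of_ne _ _ h', map_zero]

theorem copy_mul_of_ne {s t : ZMod m} (h : s ≠ t) (x y : PathAlgebra k Q) :
    copy ν m s x * copy ν m t y = 0 := by
  induction x using PathAlgebra.induction_linear with
  | zero => simp
  | add x x' hx hx' => simp only [add_mul, map_add, hx, hx', add_zero]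
  | single p c =>
    induction y using PathAlgebra.induction_linear with
    | zero => simp
    | add y y' hy hy' => simp only [mul_add, map_add, hy, hy', add_zero]
    | single q d =>
      rw [copy_single, copy_single]
      exact PathAlgebra.single_mul_single_of_ne _ _ (fun h' => h (congrArg Prod.snd h')) _ _

/-- The sum of the arrows `(β_i, t)`. -/
def betaSum (k : Type u) [Field k] (Q : ArrowQuiver V A) : PathAlgebra k (Q.tilde ν m) :=
  ∑ x : V × ZMod m, betaArrow ν m k Q x.1 x.2

theorem betaSum_mul_vertex (i : V) (t : ZMod m) :
    betaSum ν m k Q * vertex k (Q.tilde ν m) (i, t) = betaArrow ν m k Q i t := by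
  classical
  rw [betaSum, Finset.sum_mul, Finset.sum_eq_single (i, t)]
  · exact arrow_mul_vertex_src (Q := Q.tilde ν m) (.inr (i, t))
  · intro x _ hx
    exact (arrow_mul_vertex (Q := Q.tilde ν m) (i, t) (.inr x)).trans (if_neg hx)
  · simp

theorem vertex_mul_betaSum (i : V) (t : ZMod m) :
    vertex k (Q.tilde ν m) (ν i, t + 1) * betaSum ν m k Q = betaArrow ν m k Q i t := by
  classical
  rw [betaSum, Finset.mul_sum, Finset.sum_eq_single (i, t)]
  · exact vertex_tgt_mul_arrow (Q := Q.tilde ν m) (.inr (i, t))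
  · intro x _ hx
    refine (vertex_mul_arrow (Q := Q.tilde ν m) (ν i, t + 1) (.inr x)).trans (if_neg fun h => hx ?_)
    have h1 : (ν i, t + 1) = (ν x.1, x.2 + 1) := h
    rw [Prod.mk.injEq] at h1
    exact Prod.ext (ν.injective h1.1).symm (add_right_cancel h1.2).symm
  · simp

end Copies

theorem NakayamaAutomorphism.vertex_mul_dualInv {k : Type u} [Field k] {V : Type v} {A : Type w}
    [Fintype V] [Fintype A] {Q : ArrowQuiver V A} {θ : Set (PathAlgebra k Q)}
    (ν : NakayamaAutomorphism k Q θ) (hθ : θ ⊆ degree k Q 2) (α : A) :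
    vertex k Q (ν.onVertices.symm (Q.tgt α)) * ofArrows k Q (ν.dualInv α) =
      ofArrows k Q (ν.dualInv α) := by
  classical
  rw [ofArrows_apply, Finset.mul_sum]
  refine Finset.sum_congr rfl fun γ _ => ?_
  rw [mul_smul_comm]
  by_cases h : ν.dualInv α γ = 0
  · rw [h, zero_smul, zero_smul]
  · rw [(ν.onArrows_endpoints hθ h).1, Equiv.symm_apply_apply, vertex_tgt_mul_arrow]

section NormalForm

variable {k : Type u} [Field k] {V : Type v} {A : Type w} [Fintype V] [Fintype A]
  {Q : ArrowQuiver V A} {θ : Set (PathAlgebra k Q)} (ν : NakayamaAutomorphism k Q θ)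
  (hθ : θ ⊆ degree k Q 2) (m : ℕ) [NeZero m] (ρ : Set (PathAlgebra k Q)) (c : k)

theorem mk_copy_eq_zero {y : PathAlgebra k Q} (t : ZMod m) (hy : BoundQuiverAlgebra.mk ρ y = 0) :
    BoundQuiverAlgebra.mk (commutationRelations ν m ρ c ν.dualInv) (copy ν.onVertices m t y) = 0 :=
  mem_of_mk_eq_zero hy (LinearMap.ker ((BoundQuiverAlgebra.mk
      (commutationRelations ν m ρ c ν.dualInv)).toLinearMap ∘ₗ copy ν.onVertices m t))
    (fun r hr => mk_eq_zero_of_mem (Set.mem_iUnion.2 ⟨t, Or.inl ⟨r, hr, rfl⟩⟩))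
    (fun y x hx => by
      change BoundQuiverAlgebra.mk _ (copy ν.onVertices m t (y * x)) = 0
      rw [copy_mul, map_mul, show BoundQuiverAlgebra.mk _ (copy ν.onVertices m t x) = 0 from hx,
        mul_zero])
    (fun y x hx => by
      change BoundQuiverAlgebra.mk _ (copy ν.onVertices m t (x * y)) = 0
      rw [copy_mul, map_mul, show BoundQuiverAlgebra.mk _ (copy ν.onVertices m t x) = 0 from hx,
        zero_mul])

theorem copy_arrow_mul_betaSum (t : ZMod m) (α : A) :
    copy ν.onVertices m t (arrow k Q α) * betaSum ν.onVertices m k Q =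
      alphaArrow ν.onVertices m k Q α t *
          betaArrow ν.onVertices m k Q (ν.onVertices.symm (Q.src α)) (t - 1) := by
  rw [← vertex_mul_betaSum, sub_add_cancel, Equiv.apply_symm_apply, ← mul_assoc, copy_arrow]
  congr 1
  exact (arrow_mul_vertex_src _).symm

theorem copy_vertex_mul_betaSum (t : ZMod m) (i : V) :
    copy ν.onVertices m t (vertex k Q i) * betaSum ν.onVertices m k Q =
      betaSum ν.onVertices m k Q *
        copy ν.onVertices m (t - 1) (vertex k Q (ν.onVertices.symm i)) := by
  rw [copy_vertex, copy_vertex, betaSum_mul_vertex, ← vertex_mul_betaSum, sub_add_cancel,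
    Equiv.apply_symm_apply]

-- The commutation relations say exactly how an arrow moves past the sum of all `β`; the projection
-- to a single `β_i` is supplied by the endpoints of the arrow.
include hθ in
theorem mk_copy_arrow_mul_betaSum (t : ZMod m) (α : A) :
    BoundQuiverAlgebra.mk (commutationRelations ν m ρ c ν.dualInv)
      (copy ν.onVertices m t (arrow k Q α) * betaSum ν.onVertices m k Q) =
    BoundQuiverAlgebra.mk (commutationRelations ν m ρ c ν.dualInv)
      (betaSum ν.onVertices m k Q *
        copy ν.onVertices m (t - 1) (c • ofArrows k Q (ν.dualInv α))) := by
  rw [copy_arrow_mul_betaSum, ← sub_eq_zero, ← map_sub, ← ν.vertex_mul_dualInv hθ, map_smul,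
    copy_mul, copy_vertex, mul_smul_comm, ← mul_assoc, betaSum_mul_vertex]
  exact mk_eq_zero_of_mem (Set.mem_iUnion.2 ⟨t, Or.inr ⟨α, rfl⟩⟩)

/-- Elements of the bound quiver algebra that are polynomials of degree less than `n` in the sum of
the arrows `(β_i, t)`, with coefficients from the copies of `Q` on the right. -/
def IsNormal : ℕ → BoundQuiverAlgebra k (Q.tilde ν.onVertices m)
    (commutationRelations ν m ρ c ν.dualInv) → Prop
  | 0, a => a = 0
  | n + 1, a => ∃ (y : ZMod m → PathAlgebra k Q) (a' : _), IsNormal n a' ∧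
    a = .mk _ (∑ t, copy ν.onVertices m t (y t)) + .mk _ (betaSum ν.onVertices m k Q) * a'

variable {ν m ρ c}

theorem IsNormal.succ {n : ℕ} {a} (h : IsNormal ν m ρ c n a) : IsNormal ν m ρ c (n + 1) a := by
  induction n generalizing a with
  | zero =>
    refine ⟨0, 0, rfl, ?_⟩
    rw [show a = 0 from h]; simp
  | succ n ih =>
    obtain ⟨y, a', ha', rfl⟩ := h
    exact ⟨y, a', ih ha', rfl⟩

theorem IsNormal.mono {n n' : ℕ} (hn : n ≤ n') {a} (h : IsNormal ν m ρ c n a) :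
    IsNormal ν m ρ c n' a := by
  induction hn with
  | refl => exact h
  | step _ ih => exact ih.succ

theorem IsNormal.add {n : ℕ} {a b} (ha : IsNormal ν m ρ c n a) (hb : IsNormal ν m ρ c n b) :
    IsNormal ν m ρ c n (a + b) := by
  induction n generalizing a b with
  | zero => rw [show a = 0 from ha, show b = 0 from hb]; exact add_zero 0
  | succ n ih =>
    obtain ⟨y, a', ha', rfl⟩ := ha
    obtain ⟨z, b', hb', rfl⟩ := hb
    refine ⟨y + z, a' + b', ih ha' hb', ?_⟩
    simp only [Pi.add_apply, map_add, Finset.sum_add_distrib, mul_add]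
    exact add_add_add_comm _ _ _ _

theorem IsNormal.smul {n : ℕ} {a} (d : k) (ha : IsNormal ν m ρ c n a) :
    IsNormal ν m ρ c n (d • a) := by
  induction n generalizing a with
  | zero => rw [show a = 0 from ha]; exact smul_zero d
  | succ n ih =>
    obtain ⟨y, a', ha', rfl⟩ := ha
    refine ⟨d • y, d • a', ih ha', ?_⟩
    simp only [Pi.smul_apply, map_smul, ← Finset.smul_sum, mul_smul_comm, smul_add]

theorem IsNormal.betaSum_mul {n : ℕ} {a} (ha : IsNormal ν m ρ c n a) :
    IsNormal ν m ρ c (n + 1) (.mk _ (betaSum ν.onVertices m k Q) * a) :=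
  ⟨0, a, ha, by simp⟩

theorem copy_mul_sum (t : ZMod m) (x : PathAlgebra k Q) (y : ZMod m → PathAlgebra k Q) :
    copy ν.onVertices m t x * ∑ s, copy ν.onVertices m s (y s) =
      copy ν.onVertices m t (x * y t) := by
  rw [Finset.mul_sum, Finset.sum_eq_single t, copy_mul]
  · exact fun s _ hs => copy_mul_of_ne _ _ (Ne.symm hs) _ _
  · simp

theorem sum_copy_single (t : ZMod m) (x : PathAlgebra k Q) :
    ∑ s, copy ν.onVertices m s ((Pi.single t x : ZMod m → PathAlgebra k Q) s) =
      copy ν.onVertices m t x := by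
  rw [Finset.sum_eq_single t, Pi.single_eq_same]
  · intro s _ hs; rw [Pi.single_eq_of_ne hs, map_zero]
  · simp

theorem isNormal_copy (t : ZMod m) (x : PathAlgebra k Q) :
    IsNormal ν m ρ c 1 (.mk _ (copy ν.onVertices m t x)) :=
  ⟨Pi.single t x, 0, rfl, by rw [sum_copy_single, mul_zero, add_zero]⟩

/-- Elements of `X` can be moved past the sum of the `β` without leaving `X`. It is applied to the
linear combinations of arrows and to the trivial paths. -/
theorem IsNormal.copy_mul {X : Set (PathAlgebra k Q)} (hX : ∀ x ∈ X, ∀ t, ∃ x' ∈ X,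
      BoundQuiverAlgebra.mk (commutationRelations ν m ρ c ν.dualInv)
        (copy ν.onVertices m t x * betaSum ν.onVertices m k Q) =
      BoundQuiverAlgebra.mk (commutationRelations ν m ρ c ν.dualInv)
        (betaSum ν.onVertices m k Q * copy ν.onVertices m (t - 1) x'))
    {n : ℕ} {a} (t : ZMod m) {x : PathAlgebra k Q} (hx : x ∈ X) (ha : IsNormal ν m ρ c n a) :
    IsNormal ν m ρ c n (.mk _ (copy ν.onVertices m t x) * a) := by
  induction n generalizing a t x with
  | zero => rw [show a = 0 from ha]; exact mul_zero _
  | succ n ih =>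
    obtain ⟨y, a', ha', rfl⟩ := ha
    obtain ⟨x', hx', h⟩ := hX x hx t
    refine ⟨Pi.single t (x * y t), .mk _ (copy ν.onVertices m (t - 1) x') * a',
      ih _ hx' ha', ?_⟩
    rw [sum_copy_single, mul_add, ← map_mul, copy_mul_sum, ← mul_assoc, ← mul_assoc, ← map_mul,
      ← map_mul, h]

include hθ in
theorem exists_copy_ofArrows_mul_betaSum (x : A →₀ k) (t : ZMod m) :
    ∃ x' ∈ Set.range (ofArrows k Q),
      BoundQuiverAlgebra.mk (commutationRelations ν m ρ c ν.dualInv)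
        (copy ν.onVertices m t (ofArrows k Q x) * betaSum ν.onVertices m k Q) =
      BoundQuiverAlgebra.mk (commutationRelations ν m ρ c ν.dualInv)
        (betaSum ν.onVertices m k Q * copy ν.onVertices m (t - 1) x') := by
  refine ⟨_, ⟨∑ α, x α • c • ν.dualInv α, rfl⟩, ?_⟩
  rw [ofArrows_apply, map_sum, Finset.sum_mul, map_sum, map_sum, map_sum, Finset.mul_sum, map_sum]
  refine Finset.sum_congr rfl fun α _ => ?_
  rw [map_smul, map_smul, map_smul, smul_mul_assoc, mul_smul_comm, map_smul, map_smul,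
    mk_copy_arrow_mul_betaSum ν hθ, map_smul (ofArrows k Q)]

-- Arrows of the copies of `Q` are moved to the right of all `β`. The sum of all `β` serves as a
-- single variable, with `β_i` in level `t` its product with a trivial path.
include hθ in
theorem exists_isNormal (a) : ∃ n, IsNormal ν m ρ c n a := by
  obtain ⟨x, rfl⟩ := mk_surjective _ a
  induction x using induction_arrow with
  | zero => exact ⟨0, map_zero _⟩
  | add x y hx hy =>
    obtain ⟨n, hn⟩ := hx
    obtain ⟨n', hn'⟩ := hy
    rw [map_add]
    exact ⟨max n n', (hn.mono (le_max_left _ _)).add (hn'.mono (le_max_right _ _))⟩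
  | smul d x hx =>
    obtain ⟨n, hn⟩ := hx
    rw [map_smul]
    exact ⟨n, hn.smul d⟩
  | vertex i =>
    obtain ⟨i, t⟩ := i
    rw [← copy_vertex]
    exact ⟨1, isNormal_copy t _⟩
  | arrow_mul a x hx =>
    obtain ⟨n, hn⟩ := hx
    rw [map_mul]
    rcases a with ⟨α, t⟩ | ⟨i, t⟩
    · refine ⟨n, ?_⟩
      have h := IsNormal.copy_mul (X := Set.range (ofArrows k Q)) (by
        rintro _ ⟨x, rfl⟩ t
        exact exists_copy_ofArrows_mul_betaSum hθ x t) t ⟨Finsupp.single α 1, rfl⟩ hn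
      rwa [show ofArrows k Q (Finsupp.single α 1) = arrow k Q α by simp [ofArrows],
        copy_arrow] at h
    · refine ⟨n + 1, ?_⟩
      have h := IsNormal.copy_mul (X := Set.range (vertex k Q)) (by
        rintro _ ⟨i, rfl⟩ t
        exact ⟨_, ⟨_, rfl⟩, congrArg _ (copy_vertex_mul_betaSum ν m t i)⟩) t ⟨i, rfl⟩ hn
      have h1 := h.betaSum_mul
      rwa [← mul_assoc, ← map_mul, copy_vertex, betaSum_mul_vertex] at h1

end NormalForm

/-! ### Recognition of twisted extensions -/

/-- The element `b`, which stands for the sum of the arrows `(β_i, t)`, and the idempotents `E t`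
in an algebra that contains the algebra of the bound quiver `(Q, ρ)`. -/
structure IsTwistedExtension {k : Type u} [Field k] {V : Type v} {A : Type w} [Fintype V]
    [Fintype A] {Q : ArrowQuiver V A} {ρ θ : Set (PathAlgebra k Q)} (ν : NakayamaAutomorphism k Q θ)
    (m : ℕ) [NeZero m] (c : k) {R : Type*} [Ring R] [Algebra k R]
    (Ψ : BoundQuiverAlgebra k Q ρ →ₙₐ[k] R) (E : ZMod m → R) (b : R) : Prop where
  ortho : ∀ s t, E s * E t = if s = t then E t else 0
  sum_eq : ∑ t, E t = 1
  comm : ∀ t y, E t * Ψ y = Ψ y * E t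
  shift : ∀ t, E (t + 1) * b = b * E t
  mul_one : b * Ψ 1 = b
  vertex_mul : ∀ i, Ψ (.mk ρ (vertex k Q (ν.onVertices i))) * b = b * Ψ (.mk ρ (vertex k Q i))
  arrow_mul : ∀ α, Ψ (.mk ρ (arrow k Q α)) * b = c • (b * Ψ (.mk ρ (ofArrows k Q (ν.dualInv α))))
  -- This condition and `cancel` make the powers of `b` independent, which gives injectivity;
  -- `generate` gives the image.
  eq_zero : ∀ y t w, Ψ y * E t + b * w = 0 → y = 0
  cancel : ∀ w, b * w = 0 → Ψ 1 * w = w → w = 0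
  generate : ∀ N : Submodule k R, (∀ y t, Ψ y * E t ∈ N) → (∀ z ∈ N, b * z ∈ N) →
    ∀ z, Ψ 1 * z * Ψ 1 ∈ N

namespace IsTwistedExtension

variable {k : Type u} [Field k] {V : Type v} {A : Type w} [Fintype V] [Fintype A]
  {Q : ArrowQuiver V A} {ρ θ : Set (PathAlgebra k Q)} {ν : NakayamaAutomorphism k Q θ}
  {m : ℕ} [NeZero m] {c : k} {R : Type*} [Ring R] [Algebra k R]
  {Ψ : BoundQuiverAlgebra k Q ρ →ₙₐ[k] R} {E : ZMod m → R} {b : R}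
  (h : IsTwistedExtension ν m c Ψ E b)
include h

/-- The idempotent of the extended algebra that belongs to a vertex. -/
def idem (_h : IsTwistedExtension ν m c Ψ E b) (x : V × ZMod m) : R :=
  Ψ (.mk ρ (vertex k Q x.1)) * E x.2

/-- The element of the extended algebra that belongs to an arrow. -/
def arr (_h : IsTwistedExtension ν m c Ψ E b) : A × ZMod m ⊕ V × ZMod m → R
  | .inl (α, t) => Ψ (.mk ρ (arrow k Q α)) * E t
  | .inr (i, t) => b * (Ψ (.mk ρ (vertex k Q i)) * E t)

theorem mul_E_mul (x y : BoundQuiverAlgebra k Q ρ) (s t : ZMod m) :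
    Ψ x * E s * (Ψ y * E t) = if s = t then Ψ (x * y) * E t else 0 := by
  rw [mul_assoc, ← mul_assoc (E s), h.comm, mul_assoc, h.ortho, ← mul_assoc, ← map_mul]
  split_ifs <;> simp

theorem orthogonal : OrthogonalIdempotents h.idem := by
  classical
  refine ⟨fun x => ?_, fun x y hxy => ?_⟩
  · change Ψ _ * E _ * (Ψ _ * E _) = _
    rw [h.mul_E_mul, if_pos rfl, ← map_mul, vertex_mul_vertex, if_pos rfl]; rfl
  · change Ψ _ * E _ * (Ψ _ * E _) = _
    rw [h.mul_E_mul, ← map_mul, vertex_mul_vertex]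
    split_ifs with h1 h2
    · exact absurd (Prod.ext h2 h1) hxy
    · simp
    · rfl

theorem tgt_mul (a) : h.idem ((Q.tilde ν.onVertices m).tgt a) * h.arr a = h.arr a := by
  rcases a with ⟨α, t⟩ | ⟨i, t⟩
  · refine (h.mul_E_mul _ _ t t).trans ?_
    change _ = Ψ _ * E _
    rw [if_pos rfl, ← map_mul (BoundQuiverAlgebra.mk ρ)]
    exact congrArg (fun x => Ψ (.mk ρ x) * E t) (vertex_tgt_mul_arrow α)
  · classical
    change Ψ (.mk ρ (vertex k Q (ν.onVertices i))) * E (t + 1) * (b * (Ψ _ * E t)) = b * (Ψ _ * E t)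
    rw [mul_assoc, ← mul_assoc (E (t + 1)), h.shift, mul_assoc b, ← mul_assoc _ b, h.vertex_mul,
      mul_assoc b, ← mul_assoc _ (E t), h.mul_E_mul, if_pos rfl, ← map_mul, vertex_mul_vertex, if_pos rfl]

theorem mul_src (a) : h.arr a * h.idem ((Q.tilde ν.onVertices m).src a) = h.arr a := by
  rcases a with ⟨α, t⟩ | ⟨i, t⟩
  · refine (h.mul_E_mul _ _ t t).trans ?_
    change _ = Ψ _ * E _
    rw [if_pos rfl, ← map_mul (BoundQuiverAlgebra.mk ρ)]
    exact congrArg (fun x => Ψ (.mk ρ x) * E t) (arrow_mul_vertex_src α)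
  · classical
    change b * (Ψ (.mk ρ (vertex k Q i)) * E t) * (Ψ (.mk ρ (vertex k Q i)) * E t) = b * (Ψ _ * E t)
    rw [mul_assoc, h.mul_E_mul, if_pos rfl, ← map_mul, vertex_mul_vertex, if_pos rfl]

/-- The homomorphism from the path algebra to the extended algebra. -/
def hom (h : IsTwistedExtension ν m c Ψ E b) :
    PathAlgebra k (Q.tilde ν.onVertices m) →ₙₐ[k] R :=
  liftHom k h.idem h.orthogonal h.arr h.tgt_mul

theorem hom_vertex (x : V × ZMod m) : h.hom (vertex k _ x) = h.idem x := liftHom_vertex ..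

theorem hom_arrow (a) : h.hom (arrow k _ a) = h.arr a :=
  liftHom_arrow _ h.orthogonal _ _ h.mul_src a

theorem hom_copy (t : ZMod m) (y : PathAlgebra k Q) :
    h.hom (copy ν.onVertices m t y) = Ψ (.mk ρ y) * E t := by
  induction y using induction_arrow with
  | zero => simp
  | add x y hx hy => simp only [map_add, hx, hy, add_mul]
  | smul c x hx => simp only [map_smul, hx, smul_mul_assoc]
  | vertex i => rw [copy_vertex, hom_vertex]; rfl
  | arrow_mul a x hx =>
    rw [copy_mul, map_mul, hx, copy_arrow, alphaArrow, hom_arrow]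
    refine (h.mul_E_mul _ _ t t).trans ?_
    rw [if_pos rfl, map_mul (BoundQuiverAlgebra.mk ρ)]

/-- The homomorphisms do not preserve units: `Ψ 1` is the idempotent that cuts out the corner which
will be the image. -/
theorem hom_one : h.hom 1 = Ψ 1 := by
  have h2 : (1 : BoundQuiverAlgebra k Q ρ) = .mk ρ (∑ i, vertex k Q i) :=
    (map_one (BoundQuiverAlgebra.mk ρ)).symm
  rw [PathAlgebra.one_def, map_sum]
  simp only [hom_vertex, idem]
  rw [Fintype.sum_prod_type]
  simp only [← Finset.mul_sum, h.sum_eq, _root_.mul_one]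
  rw [h2, map_sum, map_sum]

theorem hom_betaSum : h.hom (betaSum ν.onVertices m k Q) = b := by
  rw [betaSum, map_sum]
  have h1 : ∀ x : V × ZMod m, h.hom (betaArrow ν.onVertices m k Q x.1 x.2) =
      b * h.hom (vertex k _ x) := fun x => (h.hom_arrow _).trans (by rw [hom_vertex]; rfl)
  simp only [h1]
  rw [← Finset.mul_sum, ← map_sum, ← PathAlgebra.one_def, hom_one, h.mul_one]

theorem hom_eq_zero (hθ : θ ⊆ degree k Q 2) :
    ∀ r ∈ commutationRelations ν m ρ c ν.dualInv, h.hom r = 0 := by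
  intro r hr
  obtain ⟨t, ⟨ϱ, hϱ, rfl⟩ | ⟨α, rfl⟩⟩ := Set.mem_iUnion.1 hr
  · rw [hom_copy, mk_eq_zero_of_mem hϱ, map_zero, zero_mul]
  · have h1 : h.arr (.inl (α, t)) * h.arr (.inr (ν.onVertices.symm (Q.src α), t - 1)) =
        Ψ (.mk ρ (arrow k Q α)) * b * E (t - 1) := by
      change Ψ _ * E t * (b * (Ψ _ * E (t - 1))) = _
      have h2 := h.shift (t - 1)
      have h3 := h.vertex_mul (ν.onVertices.symm (Q.src α))
      rw [sub_add_cancel] at h2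
      rw [Equiv.apply_symm_apply] at h3
      rw [← h.comm (t - 1), ← mul_assoc b, mul_assoc, ← mul_assoc (E t), ← mul_assoc (E t), h2,
        mul_assoc b, h.ortho, if_pos rfl, mul_assoc b, h.comm, ← mul_assoc b, ← h3,
        ← mul_assoc, ← mul_assoc, ← map_mul, ← map_mul, arrow_mul_vertex_src]
    have h2 : h.arr (.inr (ν.onVertices.symm (Q.tgt α), t - 1)) *
        (Ψ (.mk ρ (ofArrows k Q (ν.dualInv α))) * E (t - 1)) =
        b * Ψ (.mk ρ (ofArrows k Q (ν.dualInv α))) * E (t - 1) := by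
      change b * (Ψ _ * E (t - 1)) * _ = _
      rw [mul_assoc, h.mul_E_mul, if_pos rfl, ← map_mul, ν.vertex_mul_dualInv hθ, mul_assoc]
    rw [map_sub, map_mul, map_smul, map_mul, alphaArrow, betaArrow, betaArrow, hom_arrow,
      hom_arrow, hom_arrow, hom_copy, h1, h2, h.arrow_mul, smul_mul_assoc, sub_self]

/-- Multiplication by `E t` isolates one copy of the constant term, which vanishes by `eq_zero`.
Then `b` is cancelled and the induction continues with the remaining polynomial. -/
theorem eq_zero_of_isNormal {φ : BoundQuiverAlgebra k (Q.tilde ν.onVertices m)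
      (commutationRelations ν m ρ c ν.dualInv) →ₙₐ[k] R} (hφ : ∀ x, φ (.mk _ x) = h.hom x)
    {n : ℕ} {a} (ha : IsNormal ν m ρ c n a) (h0 : φ a = 0) : a = 0 := by
  induction n generalizing a with
  | zero => exact ha
  | succ n ih =>
    obtain ⟨y, a', ha', rfl⟩ := ha
    have h1 : ∑ t, Ψ (.mk ρ (y t)) * E t + b * φ a' = 0 := by
      rw [map_add, map_mul φ, hφ, hφ, hom_betaSum, map_sum] at h0
      simpa only [hom_copy] using h0
    have h2 : ∀ t, BoundQuiverAlgebra.mk ρ (y t) = 0 := by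
      intro t
      refine h.eq_zero _ t (φ a' * E t) ?_
      have h3 := congrArg (· * E t) h1
      simp only [add_mul, Finset.sum_mul, zero_mul, mul_assoc, h.ortho] at h3
      rw [Finset.sum_eq_single t] at h3
      · rwa [if_pos rfl] at h3
      · intro s _ hs; rw [if_neg hs, mul_zero]
      · simp
    have h3 : b * φ a' = 0 := by
      simpa only [h2, map_zero, zero_mul, Finset.sum_const_zero, zero_add] using h1
    have h4 : a' = 0 := by
      refine ih ha' (h.cancel _ h3 ?_)
      obtain ⟨x, rfl⟩ := mk_surjective _ a'
      rw [hφ, ← h.hom_one, ← map_mul, _root_.one_mul]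
    rw [h4, mul_zero, add_zero, map_sum]
    exact Finset.sum_eq_zero fun t _ => mk_copy_eq_zero ν m ρ c t (h2 t)

theorem exists_iso (hθ : θ ⊆ degree k Q 2) :
    ∃ φ : BoundQuiverAlgebra k (Q.tilde ν.onVertices m)
        (commutationRelations ν m ρ c ν.dualInv) →ₙₐ[k] R,
      (∀ x, φ (.mk _ (vertex k _ x)) = h.idem x) ∧ (∀ a, φ (.mk _ (arrow k _ a)) = h.arr a) ∧
      Function.Injective φ ∧ Set.range φ = {z | Ψ 1 * z * Ψ 1 = z} := by
  obtain ⟨φ, hφ⟩ := exists_lift_quot h.hom (h.hom_eq_zero hθ)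
  refine ⟨φ, fun x => (hφ _).trans (h.hom_vertex x), fun a => (hφ _).trans (h.hom_arrow a), ?_, ?_⟩
  · rw [injective_iff_map_eq_zero]
    intro a ha
    obtain ⟨n, hn⟩ := exists_isNormal hθ a
    exact h.eq_zero_of_isNormal hφ hn ha
  · ext z
    constructor
    · rintro ⟨a, rfl⟩
      obtain ⟨x, rfl⟩ := mk_surjective _ a
      rw [Set.mem_ofPred_eq, hφ, ← h.hom_one, ← map_mul, ← map_mul, _root_.one_mul, _root_.mul_one]
    · intro hz
      have h1 := h.generate
        (LinearMap.range (φ : BoundQuiverAlgebra k (Q.tilde ν.onVertices m)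
          (commutationRelations ν m ρ c ν.dualInv) →ₗ[k] R))
        (fun y t => by
          obtain ⟨x, rfl⟩ := mk_surjective _ y
          exact ⟨.mk _ (copy ν.onVertices m t x), (hφ _).trans (h.hom_copy t x)⟩)
        (by
          rintro _ ⟨a, rfl⟩
          refine ⟨.mk _ (betaSum ν.onVertices m k Q) * a, ?_⟩
          refine (map_mul φ _ _).trans ?_
          rw [hφ, hom_betaSum]; rfl) z
      rw [show Ψ 1 * z * Ψ 1 = z from hz] at h1
      exact h1

end IsTwistedExtension

end

/-! ### The skew group algebra of `G̃` is a twisted extension -/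

noncomputable section

open PathAlgebra ArrowQuiver

section TwistElement

variable {k : Type u} [Field k] [IsAlgClosed k] [CharZero k] {n : ℕ}
  {G : Subgroup (GL (Fin (n + 1)) k)} [Fintype G] {V : Type v} {A : Type w} [Fintype V] [Fintype A]
  {Q : ArrowQuiver V A} {ρ θ : Set (PathAlgebra k Q)} {e : V → k[G]}

/-- The element `v` of the group algebra for which `x v`, where `x` is the additional variable,
represents the sum of the arrows `β_i`. -/
structure IsTwistElement (ν : NakayamaAutomorphism k Q θ) (e : V → k[G])
    (col : A → Fin (n + 1) → k[G]) (v v' : k[G]) : Prop where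
  vertex_mul : ∀ i, charTwist (detChar G)⁻¹ (e (ν.onVertices i)) * v = v * e i
  mul_sum : v * ∑ i, e i = v
  inv_mul : v' * v = ∑ i, e i
  mul_inv : v * v' = charTwist (detChar G)⁻¹ (∑ i, e i)
  sum_mul : (∑ i, e i) * v' = v'
  arrow_mul : ∀ α l, charTwist (detChar G)⁻¹ (col α l) * v =
    (-1 : k) ^ n • (colAct G v *ᵥ ∑ γ, ν.dualInv α γ • col γ) l

/-- The sum of the elements `v i`. Each of them sits between a different pair of orthogonal
idempotents, so they are recovered from the sum by multiplication with idempotents. -/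
theorem exists_isTwistElement {col : A → Fin (n + 1) → k[G]} (hs : IsArrowSystem Q ρ e col)
    (hρ : ∀ r ∈ ρ, IsQuadraticRelation r) (hθ : Submodule.span k θ = quadraticOrthogonal ρ)
    (ν : NakayamaAutomorphism k Q θ) : ∃ v v' : k[G], IsTwistElement ν e col v v' := by
  classical
  obtain ⟨v, v', h1, h2, h3, h4, h5⟩ := exists_twistElements hs hρ hθ ν
  have he := hs.basic
  have hθ2 : θ ⊆ degree k Q 2 := fun r hr =>
    (hθ ▸ Submodule.subset_span hr : r ∈ quadraticOrthogonal ρ).1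
  set σ := charTwist (k := k) (detChar G)⁻¹ with hσ
  have hve : ∀ i, (∑ j, v j) * e i = v i := by
    intro i
    rw [Finset.sum_mul, Finset.sum_eq_single i]
    · exact h2 i
    · intro j _ hj; rw [← h2 j, mul_assoc, he.mul_ne hj, mul_zero]
    · simp
  have hev : ∀ i j, σ (e (ν.onVertices i)) * v j = if i = j then v j else 0 := by
    intro i j
    rw [← h1 j, ← mul_assoc, ← map_mul]
    by_cases hij : i = j
    · rw [hij, he.mul_self, if_pos rfl]
    · rw [he.mul_ne fun h => hij (ν.onVertices.injective h), map_zero, zero_mul, if_neg hij]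
  have hvs : ∀ i, σ (e (ν.onVertices i)) * ∑ j, v j = v i := by
    intro i
    rw [Finset.mul_sum]
    simp only [hev]
    simp
  have hv' : ∀ i, e i * v' i = v' i * σ (e (ν.onVertices i)) := by
    intro i; rw [← h3, mul_assoc, h4]
  refine ⟨∑ i, v i, ∑ i, e i * v' i, ⟨fun i => by rw [hvs, hve], ?_, ?_, ?_, ?_, ?_⟩⟩
  · rw [Finset.mul_sum]; exact Finset.sum_congr rfl fun i _ => hve i
  · rw [Finset.sum_mul]
    refine Finset.sum_congr rfl fun i _ => ?_
    rw [hv', mul_assoc, hvs, h3]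
  · rw [Finset.mul_sum, map_sum, ← Equiv.sum_comp ν.onVertices fun i => σ (e i)]
    refine Finset.sum_congr rfl fun i _ => ?_
    rw [← mul_assoc, hve, h4]
  · rw [Finset.mul_sum]
    refine Finset.sum_congr rfl fun i _ => ?_
    rw [← mul_assoc, he.sum_mul]
  · intro α l
    have h6 : (∑ γ, ν.dualInv α γ • col γ) =
        colAct G (e (ν.onVertices.symm (Q.tgt α))) *ᵥ ∑ γ, ν.dualInv α γ • col γ := by
      rw [Matrix.mulVec_sum]
      refine Finset.sum_congr rfl fun γ _ => ?_
      by_cases h : ν.dualInv α γ = 0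
      · rw [h, zero_smul, Matrix.mulVec_zero]
      · rw [(ν.onArrows_endpoints hθ2 h).1, Equiv.symm_apply_apply, Matrix.mulVec_smul, hs.tgt_mul]
    have h7 := hve (ν.onVertices.symm (Q.tgt α))
    rw [h6, Matrix.mulVec_mulVec, ← map_mul, h7]
    have h8 := h5 α l
    rw [← hvs, Equiv.apply_symm_apply, ← mul_assoc, ← map_mul, hs.mul_src] at h8
    exact h8

variable {φ : BoundQuiverAlgebra k Q ρ →ₙₐ[k] SkewGroupAlgebra G} {ν : NakayamaAutomorphism k Q θ}
  {m : ℕ} [NeZero m] {ξ : kˣ} (hξ : IsPrimitiveRoot ξ m)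

variable (φ) in
/-- The homomorphism from the algebra of the bound quiver to `k[V ⊕ k] * G̃`. -/
def boundIncl : BoundQuiverAlgebra k Q ρ →ₙₐ[k] SkewGroupAlgebra (cyclicExtension G ξ) :=
  (skewIncl G hξ : SkewGroupAlgebra G →ₙₐ[k] SkewGroupAlgebra (cyclicExtension G ξ)).comp φ

theorem boundIncl_apply (y : BoundQuiverAlgebra k Q ρ) :
    boundIncl φ hξ y = skewIncl G hξ (φ y) := rfl

theorem exists_groupAlgebraIncl_mul_pow (z : k[G]) (d : ℕ) :
    ∃ z' : k[G], skewIncl G hξ (groupAlgebraIncl G z) * extraVar G ξ ^ d =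
      extraVar G ξ ^ d * skewIncl G hξ (groupAlgebraIncl G z') := by
  induction d with
  | zero => exact ⟨z, by simp⟩
  | succ d ih =>
    obtain ⟨z', hz'⟩ := ih
    exact ⟨_, by rw [pow_succ, ← mul_assoc, hz', mul_assoc, skewIncl_mul_extraVar, ← mul_assoc]⟩

theorem map_one_eq (hv : ∀ i, φ (.mk ρ (vertex k Q i)) = groupAlgebraIncl G (e i)) :
    φ 1 = groupAlgebraIncl G (∑ i, e i) := by
  have h2 : (1 : BoundQuiverAlgebra k Q ρ) = .mk ρ (∑ i, vertex k Q i) :=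
    (map_one (BoundQuiverAlgebra.mk ρ)).symm
  rw [h2, map_sum, map_sum, map_sum]
  exact Finset.sum_congr rfl fun i _ => hv i

/-- With `b = x v`, the conditions on vertices and arrows come from moving them past `x`, which
twists them by `det⁻¹`, and then past `v` by the properties of a twist element. -/
theorem isTwistedExtension (hv : ∀ i, φ (.mk ρ (vertex k Q i)) = groupAlgebraIncl G (e i))
    (ha : ∀ a g, (φ (.mk ρ (arrow k Q a))).coeff g ∈
      MvPolynomial.homogeneousSubmodule (Fin (n + 1)) k 1)
    (hinj : Function.Injective φ)
    (hrange : Set.range φ =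
      {x | groupAlgebraIncl G (∑ i, e i) * x * groupAlgebraIncl G (∑ i, e i) = x})
    {v v' : k[G]} (h : IsTwistElement ν e (arrowCol φ) v v') :
    IsTwistedExtension ν m ((-1) ^ n) (boundIncl φ hξ)
      (fun t => groupAlgebraIncl _ (charIdem G hξ t))
      (extraVar G ξ * skewIncl G hξ (groupAlgebraIncl G v)) where
  ortho s t := by
    rw [← map_mul, charIdem_mul_charIdem]
    split_ifs <;> simp
  sum_eq := by rw [← map_sum, sum_charIdem, map_one]
  comm t y := charIdem_mul_skewIncl hξ t _
  shift t := by
    rw [← mul_assoc, charIdem_mul_extraVar, mul_assoc, charIdem_mul_skewIncl, mul_assoc]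
  mul_one := by
    rw [boundIncl_apply, map_one_eq hv, mul_assoc, ← map_mul, ← map_mul, h.mul_sum]
  vertex_mul i := by
    rw [boundIncl_apply, boundIncl_apply, hv, hv, ← mul_assoc, skewIncl_mul_extraVar, mul_assoc,
      mul_assoc, ← map_mul, ← map_mul, ← map_mul, ← map_mul, h.vertex_mul]
  arrow_mul α := by
    have h1 : φ (.mk ρ (ofArrows k Q (ν.dualInv α))) =
        embCol (∑ γ, ν.dualInv α γ • arrowCol φ γ) := by
      simp only [ofArrows_apply, map_sum, map_smul, embCol_arrowCol ha]
    have h2 : (fun l => charTwist (detChar G)⁻¹ (arrowCol φ α l) * v) =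
        (-1 : k) ^ n • (colAct G v *ᵥ ∑ γ, ν.dualInv α γ • arrowCol φ γ) :=
      funext fun l => h.arrow_mul α l
    rw [boundIncl_apply, boundIncl_apply, ← embCol_arrowCol ha, h1, ← mul_assoc,
      skewIncl_embCol_mul_extraVar, mul_assoc, mul_assoc, ← map_mul, ← map_mul,
      embCol_mul_groupAlgebraIncl, groupAlgebraIncl_mul_embCol, h2, map_smul, map_smul,
      mul_smul_comm]
  eq_zero y t w h0 := by
    rw [mul_assoc] at h0
    exact hinj ((eq_zero_of_skewIncl_add hξ h0).trans (map_zero φ).symm)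
  cancel w h0 h1 := by
    rw [mul_assoc] at h0
    have h2 := eq_zero_of_extraVar_mul h0
    have h3 := congrArg (skewIncl G hξ (groupAlgebraIncl G v') * ·) h2
    simp only [mul_zero] at h3
    rw [← mul_assoc, ← map_mul, ← map_mul, h.inv_mul, ← map_one_eq hv] at h3
    exact h1.symm.trans h3
  generate N hN hb z := by
    rw [boundIncl_apply, map_one_eq hv]
    set ē := skewIncl G hξ (groupAlgebraIncl G (∑ i, e i)) with hē
    have key : ∀ d r t, ē * (extraVar G ξ ^ d * skewIncl G hξ r *
        groupAlgebraIncl (cyclicExtension G ξ) (charIdem G hξ t)) * ē ∈ N := by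
      intro d
      induction d with
      | zero =>
        intro r t
        have h1 : groupAlgebraIncl G (∑ i, e i) * r * groupAlgebraIncl G (∑ i, e i) ∈
            Set.range φ := by
          have h2 : (∑ i, e i) * ∑ i, e i = ∑ i, e i := by
            nth_rewrite 1 [← h.inv_mul]
            rw [mul_assoc, h.mul_sum, h.inv_mul]
          rw [hrange, Set.mem_ofPred_eq]
          simp only [mul_assoc]
          rw [← map_mul, h2, ← mul_assoc, ← map_mul, h2]
        obtain ⟨y, hy⟩ := h1
        have h2 := hN y t
        rw [boundIncl_apply, hy, map_mul, map_mul] at h2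
        rw [pow_zero, _root_.one_mul, mul_assoc, mul_assoc, hē, charIdem_mul_skewIncl,
          ← mul_assoc, ← mul_assoc]
        exact h2
      | succ d ih =>
        intro r t
        obtain ⟨z', hz'⟩ := exists_groupAlgebraIncl_mul_pow hξ v' d
        have h1 := hb _ (ih (groupAlgebraIncl G z' * r) t)
        convert h1 using 1
        -- One factor `x` is exchanged for one factor `b`: moving `ē` past `x` twists it, and the
        -- twisted idempotent is `v * v'`. The element `v'` is then carried past the other powers of
        -- `x` into the coefficient.
        have h2 : ē * extraVar G ξ = extraVar G ξ * skewIncl G hξ (groupAlgebraIncl G v) * 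
            (ē * skewIncl G hξ (groupAlgebraIncl G v')) := by
          rw [hē, skewIncl_mul_extraVar, ← h.mul_inv, ← map_mul, ← map_mul, h.sum_mul, mul_assoc,
            ← map_mul, ← map_mul]
        rw [pow_succ', map_mul]
        calc _ = (ē * extraVar G ξ) * extraVar G ξ ^ d * (skewIncl G hξ r *
              groupAlgebraIncl (cyclicExtension G ξ) (charIdem G hξ t) * ē) := by
              simp only [mul_assoc]
          _ = extraVar G ξ * skewIncl G hξ (groupAlgebraIncl G v) * ē *
              (skewIncl G hξ (groupAlgebraIncl G v') * extraVar G ξ ^ d) * (skewIncl G hξ r *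
              groupAlgebraIncl (cyclicExtension G ξ) (charIdem G hξ t) * ē) := by
              rw [h2]; simp only [mul_assoc]
          _ = _ := by rw [hz']; simp only [mul_assoc]
    induction z using skewExtension_induction hξ with
    | zero => rw [mul_zero, zero_mul]; exact N.zero_mem
    | add x y hx hy => rw [mul_add, add_mul]; exact N.add_mem hx hy
    | smul c x hx => rw [mul_smul_comm, smul_mul_assoc]; exact N.smul_mem c hx
    | mem d r t => exact key d r t

end TwistElement

end

/-! ### Irreducible representations of `G̃` -/

noncomputable section

open PathAlgebra ArrowQuiver

section ExtRep

variable {k : Type u} [Field k] {ι : Type} [Fintype ι] [DecidableEq ι]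
  {G : Subgroup (GL ι k)} {m : ℕ} [NeZero m] {ξ : kˣ} (hξ : IsPrimitiveRoot ξ m)
  {X : Type*} [AddCommGroup X] [Module k X]

/-- The representation of `G̃` on which `G` acts as given, and the cyclic group acts by the
character `j ↦ ξ ^ (t j)`. -/
def extRep (σ : Representation k G X) (t : ZMod m) : Representation k (cyclicExtension G ξ) X :=
  ({ toFun := fun x => ((hξ.zpw (t * Multiplicative.toAdd x.2) : kˣ) : k) • σ x.1
     map_one' := by simp [hξ.zpw_zero]
     map_mul' := fun x y => by
       rw [Prod.snd_mul, toAdd_mul, mul_add, hξ.zpw_add, Prod.fst_mul, map_mul, smul_mul_smul_comm,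
         Units.val_mul] } :
    G × Multiplicative (ZMod m) →* Module.End k X).comp (extEquiv G hξ).symm.toMonoidHom

theorem extRep_extElem (σ : Representation k G X) (t : ZMod m) (g : G) (j : ZMod m) :
    extRep hξ σ t (extElem G hξ g j) = ((hξ.zpw (t * j) : kˣ) : k) • σ g := by
  have h : (extEquiv G hξ).symm (extElem G hξ g j) = (g, Multiplicative.ofAdd j) :=
    MulEquiv.symm_apply_apply _ _
  change ((hξ.zpw (t * Multiplicative.toAdd ((extEquiv G hξ).symm (extElem G hξ g j)).2) : kˣ) : k) •
    σ ((extEquiv G hξ).symm (extElem G hξ g j)).1 = _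
  rw [h]; rfl

theorem extRep_extElem_zero (σ : Representation k G X) (t : ZMod m) (g : G) :
    extRep hξ σ t (extElem G hξ g 0) = σ g := by
  rw [extRep_extElem, mul_zero, hξ.zpw_zero, Units.val_one, one_smul]

theorem extRep_isIrreducible_iff (σ : Representation k G X) (t : ZMod m) :
    (extRep hξ σ t).IsIrreducible ↔ σ.IsIrreducible := by
  refine OrderIso.isSimpleOrder_iff
    { toFun := fun N => ⟨N.toSubmodule, fun g x hx => ?_⟩
      invFun := fun N => ⟨N.toSubmodule, fun g x hx => ?_⟩
      left_inv := fun N => rfl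
      right_inv := fun N => rfl
      map_rel_iff' := Iff.rfl }
  · have h := N.apply_mem_toSubmodule (extElem G hξ g 0) hx
    rwa [extRep_extElem_zero] at h
  · obtain ⟨g, j, rfl⟩ := exists_extElem hξ g
    rw [extRep_extElem]
    exact N.toSubmodule.smul_mem _ (N.apply_mem_toSubmodule g hx)

theorem nontrivial_of_isIrreducible {σ : Representation k G X} (h : σ.IsIrreducible) :
    Nontrivial X := by
  by_contra hX
  rw [not_nontrivial_iff_subsingleton] at hX
  have := h.toNontrivial
  obtain ⟨M, N, hMN⟩ := exists_pair_ne (Subrepresentation σ)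
  exact hMN (Subrepresentation.toSubmodule_injective (Subsingleton.elim _ _))

/-- Isomorphic representations of `G` define isomorphic representations of `G̃`. -/
def extRepCongr {Y : Type*} [AddCommGroup Y] [Module k Y] {σ : Representation k G X}
    {τ : Representation k G Y} (f : σ.Equiv τ) (t : ZMod m) :
    (extRep hξ σ t).Equiv (extRep hξ τ t) :=
  .mk f.toLinearEquiv fun x => by
    obtain ⟨g, j, rfl⟩ := exists_extElem hξ x
    rw [extRep_extElem, extRep_extElem]
    refine LinearMap.ext fun x => ?_
    refine (f.toLinearEquiv.map_smul _ _).trans ?_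
    exact congrArg _ (Representation.IntertwiningMap.isIntertwining _ _ f.toIntertwiningMap g x)

/-- The scalar by which the cyclic generator acts determines the character; restriction to the
elements `extElem G hξ g 0` determines the representation of `G`. -/
theorem extRep_eq_of_equiv {Y : Type*} [AddCommGroup Y] [Module k Y] {σ : Representation k G X}
    {τ : Representation k G Y} [Nontrivial X] {s t : ZMod m}
    (f : (extRep hξ σ s).Equiv (extRep hξ τ t)) : s = t ∧ Nonempty (σ.Equiv τ) := by
  constructor
  · obtain ⟨x, hx⟩ := exists_ne (0 : X)
    have h := Representation.IntertwiningMap.isIntertwining _ _ f.toIntertwiningMap (extElem G hξ 1 1) x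
    rw [extRep_extElem, extRep_extElem] at h
    simp only [mul_one, map_one, LinearMap.smul_apply, Module.End.one_apply, map_smul] at h
    refine hξ.zpw_injective (Units.ext (smul_left_injective k ?_ h))
    exact fun h0 => hx (f.toLinearEquiv.map_eq_zero_iff.1 h0)
  · refine ⟨.mk f.toLinearEquiv fun g => LinearMap.ext fun x => ?_⟩
    have h := Representation.IntertwiningMap.isIntertwining _ _ f.toIntertwiningMap (extElem G hξ g 0) x
    rwa [extRep_extElem_zero, extRep_extElem_zero] at h

/-- The generator of the cyclic group is central and hence acts by a scalar, by Schur's lemma. Its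
`m`-th power is `1`, so it is a power of `ξ`. -/
theorem exists_eq_extRep [IsAlgClosed k] [FiniteDimensional k X]
    (τ : Representation k (cyclicExtension G ξ) X) (hτ : τ.IsIrreducible) :
    ∃ (σ : Representation k G X) (t : ZMod m), τ = extRep hξ σ t := by
  have hX : Nontrivial X := nontrivial_of_isIrreducible hτ
  have hc : extElem G hξ 1 1 ∈ Submonoid.center (cyclicExtension G ξ) := by
    rw [Submonoid.mem_center_iff]
    intro x
    obtain ⟨g, j, rfl⟩ := exists_extElem hξ x
    rw [extElem_mul, extElem_mul, mul_one, one_mul, add_comm]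
  obtain ⟨c, hc'⟩ := (Representation.IsIrreducible.algebraMap_intertwiningMap_bijective_of_isAlgClosed
    (ρ := τ)).2
      (Representation.IntertwiningMap.centralMul τ _ hc)
  have h1 : τ (extElem G hξ 1 1) = c • 1 := by
    refine LinearMap.ext fun x => ?_
    exact (congrArg (fun f : Representation.IntertwiningMap τ τ => f x) hc').symm
  have h2 : ∀ d : ℕ, τ (extElem G hξ 1 (d : ZMod m)) = c ^ d • 1 := by
    intro d
    induction d with
    | zero => rw [Nat.cast_zero, extElem_one, map_one, pow_zero, one_smul]
    | succ d ih =>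
      have h3 := extElem_mul hξ (1 : G) 1 (d : ZMod m) 1
      rw [one_mul] at h3
      rw [Nat.cast_succ, ← h3, map_mul, ih, h1, smul_mul_smul_comm, one_mul, pow_succ]
  have h3 : c ^ m = 1 := by
    have h4 := h2 m
    rw [ZMod.natCast_self, extElem_one, map_one] at h4
    obtain ⟨x, hx⟩ := exists_ne (0 : X)
    have h5 := congrArg (fun f : Module.End k X => f x) h4
    simp only [Module.End.one_apply, LinearMap.smul_apply] at h5
    refine smul_left_injective k hx ?_
    simpa using h5.symm
  obtain ⟨t, -, ht⟩ := (IsPrimitiveRoot.coe_units_iff.2 hξ).eq_pow_of_pow_eq_one h3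
  refine ⟨τ.comp ⟨⟨fun g => extElem G hξ g 0, extElem_one hξ⟩, fun g h => by
    rw [extElem_mul, add_zero]⟩, (t : ZMod m), ?_⟩
  refine MonoidHom.ext fun x => ?_
  obtain ⟨g, j, rfl⟩ := exists_extElem hξ x
  rw [extRep_extElem]
  change _ = _ • τ (extElem G hξ g 0)
  have h4 := extElem_mul hξ 1 g j 0
  rw [one_mul, add_zero] at h4
  have h5 := h2 j.val
  rw [ZMod.natCast_zmod_val] at h5
  have h6 : hξ.zpw ((t : ZMod m) * j) = ξ ^ (t * j.val) := by
    rw [← hξ.zpw_natCast, Nat.cast_mul, ZMod.natCast_zmod_val]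
  rw [← h4, map_mul, h5, h6, smul_one_mul, pow_mul, Units.val_pow_eq_pow_val,
    Units.val_pow_eq_pow_val, ht]

end ExtRep

end

/-! ### Projective modules of `kG̃` and the twist of representations by `det` -/

noncomputable section

open PathAlgebra ArrowQuiver

section ExtModule

variable {k : Type u} [Field k] {ι : Type} [Fintype ι] [DecidableEq ι]
  {G : Subgroup (GL ι k)} {m : ℕ} [NeZero m] {ξ : kˣ} (hξ : IsPrimitiveRoot ξ m)
  {X : Type*} [AddCommGroup X] [Module k X]

theorem extRep_groupIncl (σ : Representation k G X) (t : ZMod m) (z : k[G]) :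
    (extRep hξ σ t).asAlgebraHom (groupIncl G hξ z) = σ.asAlgebraHom z := by
  induction z using MonoidAlgebra.induction_linear with
  | zero => simp
  | add x y hx hy => simp only [map_add, hx, hy]
  | single g c =>
    rw [groupIncl_single, Representation.asAlgebraHom_single, Representation.asAlgebraHom_single,
      extRep_extElem_zero]

variable [CharZero k]

theorem extRep_charIdem (σ : Representation k G X) (t : ZMod m) :
    (extRep hξ σ t).asAlgebraHom (charIdem G hξ t) = 1 := by
  have hm : (m : k) ≠ 0 := Nat.cast_ne_zero.2 (NeZero.ne m)
  simp only [charIdem, map_smul, map_sum, Representation.asAlgebraHom_single, extRep_extElem,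
    map_one, smul_smul, ← Units.val_mul, ← hξ.zpw_add, neg_add_cancel, hξ.zpw_zero, Units.val_one,
    one_smul, Finset.sum_const, Finset.card_univ, ZMod.card]
  rw [← Nat.cast_smul_eq_nsmul k, smul_smul, inv_mul_cancel₀ hm, one_smul]

theorem exists_mul_charIdem (z : k[cyclicExtension G ξ]) (t : ZMod m) :
    ∃ z' : k[G], z * charIdem G hξ t = groupIncl G hξ z' * charIdem G hξ t := by
  induction z using MonoidAlgebra.induction_linear with
  | zero => exact ⟨0, by simp⟩
  | add x y hx hy =>
    obtain ⟨x', hx'⟩ := hx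
    obtain ⟨y', hy'⟩ := hy
    exact ⟨x' + y', by rw [add_mul, hx', hy', map_add, add_mul]⟩
  | single g c =>
    obtain ⟨g, j, rfl⟩ := exists_extElem hξ g
    refine ⟨MonoidAlgebra.single g (c * hξ.zpw (t * j)), ?_⟩
    have h : MonoidAlgebra.single (extElem G hξ g j) c =
        MonoidAlgebra.single (extElem G hξ g 0) c *
          MonoidAlgebra.single (extElem G hξ 1 j) (1 : k) := by
      rw [MonoidAlgebra.single_mul_single, extElem_mul, mul_one, mul_one, zero_add]
    rw [h, mul_assoc, extElem_mul_charIdem, mul_smul_comm, ← smul_mul_assoc,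
      MonoidAlgebra.smul_single, groupIncl_single, smul_eq_mul, mul_comm c]

theorem groupIncl_mul_charIdem (z : k[G]) (t : ZMod m) :
    groupIncl G hξ z * charIdem G hξ t = charIdem G hξ t * groupIncl G hξ z := by
  apply groupAlgebraIncl_injective
  rw [map_mul, map_mul, ← skewIncl_groupAlgebraIncl, charIdem_mul_skewIncl]

/-- The map lets elements act on the generator of the irreducible module. It is bijective because
`kG̃ ε_t` equals `kG ε_t`, and `ε_t` acts as the identity. -/
theorem extModuleEquiv {e : k[G]} (he : e * e = e) (σ : Representation k G X)
    (f : Submodule.span k[G] {e} ≃ₗ[k[G]] σ.asModule) (t : ZMod m) :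
    Nonempty (Submodule.span k[cyclicExtension G ξ] {groupIncl G hξ e * charIdem G hξ t}
      ≃ₗ[k[cyclicExtension G ξ]] (extRep hξ σ t).asModule) := by
  set s₀ : X := f ⟨e, Submodule.mem_span_singleton_self e⟩ with hs₀
  have hf : ∀ z : k[G], ∀ hz : z ∈ Submodule.span k[G] {e}, z * e = z →
      f ⟨z, hz⟩ = σ.asAlgebraHom z s₀ := by
    intro z hz hze
    have h := f.map_smul z ⟨e, Submodule.mem_span_singleton_self e⟩
    have h2 : z • (⟨e, Submodule.mem_span_singleton_self e⟩ : Submodule.span k[G] {e}) =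
      ⟨z, hz⟩ := Subtype.ext hze
    rw [h2] at h
    exact h
  have hmem : ∀ z, (hz : z * e = z) → z ∈ Submodule.span k[G] {e} := fun z hz =>
    Submodule.mem_span_singleton.2 ⟨z, hz⟩
  have hact : ∀ z, (extRep hξ σ t).asAlgebraHom (groupIncl G hξ z * charIdem G hξ t) =
      σ.asAlgebraHom z := fun z => by
    rw [map_mul, extRep_charIdem, mul_one, extRep_groupIncl]
  let F : Submodule.span k[cyclicExtension G ξ] {groupIncl G hξ e * charIdem G hξ t}
      →ₗ[k[cyclicExtension G ξ]] (extRep hξ σ t).asModule :=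
    (LinearMap.toSpanSingleton k[cyclicExtension G ξ] (extRep hξ σ t).asModule s₀).domRestrict _
  have hF : ∀ z, F z = (extRep hξ σ t).asAlgebraHom z s₀ := fun z => rfl
  refine ⟨LinearEquiv.ofBijective F ⟨?_, ?_⟩⟩
  · rw [injective_iff_map_eq_zero]
    rintro ⟨z, hz⟩ h0
    obtain ⟨y, rfl⟩ := Submodule.mem_span_singleton.1 hz
    obtain ⟨z', hz'⟩ := exists_mul_charIdem hξ (y * groupIncl G hξ e) t
    have h1 : y • (groupIncl G hξ e * charIdem G hξ t) =
        groupIncl G hξ (z' * e) * charIdem G hξ t := by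
      have h2 := congrArg (· * groupIncl G hξ e) hz'
      simp only [mul_assoc, ← groupIncl_mul_charIdem] at h2
      rw [← mul_assoc (groupIncl G hξ e), ← map_mul, he] at h2
      rw [smul_eq_mul, h2, ← mul_assoc, ← map_mul]
    rw [hF] at h0
    simp only at h0
    rw [h1, hact, ← hf _ (hmem _ (by rw [mul_assoc, he])) (by rw [mul_assoc, he])] at h0
    have h3 := congrArg Subtype.val (f.map_eq_zero_iff.1 h0)
    refine Subtype.ext ?_
    simp only [h1]
    rw [show z' * e = 0 from h3, map_zero, zero_mul]; rfl
  · intro x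
    obtain ⟨⟨w, hw⟩, rfl⟩ := f.surjective x
    have hwe : w * e = w := by
      obtain ⟨y, rfl⟩ := Submodule.mem_span_singleton.1 hw
      rw [smul_eq_mul, mul_assoc, he]
    refine ⟨⟨groupIncl G hξ w * charIdem G hξ t, Submodule.mem_span_singleton.2
      ⟨groupIncl G hξ w, ?_⟩⟩, ?_⟩
    · rw [smul_eq_mul, ← mul_assoc, ← map_mul, hwe]
    · rw [hF]
      simp only
      rw [hact, ← hf w hw hwe]

end ExtModule

section TwistedModule

variable {k : Type u} [Field k] [IsAlgClosed k] [CharZero k] {n : ℕ}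
  {G : Subgroup (GL (Fin (n + 1)) k)} [Fintype G] {V : Type v} {A : Type w} [Fintype V] [Fintype A]
  {Q : ArrowQuiver V A} {θ : Set (PathAlgebra k Q)} {ν : NakayamaAutomorphism k Q θ} {e : V → k[G]}
  {col : A → Fin (n + 1) → k[G]} {v v' : k[G]}

/-- The isomorphism from `S_i`, twisted by the inverse of the determinant, to `S_{ν i}`. -/
theorem IsTwistElement.exists_equiv (h : IsTwistElement ν e col v v') (he : IsBasicSystem e)
    {X : V → Type*} [∀ i, AddCommGroup (X i)] [∀ i, Module k (X i)]
    (σ : ∀ i, Representation k G (X i))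
    (f : ∀ i, Submodule.span k[G] {e i} ≃ₗ[k[G]] (σ i).asModule) (i : V) :
    ∃ δ : X i ≃ₗ[k] X (ν.onVertices i), ∀ g x, δ (σ i g x) =
      (detChar G g : k) • σ (ν.onVertices i) g (δ x) := by
  have hv' : v' * charTwist (detChar G)⁻¹ (e (ν.onVertices i)) = e i * v' := by
    have h1 := congrArg (fun z => v' * z * v') (h.vertex_mul i)
    simp only [mul_assoc] at h1
    rw [h.mul_inv, ← map_mul, he.mul_sum, ← mul_assoc, ← mul_assoc, h.inv_mul,
      he.sum_mul] at h1
    exact h1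
  have hmem : ∀ (i : V) (z : k[G]), z ∈ Submodule.span k[G] {e i} ↔ z * e i = z :=
    fun i z => he.mem_span_iff
  -- Right multiplication by `v'` moves the left ideal to the one of `τ⁻¹(e (ν i))`; the twist by
  -- `det` then makes it the left ideal of `e (ν i)` and produces the factor `det g`.
  let F : Submodule.span k[G] {e i} →ₗ[k] Submodule.span k[G] {e (ν.onVertices i)} :=
    { toFun := fun w => ⟨charTwist (detChar G) (w * v'), by
        have hw := (hmem _ _).1 w.2
        rw [hmem, ← charTwist_charTwist_inv (detChar G) (e (ν.onVertices i)), ← map_mul, mul_assoc,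
          hv', ← mul_assoc, hw]⟩
      map_add' := fun x y => Subtype.ext (by
        simp only [Submodule.coe_add, add_mul, map_add])
      map_smul' := fun c x => Subtype.ext (by
        change charTwist (detChar G) (c • x.1 * v') = c • charTwist (detChar G) (x.1 * v')
        rw [smul_mul_assoc, map_smul]) }
  have hF : Function.Bijective F := by
    constructor
    · rw [injective_iff_map_eq_zero]
      intro w hw
      have h1 : charTwist (detChar G) (w * v') = 0 := congrArg Subtype.val hw
      have h2 := congrArg (fun z => charTwist (detChar G)⁻¹ z * v) h1
      simp only [charTwist_inv_charTwist, map_zero, zero_mul] at h2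
      have h3 := (hmem _ _).1 w.2
      rw [mul_assoc, h.inv_mul, ← h3, mul_assoc, he.mul_sum, h3] at h2
      exact Subtype.ext h2
    · intro z
      have hz := (hmem _ _).1 z.2
      refine ⟨⟨charTwist (detChar G)⁻¹ z * v, (hmem _ _).2 ?_⟩, Subtype.ext ?_⟩
      · rw [mul_assoc, ← h.vertex_mul, ← mul_assoc, ← map_mul, hz]
      · change charTwist (detChar G) (charTwist (detChar G)⁻¹ z * v * v') = z
        rw [mul_assoc, h.mul_inv, ← map_mul, charTwist_charTwist_inv, ← hz, mul_assoc, he.mul_sum]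
  let φ : ∀ i, Submodule.span k[G] {e i} ≃ₗ[k] X i := fun i => (f i).restrictScalars k
  have hφ : ∀ i (g : G) w, φ i (MonoidAlgebra.single g (1 : k) • w) = σ i g (φ i w) := by
    intro i g w
    refine ((f i).map_smul _ w).trans ?_
    refine ((σ i).asModuleEquiv_map_smul _ _).trans ?_
    rw [Representation.asAlgebraHom_single, one_smul]; rfl
  refine ⟨(φ i).symm.trans ((LinearEquiv.ofBijective F hF).trans (φ (ν.onVertices i))), ?_⟩
  intro g x
  obtain ⟨w, rfl⟩ := (φ i).surjective x
  rw [← hφ]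
  simp only [LinearEquiv.trans_apply, LinearEquiv.symm_apply_apply, LinearEquiv.ofBijective_apply]
  rw [← hφ, ← map_smul]
  congr 1
  refine Subtype.ext ?_
  change charTwist (detChar G) (MonoidAlgebra.single g (1 : k) * w.1 * v') =
    (detChar G g : k) • (MonoidAlgebra.single g (1 : k) * charTwist (detChar G) (w.1 * v'))
  rw [mul_assoc, map_mul, charTwist_single, one_mul, ← smul_mul_assoc, MonoidAlgebra.smul_single,
    smul_eq_mul, mul_one]

end TwistedModule

end

/-! ### The tensor product of `V ⊕ k` with an irreducible representation -/

noncomputable section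

open PathAlgebra ArrowQuiver

section Decomposition

open TensorProduct DirectSum

/-- The arrows of the quiver of `G̃` that start at `(i, t)`. -/
def tildeArrowsEquiv {V : Type v} {A : Type w} (Q : ArrowQuiver V A) (ν : Equiv.Perm V) (m : ℕ)
    (i : V) (t : ZMod m) :
    {a // (Q.tilde ν m).src a = (i, t)} ≃ Option {α : A // Q.src α = i} where
  toFun
    | ⟨.inl (α, _), h⟩ => some ⟨α, congrArg Prod.fst h⟩
    | ⟨.inr _, _⟩ => none
  invFun
    | some α => ⟨.inl (α.1, t), congrArg (fun i => (i, t)) α.2⟩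
    | none => ⟨.inr (i, t), rfl⟩
  left_inv := by
    rintro ⟨⟨α, s⟩ | ⟨j, s⟩, h⟩
    · obtain rfl : s = t := congrArg Prod.snd h
      rfl
    · obtain ⟨rfl, rfl⟩ := Prod.mk.inj h
      rfl
  right_inv := by rintro (_ | ⟨α, h⟩) <;> rfl

variable {k : Type u} [Field k] {ι : Type} [Fintype ι] [DecidableEq ι]

/-- The decomposition `(V ⊕ k) ⊗ X = X ⊕ V ⊗ X`. -/
def sumTensorEquiv (k : Type u) [Field k] (ι : Type) (X : Type*) [AddCommGroup X] [Module k X] :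
    (ι ⊕ Unit → k) ⊗[k] X ≃ₗ[k] X × ((ι → k) ⊗[k] X) :=
  (TensorProduct.congr (LinearEquiv.sumArrowLequivProdArrow ι Unit k k) (.refl k X)) ≪≫ₗ
    TensorProduct.prodLeft k k (ι → k) (Unit → k) X ≪≫ₗ
    LinearEquiv.prodComm k _ _ ≪≫ₗ
    ((TensorProduct.congr (LinearEquiv.funUnique Unit k k) (.refl k X)) ≪≫ₗ
      TensorProduct.lid k X).prodCongr (.refl k _)

theorem sumTensorEquiv_tmul {X : Type*} [AddCommGroup X] [Module k X] (f : ι ⊕ Unit → k) (x : X) :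
    sumTensorEquiv k ι X (f ⊗ₜ x) = (f (Sum.inr ()) • x, (fun l => f (Sum.inl l)) ⊗ₜ x) := rfl

variable {G : Subgroup (GL ι k)} {m : ℕ} [NeZero m] {ξ : kˣ} (hξ : IsPrimitiveRoot ξ m)
  {V : Type v} {A : Type w} {Q : ArrowQuiver V A}

theorem naturalRep_extElem_inr (g : G) (j : ZMod m) (f : ι ⊕ Unit → k) :
    naturalRep (cyclicExtension G ξ) (extElem G hξ g j) f (Sum.inr ()) =
      ((detChar G g)⁻¹ * hξ.zpw j : kˣ) * f (Sum.inr ()) := by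
  change ((extElem G hξ g j).1.1 *ᵥ f) (Sum.inr ()) = _
  rw [extElem_val, Matrix.fromBlocks_mulVec]
  simp
  exact Or.inl rfl

theorem naturalRep_extElem_inl (g : G) (j : ZMod m) (f : ι ⊕ Unit → k) :
    (fun l => naturalRep (cyclicExtension G ξ) (extElem G hξ g j) f (Sum.inl l)) =
      naturalRep G g (fun l => f (Sum.inl l)) := by
  funext l
  change ((extElem G hξ g j).1.1 *ᵥ f) (Sum.inl l) = (g.1.1 *ᵥ fun l => f (Sum.inl l)) l
  rw [extElem_val, Matrix.fromBlocks_mulVec]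
  simp [Function.comp_def]

/-- On the additional line `G̃` acts by `det⁻¹` and by the basic character of the cyclic group.
Hence this summand has its level raised by one. -/
theorem sumTensorEquiv_tprod {X : Type*} [AddCommGroup X] [Module k X] (σ : Representation k G X)
    (t : ZMod m) (g : G) (j : ZMod m) (y) :
    sumTensorEquiv k ι X (((naturalRep (cyclicExtension G ξ)).tprod (extRep hξ σ t))
      (extElem G hξ g j) y) =
    (((hξ.zpw ((t + 1) * j) : kˣ) : k) • (((detChar G g)⁻¹ : kˣ) : k) •
        σ g (sumTensorEquiv k ι X y).1,
      ((hξ.zpw (t * j) : kˣ) : k) • ((naturalRep G).tprod σ) g (sumTensorEquiv k ι X y).2) := by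
  induction y using TensorProduct.induction_on with
  | zero => simp only [map_zero, Prod.fst_zero, Prod.snd_zero, smul_zero]; rfl
  | add x y hx hy =>
    simp only [map_add, hx, hy, Prod.fst_add, Prod.snd_add, smul_add, Prod.mk_add_mk]
  | tmul f x =>
    rw [Representation.tprod_apply, TensorProduct.map_tmul, sumTensorEquiv_tmul,
      sumTensorEquiv_tmul, naturalRep_extElem_inr, naturalRep_extElem_inl, extRep_extElem]
    refine Prod.ext ?_ ?_
    · simp only [LinearMap.smul_apply, map_smul, smul_smul, add_mul, one_mul, hξ.zpw_add,
        Units.val_mul]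
      congr 1; ring
    · simp only [LinearMap.smul_apply, Representation.tprod_apply, TensorProduct.map_tmul,
        TensorProduct.tmul_smul]

/-- The part `V ⊗ X` decomposes as for `G`, within level `t`, and accounts for the arrows of the
copy of `Q`. The additional line gives `X i` twisted by `det⁻¹` in level `t + 1`, which `δ`
identifies with the target of the single `β` at this vertex. -/
theorem extRep_decomposition {X : V → Type*} [∀ i, AddCommGroup (X i)] [∀ i, Module k (X i)]
    (σ : ∀ i, Representation k G (X i)) (ν : Equiv.Perm V) (i : V) (t : ZMod m)
    (D : ((naturalRep G).tprod (σ i)).Equiv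
      (Representation.directSum fun a : {a : A // Q.src a = i} => σ (Q.tgt a)))
    (δ : X i ≃ₗ[k] X (ν i)) (hδ : ∀ g x, δ (σ i g x) = (detChar G g : k) • σ (ν i) g (δ x)) :
    Nonempty (((naturalRep (cyclicExtension G ξ)).tprod (extRep hξ (σ i) t)).Equiv
      (Representation.directSum fun a : {a // (Q.tilde ν m).src a = (i, t)} =>
        extRep hξ (σ ((Q.tilde ν m).tgt a).1) ((Q.tilde ν m).tgt a).2)) := by
  let M : {a // (Q.tilde ν m).src a = (i, t)} → Type _ := fun a => X ((Q.tilde ν m).tgt a).1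
  -- Splits off the summand of the arrow `β_i`, which is `none` under `tildeArrowsEquiv`.
  let T : (⨁ a, M a) ≃ₗ[k] X (ν i) × ⨁ a : {a : A // Q.src a = i}, X (Q.tgt a) :=
    (DirectSum.lequivCongrLeft k (tildeArrowsEquiv Q ν m i t)).trans
      (DirectSum.lequivProdDirectSum k
        (α := fun o => M ((tildeArrowsEquiv Q ν m i t).symm o)))
  have hT1 : ∀ y, (T y).1 = y ((tildeArrowsEquiv Q ν m i t).symm none) := fun y => rfl
  have hT2 : ∀ y α, (T y).2 α = y ((tildeArrowsEquiv Q ν m i t).symm (some α)) := fun y α => rfl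
  let L : (ι ⊕ Unit → k) ⊗[k] X i ≃ₗ[k] ⨁ a, M a :=
    (sumTensorEquiv k ι (X i)).trans ((δ.prodCongr D.toLinearEquiv).trans T.symm)
  have hL : ∀ y, T (L y) = (δ (sumTensorEquiv k ι (X i) y).1,
      D.toLinearEquiv (sumTensorEquiv k ι (X i) y).2) := fun y => T.apply_symm_apply _
  refine ⟨.mk L fun x => ?_⟩
  obtain ⟨g, j, rfl⟩ := exists_extElem hξ x
  refine LinearMap.ext fun y => T.injective ?_
  refine (hL _).trans ?_
  rw [sumTensorEquiv_tprod]
  refine Prod.ext ?_ ?_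
  · have h1 : (T (Representation.directSum (fun a : {a // (Q.tilde ν m).src a = (i, t)} =>
        extRep hξ (σ ((Q.tilde ν m).tgt a).1) ((Q.tilde ν m).tgt a).2) (extElem G hξ g j) (L y))).1 =
        extRep hξ (σ (ν i)) (t + 1) (extElem G hξ g j) (T (L y)).1 := rfl
    refine Eq.trans ?_ h1.symm
    rw [hL, extRep_extElem]
    simp only [map_smul, hδ, LinearMap.smul_apply]
    rw [smul_smul (((detChar G g)⁻¹ : kˣ) : k), Units.inv_mul, one_smul]
  · refine DFinsupp.ext fun α => ?_
    have h1 : (T (Representation.directSum (fun a : {a // (Q.tilde ν m).src a = (i, t)} =>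
        extRep hξ (σ ((Q.tilde ν m).tgt a).1) ((Q.tilde ν m).tgt a).2) (extElem G hξ g j)
          (L y))).2 α =
        extRep hξ (σ (Q.tgt α)) t (extElem G hξ g j) ((T (L y)).2 α) := rfl
    refine Eq.trans ?_ h1.symm
    rw [hL, extRep_extElem]
    have h2 : D.toLinearEquiv (((naturalRep G).tprod (σ i)) g (sumTensorEquiv k ι (X i) y).2) =
        Representation.directSum (fun a : {a : A // Q.src a = i} => σ (Q.tgt a)) g
          (D.toLinearEquiv (sumTensorEquiv k ι (X i) y).2) :=
      Representation.IntertwiningMap.isIntertwining _ _ D.toIntertwiningMap g _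
    simp only [map_smul, h2]
    rfl

end Decomposition

end

/-! ### The McKay quiver of `G̃` -/

noncomputable section

open PathAlgebra ArrowQuiver

section McKayTilde

variable {k : Type u} [Field k] [IsAlgClosed k] [CharZero k] {n : ℕ}
  {G : Subgroup (GL (Fin (n + 1)) k)} [Fintype G] {V : Type v} {A : Type w} [Fintype V] [Fintype A]
  {Q : ArrowQuiver V A} {θ : Set (PathAlgebra k Q)} {ν : NakayamaAutomorphism k Q θ} {e : V → k[G]}
  {col : A → Fin (n + 1) → k[G]} {v v' : k[G]} {m : ℕ} [NeZero m] {ξ : kˣ}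
  (hξ : IsPrimitiveRoot ξ m) {S : V → FDRep k G}

theorem IsMcKayQuiver.tilde (hS : IsMcKayQuiver G Q S) (he : IsBasicSystem e)
    (f : ∀ i, Nonempty (Submodule.span k[G] {e i} ≃ₗ[k[G]] (S i).rep.asModule))
    (h : IsTwistElement ν e col v v') :
    IsMcKayQuiver (cyclicExtension G ξ) (Q.tilde ν.onVertices m)
      (fun x => FDRep.of (extRep hξ (S x.1).rep x.2)) where
  irreducible x := (extRep_isIrreducible_iff hξ _ _).2 (hS.irreducible x.1)
  complete X hX := by
    obtain ⟨σ, t, hσ⟩ := exists_eq_extRep hξ X.rep hX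
    rw [hσ, extRep_isIrreducible_iff] at hX
    obtain ⟨i, ⟨g⟩⟩ := hS.complete (FDRep.of σ) hX
    refine ⟨(i, t), ?_⟩
    rw [hσ]
    exact ⟨extRepCongr hξ g t⟩
  distinct x y := by
    rintro ⟨g⟩
    have : Nontrivial (S x.1) := nontrivial_of_isIrreducible (hS.irreducible x.1)
    obtain ⟨h1, h2⟩ := extRep_eq_of_equiv (σ := (S x.1).rep) (τ := (S y.1).rep) hξ g
    exact Prod.ext (hS.distinct _ _ h2) h1
  decomposition x := by
    obtain ⟨D⟩ := hS.decomposition x.1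
    obtain ⟨δ, hδ⟩ := h.exists_equiv he (fun i => (S i).rep) (fun i => (f i).some) x.1
    exact extRep_decomposition hξ (fun i => (S i).rep) ν.onVertices x.1 x.2 D δ hδ

end McKayTilde

end

/-! ### Orthogonal complements in the space of quadratic elements -/

noncomputable section

open PathAlgebra ArrowQuiver

section DoubleOrthogonal

variable {k : Type u} [Field k] {V : Type v} {A : Type w} [Fintype V] [Fintype A]
  {Q : ArrowQuiver V A}

theorem finiteDimensional_degree_two : FiniteDimensional k (degree k Q 2) := by
  have h : degree k Q 2 ≤ Submodule.span k
      (Set.range fun x : A × A => arrow k Q x.1 * arrow k Q x.2) := by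
    intro d hd
    rw [eq_sum_of_mem_degree_two hd]
    exact Submodule.sum_mem _ fun a _ => Submodule.sum_mem _ fun b _ =>
      Submodule.smul_mem _ _ (Submodule.subset_span ⟨(a, b), rfl⟩)
  have := FiniteDimensional.span_of_finite k
    (Set.finite_range fun x : A × A => arrow k Q x.1 * arrow k Q x.2)
  exact Submodule.finiteDimensional_of_le h

/-- The pairing on the space of quadratic elements. -/
def quadraticForm (k : Type u) [Field k] (Q : ArrowQuiver V A) :
    LinearMap.BilinForm k (degree k Q 2) :=
  pairing.compl₁₂ (degree k Q 2).subtype (degree k Q 2).subtype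

theorem eq_zero_of_pairing {d : PathAlgebra k Q} (hd : d ∈ degree k Q 2)
    (h : ∀ d' ∈ degree k Q 2, pairing d' d = 0) : d = 0 := by
  rw [eq_sum_of_mem_degree_two hd]
  refine Finset.sum_eq_zero fun a _ => Finset.sum_eq_zero fun b _ => ?_
  rw [h _ (arrow_mul_arrow_mem_degree a b), zero_smul]

/-- The pairing is nondegenerate on the finite-dimensional space `kQ_2`, so the double orthogonal of
a subspace is the subspace itself. -/
theorem quadraticOrthogonal_quadraticOrthogonal {ρ θ : Set (PathAlgebra k Q)}
    (hρ : ρ ⊆ degree k Q 2) (hθ : Submodule.span k θ = quadraticOrthogonal ρ) :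
    quadraticOrthogonal θ = Submodule.span k ρ := by
  have := finiteDimensional_degree_two (k := k) (Q := Q)
  have hρ' : Submodule.span k ρ ≤ degree k Q 2 := Submodule.span_le.2 hρ
  have hθ2 : ∀ y ∈ quadraticOrthogonal ρ, y ∈ degree k Q 2 := fun y hy => hy.1
  have hrefl : (quadraticForm k Q).IsRefl := fun x y h => (pairing_comm _ _).trans h
  have hnd : (quadraticForm k Q).Nondegenerate := by
    refine ⟨fun x hx => Subtype.ext (eq_zero_of_pairing x.2 fun d hd => ?_),
      fun x hx => Subtype.ext (eq_zero_of_pairing x.2 fun d hd => hx ⟨d, hd⟩)⟩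
    exact (pairing_comm _ _).trans (hx ⟨d, hd⟩)
  have key := LinearMap.BilinForm.orthogonal_orthogonal hnd hrefl
    ((Submodule.span k ρ).comap (degree k Q 2).subtype)
  have hspan : ∀ x, x ∈ quadraticOrthogonal θ ↔
      x ∈ degree k Q 2 ∧ ∀ y ∈ quadraticOrthogonal ρ, pairing x y = 0 := by
    intro x
    refine ⟨fun hx => ⟨hx.1, fun y hy => ?_⟩, fun hx => ⟨hx.1, fun y hy => hx.2 y ?_⟩⟩
    · rw [← hθ] at hy
      exact (Submodule.span_le.2 hx.2 : _ ≤ LinearMap.ker (pairing x)) hy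
    · rw [← hθ]; exact Submodule.subset_span hy
  have horth : ∀ y : degree k Q 2, y ∈ (quadraticForm k Q).orthogonal
      ((Submodule.span k ρ).comap (degree k Q 2).subtype) ↔
        (y : PathAlgebra k Q) ∈ quadraticOrthogonal ρ := by
    intro y
    constructor
    · intro hy
      refine ⟨y.2, fun r hr => ?_⟩
      exact (pairing_comm _ _).trans (hy ⟨r, hρ hr⟩ (Submodule.subset_span hr))
    · intro hy r hr
      refine (pairing_comm _ _).trans ?_
      exact (Submodule.span_le.2 hy.2 : _ ≤ LinearMap.ker (pairing (y : PathAlgebra k Q))) hr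
  ext x
  rw [hspan]
  constructor
  · rintro ⟨hx, h⟩
    have h1 : (⟨x, hx⟩ : degree k Q 2) ∈ (quadraticForm k Q).orthogonal
        ((quadraticForm k Q).orthogonal
          ((Submodule.span k ρ).comap (degree k Q 2).subtype)) := by
      intro y hy
      exact (pairing_comm _ _).trans (h y ((horth y).1 hy))
    rw [key] at h1
    exact h1
  · intro hx
    refine ⟨hρ' hx, fun y hy => ?_⟩
    rw [pairing_comm]
    exact (Submodule.span_le.2 hy.2 : _ ≤ LinearMap.ker (pairing y)) hx

end DoubleOrthogonal

/-! ### Quadratic paths of the quiver of `G̃` -/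

section TildePairing

variable {k : Type u} [Field k] {V : Type v} {A : Type w} [Fintype V] [Fintype A]
  {Q : ArrowQuiver V A} (ν : Equiv.Perm V) {m : ℕ} [NeZero m]

/-- The path `(α, t) (β_{ν⁻¹ i}, t - 1)` for an arrow `α : i → j`. -/
def alphaBeta (k : Type u) [Field k] (Q : ArrowQuiver V A) (α : A) (t : ZMod m) :
    PathAlgebra k (Q.tilde ν m) :=
  alphaArrow ν m k Q α t * betaArrow ν m k Q (ν.symm (Q.src α)) (t - 1)

/-- The path `(β_j, t) (α, t)` for an arrow `α : i → j`. -/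
def betaAlpha (k : Type u) [Field k] (Q : ArrowQuiver V A) (α : A) (t : ZMod m) :
    PathAlgebra k (Q.tilde ν m) :=
  betaArrow ν m k Q (Q.tgt α) t * alphaArrow ν m k Q α t

/-- The path `(β_{ν i}, t + 1) (β_i, t)`. -/
def betaBeta (k : Type u) [Field k] (Q : ArrowQuiver V A) (i : V) (t : ZMod m) :
    PathAlgebra k (Q.tilde ν m) :=
  betaArrow ν m k Q (ν i) (t + 1) * betaArrow ν m k Q i t

theorem composable_alphaBeta (α : A) (t : ZMod m) : (Q.tilde ν m).src (.inl (α, t)) =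
    (Q.tilde ν m).tgt (.inr (ν.symm (Q.src α), t - 1)) := by
  change (Q.src α, t) = (ν (ν.symm (Q.src α)), t - 1 + 1)
  rw [Equiv.apply_symm_apply, sub_add_cancel]

theorem composable_betaAlpha (α : A) (t : ZMod m) : (Q.tilde ν m).src (.inr (Q.tgt α, t)) =
    (Q.tilde ν m).tgt (.inl (α, t)) := rfl

theorem composable_betaBeta (i : V) (t : ZMod m) : (Q.tilde ν m).src (.inr (ν i, t + 1)) =
    (Q.tilde ν m).tgt (.inr (i, t)) := rfl

theorem pairing_copy_copy (s t : ZMod m) (x y : PathAlgebra k Q) :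
    pairing (copy ν m s x) (copy ν m t y) = if s = t then pairing x y else 0 := by
  classical
  induction x using PathAlgebra.induction_linear with
  | zero => simp
  | add x x' hx hx' => simp only [map_add, LinearMap.add_apply, hx, hx']; split_ifs <;> simp
  | single p a =>
  induction y using PathAlgebra.induction_linear with
  | zero => simp
  | add x x' hx hx' => simp only [map_add, hx, hx']; split_ifs <;> simp
  | single q b =>
    rw [copy_single, copy_single, pairing_single_left, pairing_single_left,
      PathAlgebra.coeff_single, PathAlgebra.coeff_single]
    by_cases hst : s = t
    · subst hst
      rw [if_pos rfl]
      congr 1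
      refine if_congr ⟨fun h => ?_, fun h => by rw [h]⟩ rfl rfl
      have h1 := congrArg QPath.arrows h
      have h2 := congrArg QPath.source h
      have h3 := congrArg QPath.target h
      refine QPath.ext (congrArg Prod.fst h2) (congrArg Prod.fst h3) ?_
      refine List.map_injective_iff.2 (fun α β h => ?_) h1
      exact congrArg Prod.fst (Sum.inl_injective h)
    · rw [if_neg hst, if_neg fun h => hst (congrArg (fun p => p.source.2) h).symm, mul_zero]

theorem pairing_copy_arrow_mul_arrow (t : ZMod m) (x : PathAlgebra k Q) (a b)
    (hab : (∃ y, a = Sum.inr y) ∨ ∃ y, b = Sum.inr y) :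
    pairing (copy ν m t x) (arrow k (Q.tilde ν m) a * arrow k (Q.tilde ν m) b) = 0 := by
  classical
  by_cases h : (Q.tilde ν m).src a = (Q.tilde ν m).tgt b
  · induction x using PathAlgebra.induction_linear with
    | zero => simp
    | add x x' hx hx' => simp only [map_add, LinearMap.add_apply, hx, hx', add_zero]
    | single p c =>
      rw [copy_single, pairing_single_left, arrow_mul_arrow_of_eq h, PathAlgebra.coeff_single,
        if_neg, mul_zero]
      intro h1
      have h2 : [a, b] = p.arrows.map fun α => Sum.inl (α, t) := congrArg QPath.arrows h1
      rcases hab with ⟨y, rfl⟩ | ⟨y, rfl⟩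
      · have h3 : Sum.inr y ∈ p.arrows.map fun α => Sum.inl (α, t) := by rw [← h2]; simp
        simp at h3
      · have h3 : Sum.inr y ∈ p.arrows.map fun α => Sum.inl (α, t) := by rw [← h2]; simp
        simp at h3
  · rw [arrow_mul_arrow_of_ne h, map_zero]

end TildePairing

section TildeRelations

variable {k : Type u} [Field k] {V : Type v} {A : Type w} [Fintype V] [Fintype A]
  {Q : ArrowQuiver V A} {ρ θ : Set (PathAlgebra k Q)} (ν : NakayamaAutomorphism k Q θ)
  {m : ℕ} [NeZero m]

/-- Every arrow `γ` that occurs in `x` ends at `ν⁻¹` of the target of `α`, so the common factor `β`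
composes with each of them and the relation becomes a combination of paths. -/
theorem commutation_eq (α : A) (t : ZMod m) (c : k) {x : A →₀ k}
    (hx : ∀ γ, x γ ≠ 0 → Q.tgt α = ν.onVertices (Q.tgt γ)) :
    alphaArrow ν.onVertices m k Q α t *
        betaArrow ν.onVertices m k Q (ν.onVertices.symm (Q.src α)) (t - 1) -
      c • (betaArrow ν.onVertices m k Q (ν.onVertices.symm (Q.tgt α)) (t - 1) *
        copy ν.onVertices m (t - 1) (ofArrows k Q x)) =
    alphaBeta ν.onVertices k Q α t - c • ∑ γ, x γ • betaAlpha ν.onVertices k Q γ (t - 1) := by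
  rw [alphaBeta, ofArrows_apply, map_sum, Finset.mul_sum]
  congr 2
  refine Finset.sum_congr rfl fun γ _ => ?_
  rw [map_smul, mul_smul_comm, copy_arrow, betaAlpha]
  by_cases h : x γ = 0
  · rw [h, zero_smul, zero_smul]
  · rw [hx γ h, Equiv.symm_apply_apply]

theorem IsQuadraticRelation.copy {r : PathAlgebra k Q} (hr : IsQuadraticRelation r)
    (ν : Equiv.Perm V) (t : ZMod m) : IsQuadraticRelation (copy ν m t r) := by
  obtain ⟨i, j, h⟩ := hr
  refine ⟨(i, t), (j, t), ?_⟩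
  have h1 := Submodule.mem_map_of_mem (f := PathAlgebra.copy ν m t) h
  rw [Submodule.map_span] at h1
  refine Submodule.span_mono ?_ h1
  rintro _ ⟨_, ⟨p, hp, rfl, rfl, rfl⟩, rfl⟩
  exact ⟨p.copy ν m t, (List.length_map _).trans hp, rfl, rfl, copy_single ν m t p 1⟩

theorem isQuadraticRelation_commutationRelations (hρ : ∀ r ∈ ρ, IsQuadraticRelation r)
    (hθ : θ ⊆ degree k Q 2) (c : k) :
    ∀ r ∈ commutationRelations ν m ρ c ν.dualInv, IsQuadraticRelation r := by
  intro r hr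
  obtain ⟨t, ⟨ϱ, hϱ, rfl⟩ | ⟨α, rfl⟩⟩ := Set.mem_iUnion.1 hr
  · exact IsQuadraticRelation.copy (hρ ϱ hϱ) _ t
  · rw [commutation_eq ν α t c (x := ν.dualInv α) fun γ h => (ν.onArrows_endpoints hθ h).1]
    refine ⟨(ν.onVertices.symm (Q.src α), t - 1), (Q.tgt α, t), Submodule.sub_mem _ ?_ ?_⟩
    · exact Submodule.subset_span
        ⟨_, rfl, rfl, rfl, arrow_mul_arrow_of_eq (composable_alphaBeta ν.onVertices α t)⟩
    · refine Submodule.smul_mem _ _ (Submodule.sum_mem _ fun γ _ => ?_)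
      by_cases h : ν.dualInv α γ = 0
      · rw [h, zero_smul]; exact Submodule.zero_mem _
      · obtain ⟨h1, h2⟩ := ν.onArrows_endpoints hθ h
        refine Submodule.smul_mem _ _ (Submodule.subset_span
          ⟨_, rfl, ?_, ?_, arrow_mul_arrow_of_eq (composable_betaAlpha ν.onVertices γ (t - 1))⟩)
        · change (Q.src γ, t - 1) = _
          rw [h2, Equiv.symm_apply_apply]
        · change (ν.onVertices (Q.tgt γ), t - 1 + 1) = _
          rw [h1, sub_add_cancel]

end TildeRelations

end

/-! ### Orthogonality of the types of quadratic paths -/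

noncomputable section

open PathAlgebra ArrowQuiver

section Orthogonality

variable {k : Type u} [Field k] {V : Type v} {A : Type w} [Fintype V] [Fintype A]
  {Q : ArrowQuiver V A} (ν : Equiv.Perm V) {m : ℕ} [NeZero m]

theorem pairing_alphaBeta_alphaBeta [DecidableEq A] (α β : A) (s t : ZMod m) :
    pairing (alphaBeta ν k Q α s) (alphaBeta ν k Q β t) = if α = β ∧ s = t then 1 else 0 := by
  classical
  refine (pairing_arrow_mul_arrow (composable_alphaBeta ν β t) _ _).trans
    (if_congr ⟨fun h => ?_, ?_⟩ rfl rfl)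
  · exact Prod.mk.inj (Sum.inl_injective h.1)
  · rintro ⟨rfl, rfl⟩; exact ⟨rfl, rfl⟩

theorem pairing_betaAlpha_betaAlpha [DecidableEq A] (α β : A) (s t : ZMod m) :
    pairing (betaAlpha ν k Q α s) (betaAlpha ν k Q β t) = if α = β ∧ s = t then 1 else 0 := by
  classical
  refine (pairing_arrow_mul_arrow (composable_betaAlpha ν β t) _ _).trans
    (if_congr ⟨fun h => ?_, ?_⟩ rfl rfl)
  · exact Prod.mk.inj (Sum.inl_injective h.2)
  · rintro ⟨rfl, rfl⟩; exact ⟨rfl, rfl⟩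

theorem pairing_alphaBeta_betaAlpha (α β : A) (s t : ZMod m) :
    pairing (alphaBeta ν k Q α s) (betaAlpha ν k Q β t) = 0 := by
  classical
  exact (pairing_arrow_mul_arrow (composable_betaAlpha ν β t) _ _).trans
    (if_neg fun h => by simpa using h.1)

theorem pairing_alphaBeta_betaBeta (α : A) (i : V) (s t : ZMod m) :
    pairing (alphaBeta ν k Q α s) (betaBeta ν k Q i t) = 0 := by
  classical
  exact (pairing_arrow_mul_arrow (composable_betaBeta ν i t) _ _).trans
    (if_neg fun h => by simpa using h.1)

theorem pairing_betaAlpha_betaBeta (α : A) (i : V) (s t : ZMod m) :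
    pairing (betaAlpha ν k Q α s) (betaBeta ν k Q i t) = 0 := by
  classical
  exact (pairing_arrow_mul_arrow (composable_betaBeta ν i t) _ _).trans
    (if_neg fun h => by simpa using h.2)

theorem pairing_copy_alphaBeta (x : PathAlgebra k Q) (α : A) (s t : ZMod m) :
    pairing (copy ν m s x) (alphaBeta ν k Q α t) = 0 :=
  pairing_copy_arrow_mul_arrow ν s x _ _ (Or.inr ⟨_, rfl⟩)

theorem pairing_copy_betaAlpha (x : PathAlgebra k Q) (α : A) (s t : ZMod m) :
    pairing (copy ν m s x) (betaAlpha ν k Q α t) = 0 :=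
  pairing_copy_arrow_mul_arrow ν s x _ _ (Or.inl ⟨_, rfl⟩)

theorem pairing_copy_betaBeta (x : PathAlgebra k Q) (i : V) (s t : ZMod m) :
    pairing (copy ν m s x) (betaBeta ν k Q i t) = 0 :=
  pairing_copy_arrow_mul_arrow ν s x _ _ (Or.inl ⟨_, rfl⟩)

/-- The part of a quadratic element that lies in the `t`-th copy of `Q`. -/
def uncopy (t : ZMod m) (d : PathAlgebra k (Q.tilde ν m)) : PathAlgebra k Q :=
  ∑ α, ∑ γ, pairing (alphaArrow ν m k Q α t * alphaArrow ν m k Q γ t) d •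
    (arrow k Q α * arrow k Q γ)

theorem pairing_uncopy (t : ZMod m) (d : PathAlgebra k (Q.tilde ν m)) {r : PathAlgebra k Q}
    (hr : r ∈ degree k Q 2) : pairing (uncopy ν t d) r = pairing d (copy ν m t r) := by
  rw [pairing_comm d, pairing_comm _ r, uncopy]
  conv_rhs => rw [eq_sum_of_mem_degree_two hr]
  simp only [map_sum, map_smul, LinearMap.sum_apply, LinearMap.smul_apply, smul_eq_mul, copy_mul,
    copy_arrow]
  refine Finset.sum_congr rfl fun α _ => Finset.sum_congr rfl fun γ _ => ?_
  rw [pairing_comm r, mul_comm]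

/-- The paths of length two fall into four types, according to the position of the arrows `β`; a
composable partner of a given `β` has determined level or vertex, which collapses the double sums.
-/
theorem eq_sum_tilde {d : PathAlgebra k (Q.tilde ν m)} (hd : d ∈ degree k (Q.tilde ν m) 2) :
    d = ∑ t, copy ν m t (uncopy ν t d) +
      ∑ t, ∑ α, pairing (alphaBeta ν k Q α t) d • alphaBeta ν k Q α t +
      ∑ t, ∑ γ, pairing (betaAlpha ν k Q γ t) d • betaAlpha ν k Q γ t +
      ∑ t, ∑ i, pairing (betaBeta ν k Q i t) d • betaBeta ν k Q i t := by
  classical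
  conv_lhs => rw [eq_sum_of_mem_degree_two hd]
  simp only [Fintype.sum_sum_type, Finset.sum_add_distrib]
  have h0 : ∀ a b, (Q.tilde ν m).src a ≠ (Q.tilde ν m).tgt b →
      pairing (arrow k (Q.tilde ν m) a * arrow k (Q.tilde ν m) b) d •
        (arrow k (Q.tilde ν m) a * arrow k (Q.tilde ν m) b) = 0 := fun a b h => by
    rw [arrow_mul_arrow_of_ne h, smul_zero]
  have h1 : ∑ x : A × ZMod m, ∑ y : A × ZMod m,
      pairing (arrow k (Q.tilde ν m) (.inl x) * arrow k (Q.tilde ν m) (.inl y)) d •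
        (arrow k (Q.tilde ν m) (.inl x) * arrow k (Q.tilde ν m) (.inl y)) =
      ∑ t, copy ν m t (uncopy ν t d) := by
    rw [Fintype.sum_prod_type_right]
    refine Finset.sum_congr rfl fun t _ => ?_
    simp only [uncopy, map_sum, map_smul, copy_mul, copy_arrow]
    refine Finset.sum_congr rfl fun α _ => ?_
    rw [Fintype.sum_prod_type]
    refine Finset.sum_congr rfl fun γ _ => ?_
    rw [Finset.sum_eq_single t]
    · rfl
    · intro s _ hs
      exact h0 _ _ fun h => hs (congrArg Prod.snd h).symm
    · simp
  have h2 : ∑ x : A × ZMod m, ∑ y : V × ZMod m,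
      pairing (arrow k (Q.tilde ν m) (.inl x) * arrow k (Q.tilde ν m) (.inr y)) d •
        (arrow k (Q.tilde ν m) (.inl x) * arrow k (Q.tilde ν m) (.inr y)) =
      ∑ t, ∑ α, pairing (alphaBeta ν k Q α t) d • alphaBeta ν k Q α t := by
    rw [Fintype.sum_prod_type_right]
    refine Finset.sum_congr rfl fun t _ => Finset.sum_congr rfl fun α _ => ?_
    rw [Finset.sum_eq_single (ν.symm (Q.src α), t - 1)]
    · rfl
    · rintro ⟨i, s⟩ _ hs
      refine h0 _ _ fun h => hs ?_
      have h' : (Q.src α, t) = (ν i, s + 1) := h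
      rw [Prod.mk.injEq] at h'
      rw [h'.1, h'.2, Equiv.symm_apply_apply, add_sub_cancel_right]
    · simp
  have h3 : ∑ x : V × ZMod m, ∑ y : A × ZMod m,
      pairing (arrow k (Q.tilde ν m) (.inr x) * arrow k (Q.tilde ν m) (.inl y)) d •
        (arrow k (Q.tilde ν m) (.inr x) * arrow k (Q.tilde ν m) (.inl y)) =
      ∑ t, ∑ γ, pairing (betaAlpha ν k Q γ t) d • betaAlpha ν k Q γ t := by
    rw [Finset.sum_comm, Fintype.sum_prod_type_right]
    refine Finset.sum_congr rfl fun t _ => Finset.sum_congr rfl fun α _ => ?_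
    rw [Finset.sum_eq_single (Q.tgt α, t)]
    · rfl
    · rintro ⟨i, s⟩ _ hs
      exact h0 _ _ fun h => hs h
    · simp
  have h4 : ∑ x : V × ZMod m, ∑ y : V × ZMod m,
      pairing (arrow k (Q.tilde ν m) (.inr x) * arrow k (Q.tilde ν m) (.inr y)) d •
        (arrow k (Q.tilde ν m) (.inr x) * arrow k (Q.tilde ν m) (.inr y)) =
      ∑ t, ∑ i, pairing (betaBeta ν k Q i t) d • betaBeta ν k Q i t := by
    rw [Finset.sum_comm, Fintype.sum_prod_type_right]
    refine Finset.sum_congr rfl fun t _ => Finset.sum_congr rfl fun α _ => ?_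
    rw [Finset.sum_eq_single (ν α, t + 1)]
    · rfl
    · rintro ⟨i, s⟩ _ hs
      exact h0 _ _ fun h => hs h
    · simp
  rw [h1, h2, h3, h4]
  abel

end Orthogonality

/-! ### The orthogonal complement of `θ_{G̃}` -/

section Main

variable {k : Type u} [Field k] {V : Type v} {A : Type w} [Fintype V] [Fintype A]
  {Q : ArrowQuiver V A} {ρ θ : Set (PathAlgebra k Q)} (ν : NakayamaAutomorphism k Q θ)
  (m : ℕ) [NeZero m]

theorem sum_onArrows_symm_mul (α β : A) [DecidableEq A] :
    ∑ γ, ν.onArrows.symm (Finsupp.single α 1) γ * ν.onArrows (Finsupp.single γ 1) β =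
      if α = β then 1 else 0 := by
  have h := ν.onArrows.apply_symm_apply (Finsupp.single α 1)
  have h1 : ν.onArrows.symm (Finsupp.single α 1) =
      ∑ γ, ν.onArrows.symm (Finsupp.single α 1) γ • Finsupp.single γ (1 : k) := by
    ext β
    simp
  rw [h1, map_sum] at h
  have h2 := DFunLike.congr_fun h β
  simp only [map_smul, Finsupp.coe_finsetSum, Finset.sum_apply, Finsupp.smul_apply, smul_eq_mul,
    Finsupp.single_apply] at h2
  exact h2

theorem sum_onArrows_mul_symm (γ δ : A) [DecidableEq A] :
    ∑ α, ν.onArrows (Finsupp.single γ 1) α * ν.onArrows.symm (Finsupp.single α 1) δ =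
      if γ = δ then 1 else 0 := by
  have h := ν.onArrows.symm_apply_apply (Finsupp.single γ 1)
  have h1 : ν.onArrows (Finsupp.single γ 1) =
      ∑ α, ν.onArrows (Finsupp.single γ 1) α • Finsupp.single α (1 : k) := by
    ext β
    simp
  rw [h1, map_sum] at h
  have h2 := DFunLike.congr_fun h δ
  simp only [map_smul, Finsupp.coe_finsetSum, Finset.sum_apply, Finsupp.smul_apply, smul_eq_mul,
    Finsupp.single_apply] at h2
  exact h2

/-- The four types of paths are mutually orthogonal. Inside the copies the statement is the duality
of `ρ` and `θ`, and the paths `β β` are all in `θ_{G̃}`. In the mixed part the relations are graphs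
of two linear maps, which are orthogonal complements since one is minus the inverse transpose of the
other. -/
theorem span_rhoTilde (hρ : ∀ r ∈ ρ, IsQuadraticRelation r)
    (hθ : Submodule.span k θ = quadraticOrthogonal ρ) (s : ℕ) :
    Submodule.span k (rhoTilde ν m s ρ) = quadraticOrthogonal (thetaTilde ν m s) := by
  classical
  have hθ2 : θ ⊆ degree k Q 2 := fun r hr =>
    (hθ ▸ Submodule.subset_span hr : r ∈ quadraticOrthogonal ρ).1
  have hρ2 : ρ ⊆ degree k Q 2 := fun r hr => (hρ r hr).mem_degree
  have hsgn : (-1 : k) ^ (s + 1) = -(-1) ^ s := by rw [pow_succ]; ring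
  have hsq : (-1 : k) ^ s * (-1) ^ s = 1 := by rw [← mul_pow]; simp
  have hrel : ∀ α (t : ZMod m), alphaArrow ν.onVertices m k Q α t *
        betaArrow ν.onVertices m k Q (ν.onVertices.symm (Q.src α)) (t - 1) -
      (-1 : k) ^ (s + 1) • (betaArrow ν.onVertices m k Q (ν.onVertices.symm (Q.tgt α)) (t - 1) *
        copy ν.onVertices m (t - 1) (ofArrows k Q (ν.dualInv α))) =
      alphaBeta ν.onVertices k Q α t + (-1 : k) ^ s • ∑ γ, ν.onArrows (Finsupp.single γ 1) α •
        betaAlpha ν.onVertices k Q γ (t - 1) := fun α t => by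
    rw [commutation_eq ν α t _ (x := ν.dualInv α) fun γ h => (ν.onArrows_endpoints hθ2 h).1, hsgn,
      neg_smul, sub_neg_eq_add]
    rfl
  have hrel' : ∀ α (t : ZMod m), alphaArrow ν.onVertices m k Q α t *
        betaArrow ν.onVertices m k Q (ν.onVertices.symm (Q.src α)) (t - 1) -
      (-1 : k) ^ s • (betaArrow ν.onVertices m k Q (ν.onVertices.symm (Q.tgt α)) (t - 1) *
        copy ν.onVertices m (t - 1) (ofArrows k Q (ν.onArrows.symm (Finsupp.single α 1)))) =
      alphaBeta ν.onVertices k Q α t - (-1 : k) ^ s •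
        ∑ γ, ν.onArrows.symm (Finsupp.single α 1) γ •
          betaAlpha ν.onVertices k Q γ (t - 1) := fun α t =>
    commutation_eq ν α t _ fun γ h => (ν.onArrows_symm_endpoints hθ2 h).1
  apply le_antisymm
  · rw [Submodule.span_le]
    intro r hr
    refine ⟨(isQuadraticRelation_commutationRelations ν hρ hθ2 _ r hr).mem_degree, ?_⟩
    intro r' hr'
    obtain ⟨t, ⟨ϱ, hϱ, rfl⟩ | ⟨α, rfl⟩⟩ := Set.mem_iUnion.1 hr
    · rcases hr' with hr' | ⟨i, t', rfl⟩
      · obtain ⟨t', ⟨ϑ, hϑ, rfl⟩ | ⟨α, rfl⟩⟩ := Set.mem_iUnion.1 hr'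
        · rw [pairing_copy_copy]
          split_ifs
          · rw [pairing_comm]
            exact (hθ ▸ Submodule.subset_span hϑ : ϑ ∈ quadraticOrthogonal ρ).2 ϱ hϱ
          · rfl
        · rw [hrel']
          simp only [map_sub, map_smul, map_sum, pairing_copy_alphaBeta, pairing_copy_betaAlpha,
            smul_zero, Finset.sum_const_zero, sub_zero]
      · exact pairing_copy_betaBeta ν.onVertices ϱ i t t'
    · rw [hrel]
      rcases hr' with hr' | ⟨i, t', rfl⟩
      · obtain ⟨t', ⟨ϑ, hϑ, rfl⟩ | ⟨β, rfl⟩⟩ := Set.mem_iUnion.1 hr'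
        · rw [pairing_comm]
          simp only [map_add, map_smul, map_sum, pairing_copy_alphaBeta, pairing_copy_betaAlpha,
            smul_zero, Finset.sum_const_zero, add_zero]
        · rw [hrel']
          have hba : ∀ α β : A, ∀ s t : ZMod m, pairing (betaAlpha ν.onVertices k Q β t)
              (alphaBeta ν.onVertices k Q α s) = 0 := fun α β s t => by
            rw [pairing_comm, pairing_alphaBeta_betaAlpha]
          simp only [map_add, map_sub, map_smul, map_sum, LinearMap.add_apply,
            LinearMap.smul_apply, LinearMap.sum_apply, pairing_alphaBeta_alphaBeta,
            pairing_alphaBeta_betaAlpha, hba, pairing_betaAlpha_betaAlpha, smul_eq_mul, mul_zero,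
            Finset.sum_const_zero, add_zero, sub_left_inj]
          by_cases htt : t = t'
          · subst htt
            simp only [and_true, mul_ite, mul_one, mul_zero, Finset.sum_ite_eq',
              Finset.mem_univ, if_true]
            -- The contribution of the paths `β α` cancels that of the paths `α β`: the product of
            -- the two matrices is the identity and the signs are opposite.
            have h2 := sum_onArrows_symm_mul ν β α
            rw [sub_eq_zero, if_congr eq_comm rfl rfl, ← h2, Finset.mul_sum]
            refine Finset.sum_congr rfl fun γ _ => ?_
            rw [zero_add, mul_left_comm, ← mul_assoc ((-1 : k) ^ s), hsq, one_mul]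
          · simp [htt]
      · change pairing _ (betaBeta ν.onVertices k Q i t') = 0
        simp only [map_add, map_smul, map_sum, LinearMap.add_apply, LinearMap.smul_apply,
          LinearMap.sum_apply, pairing_alphaBeta_betaBeta, pairing_betaAlpha_betaBeta, smul_zero,
          Finset.sum_const_zero, add_zero]
  · intro d hd
    have hcopy : ∀ t, copy ν.onVertices m t (uncopy ν.onVertices t d) ∈
        Submodule.span k (rhoTilde ν m s ρ) := by
      intro t
      have h1 : uncopy ν.onVertices t d ∈ Submodule.span k ρ := by
        rw [← quadraticOrthogonal_quadraticOrthogonal hρ2 hθ]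
        refine ⟨sum_mem_degree_two _, fun r hr => ?_⟩
        rw [pairing_uncopy _ _ _ (hθ2 hr)]
        exact hd.2 _ (Or.inl (Set.mem_iUnion.2 ⟨t, Or.inl ⟨r, hr, rfl⟩⟩))
      have h2 := Submodule.mem_map_of_mem (f := copy ν.onVertices m t) h1
      rw [Submodule.map_span] at h2
      refine Submodule.span_mono ?_ h2
      rintro _ ⟨r, hr, rfl⟩
      exact Set.mem_iUnion.2 ⟨t, Or.inl ⟨r, hr, rfl⟩⟩
    have hbb : ∀ t i, pairing (betaBeta ν.onVertices k Q i t) d = 0 := by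
      intro t i
      rw [pairing_comm]
      exact hd.2 _ (Or.inr ⟨i, t, rfl⟩)
    have hab : ∀ t α, pairing (alphaBeta ν.onVertices k Q α t) d = (-1 : k) ^ s *
        ∑ γ, ν.onArrows.symm (Finsupp.single α 1) γ *
          pairing (betaAlpha ν.onVertices k Q γ (t - 1)) d := by
      intro t α
      have h1 := hd.2 _ (Or.inl (Set.mem_iUnion.2 ⟨t, Or.inr ⟨α, rfl⟩⟩))
      rw [hrel', map_sub, sub_eq_zero] at h1
      rw [pairing_comm, h1]
      simp only [map_smul, map_sum, smul_eq_mul]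
      congr 1
      exact Finset.sum_congr rfl fun γ _ => by rw [pairing_comm]
    -- Solves `hab` for the coefficients of the paths `β α` with the inverse matrix; so the mixed
    -- part of `d` is determined by its coefficients at the paths `α β`.
    have hba : ∀ t γ, pairing (betaAlpha ν.onVertices k Q γ (t - 1)) d = (-1 : k) ^ s *
        ∑ α, pairing (alphaBeta ν.onVertices k Q α t) d *
          ν.onArrows (Finsupp.single γ 1) α := by
      intro t γ
      have h1 : ∀ α, pairing (alphaBeta ν.onVertices k Q α t) d *
          ν.onArrows (Finsupp.single γ 1) α = (-1 : k) ^ s * ∑ δ,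
            ν.onArrows (Finsupp.single γ 1) α * ν.onArrows.symm (Finsupp.single α 1) δ *
              pairing (betaAlpha ν.onVertices k Q δ (t - 1)) d := by
        intro α
        rw [hab, mul_assoc, Finset.sum_mul]
        congr 1
        exact Finset.sum_congr rfl fun δ _ => by ring
      simp only [h1]
      rw [← Finset.mul_sum, ← mul_assoc, hsq, one_mul, Finset.sum_comm]
      simp only [← Finset.sum_mul, sum_onArrows_mul_symm]
      simp
    rw [eq_sum_tilde ν.onVertices hd.1]
    simp only [hbb, zero_smul, Finset.sum_const_zero, add_zero]
    rw [add_assoc]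
    refine Submodule.add_mem _ (Submodule.sum_mem _ fun t _ => hcopy t) ?_
    -- The levels are shifted because a relation combines `α β` ending in level `t` with paths `β α`
    -- that start in level `t - 1`.
    rw [← Equiv.sum_comp (Equiv.subRight (1 : ZMod m)) fun t =>
      ∑ γ, pairing (betaAlpha ν.onVertices k Q γ t) d • betaAlpha ν.onVertices k Q γ t,
      ← Finset.sum_add_distrib]
    refine Submodule.sum_mem _ fun t _ => ?_
    simp only [Equiv.subRight_apply, hba]
    have h3 : ∑ α, pairing (alphaBeta ν.onVertices k Q α t) d • alphaBeta ν.onVertices k Q α t +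
        ∑ γ, ((-1 : k) ^ s * ∑ α, pairing (alphaBeta ν.onVertices k Q α t) d *
          ν.onArrows (Finsupp.single γ 1) α) • betaAlpha ν.onVertices k Q γ (t - 1) =
        ∑ α, pairing (alphaBeta ν.onVertices k Q α t) d • (alphaBeta ν.onVertices k Q α t +
          (-1 : k) ^ s • ∑ γ, ν.onArrows (Finsupp.single γ 1) α •
            betaAlpha ν.onVertices k Q γ (t - 1)) := by
      simp only [smul_add, Finset.sum_add_distrib, Finset.mul_sum, Finset.sum_smul,
        Finset.smul_sum, smul_smul]
      congr 1
      rw [Finset.sum_comm]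
      refine Finset.sum_congr rfl fun α _ => Finset.sum_congr rfl fun γ _ => ?_
      congr 1; ring
    rw [h3]
    refine Submodule.sum_mem _ fun α _ => Submodule.smul_mem _ _ (Submodule.subset_span ?_)
    exact Set.mem_iUnion.2 ⟨t, Or.inr ⟨α, (hrel α t).symm⟩⟩

end Main

/-! ### Degrees of elements of the skew group algebra of `G̃` -/

section Homogeneous

variable {k : Type u} [Field k] {ι : Type} [Fintype ι] [DecidableEq ι]
  {G : Subgroup (GL ι k)} {m : ℕ} [NeZero m] {ξ : kˣ} (hξ : IsPrimitiveRoot ξ m)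

theorem skewIncl_coeff (r : SkewGroupAlgebra G) (g : G) (j : ZMod m) :
    (skewIncl G hξ r).coeff (extElem G hξ g j) =
      if j = 0 then MvPolynomial.rename Sum.inl (r.coeff g) else 0 := by
  classical
  induction r using SkewMonoidAlgebra.induction_on with
  | zero => simp
  | add x y hx hy =>
    rw [map_add, SkewMonoidAlgebra.coeff_add, SkewMonoidAlgebra.coeff_add, Finsupp.add_apply,
      Finsupp.add_apply, hx, hy]
    split_ifs <;> simp
  | single h f =>
    rw [skewIncl_single, SkewMonoidAlgebra.coeff_single_apply,
      SkewMonoidAlgebra.coeff_single_apply]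
    by_cases hj : j = 0
    · subst hj
      by_cases hg : h = g
      · rw [hg, if_pos rfl, if_pos rfl, if_pos rfl]
      · rw [if_neg fun h' => hg (extElem_inj hξ h').1, if_pos rfl, if_neg hg, map_zero]
    · rw [if_neg fun h' => hj (extElem_inj hξ h').2.symm, if_neg hj]

theorem isHomogeneous_skewIncl {r : SkewGroupAlgebra G} {d : ℕ}
    (hr : ∀ g, (r.coeff g).IsHomogeneous d) (g) : ((skewIncl G hξ r).coeff g).IsHomogeneous d := by
  obtain ⟨g, j, rfl⟩ := exists_extElem hξ g
  rw [skewIncl_coeff]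
  split_ifs
  · exact (hr g).rename_isHomogeneous
  · exact MvPolynomial.isHomogeneous_zero _ _ _

theorem isHomogeneous_groupAlgebraIncl (z : k[G]) (g : G) :
    ((groupAlgebraIncl G z).coeff g).IsHomogeneous 0 := by
  rw [groupAlgebraIncl_coeff]
  exact MvPolynomial.isHomogeneous_C _ _

end Homogeneous

end

/-! ### The bound McKay quiver of `G̃` -/

theorem mainTheorem3 {k : Type u} [Field k] [IsAlgClosed k] [CharZero k]
    {s : ℕ} (hs : 0 < s) (G : Subgroup (GL (Fin s) k)) [Finite G]
    {m : ℕ} [NeZero m] (ξ : kˣ) (hξ : IsPrimitiveRoot ξ m)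
    {V : Type v} {A : Type w} [Fintype V] [Fintype A] (Q : ArrowQuiver V A)
    (ρ θ : Set (PathAlgebra k Q)) (hρ : IsBoundMcKayQuiver G Q ρ)
    (hθ : Submodule.span k θ = PathAlgebra.quadraticOrthogonal ρ)
    (ν : NakayamaAutomorphism k Q θ) :
    IsBoundMcKayQuiver (cyclicExtension G ξ) (Q.tilde ν.onVertices m) (rhoTilde ν m s ρ) ∧
    Submodule.span k (rhoTilde ν m s ρ) =
      PathAlgebra.quadraticOrthogonal (thetaTilde ν m s) := by
  obtain ⟨hq, S, e, φ, hS, he, hspan, hv, ha, hinj, hrange⟩ := hρ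
  refine ⟨?_, span_rhoTilde ν m hq hθ s⟩
  obtain ⟨n, rfl⟩ : ∃ n, s = n + 1 := ⟨s - 1, by omega⟩
  have : Fintype G := Fintype.ofFinite G
  have hθ2 : θ ⊆ PathAlgebra.degree k Q 2 := fun r hr =>
    (hθ ▸ Submodule.subset_span hr : r ∈ PathAlgebra.quadraticOrthogonal ρ).1
  have hb : IsBasicSystem e := hS.isBasicSystem he hspan
  obtain ⟨v, v', hvv⟩ := exists_isTwistElement
    (isArrowSystem_arrowCol hq hb hv ha hinj hrange) hq hθ ν
  -- With `s = n + 1` the sign of `rhoTilde` is the one from carrying a letter past `n` others.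
  have hc : (-1 : k) ^ (n + 1 + 1) = (-1) ^ n := by rw [pow_succ, pow_succ]; ring
  have hT := isTwistedExtension hξ hv ha hinj hrange hvv
  obtain ⟨Φ, hΦv, hΦa, hΦinj, hΦrange⟩ := hT.exists_iso hθ2
  rw [rhoTilde, hc]
  have hidem : ∀ x : V × ZMod m, hT.idem x = groupAlgebraIncl (cyclicExtension G ξ)
      (groupIncl G hξ (e x.1) * charIdem G hξ x.2) := fun x => by
    rw [IsTwistedExtension.idem, boundIncl_apply, hv, skewIncl_groupAlgebraIncl, map_mul]
  refine ⟨isQuadraticRelation_commutationRelations ν hq hθ2 _,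
    fun x => FDRep.of (extRep hξ (S x.1).rep x.2),
    fun x => groupIncl G hξ (e x.1) * charIdem G hξ x.2, Φ, hS.tilde hξ hb hspan hvv, ?_,
    fun x => extModuleEquiv hξ (hb.mul_self x.1) _ (hspan x.1).some x.2,
    fun x => (hΦv x).trans (hidem x), ?_, hΦinj, ?_⟩
  · refine ⟨fun x => groupAlgebraIncl_injective ?_, fun x y hxy => groupAlgebraIncl_injective ?_⟩
    · rw [map_mul, ← hidem]
      exact hT.orthogonal.idem x
    · rw [map_mul, ← hidem, ← hidem, map_zero]
      exact hT.orthogonal.ortho hxy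
  · intro a g
    rw [hΦa]
    rcases a with ⟨α, t⟩ | ⟨i, t⟩
    · exact homogeneous_mul (isHomogeneous_skewIncl hξ (ha α))
        (isHomogeneous_groupAlgebraIncl (charIdem G hξ t)) g
    -- The arrow `β_i` is the additional variable times a group algebra element, and so has degree
    -- one.
    · have h1 : hT.arr (.inr (i, t)) = extraVar G ξ * groupAlgebraIncl (cyclicExtension G ξ)
          (groupIncl G hξ v * (groupIncl G hξ (e i) * charIdem G hξ t)) := by
        change extraVar G ξ * skewIncl G hξ (groupAlgebraIncl G v) * hT.idem (i, t) = _
        rw [hidem, skewIncl_groupAlgebraIncl, mul_assoc, ← map_mul]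
      rw [h1, extraVar_mul_coeff]
      exact (MvPolynomial.isHomogeneous_X k _).mul (isHomogeneous_groupAlgebraIncl _ g)
  · rw [hΦrange, boundIncl_apply, map_one_eq hv, skewIncl_groupAlgebraIncl]
    have h1 : ∑ x : V × ZMod m, groupIncl G hξ (e x.1) * charIdem G hξ x.2 =
        groupIncl G hξ (∑ i, e i) := by
      rw [Fintype.sum_prod_type, map_sum]
      simp only [← Finset.mul_sum, sum_charIdem, mul_one]
    rw [h1]
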